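/- Let $\mathbb{k}$ be an algebraically closed field of characteristic $p>0$, let $\zeta\in\mathbb{k}$ be a primitive fourth root of unity (so $p\neq 2$), and fix a square root $\zeta^{1/2}$. Let $\mathrm{Tilt}$ be the Cauchy completion (finite direct sums and direct summands) of the $\mathbb{k}$-linear Temperley--Lieb category in which a circle has value $-(\zeta+\zeta^{-1})$, with the ribbon structure given by the Kauffman bracket crossing $\zeta^{1/2}\,\mathrm{id}+\zeta^{-1/2}\,\mathrm{cup}\circ\mathrm{cap}$, in which a single strand has twist $-\zeta^{3/2}$. Let $T(m)$ be its indecomposable object of highest weight $m$, that is, the indecomposable summand of $T(1)^{\otimes m}$ that is not a summand of a smaller tensor power of the strand $T(1)$. For $N\ge 1$ let $\mathcal{J}_{N}$ be the tensor ideal of finite direct sums of objects $T(v-1)$ with $v\ge N$. The mixed Verlinde category $\mathrm{Ver}=\mathrm{Ver}_{p^{(2)}}^{\zeta^{1/2}}$ is the abelian envelope of $\mathrm{Tilt}/\mathcal{J}_{2p}$; it contains $\mathrm{Tilt}/\mathcal{J}_{2p}$ as a full ribbon subcategory, and its projective objects are those of $\mathcal{J}_{2}/\mathcal{J}_{2p}$.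 There is a modified trace $\mathsf{t}$ on the projective objects of $\mathrm{Ver}$ (a family of linear maps $\mathsf t_P:\mathrm{End}(P)\to\mathbb{k}$ that is cyclic and compatible with left and right partial traces) with $\mathsf{t}(\mathrm{id}_{T(1)})=1$. For a projective object $Q$ let $\Lambda_Q=\sum_i x_i\circ x^i\in\mathrm{End}(Q)$, where $(x^i)$ and $(x_i)$ are bases of $\mathrm{Hom}(Q,\mathbb{1})$ and $\mathrm{Hom}(\mathbb{1},Q)$ that are dual with respect to $\mathsf{t}$. For a projective generator $G$ and a projective object $P$, a chromatic morphism based at $P$ is an endomorphism $\mathsf{c}_P$ of $G\otimes P$ such that, for every projective object $V$, placing $\Lambda_{V\otimes G^*}$ to the left of $\mathsf{c}_P$ and joining $G^*$ to $G$ by a cup below and a cap above gives $\mathrm{id}_{V\otimes P}$. Let $P_{\mathbb{1}}$ be the projective cover of the unit, and let $\theta$ be the twist. The values of the associated invariant of 4-dimensional 2-handlebodies on $\mathbb{CP}^2$ and $\overline{\mathbb{CP}}^2$ (a single 2-handle attached along the unknot with framing $\pm1$) are $$\Delta_{\pm}=\mathsf{t}\big((\theta_G^{\pm1}\otimes\Lambda_{P_{\mathbb{1}}})\circ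 \mathsf{c}_{P_{\mathbb{1}}}\big).$$ Then $\Delta_\pm$ are well defined: a chromatic morphism based at $P_{\mathbb 1}$ exists for some $G$, and the values do not depend on the choices. Moreover, $$\Delta_{\pm}=\mathsf{t}\big((\theta_G^{\pm1}\otimes\mathrm{id}_{T(1)})\circ \mathsf{c}_{T(1)}\big)=\frac{(p-1)p(2p-1)}{3}\cdot\zeta^{\mp1}$$ for every projective generator $G$ and every chromatic morphism $\mathsf{c}_{T(1)}$ based at $T(1)$, where the integer $\frac{(p-1)p(2p-1)}{3}$ is mapped to $\mathbb{k}$. In particular $\Delta_+=\Delta_-=0$ if $p>3$, and $\mathrm{Ver}_{p^{(2)}}^{\zeta^{1/2}}$ is twist non-degenerate (that is, $\Delta_+$ and $\Delta_-$ are both nonzero) if and only if $p=3$. -/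

import Mathlib

open CategoryTheory CategoryTheory.Idempotents

universe u

noncomputable section

namespace TemperleyLieb

/-! ### The Temperley-Lieb category

Morphisms are formal `k`-linear combinations of composites of elementary planar tangles, modulo
planar isotopy and the value `δ` of a closed circle.  An elementary tangle on parallel vertical
strands is a cup or a cap; its position `i` is the number of strands on its left. Composites are
read from bottom to top. -/

/-- Formal expressions for morphisms from `m` strands (bottom) to `n` strands (top). -/
inductive Pre (k : Type u) : ℕ → ℕ → Type u
  | id (n : ℕ) : Pre k n n
  | comp {a b c : ℕ} (f : Pre k a b) (g : Pre k b c) : Pre k a c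
  | cup {m n : ℕ} (i : ℕ) (hi : i ≤ m) (h : n = m + 2) : Pre k m n
  | cap {m n : ℕ} (i : ℕ) (hi : i ≤ n) (h : m = n + 2) : Pre k m n
  | zero {a b : ℕ} : Pre k a b
  | add {a b : ℕ} (f g : Pre k a b) : Pre k a b
  | smul {a b : ℕ} (c : k) (f : Pre k a b) : Pre k a b

variable {k : Type u} [Field k]

/-- The defining relations: a `k`-linear category (first three groups), the circle relation, the
two zigzag isotopies, and the height exchange of elementary tangles with disjoint support. -/
inductive Rel (δ : k) : {a b : ℕ} → Pre k a b → Pre k a b → Prop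
  -- equivalence relation, compatible with the operations
  | refl {a b : ℕ} (f : Pre k a b) : Rel δ f f
  | symm {a b : ℕ} {f g : Pre k a b} : Rel δ f g → Rel δ g f
  | trans {a b : ℕ} {f g h : Pre k a b} : Rel δ f g → Rel δ g h → Rel δ f h
  | comp_congr {a b c : ℕ} {f f' : Pre k a b} {g g' : Pre k b c} :
      Rel δ f f' → Rel δ g g' → Rel δ (f.comp g) (f'.comp g')
  | add_congr {a b : ℕ} {f f' g g' : Pre k a b} :
      Rel δ f f' → Rel δ g g' → Rel δ (f.add g) (f'.add g')
  | smul_congr {a b : ℕ} (c : k) {f f' : Pre k a b} :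
      Rel δ f f' → Rel δ (f.smul c) (f'.smul c)
  -- category with bilinear composition
  | id_comp {a b : ℕ} (f : Pre k a b) : Rel δ ((Pre.id a).comp f) f
  | comp_id {a b : ℕ} (f : Pre k a b) : Rel δ (f.comp (Pre.id b)) f
  | assoc {a b c d : ℕ} (f : Pre k a b) (g : Pre k b c) (h : Pre k c d) :
      Rel δ ((f.comp g).comp h) (f.comp (g.comp h))
  | add_comp {a b c : ℕ} (f f' : Pre k a b) (g : Pre k b c) :
      Rel δ ((f.add f').comp g) ((f.comp g).add (f'.comp g))
  | comp_add {a b c : ℕ} (f : Pre k a b) (g g' : Pre k b c) :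
      Rel δ (f.comp (g.add g')) ((f.comp g).add (f.comp g'))
  | smul_comp {a b c : ℕ} (r : k) (f : Pre k a b) (g : Pre k b c) :
      Rel δ ((f.smul r).comp g) ((f.comp g).smul r)
  | comp_smul {a b c : ℕ} (r : k) (f : Pre k a b) (g : Pre k b c) :
      Rel δ (f.comp (g.smul r)) ((f.comp g).smul r)
  -- vector space structure on morphisms
  | add_assoc {a b : ℕ} (f g h : Pre k a b) : Rel δ ((f.add g).add h) (f.add (g.add h))
  | add_comm {a b : ℕ} (f g : Pre k a b) : Rel δ (f.add g) (g.add f)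
  | zero_add {a b : ℕ} (f : Pre k a b) : Rel δ (Pre.zero.add f) f
  | smul_add {a b : ℕ} (r : k) (f g : Pre k a b) :
      Rel δ ((f.add g).smul r) ((f.smul r).add (g.smul r))
  | add_smul {a b : ℕ} (r r' : k) (f : Pre k a b) :
      Rel δ (f.smul (r + r')) ((f.smul r).add (f.smul r'))
  | mul_smul {a b : ℕ} (r r' : k) (f : Pre k a b) :
      Rel δ (f.smul (r * r')) ((f.smul r').smul r)
  | one_smul {a b : ℕ} (f : Pre k a b) : Rel δ (f.smul 1) f
  | zero_smul {a b : ℕ} (f : Pre k a b) : Rel δ (f.smul 0) Pre.zero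
  -- a circle evaluates to `δ`
  | circle {m n : ℕ} (i : ℕ) (hi : i ≤ m) (h : n = m + 2) :
      Rel δ ((Pre.cup i hi h).comp (Pre.cap i hi h)) ((Pre.id m).smul δ)
  -- zigzags can be straightened
  | zigzag {m n : ℕ} (i j : ℕ) (hi : i ≤ m) (hj : j ≤ m) (h : n = m + 2) (hij : j = i + 1) :
      Rel δ ((Pre.cup i hi h).comp (Pre.cap j hj h)) (Pre.id m)
  | zagzig {m n : ℕ} (i j : ℕ) (hi : i ≤ m) (hj : j ≤ m) (h : n = m + 2) (hij : j = i + 1) :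
      Rel δ ((Pre.cup j hj h).comp (Pre.cap i hi h)) (Pre.id m)
  -- height exchange; here `j' = j + 2` is the position `j` after two strands appear on its left
  | cup_cup {a b b' c : ℕ} (i j j' : ℕ) (hij : i ≤ j) (hj' : j' = j + 2) (hj : j ≤ a) (hi : i ≤ a)
      (hib : i ≤ b) (hjb : j' ≤ b') (h₁ : b = a + 2) (h₂ : c = b + 2) (h₃ : b' = a + 2)
      (h₄ : c = b' + 2) :
      Rel δ ((Pre.cup j hj h₁).comp (Pre.cup i hib h₂))
        ((Pre.cup i hi h₃).comp (Pre.cup j' hjb h₄))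
  | cap_cap {a b b' c : ℕ} (i j j' : ℕ) (hij : i ≤ j) (hj' : j' = j + 2) (hj : j ≤ c) (hi : i ≤ c)
      (hib : i ≤ b) (hjb : j' ≤ b') (h₁ : a = b + 2) (h₂ : b = c + 2) (h₃ : a = b' + 2)
      (h₄ : b' = c + 2) :
      Rel δ ((Pre.cap i hib h₁).comp (Pre.cap j hj h₂))
        ((Pre.cap j' hjb h₃).comp (Pre.cap i hi h₄))
  | cap_cup {a b c d : ℕ} (i j j' : ℕ) (hij : i ≤ j) (hj' : j' = j + 2) (hi : i ≤ b) (hj : j ≤ b)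
      (hja : j' ≤ a) (hid : i ≤ d) (h₁ : a = b + 2) (h₂ : d = b + 2) (h₃ : c = a + 2)
      (h₄ : c = d + 2) :
      Rel δ ((Pre.cap i hi h₁).comp (Pre.cup j hj h₂))
        ((Pre.cup j' hja h₃).comp (Pre.cap i hid h₄))
  | cup_cap {a b c d : ℕ} (i j j' : ℕ) (hij : i ≤ j) (hj' : j' = j + 2) (hi : i ≤ b) (hj : j ≤ b)
      (hia : i ≤ a) (hjd : j' ≤ d) (h₁ : a = b + 2) (h₂ : d = b + 2) (h₃ : c = a + 2)
      (h₄ : c = d + 2) :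
      Rel δ ((Pre.cap j hj h₁).comp (Pre.cup i hi h₂))
        ((Pre.cup i hia h₃).comp (Pre.cap j' hjd h₄))

/-- The relation as a setoid. -/
def setoid (δ : k) (a b : ℕ) : Setoid (Pre k a b) :=
  ⟨Rel δ, ⟨Rel.refl, Rel.symm, Rel.trans⟩⟩

/-- Morphisms of the Temperley-Lieb category with circle value `δ`. -/
def Mor (δ : k) (a b : ℕ) : Type u := Quotient (setoid δ a b)

namespace Mor

variable {δ : k}

/-- The morphism represented by a formal expression. -/
def mk {a b : ℕ} (f : Pre k a b) : Mor δ a b := Quotient.mk (setoid δ a b) f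

theorem sound {a b : ℕ} {f g : Pre k a b} (h : Rel δ f g) : (mk f : Mor δ a b) = mk g :=
  Quotient.sound h

instance (a b : ℕ) : Zero (Mor δ a b) := ⟨mk Pre.zero⟩

instance (a b : ℕ) : Add (Mor δ a b) :=
  ⟨Quotient.map₂ Pre.add fun _ _ h _ _ h' => Rel.add_congr h h'⟩

instance (a b : ℕ) : SMul k (Mor δ a b) :=
  ⟨fun r => Quotient.map (Pre.smul r) fun _ _ h => Rel.smul_congr r h⟩

instance (a b : ℕ) : Neg (Mor δ a b) := ⟨fun f => (-1 : k) • f⟩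

/-- Vertical stacking, `f` below `g`. -/
def comp {a b c : ℕ} : Mor δ a b → Mor δ b c → Mor δ a c :=
  Quotient.map₂ Pre.comp fun _ _ h _ _ h' => Rel.comp_congr h h'

theorem zero_smul' {a b : ℕ} (f : Mor δ a b) : (0 : k) • f = 0 := by
  rcases f with ⟨f⟩; exact sound (.zero_smul f)

theorem one_smul' {a b : ℕ} (f : Mor δ a b) : (1 : k) • f = f := by
  rcases f with ⟨f⟩; exact sound (.one_smul f)

theorem add_smul' {a b : ℕ} (r r' : k) (f : Mor δ a b) : (r + r') • f = r • f + r' • f := by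
  rcases f with ⟨f⟩; exact sound (.add_smul r r' f)

theorem mul_smul' {a b : ℕ} (r r' : k) (f : Mor δ a b) : (r * r') • f = r • r' • f := by
  rcases f with ⟨f⟩; exact sound (.mul_smul r r' f)

theorem zero_add' {a b : ℕ} (f : Mor δ a b) : 0 + f = f := by
  rcases f with ⟨f⟩; exact sound (.zero_add f)

theorem add_comm' {a b : ℕ} (f g : Mor δ a b) : f + g = g + f := by
  rcases f with ⟨f⟩; rcases g with ⟨g⟩; exact sound (.add_comm f g)

instance (a b : ℕ) : AddCommGroup (Mor δ a b) where
  add_assoc := by rintro ⟨f⟩ ⟨g⟩ ⟨h⟩; exact sound (.add_assoc f g h)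
  zero_add := zero_add'
  add_zero f := by rw [add_comm', zero_add']
  add_comm := add_comm'
  neg_add_cancel f := by
    change (-1 : k) • f + f = 0
    nth_rewrite 2 [← one_smul' f]
    rw [← add_smul', neg_add_cancel, zero_smul']
  nsmul := nsmulRec
  zsmul := zsmulRec

instance (a b : ℕ) : Module k (Mor δ a b) where
  one_smul := one_smul'
  mul_smul := mul_smul'
  smul_zero r := by
    have h : (0 : Mor δ a b) = (0 : k) • 0 := (zero_smul' 0).symm
    rw [h, ← mul_smul', mul_zero]
  smul_add := by rintro r ⟨f⟩ ⟨g⟩; exact sound (.smul_add r f g)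
  add_smul := add_smul'
  zero_smul := zero_smul'

end Mor

/-- The objects of the Temperley-Lieb category with circle value `δ`: numbers of strands. -/
structure TL (δ : k) where
  n : ℕ

variable {δ : k}

instance : Category (TL δ) where
  Hom a b := Mor δ a.n b.n
  id a := Mor.mk (Pre.id a.n)
  comp f g := Mor.comp f g
  id_comp := by rintro _ _ ⟨f⟩; exact Mor.sound (.id_comp f)
  comp_id := by rintro _ _ ⟨f⟩; exact Mor.sound (.comp_id f)
  assoc := by rintro _ _ _ _ ⟨f⟩ ⟨g⟩ ⟨h⟩; exact Mor.sound (.assoc f g h)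

instance (a b : TL δ) : AddCommGroup (a ⟶ b) := inferInstanceAs (AddCommGroup (Mor δ a.n b.n))

instance (a b : TL δ) : Module k (a ⟶ b) := inferInstanceAs (Module k (Mor δ a.n b.n))

instance : Preadditive (TL δ) where
  add_comp := by rintro _ _ _ ⟨f⟩ ⟨f'⟩ ⟨g⟩; exact Mor.sound (.add_comp f f' g)
  comp_add := by rintro _ _ _ ⟨f⟩ ⟨g⟩ ⟨g'⟩; exact Mor.sound (.comp_add f g g')

instance : Linear k (TL δ) where
  smul_comp := by rintro _ _ _ r ⟨f⟩ ⟨g⟩; exact Mor.sound (.smul_comp r f g)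
  comp_smul := by rintro _ _ _ ⟨f⟩ r ⟨g⟩; exact Mor.sound (.comp_smul r f g)

/-- The elementary cup with `i` strands on its left. -/
def cup {m n : ℕ} (i : ℕ) (hi : i ≤ m) (h : n = m + 2) : (⟨m⟩ : TL δ) ⟶ ⟨n⟩ :=
  Mor.mk (Pre.cup i hi h)

/-- The elementary cap with `i` strands on its left. -/
def cap {m n : ℕ} (i : ℕ) (hi : i ≤ n) (h : m = n + 2) : (⟨m⟩ : TL δ) ⟶ ⟨n⟩ :=
  Mor.mk (Pre.cap i hi h)

/-! ### Horizontal juxtaposition and rotation -/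

namespace Pre

/-- Add `a` vertical strands on the left. -/
def wl (a : ℕ) : {m n : ℕ} → Pre k m n → Pre k (a + m) (a + n)
  | _, _, id n => id (a + n)
  | _, _, comp f g => comp (wl a f) (wl a g)
  | _, _, cup i hi h => cup (a + i) (by omega) (by omega)
  | _, _, cap i hi h => cap (a + i) (by omega) (by omega)
  | _, _, zero => zero
  | _, _, add f g => add (wl a f) (wl a g)
  | _, _, smul c f => smul c (wl a f)

/-- Add `b` vertical strands on the right. -/
def wr (b : ℕ) : {m n : ℕ} → Pre k m n → Pre k (m + b) (n + b)
  | _, _, id n => id (n + b)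
  | _, _, comp f g => comp (wr b f) (wr b g)
  | _, _, cup i hi h => cup i (by omega) (by omega)
  | _, _, cap i hi h => cap i (by omega) (by omega)
  | _, _, zero => zero
  | _, _, add f g => add (wr b f) (wr b g)
  | _, _, smul c f => smul c (wr b f)

/-- Rotate a diagram by 180 degrees. -/
def rot : {m n : ℕ} → Pre k m n → Pre k n m
  | _, _, id n => id n
  | _, _, comp f g => comp (rot g) (rot f)
  | _, _, cup (m := m) i hi h => cap (m - i) (by omega) h
  | _, _, cap (n := n) i hi h => cup (n - i) (by omega) h
  | _, _, zero => zero
  | _, _, add f g => add (rot f) (rot g)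
  | _, _, smul c f => smul c (rot f)

end Pre

theorem Rel.wl (a : ℕ) {m n : ℕ} {f g : Pre k m n} (h : Rel δ f g) :
    Rel δ (f.wl a) (g.wl a) := by
  induction h with
  | refl f => exact .refl _
  | symm _ ih => exact .symm ih
  | trans _ _ ih ih' => exact .trans ih ih'
  | comp_congr _ _ ih ih' => exact .comp_congr ih ih'
  | add_congr _ _ ih ih' => exact .add_congr ih ih'
  | smul_congr c _ ih => exact .smul_congr c ih
  | id_comp f => exact .id_comp _
  | comp_id f => exact .comp_id _
  | assoc f g h => exact .assoc _ _ _
  | add_comp f f' g => exact .add_comp _ _ _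
  | comp_add f g g' => exact .comp_add _ _ _
  | smul_comp r f g => exact .smul_comp _ _ _
  | comp_smul r f g => exact .comp_smul _ _ _
  | add_assoc f g h => exact .add_assoc _ _ _
  | add_comm f g => exact .add_comm _ _
  | zero_add f => exact .zero_add _
  | smul_add r f g => exact .smul_add _ _ _
  | add_smul r r' f => exact .add_smul _ _ _
  | mul_smul r r' f => exact .mul_smul _ _ _
  | one_smul f => exact .one_smul _
  | zero_smul f => exact .zero_smul _
  | circle i hi h => exact .circle _ _ _
  | zigzag i j hi hj h hij => exact .zigzag _ _ _ _ _ (by omega)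
  | zagzig i j hi hj h hij => exact .zagzig _ _ _ _ _ (by omega)
  | cup_cup i j j' => exact .cup_cup _ _ _ (by omega) (by omega) _ _ _ _ _ _ _ _
  | cap_cap i j j' => exact .cap_cap _ _ _ (by omega) (by omega) _ _ _ _ _ _ _ _
  | cap_cup i j j' => exact .cap_cup _ _ _ (by omega) (by omega) _ _ _ _ _ _ _ _
  | cup_cap i j j' => exact .cup_cap _ _ _ (by omega) (by omega) _ _ _ _ _ _ _ _

theorem Rel.wr (b : ℕ) {m n : ℕ} {f g : Pre k m n} (h : Rel δ f g) :
    Rel δ (f.wr b) (g.wr b) := by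
  induction h with
  | refl f => exact .refl _
  | symm _ ih => exact .symm ih
  | trans _ _ ih ih' => exact .trans ih ih'
  | comp_congr _ _ ih ih' => exact .comp_congr ih ih'
  | add_congr _ _ ih ih' => exact .add_congr ih ih'
  | smul_congr c _ ih => exact .smul_congr c ih
  | id_comp f => exact .id_comp _
  | comp_id f => exact .comp_id _
  | assoc f g h => exact .assoc _ _ _
  | add_comp f f' g => exact .add_comp _ _ _
  | comp_add f g g' => exact .comp_add _ _ _
  | smul_comp r f g => exact .smul_comp _ _ _
  | comp_smul r f g => exact .comp_smul _ _ _
  | add_assoc f g h => exact .add_assoc _ _ _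
  | add_comm f g => exact .add_comm _ _
  | zero_add f => exact .zero_add _
  | smul_add r f g => exact .smul_add _ _ _
  | add_smul r r' f => exact .add_smul _ _ _
  | mul_smul r r' f => exact .mul_smul _ _ _
  | one_smul f => exact .one_smul _
  | zero_smul f => exact .zero_smul _
  | circle i hi h => exact .circle _ _ _
  | zigzag i j hi hj h hij => exact .zigzag _ _ _ _ _ hij
  | zagzig i j hi hj h hij => exact .zagzig _ _ _ _ _ hij
  | cup_cup i j j' hij hj' => exact .cup_cup _ _ _ hij hj' _ _ _ _ _ _ _ _
  | cap_cap i j j' hij hj' => exact .cap_cap _ _ _ hij hj' _ _ _ _ _ _ _ _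
  | cap_cup i j j' hij hj' => exact .cap_cup _ _ _ hij hj' _ _ _ _ _ _ _ _
  | cup_cap i j j' hij hj' => exact .cup_cap _ _ _ hij hj' _ _ _ _ _ _ _ _

theorem Rel.rot {m n : ℕ} {f g : Pre k m n} (h : Rel δ f g) : Rel δ f.rot g.rot := by
  induction h with
  | refl f => exact .refl _
  | symm _ ih => exact .symm ih
  | trans _ _ ih ih' => exact .trans ih ih'
  | comp_congr _ _ ih ih' => exact .comp_congr ih' ih
  | add_congr _ _ ih ih' => exact .add_congr ih ih'
  | smul_congr c _ ih => exact .smul_congr c ih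
  | id_comp f => exact .comp_id _
  | comp_id f => exact .id_comp _
  | assoc f g h => exact .symm (.assoc _ _ _)
  | add_comp f f' g => exact .comp_add _ _ _
  | comp_add f g g' => exact .add_comp _ _ _
  | smul_comp r f g => exact .comp_smul _ _ _
  | comp_smul r f g => exact .smul_comp _ _ _
  | add_assoc f g h => exact .add_assoc _ _ _
  | add_comm f g => exact .add_comm _ _
  | zero_add f => exact .zero_add _
  | smul_add r f g => exact .smul_add _ _ _
  | add_smul r r' f => exact .add_smul _ _ _
  | mul_smul r r' f => exact .mul_smul _ _ _
  | one_smul f => exact .one_smul _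
  | zero_smul f => exact .zero_smul _
  | circle i hi h => exact .circle _ _ _
  | zigzag i j hi hj h hij => exact .zigzag _ _ _ _ _ (by omega)
  | zagzig i j hi hj h hij => exact .zagzig _ _ _ _ _ (by omega)
  | @cup_cup a b b' c i j j' hij hj' hj hi hib hjb h₁ h₂ h₃ h₄ =>
    have e : b' - j' = a - j := by omega
    simp only [Pre.rot, e]
    exact .symm (.cap_cap _ _ _ (by omega) (by omega) _ _ _ _ _ _ _ _)
  | @cap_cap a b b' c i j j' hij hj' hj hi hib hjb h₁ h₂ h₃ h₄ =>
    have e : b' - j' = c - j := by omega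
    simp only [Pre.rot, e]
    exact .symm (.cup_cup _ _ _ (by omega) (by omega) _ _ _ _ _ _ _ _)
  | @cap_cup a b c d i j j' hij hj' hi hj hja hid h₁ h₂ h₃ h₄ =>
    have e : a - j' = b - j := by omega
    simp only [Pre.rot, e]
    exact .cap_cup _ _ _ (by omega) (by omega) _ _ _ _ _ _ _ _
  | @cup_cap a b c d i j j' hij hj' hi hj hia hjd h₁ h₂ h₃ h₄ =>
    have e : d - j' = b - j := by omega
    simp only [Pre.rot, e]
    exact .cup_cap _ _ _ (by omega) (by omega) _ _ _ _ _ _ _ _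

/-- `id_a ⊗ f`. -/
def wl (a : ℕ) {m n : ℕ} (f : (⟨m⟩ : TL δ) ⟶ ⟨n⟩) : (⟨a + m⟩ : TL δ) ⟶ ⟨a + n⟩ :=
  Quotient.map (Pre.wl a) (fun _ _ h => Rel.wl a h) f

/-- `f ⊗ id_b`. -/
def wr (b : ℕ) {m n : ℕ} (f : (⟨m⟩ : TL δ) ⟶ ⟨n⟩) : (⟨m + b⟩ : TL δ) ⟶ ⟨n + b⟩ :=
  Quotient.map (Pre.wr b) (fun _ _ h => Rel.wr b h) f

/-- The dual morphism: rotation by 180 degrees. -/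
def rot {m n : ℕ} (f : (⟨m⟩ : TL δ) ⟶ ⟨n⟩) : (⟨n⟩ : TL δ) ⟶ ⟨m⟩ :=
  Quotient.map Pre.rot (fun _ _ h => Rel.rot h) f

/-- `f ⊗ g`: the diagram `f` to the left of the diagram `g`. -/
def tensor {a b c d : ℕ} (f : (⟨a⟩ : TL δ) ⟶ ⟨b⟩) (g : (⟨c⟩ : TL δ) ⟶ ⟨d⟩) :
    (⟨a + c⟩ : TL δ) ⟶ ⟨b + d⟩ :=
  wr c f ≫ wl b g

theorem wl_comp (r : ℕ) {a b c : ℕ} (f : (⟨a⟩ : TL δ) ⟶ ⟨b⟩) (g : (⟨b⟩ : TL δ) ⟶ ⟨c⟩) :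
    wl r (f ≫ g) = wl r f ≫ wl r g := by
  rcases f with ⟨f⟩; rcases g with ⟨g⟩; rfl

theorem wr_comp (r : ℕ) {a b c : ℕ} (f : (⟨a⟩ : TL δ) ⟶ ⟨b⟩) (g : (⟨b⟩ : TL δ) ⟶ ⟨c⟩) :
    wr r (f ≫ g) = wr r f ≫ wr r g := by
  rcases f with ⟨f⟩; rcases g with ⟨g⟩; rfl

theorem wl_add (r : ℕ) {a b : ℕ} (f g : (⟨a⟩ : TL δ) ⟶ ⟨b⟩) :
    wl r (f + g) = wl r f + wl r g := by
  rcases f with ⟨f⟩; rcases g with ⟨g⟩; rfl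

theorem wr_add (r : ℕ) {a b : ℕ} (f g : (⟨a⟩ : TL δ) ⟶ ⟨b⟩) :
    wr r (f + g) = wr r f + wr r g := by
  rcases f with ⟨f⟩; rcases g with ⟨g⟩; rfl

theorem rot_add {a b : ℕ} (f g : (⟨a⟩ : TL δ) ⟶ ⟨b⟩) : rot (f + g) = rot f + rot g := by
  rcases f with ⟨f⟩; rcases g with ⟨g⟩; rfl

theorem rot_comp {a b c : ℕ} (f : (⟨a⟩ : TL δ) ⟶ ⟨b⟩) (g : (⟨b⟩ : TL δ) ⟶ ⟨c⟩) :
    rot (f ≫ g) = rot g ≫ rot f := by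
  rcases f with ⟨f⟩; rcases g with ⟨g⟩; rfl

theorem wl_smul (r : ℕ) {a b : ℕ} (c : k) (f : (⟨a⟩ : TL δ) ⟶ ⟨b⟩) :
    wl r (c • f) = c • wl r f := by
  rcases f with ⟨f⟩; rfl

theorem wr_smul (r : ℕ) {a b : ℕ} (c : k) (f : (⟨a⟩ : TL δ) ⟶ ⟨b⟩) :
    wr r (c • f) = c • wr r f := by
  rcases f with ⟨f⟩; rfl

theorem exchange_aux {a b : ℕ} (f : (⟨a⟩ : TL δ) ⟶ ⟨b⟩)
    (hcup : ∀ {c d : ℕ} (j : ℕ) (hj : j ≤ c) (h : d = c + 2),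
      wr c f ≫ wl b (cup j hj h) = wl a (cup j hj h) ≫ wr d f)
    (hcap : ∀ {c d : ℕ} (j : ℕ) (hj : j ≤ d) (h : c = d + 2),
      wr c f ≫ wl b (cap j hj h) = wl a (cap j hj h) ≫ wr d f)
    {c d : ℕ} (g : Pre k c d) :
    wr c f ≫ wl b (Mor.mk g : (⟨c⟩ : TL δ) ⟶ ⟨d⟩) = wl a (Mor.mk g) ≫ wr d f := by
  induction g with
  | id n => exact (Category.comp_id (wr n f)).trans (Category.id_comp (wr n f)).symm
  | @comp c e d g g' ih ih' =>
    change wr c f ≫ (wl b (Mor.mk g) ≫ wl b (Mor.mk g')) =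
      (wl a (Mor.mk g) ≫ wl a (Mor.mk g')) ≫ wr d f
    rw [← Category.assoc, ih, Category.assoc, ih', Category.assoc]
  | zero =>
    change _ ≫ (0 : (⟨_⟩ : TL δ) ⟶ ⟨_⟩) = (0 : (⟨_⟩ : TL δ) ⟶ ⟨_⟩) ≫ _
    rw [Limits.zero_comp, Limits.comp_zero]
  | @add c d g g' ih ih' =>
    change wr c f ≫ (wl b (Mor.mk g) + wl b (Mor.mk g')) =
      (wl a (Mor.mk g) + wl a (Mor.mk g')) ≫ wr d f
    rw [Preadditive.add_comp, Preadditive.comp_add, ih, ih']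
  | @smul c d r g ih =>
    change wr c f ≫ (r • wl b (Mor.mk g)) = (r • wl a (Mor.mk g)) ≫ wr d f
    rw [Linear.smul_comp, Linear.comp_smul, ih]
  | cup j hj h => exact hcup j hj h
  | cap j hj h => exact hcap j hj h

theorem exchange_pre {a b c d : ℕ} (f : Pre k a b) (g : Pre k c d) :
    wr c (Mor.mk f : (⟨a⟩ : TL δ) ⟶ ⟨b⟩) ≫ wl b (Mor.mk g : (⟨c⟩ : TL δ) ⟶ ⟨d⟩) =
      wl a (Mor.mk g) ≫ wr d (Mor.mk f) := by
  induction f with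
  | id n =>
    exact (Category.id_comp (wl n (Mor.mk g))).trans (Category.comp_id (wl n (Mor.mk g))).symm
  | @comp a e b f f' ih ih' =>
    change (wr c (Mor.mk f) ≫ wr c (Mor.mk f')) ≫ wl b (Mor.mk g) =
      wl a (Mor.mk g) ≫ (wr d (Mor.mk f) ≫ wr d (Mor.mk f'))
    rw [Category.assoc, ih', ← Category.assoc, ih, Category.assoc]
  | zero =>
    change (0 : (⟨_⟩ : TL δ) ⟶ ⟨_⟩) ≫ _ = _ ≫ (0 : (⟨_⟩ : TL δ) ⟶ ⟨_⟩)
    rw [Limits.zero_comp, Limits.comp_zero]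
  | @add a b f f' ih ih' =>
    change (wr c (Mor.mk f) + wr c (Mor.mk f')) ≫ wl b (Mor.mk g) =
      wl a (Mor.mk g) ≫ (wr d (Mor.mk f) + wr d (Mor.mk f'))
    rw [Preadditive.add_comp, Preadditive.comp_add, ih, ih']
  | @smul a b r f ih =>
    change (r • wr c (Mor.mk f)) ≫ wl b (Mor.mk g) = wl a (Mor.mk g) ≫ (r • wr d (Mor.mk f))
    rw [Linear.smul_comp, Linear.comp_smul, ih]
  | @cup a b i hi h =>
    refine exchange_aux _ (fun j hj h' => ?_) (fun j hj h' => ?_) g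
    · exact (Mor.sound (Rel.cup_cup (δ := δ) i (a + j) (b + j)
        (by omega) (by omega) _ _ _ _ _ _ _ _)).symm
    · exact (Mor.sound (Rel.cup_cap (δ := δ) i (a + j) (b + j)
        (by omega) (by omega) _ _ _ _ _ _ _ _)).symm
  | @cap a b i hi h =>
    refine exchange_aux _ (fun j hj h' => ?_) (fun j hj h' => ?_) g
    · exact Mor.sound (Rel.cap_cup (δ := δ) i (b + j) (a + j)
        (by omega) (by omega) _ _ _ _ _ _ _ _)
    · exact Mor.sound (Rel.cap_cap (δ := δ) i (b + j) (a + j)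
        (by omega) (by omega) _ _ _ _ _ _ _ _)

/-- Diagrams side by side can be moved past each other vertically. -/
theorem exchange {a b c d : ℕ} (f : (⟨a⟩ : TL δ) ⟶ ⟨b⟩) (g : (⟨c⟩ : TL δ) ⟶ ⟨d⟩) :
    wr c f ≫ wl b g = wl a g ≫ wr d f := by
  rcases f with ⟨f⟩; rcases g with ⟨g⟩; exact exchange_pre f g

theorem tensor_comp {a b c a' b' c' : ℕ} (f : (⟨a⟩ : TL δ) ⟶ ⟨b⟩) (g : (⟨b⟩ : TL δ) ⟶ ⟨c⟩)
    (f' : (⟨a'⟩ : TL δ) ⟶ ⟨b'⟩) (g' : (⟨b'⟩ : TL δ) ⟶ ⟨c'⟩) :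
    tensor f f' ≫ tensor g g' = tensor (f ≫ g) (f' ≫ g') := by
  simp only [tensor, wr_comp, wl_comp, Category.assoc]
  rw [← Category.assoc (wl b f'), ← exchange g f']
  simp only [Category.assoc]

/-- `f ⊗ g` as a bilinear map. -/
def tensorₗ {a b c d : ℕ} : ((⟨a⟩ : TL δ) ⟶ ⟨b⟩) →ₗ[k] ((⟨c⟩ : TL δ) ⟶ ⟨d⟩) →ₗ[k]
    ((⟨a + c⟩ : TL δ) ⟶ ⟨b + d⟩) :=
  LinearMap.mk₂ k tensor
    (fun f f' g => by simp only [tensor, wr_add, Preadditive.add_comp])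
    (fun r f g => by simp only [tensor, wr_smul, Linear.smul_comp])
    (fun f g g' => by simp only [tensor, wl_add, Preadditive.comp_add])
    (fun r f g => by simp only [tensor, wl_smul, Linear.comp_smul])

/-! ### Nested arcs, partial traces, twists -/

/-- `n` nested cups, inserted into `N` strands with `i` strands on their left. -/
def cups (N i : ℕ) (hi : i ≤ N) : (n : ℕ) → ((⟨N⟩ : TL δ) ⟶ ⟨N + 2 * n⟩)
  | 0 => 𝟙 _
  | n + 1 => cups N i hi n ≫ cup (i + n) (by omega) (by omega)

/-- `n` nested caps, with `i` strands on their left and leaving `N` strands. -/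
def caps (N i : ℕ) (hi : i ≤ N) : (n : ℕ) → ((⟨N + 2 * n⟩ : TL δ) ⟶ ⟨N⟩)
  | 0 => 𝟙 _
  | n + 1 => cap (i + n) (by omega) (by omega) ≫ caps N i hi n

/-- The identity diagram between equal numbers of strands. -/
def cast {m n : ℕ} (h : m = n) : (⟨m⟩ : TL δ) ⟶ ⟨n⟩ := eqToHom (congrArg TL.mk h)

/-- Close the `n` rightmost strands around the right. -/
def ptrR {m m' : ℕ} (n : ℕ) (f : (⟨m + n⟩ : TL δ) ⟶ ⟨m' + n⟩) : (⟨m⟩ : TL δ) ⟶ ⟨m'⟩ :=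
  cups m m le_rfl n ≫ cast (by omega) ≫ wr n f ≫ cast (by omega) ≫ caps m' m' le_rfl n

/-- Close the `n` leftmost strands around the left. -/
def ptrL {m m' : ℕ} (n : ℕ) (f : (⟨n + m⟩ : TL δ) ⟶ ⟨n + m'⟩) : (⟨m⟩ : TL δ) ⟶ ⟨m'⟩ :=
  cups m 0 (by omega) n ≫ cast (by omega) ≫ wl n f ≫ cast (by omega) ≫ caps m' 0 (by omega) n

/-- Place `f` to the left of `g`, join the `n` lower right ends of `f` to the `n` lower left ends
of `g` by nested cups, and the `n'` upper right ends of `f` to the `n'` upper left ends of `g` by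
nested caps. -/
def glue {v v' n n' w w' : ℕ} (f : (⟨v + n⟩ : TL δ) ⟶ ⟨v' + n'⟩)
    (g : (⟨n + w⟩ : TL δ) ⟶ ⟨n' + w'⟩) : (⟨v + w⟩ : TL δ) ⟶ ⟨v' + w'⟩ :=
  cups (v + w) v (by omega) n ≫ cast (by omega) ≫ tensor f g ≫ cast (by omega) ≫
    caps (v' + w') v' (by omega) n'

/-- The Kauffman bracket crossing of the strands `i` and `i + 1` among `N` strands, in which the
strand from the lower left to the upper right is the upper one. -/
def crossing (q : k) {N : ℕ} (i : ℕ) (hi : i + 2 ≤ N) : (⟨N⟩ : TL δ) ⟶ ⟨N⟩ :=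
  q • 𝟙 _ + q⁻¹ • ((cap i (by omega) (by omega) : (⟨N⟩ : TL δ) ⟶ ⟨N - 2⟩) ≫
    cup i (by omega) (by omega))

/-- The double braiding of `n` strands with one further strand on their right. -/
def doubleBraiding (q : k) : (n : ℕ) → ((⟨n + 1⟩ : TL δ) ⟶ ⟨n + 1⟩)
  | 0 => 𝟙 _
  | n + 1 => crossing q n (by omega) ≫ wr 1 (doubleBraiding q n) ≫ crossing q n (by omega)

/-- The twist of the ribbon structure on `n` strands: a full twist of all strands, where each single
strand is twisted by `-q ^ 3`, the value of the positive kink.  It is determined by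
`θ_{X ⊗ Y} = (θ_X ⊗ θ_Y) ∘ β_{Y,X} ∘ β_{X,Y}`.  Replacing `q` by `q⁻¹` gives the inverse twist. -/
def twist (q : k) : (n : ℕ) → ((⟨n⟩ : TL δ) ⟶ ⟨n⟩)
  | 0 => 𝟙 _
  | n + 1 => (-q ^ 3) • (doubleBraiding q n ≫ wr 1 (twist q n))

end TemperleyLieb

/-! ### Linear structure on additive and idempotent completions -/

section Completion

variable {k : Type u} [Field k] {C : Type*} [Category C] [Preadditive C] [Linear k C]

instance matModule (M N : Mat_ C) : Module k (M ⟶ N) :=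
  inferInstanceAs (Module k (∀ (i : M.ι) (j : N.ι), M.X i ⟶ N.X j))

instance matLinear : Linear k (Mat_ C) where
  smul_comp X Y Z r f g := by
    ext i j
    change ∑ l, (r • f i l) ≫ g l j = r • ∑ l, f i l ≫ g l j
    simp only [Linear.smul_comp, Finset.smul_sum]
  comp_smul X Y Z f r g := by
    ext i j
    change ∑ l, f i l ≫ (r • g l j) = r • ∑ l, f i l ≫ g l j
    simp only [Linear.comp_smul, Finset.smul_sum]

instance karoubiModule (P Q : Karoubi C) : Module k (P ⟶ Q) where
  smul r f := ⟨r • f.f, by rw [Linear.smul_comp, Linear.comp_smul, f.comm]⟩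
  one_smul f := Karoubi.hom_ext _ _ (one_smul k f.f)
  mul_smul r r' f := Karoubi.hom_ext _ _ (mul_smul r r' f.f)
  smul_zero r := Karoubi.hom_ext _ _ (smul_zero r)
  smul_add r f g := Karoubi.hom_ext _ _ (smul_add r f.f g.f)
  add_smul r r' f := Karoubi.hom_ext _ _ (add_smul r r' f.f)
  zero_smul f := Karoubi.hom_ext _ _ (zero_smul k f.f)

instance karoubiLinear : Linear k (Karoubi C) where
  smul_comp X Y Z r f g := Karoubi.hom_ext _ _ (Linear.smul_comp _ _ _ r f.f g.f)
  comp_smul X Y Z f r g := Karoubi.hom_ext _ _ (Linear.comp_smul _ _ _ f.f r g.f)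

/-- An endomorphism or morphism between underlying objects, cut down by the idempotents. -/
def sandwich {P Q : Karoubi C} (f : P.X ⟶ Q.X) : P ⟶ Q :=
  ⟨P.p ≫ f ≫ Q.p, by simp⟩

end Completion

namespace MixedVerlinde

open TemperleyLieb

variable {k : Type u} [Field k] {δ : k}

/-! ### The Cauchy completion of the Temperley-Lieb category -/

/-- The Cauchy completion (finite direct sums, then direct summands) of the Temperley-Lieb category:
the category of tilting modules. -/
abbrev Tilt (δ : k) : Type (max 1 u) := Karoubi (Mat_ (TL δ))

/-- The object `T(1)^{⊗ n}`, given by `n` strands. -/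
def strands (n : ℕ) : Tilt δ := (toKaroubi _).obj ((Mat_.embedding (TL δ)).obj ⟨n⟩)

/-- The monoidal unit. -/
abbrev unit : Tilt δ := strands 0

/-- The tensor product of direct sums of strand objects. -/
def matTensor (M N : Mat_ (TL δ)) : Mat_ (TL δ) :=
  ⟨M.ι × N.ι, fun x => ⟨(M.X x.1).n + (N.X x.2).n⟩⟩

/-- The tensor product of matrices of diagrams. -/
def matTensorHom {M M' N N' : Mat_ (TL δ)} (f : M ⟶ M') (g : N ⟶ N') :
    matTensor M N ⟶ matTensor M' N' :=
  fun x y => tensor (f x.1 y.1) (g x.2 y.2)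

theorem matTensorHom_comp {M M' M'' N N' N'' : Mat_ (TL δ)} (f : M ⟶ M') (f' : M' ⟶ M'')
    (g : N ⟶ N') (g' : N' ⟶ N'') :
    matTensorHom f g ≫ matTensorHom f' g' = matTensorHom (f ≫ f') (g ≫ g') := by
  ext x z
  change ∑ y : M'.ι × N'.ι, tensor (f x.1 y.1) (g x.2 y.2) ≫ tensor (f' y.1 z.1) (g' y.2 z.2) =
    tensorₗ (∑ i, f x.1 i ≫ f' i z.1) (∑ j, g x.2 j ≫ g' j z.2)
  rw [LinearMap.map_sum₂, Fintype.sum_prod_type]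
  refine Finset.sum_congr rfl fun i _ => ?_
  rw [map_sum]
  exact Finset.sum_congr rfl fun j _ => tensor_comp _ _ _ _

/-- The tensor product of objects. -/
def tensorObj (X Y : Tilt δ) : Tilt δ :=
  ⟨matTensor X.X Y.X, matTensorHom X.p Y.p, by rw [matTensorHom_comp, X.idem, Y.idem]⟩

/-- The tensor product of morphisms. -/
def tensorHom {X X' Y Y' : Tilt δ} (f : X ⟶ X') (g : Y ⟶ Y') :
    tensorObj X Y ⟶ tensorObj X' Y' :=
  ⟨matTensorHom f.f g.f, by
    change matTensorHom _ _ ≫ matTensorHom _ _ ≫ matTensorHom _ _ = _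
    rw [matTensorHom_comp, matTensorHom_comp, f.comm, g.comm]⟩

/-- The dual object: the idempotent is rotated by 180 degrees. -/
def dual (X : Tilt δ) : Tilt δ where
  X := X.X
  p := fun i j => rot (X.p j i)
  idem := by
    ext i j
    have h := congrArg (fun f : X.X ⟶ X.X => f j i) X.idem
    change ∑ l, rot (X.p l i) ≫ rot (X.p j l) = rot (X.p j i)
    change ∑ l, X.p j l ≫ X.p l i = X.p j i at h
    rw [← h]
    refine (Eq.trans ?_ (map_sum (AddMonoidHom.mk' rot rot_add)
      (fun l => X.p j l ≫ X.p l i) Finset.univ).symm)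
    exact Finset.sum_congr rfl fun l _ => (rot_comp _ _).symm

/-- The partial trace over the right tensor factor. -/
def partialTraceR {P X : Tilt δ} (f : tensorObj P X ⟶ tensorObj P X) : P ⟶ P :=
  sandwich fun i i' => ∑ j : X.X.ι, ptrR (X.X.X j).n (f.f (i, j) (i', j))

/-- The partial trace over the left tensor factor. -/
def partialTraceL {X P : Tilt δ} (f : tensorObj X P ⟶ tensorObj X P) : P ⟶ P :=
  sandwich fun i i' => ∑ j : X.X.ι, ptrL (X.X.X j).n (f.f (j, i) (j, i'))

/-- For `f` on `V ⊗ G^*` placed to the left of `c` on `G ⊗ P`: join the lower ends of `G^*` and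
`G` by a cup and their upper ends by a cap. -/
def glueAlong {V G P : Tilt δ} (f : tensorObj V (dual G) ⟶ tensorObj V (dual G))
    (c : tensorObj G P ⟶ tensorObj G P) : tensorObj V P ⟶ tensorObj V P :=
  sandwich fun x y => ∑ i : G.X.ι, ∑ j : G.X.ι,
    glue (f.f (x.1, i) (y.1, j)) (c.f (i, x.2) (j, y.2))

/-- The twist of an object, for the Kauffman bracket with parameter `q`. -/
def twistHom (q : k) (X : Tilt δ) : X ⟶ X :=
  sandwich fun i j => twist q (X.X.X i).n ≫ (𝟙 X.X : X.X ⟶ X.X) i j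

/-! ### Indecomposable tilting objects and tensor ideals -/

/-- Nonzero, without nontrivial idempotent endomorphisms. -/
def IsIndecomposable (X : Tilt δ) : Prop :=
  𝟙 X ≠ 0 ∧ ∀ f : X ⟶ X, f ≫ f = f → f = 0 ∨ f = 𝟙 X

/-- `T` is (isomorphic to) the indecomposable tilting object `T(m)` of highest weight `m`: the
indecomposable summand of `T(1)^{⊗ m}` which is not a summand of any smaller tensor power. -/
def IsTilting (m : ℕ) (T : Tilt δ) : Prop :=
  IsIndecomposable T ∧ Nonempty (Retract T (strands m)) ∧
    ∀ r < m, IsEmpty (Retract T (strands r))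

/-- The morphisms that factor through a direct sum of objects `T(v - 1)` with `v ≥ N`. -/
def tiltIdeal (N : ℕ) (X Y : Tilt δ) : Submodule k (X ⟶ Y) :=
  Submodule.span k {h | ∃ (m : ℕ) (T : Tilt δ) (f : X ⟶ T) (g : T ⟶ Y),
    N ≤ m + 1 ∧ IsTilting m T ∧ h = f ≫ g}

/-- `X` is a direct sum of objects `T(v - 1)` with `v ≥ N`. -/
def MemTiltIdeal (N : ℕ) (X : Tilt δ) : Prop := 𝟙 X ∈ tiltIdeal N X X

/-! ### The projective ideal of the mixed Verlinde category of height two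

We take `ζ = q ^ 2` a primitive fourth root of unity, so that `ℓ = 2`, `p^{(1)} = 2` and
`p^{(2)} = 2 p`.  The mixed Verlinde category contains the quotient of `Tilt` by the ideal of
`p^{(2)}` as a full ribbon subcategory; its objects are those of `Tilt`, and its morphisms are those
of `Tilt` modulo `tiltIdeal (2 * p)`.  The projective objects of the mixed Verlinde category are the
objects in the ideal of `p^{(1)}`. -/

/-- Equality of morphisms in the quotient of `Tilt` by the ideal of `p^{(2)} = 2 p`. -/
def EqMod (p : ℕ) {X Y : Tilt δ} (f g : X ⟶ Y) : Prop := f - g ∈ tiltIdeal (2 * p) X Y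

/-- The projective objects. -/
def IsProj (X : Tilt δ) : Prop := MemTiltIdeal 2 X

/-- Projective generators: projectives `G` such that every projective is a direct summand of a
finite direct sum of copies of `G`. -/
def IsProjGenerator (p : ℕ) (G : Tilt δ) : Prop :=
  IsProj G ∧ ∀ P : Tilt δ, IsProj P → ∃ (r : ℕ) (f : Fin r → (P ⟶ G)) (g : Fin r → (G ⟶ P)),
    EqMod p (∑ i, f i ≫ g i) (𝟙 P)

/-- Projective covers of the unit, which is simple: the indecomposable projective objects with a
nonzero morphism to the unit. -/
def IsProjCoverUnit (p : ℕ) (P : Tilt δ) : Prop :=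
  IsProj P ∧ IsIndecomposable P ∧ ∃ f : P ⟶ unit, ¬ EqMod p f 0

/-- Modified traces on the ideal of projective objects.  Only the values of `t` on projective
objects are meaningful. -/
structure IsModifiedTrace (p : ℕ) (t : ∀ P : Tilt δ, (P ⟶ P) → k) : Prop where
  map_add : ∀ P, IsProj P → ∀ f g : P ⟶ P, t P (f + g) = t P f + t P g
  map_smul : ∀ P, IsProj P → ∀ (r : k) (f : P ⟶ P), t P (r • f) = r * t P f
  congr : ∀ P, IsProj P → ∀ f g : P ⟶ P, EqMod p f g → t P f = t P g
  cyclic : ∀ P Q, IsProj P → IsProj Q → ∀ (f : P ⟶ Q) (g : Q ⟶ P), t P (f ≫ g) = t Q (g ≫ f)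
  right : ∀ P X, IsProj P → ∀ f : tensorObj P X ⟶ tensorObj P X,
    t (tensorObj P X) f = t P (partialTraceR f)
  left : ∀ X P, IsProj P → ∀ f : tensorObj X P ⟶ tensorObj X P,
    t (tensorObj X P) f = t P (partialTraceL f)

/-- `Λ` is the cutting morphism of the projective object `Q`: the sum of the `x_i ∘ x^i` over bases
`x^i` of `Hom(Q, 1)` and `x_i` of `Hom(1, Q)` that are dual with respect to `t`. -/
def IsCutting (p : ℕ) (t : ∀ P : Tilt δ, (P ⟶ P) → k) (Q : Tilt δ) (Λ : Q ⟶ Q) : Prop :=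
  ∃ (r : ℕ) (y : Fin r → (Q ⟶ unit)) (x : Fin r → (unit ⟶ Q)),
    (∀ i j, t Q (y i ≫ x j) = if i = j then 1 else 0) ∧
    (∀ f : Q ⟶ unit, ∃ a : Fin r → k, EqMod p f (∑ i, a i • y i)) ∧
    (∀ g : unit ⟶ Q, ∃ a : Fin r → k, EqMod p g (∑ i, a i • x i)) ∧
    EqMod p Λ (∑ i, y i ≫ x i)

/-- `c` is a chromatic morphism based at `P`, for the projective generator `G`. -/
def IsChromatic (p : ℕ) (t : ∀ P : Tilt δ, (P ⟶ P) → k) (G P : Tilt δ)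
    (c : tensorObj G P ⟶ tensorObj G P) : Prop :=
  ∀ V, IsProj V → ∃ Λ : tensorObj V (dual G) ⟶ tensorObj V (dual G),
    IsCutting p t (tensorObj V (dual G)) Λ ∧ EqMod p (glueAlong Λ c) (𝟙 (tensorObj V P))

/-- The evaluation of the admissible skein in the 3-sphere that consists of the closure of an
endomorphism `f` of `P` and of an unlinked red unknot with one kink (of framing `+1` for the Kauffman
bracket parameter `q` of the category, and `-1` for its inverse), where the red unknot is made blue
by the chromatic morphism `c` based at `P`. -/
def redKink (t : ∀ P : Tilt δ, (P ⟶ P) → k) (q : k) {G P : Tilt δ}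
    (c : tensorObj G P ⟶ tensorObj G P) (f : P ⟶ P) : k :=
  t (tensorObj G P) (c ≫ tensorHom (twistHom q G) f)

/-- `d` is the value of the 2-handlebody invariant on the single 2-handle attached along an unknot
with one kink: the evaluation of the red kinked unknot together with the closure of the cutting
morphism of the projective cover of the unit. -/
def IsInvariantOfKink (p : ℕ) (t : ∀ P : Tilt δ, (P ⟶ P) → k) (q : k) (d : k) : Prop :=
  ∃ (G P : Tilt δ) (Λ : P ⟶ P) (c : tensorObj G P ⟶ tensorObj G P),
    IsProjGenerator p G ∧ IsProjCoverUnit p P ∧ IsCutting p t P Λ ∧ IsChromatic p t G P c ∧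
      d = redKink t q c Λ

/-- The value of a circle, for the Kauffman bracket with parameter `q`. -/
def circleValue (q : k) : k := -(q ^ 2 + (q ^ 2)⁻¹)

/-- `d` is the value `Δ₊` of the invariant on the complex projective plane. -/
def IsDeltaPlus (p : ℕ) (q : k) (t : ∀ P : Tilt (circleValue q), (P ⟶ P) → k) (d : k) : Prop :=
  IsInvariantOfKink p t q d

/-- `d` is the value `Δ₋` of the invariant on the complex projective plane with reversed
orientation. -/
def IsDeltaMinus (p : ℕ) (q : k) (t : ∀ P : Tilt (circleValue q), (P ⟶ P) → k) (d : k) : Prop :=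
  IsInvariantOfKink p t q⁻¹ d

/-- The mixed Verlinde category of height two is twist non-degenerate if `Δ₊` and `Δ₋` are nonzero,
for a nonzero modified trace; rescaling the trace rescales both values. -/
def IsTwistNondegenerate (p : ℕ) (q : k) : Prop :=
  ∃ t : ∀ P : Tilt (circleValue q), (P ⟶ P) → k, IsModifiedTrace p t ∧
    (∃ (P : Tilt (circleValue q)) (f : P ⟶ P), IsProj P ∧ t P f ≠ 0) ∧
    ∃ a b : k, IsDeltaPlus p q t a ∧ IsDeltaMinus p q t b ∧ a ≠ 0 ∧ b ≠ 0

end MixedVerlinde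

end

/-! The hypothesis forces `q ^ 4 = -1`, so the circle value is zero, and this makes everything
explicit.

Modified trace. A full closure vanishes as soon as it contains a free circle, so one strand is left
open: closing all strands but one turns an endomorphism of at least one strand into a scalar, `tr`.
It is the same for closing on the left and on the right and it is cyclic (`tr_comm`). The projective
objects are the summands of sums of nonempty strand objects (`tiltIdeal_two`), so `tr` extends to a
modified trace (`isModifiedTrace_modTr`), and every other one is a multiple of it
(`IsModifiedTrace.eq_modTr`).

Projectors. Jones-Wenzl projectors are built two strands at a time on `2 * s + 1` strands, for `s <
p`. Their traces satisfy `t (s + 2) = -(2 * t (s + 1) + t s)` with `t 0 = 1` and `t 1 = -2`, so `t s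
= (-1) ^ s * (s + 1)`. The first zero is at `s = p - 1`, on `2 * p - 1` strands. This top projector
generates the ideal of `2 * p` (`mem_tiltIdeal_iff`), and this ideal is the radical of the trace
form (`mem_jwIdeal_of_tr`).

Chromatic morphism. Bending the cutting morphism turns the defining condition into `∑ y i ≫ c ≫ x i
= id` for dual bases of `Hom(V, G)` and `Hom(G, V)`. For an odd number of strands in `V` the
identity is recovered from the lower projectors with coefficients `tr (jw s)`; for an even number
one borrows a strand of `P`. This gives the explicit `chrom` (`isChromatic_chrom`) for a generator
`gen`. The value of the kink does not depend on the chromatic morphism: inserting both chromatic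
identities into the trace and using cyclicity and naturality of the twist exchanges one for the
other (`redKink_eq_of_isChromatic`).

Value. Next to one strand the odd terms contain a circle and vanish, and the even term of index `s`
is the trace of the twist on `jw s` with one further strand, `-2 * q ^ 2 * tr (jw s)`
(`tr_jw_twist`). The sum is `-2 * q ^ 2 * ∑ (s + 1) ^ 2` over `s < p - 1`, and `-q ^ 2` is the
inverse of `q ^ 2`. The projective cover of the unit is two strands with cutting morphism cap-cup;
closing its second strand leaves one plain strand, so the value is the same. The integer is
divisible by `p` exactly when `p` exceeds 3, the case `p = 2` being excluded. -/

noncomputable section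

/-! ### Diagram calculus: whiskering with flexible strand numbers, and reflection. -/

namespace TemperleyLieb

variable {k : Type u} [Field k] {δ : k}

/-! ### Generators and whiskering with flexible numbers of strands -/

/-- Morphisms of the Temperley-Lieb category, indexed by numbers of strands. -/
abbrev THom (δ : k) (m n : ℕ) : Type u := (⟨m⟩ : TL δ) ⟶ ⟨n⟩

/-- Every morphism is represented by a formal expression, so a property stable under the operations
is checked on cups and caps alone. -/
theorem hom_induction {motive : ∀ {m n : ℕ}, THom δ m n → Prop}
    (id : ∀ n, motive (𝟙 (⟨n⟩ : TL δ)))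
    (comp : ∀ {a b c : ℕ} (f : THom δ a b) (g : THom δ b c), motive f → motive g → motive (f ≫ g))
    (cup : ∀ {m n : ℕ} (i : ℕ) (hi : i ≤ m) (h : n = m + 2), motive (cup i hi h))
    (cap : ∀ {m n : ℕ} (i : ℕ) (hi : i ≤ n) (h : m = n + 2), motive (cap i hi h))
    (zero : ∀ {m n : ℕ}, motive (0 : THom δ m n))
    (add : ∀ {m n : ℕ} (f g : THom δ m n), motive f → motive g → motive (f + g))
    (smul : ∀ {m n : ℕ} (c : k) (f : THom δ m n), motive f → motive (c • f))
    {m n : ℕ} (f : THom δ m n) : motive f := by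
  obtain ⟨f, rfl⟩ : ∃ f' : Pre k m n, (Mor.mk f' : Mor δ m n) = f := Quot.exists_rep f
  induction f with
  | id n => exact id n
  | comp f g ihf ihg => exact comp _ _ ihf ihg
  | cup i hi h => exact cup i hi h
  | cap i hi h => exact cap i hi h
  | zero => exact zero
  | add f g ihf ihg => exact add _ _ ihf ihg
  | smul c f ih => exact smul c _ ih

theorem cup_cap_circle {m n : ℕ} (i : ℕ) (hi : i ≤ m) (h : n = m + 2) :
    (cup i hi h : THom δ m n) ≫ cap i hi h = δ • 𝟙 _ := Mor.sound (.circle i hi h)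

theorem cup_cap_zigzag {m n : ℕ} (i j : ℕ) (hi : i ≤ m) (hj : j ≤ m) (h : n = m + 2)
    (hij : j = i + 1) : (cup i hi h : THom δ m n) ≫ cap j hj h = 𝟙 _ :=
  Mor.sound (.zigzag i j hi hj h hij)

theorem cup_cap_zagzig {m n : ℕ} (i j : ℕ) (hi : i ≤ m) (hj : j ≤ m) (h : n = m + 2)
    (hij : j = i + 1) : (cup j hj h : THom δ m n) ≫ cap i hi h = 𝟙 _ :=
  Mor.sound (.zagzig i j hi hj h hij)

theorem cup_cup_exchange {a b c : ℕ} (b' : ℕ) (i j j' : ℕ) (hij : i ≤ j) (hj' : j' = j + 2)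
    (hj : j ≤ a) (hib : i ≤ b) (h₁ : b = a + 2) (h₂ : c = b + 2) (h₃ : b' = a + 2) :
    (cup j hj h₁ : THom δ a b) ≫ cup i hib h₂ =
      (cup i (by omega) h₃ : THom δ a b') ≫ cup j' (by omega) (by omega) :=
  Mor.sound (.cup_cup i j j' hij hj' hj _ hib _ h₁ h₂ h₃ _)

theorem cap_cap_exchange {a b c : ℕ} (b' : ℕ) (i j j' : ℕ) (hij : i ≤ j) (hj' : j' = j + 2)
    (hj : j ≤ c) (hib : i ≤ b) (h₁ : a = b + 2) (h₂ : b = c + 2) (h₃ : a = b' + 2) :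
    (cap i hib h₁ : THom δ a b) ≫ cap j hj h₂ =
      (cap j' (by omega) h₃ : THom δ a b') ≫ cap i (by omega) (by omega) :=
  Mor.sound (.cap_cap i j j' hij hj' hj _ hib _ h₁ h₂ h₃ _)

theorem cap_cup_exchange {a b d : ℕ} (c : ℕ) (i j j' : ℕ) (hij : i ≤ j) (hj' : j' = j + 2)
    (hi : i ≤ b) (hj : j ≤ b) (h₁ : a = b + 2) (h₂ : d = b + 2) (h₃ : c = a + 2) :
    (cap i hi h₁ : THom δ a b) ≫ cup j hj h₂ =
      (cup j' (by omega) h₃ : THom δ a c) ≫ cap i (by omega) (by omega) :=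
  Mor.sound (.cap_cup i j j' hij hj' hi hj _ _ h₁ h₂ h₃ _)

theorem cap_cup_exchange' {a b d : ℕ} (c : ℕ) (i j j' : ℕ) (hij : i ≤ j) (hj' : j' = j + 2)
    (hi : i ≤ b) (hj : j ≤ b) (h₁ : a = b + 2) (h₂ : d = b + 2) (h₃ : c = a + 2) :
    (cap j hj h₁ : THom δ a b) ≫ cup i hi h₂ =
      (cup i (by omega) h₃ : THom δ a c) ≫ cap j' (by omega) (by omega) :=
  Mor.sound (.cup_cap i j j' hij hj' hi hj _ _ h₁ h₂ h₃ _)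

@[simp] theorem cast_rfl {m : ℕ} : (cast rfl : THom δ m m) = 𝟙 _ := rfl

theorem cast_self {m : ℕ} (h : m = m) : (cast h : THom δ m m) = 𝟙 _ := rfl

-- Strand numbers often agree only propositionally. Together with the following lemmas, this makes
-- `simp` absorb identity diagrams between equal numbers into the neighbouring cups, caps and
-- whiskerings.
@[simp] theorem cast_cast {l m n : ℕ} (h : l = m) (h' : m = n) :
    (cast h : THom δ l m) ≫ cast h' = cast (h.trans h') := by
  subst h h'; simp

@[simp] theorem cast_cast_assoc {l m n r : ℕ} (h : l = m) (h' : m = n) (f : THom δ n r) :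
    (cast h : THom δ l m) ≫ cast h' ≫ f = cast (h.trans h') ≫ f := by
  subst h h'; simp

@[simp] theorem cast_cup {l m n : ℕ} (h : l = m) (i : ℕ) (hi : i ≤ m) (h' : n = m + 2) :
    (cast h : THom δ l m) ≫ cup i hi h' = cup i (by omega) (by omega) := by
  subst h; simp

@[simp] theorem cup_cast {l m n : ℕ} (h : n = l) (i : ℕ) (hi : i ≤ m) (h' : n = m + 2) :
    (cup i hi h' : THom δ m n) ≫ cast h = cup i (by omega) (by omega) := by
  subst h; simp

@[simp] theorem cast_cap {l m n : ℕ} (h : l = m) (i : ℕ) (hi : i ≤ n) (h' : m = n + 2) :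
    (cast h : THom δ l m) ≫ cap i hi h' = cap i (by omega) (by omega) := by
  subst h; simp

@[simp] theorem cap_cast {l m n : ℕ} (h : n = l) (i : ℕ) (hi : i ≤ n) (h' : m = n + 2) :
    (cap i hi h' : THom δ m n) ≫ cast h = cap i (by omega) (by omega) := by
  subst h; simp

@[simp] theorem cast_cup_assoc {l m n r : ℕ} (h : l = m) (i : ℕ) (hi : i ≤ m) (h' : n = m + 2)
    (f : THom δ n r) :
    (cast h : THom δ l m) ≫ cup i hi h' ≫ f = cup i (by omega) (by omega) ≫ f := by
  subst h; simp

@[simp] theorem cup_cast_assoc {l m n r : ℕ} (h : n = l) (i : ℕ) (hi : i ≤ m) (h' : n = m + 2)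
    (f : THom δ l r) :
    (cup i hi h' : THom δ m n) ≫ cast h ≫ f = cup i (by omega) (by omega) ≫ f := by
  subst h; simp

@[simp] theorem cast_cap_assoc {l m n r : ℕ} (h : l = m) (i : ℕ) (hi : i ≤ n) (h' : m = n + 2)
    (f : THom δ n r) :
    (cast h : THom δ l m) ≫ cap i hi h' ≫ f = cap i (by omega) (by omega) ≫ f := by
  subst h; simp

@[simp] theorem cap_cast_assoc {l m n r : ℕ} (h : n = l) (i : ℕ) (hi : i ≤ n) (h' : m = n + 2)
    (f : THom δ l r) :
    (cap i hi h' : THom δ m n) ≫ cast h ≫ f = cap i (by omega) (by omega) ≫ f := by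
  subst h; simp

theorem wl_id (a n : ℕ) : wl a (𝟙 (⟨n⟩ : TL δ)) = 𝟙 _ := rfl

theorem wr_id (b n : ℕ) : wr b (𝟙 (⟨n⟩ : TL δ)) = 𝟙 _ := rfl

/-- `id_a ⊗ f ⊗ id_b`, with flexible numbers of strands. -/
def wh (a b : ℕ) {m n M N : ℕ} (hM : M = a + m + b) (hN : N = a + n + b) (f : THom δ m n) :
    THom δ M N :=
  cast hM ≫ wr b (wl a f) ≫ cast hN.symm

section

variable (a b : ℕ) {m n M N : ℕ} (hM : M = a + m + b) (hN : N = a + n + b)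

@[simp] theorem cast_wh {M' : ℕ} (h : M' = M) (f : THom δ m n) :
    (cast h : THom δ M' M) ≫ wh a b hM hN f = wh a b (h.trans hM) hN f := by
  subst h; simp

@[simp] theorem wh_cast {N' : ℕ} (h : N = N') (f : THom δ m n) :
    wh a b hM hN f ≫ cast h = wh a b hM (h.symm.trans hN) f := by
  subst h; simp

@[simp] theorem cast_wh_assoc {M' r : ℕ} (h : M' = M) (f : THom δ m n) (g : THom δ N r) :
    (cast h : THom δ M' M) ≫ wh a b hM hN f ≫ g = wh a b (h.trans hM) hN f ≫ g := by
  subst h; simp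

@[simp] theorem wh_cast_assoc {N' r : ℕ} (h : N = N') (f : THom δ m n) (g : THom δ N' r) :
    wh a b hM hN f ≫ cast h ≫ g = wh a b hM (h.symm.trans hN) f ≫ g := by
  subst h; simp

theorem wh_comp {l L : ℕ} (hL : L = a + l + b) (f : THom δ m n) (g : THom δ n l) :
    wh a b hM hL (f ≫ g) = wh a b hM hN f ≫ wh a b hN hL g := by
  subst hM hN hL
  simp [wh, wl_comp, wr_comp]

@[simp] theorem wh_id (hM' : N = a + m + b) :
    wh a b hM hM' (𝟙 (⟨m⟩ : TL δ)) = cast (hM.trans hM'.symm) := by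
  subst hM hM'
  simp [wh, wl_id, wr_id]

theorem wh_add (f g : THom δ m n) : wh a b hM hN (f + g) = wh a b hM hN f + wh a b hM hN g := by
  subst hM hN
  simp [wh, wl_add, wr_add]

theorem wh_smul (c : k) (f : THom δ m n) : wh a b hM hN (c • f) = c • wh a b hM hN f := by
  subst hM hN
  simp [wh, wl_smul, wr_smul]

/-- Whiskering as a linear map. -/
def whₗ : THom δ m n →ₗ[k] THom δ M N where
  toFun := wh a b hM hN
  map_add' := wh_add a b hM hN
  map_smul' := wh_smul a b hM hN

@[simp] theorem wh_zero : wh a b hM hN (0 : THom δ m n) = 0 := (whₗ a b hM hN).map_zero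

theorem wh_sub (f g : THom δ m n) : wh a b hM hN (f - g) = wh a b hM hN f - wh a b hM hN g :=
  (whₗ a b hM hN).map_sub f g

theorem wh_sum {ι : Type*} (s : Finset ι) (f : ι → THom δ m n) :
    wh a b hM hN (∑ i ∈ s, f i) = ∑ i ∈ s, wh a b hM hN (f i) :=
  map_sum (whₗ a b hM hN) f s

@[simp] theorem wh_cup (i : ℕ) (hi : i ≤ m) (h : n = m + 2) :
    wh a b hM hN (cup i hi h : THom δ m n) = cup (a + i) (by omega) (by omega) := by
  subst hM hN
  simp only [wh, cast_rfl, Category.id_comp, Category.comp_id]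
  rfl

@[simp] theorem wh_cap (i : ℕ) (hi : i ≤ n) (h : m = n + 2) :
    wh a b hM hN (cap i hi h : THom δ m n) = cap (a + i) (by omega) (by omega) := by
  subst hM hN
  simp only [wh, cast_rfl, Category.id_comp, Category.comp_id]
  rfl

theorem wh_wh (c d : ℕ) {M' N' : ℕ} (hM' : M' = c + M + d) (hN' : N' = c + N + d)
    (f : THom δ m n) : wh c d hM' hN' (wh a b hM hN f) =
      wh (c + a) (b + d) (by omega) (by omega) f := by
  subst hM hN hM' hN'
  induction f using hom_induction with
  | id n => simp
  | @comp m l n f g hf hg =>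
    rw [wh_comp a b _ (N := a + l + b) rfl _, wh_comp c d _ (N := c + (a + l + b) + d) rfl _, hf, hg,
      ← wh_comp]
  | cup i hi h => simp [add_assoc]
  | cap i hi h => simp [add_assoc]
  | zero => simp
  | add f g hf hg => simp [wh_add, hf, hg]
  | smul c f hf => simp [wh_smul, hf]

theorem wh_congr {a' b' : ℕ} (ha : a = a') (hb : b = b') (f : THom δ m n) :
    wh a b hM hN f = wh a' b' (by omega) (by omega) f := by
  subst ha hb; rfl

end

@[simp] theorem wh_zero_zero {m n M N : ℕ} (hM : M = 0 + m + 0) (hN : N = 0 + n + 0)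
    (f : THom δ m n) : wh 0 0 hM hN f = cast (by omega) ≫ f ≫ cast (by omega) := by
  obtain rfl : M = m := by omega
  obtain rfl : N = n := by omega
  induction f using hom_induction with
  | id n => simp
  | @comp m l n f g hf hg =>
    rw [wh_comp 0 0 _ (N := l) (by omega) _, hf (by omega) (by omega), hg (by omega) (by omega)]
    simp
  | cup i hi h => simp
  | cap i hi h => simp
  | zero => simp
  | add f g hf hg => simp [wh_add, hf, hg]
  | smul c f hf => simp [wh_smul, hf]

theorem wr_eq_wh {m n : ℕ} (b : ℕ) (f : THom δ m n) :
    wr b f = wh 0 b (by omega) (by omega) f := by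
  induction f using hom_induction with
  | id n => simp [wr_id]
  | @comp m l n f g hf hg => rw [wr_comp, hf, hg, ← wh_comp]
  | cup i hi h => simp; rfl
  | cap i hi h => simp; rfl
  | zero => simp; rfl
  | add f g hf hg => simp [wh_add, wr_add, hf, hg]
  | smul c f hf => simp [wh_smul, wr_smul, hf]

theorem wl_eq_wh {m n : ℕ} (a : ℕ) (f : THom δ m n) :
    wl a f = wh a 0 (by omega) (by omega) f := by
  induction f using hom_induction with
  | id n => simp [wl_id]
  | @comp m l n f g hf hg => rw [wl_comp, hf, hg, ← wh_comp]
  | cup i hi h => simp; rfl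
  | cap i hi h => simp; rfl
  | zero => simp; rfl
  | add f g hf hg => simp [wh_add, wl_add, hf, hg]
  | smul c f hf => simp [wh_smul, wl_smul, hf]

/-- Diagrams with disjoint support commute. -/
theorem wh_exchange {a b c d M N N' L : ℕ} (f : THom δ a b) (g : THom δ c d)
    (h₁ : M = 0 + a + c) (h₂ : N = 0 + b + c) (h₃ : N = b + c + 0) (h₄ : L = b + d + 0)
    (h₅ : M = a + c + 0) (h₆ : N' = a + d + 0) (h₇ : N' = 0 + a + d) (h₈ : L = 0 + b + d) :
    wh 0 c h₁ h₂ f ≫ wh b 0 h₃ h₄ g = wh a 0 h₅ h₆ g ≫ wh 0 d h₇ h₈ f := by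
  obtain rfl : M = a + c := by omega
  obtain rfl : N = b + c := by omega
  obtain rfl : N' = a + d := by omega
  obtain rfl : L = b + d := by omega
  have := exchange f g
  rwa [wr_eq_wh, wr_eq_wh, wl_eq_wh, wl_eq_wh] at this

theorem tensor_eq_wh {a b c d : ℕ} (f : THom δ a b) (g : THom δ c d) :
    tensor f g = wh 0 c (by omega) (N := b + c) (by omega) f ≫ wh b 0 (N := b + d) (by omega) (by omega) g := by
  rw [tensor, wr_eq_wh, wl_eq_wh]

/-- A cup to the right of everything can be moved below. -/
theorem wh_comp_cup {a b c M N N' : ℕ} (f : THom δ a b) (i : ℕ) (hi : b + i ≤ M)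
    (h₁ : N = M + 2) (h₂ : M = 0 + b + c) (h₃ : N' = 0 + a + c) (h₄ : N' + 2 = 0 + a + (c + 2)) :
    wh 0 c h₃ h₂ f ≫ cup (b + i) hi h₁ =
      (cup (a + i) (by omega) rfl : THom δ N' (N' + 2)) ≫ wh 0 (c + 2) h₄ (by omega) f := by
  have := wh_exchange f (cup i (by omega) rfl : THom δ c (c + 2)) h₃ h₂ (by omega) (L := N)
    (by omega) (by omega) (N' := N' + 2) (by omega) (by omega) (by omega)
  simpa using this

/-- The reflected exchange: a cap to the right of everything can be moved above. -/
theorem cap_comp_wh {a b c M N N' : ℕ} (f : THom δ a b) (i : ℕ) (hi : a + i ≤ M)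
    (h₁ : N = M + 2) (h₂ : M = 0 + a + c) (h₃ : N' = 0 + b + c) (h₄ : N' + 2 = 0 + b + (c + 2)) :
    (cap (a + i) hi h₁ : THom δ N M) ≫ wh 0 c h₂ h₃ f =
      wh 0 (c + 2) (by omega) h₄ f ≫ (cap (b + i) (by omega) rfl : THom δ (N' + 2) N') := by
  have := wh_exchange f (cap i (by omega) rfl : THom δ (c + 2) c) (M := N) (by omega) h₄ (by omega)
    (L := N') (by omega) (by omega) (N' := M) (by omega) (by omega) (by omega)
  simpa using this.symm

/-! ### Reflection in a horizontal line -/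

namespace Pre

/-- Reflect a diagram in a horizontal line. -/
def flip : {m n : ℕ} → Pre k m n → Pre k n m
  | _, _, id n => id n
  | _, _, comp f g => comp (flip g) (flip f)
  | _, _, cup i hi h => cap i hi h
  | _, _, cap i hi h => cup i hi h
  | _, _, zero => zero
  | _, _, add f g => add (flip f) (flip g)
  | _, _, smul c f => smul c (flip f)

end Pre

theorem Rel.flip {m n : ℕ} {f g : Pre k m n} (h : Rel δ f g) : Rel δ f.flip g.flip := by
  induction h with
  | refl f => exact .refl _
  | symm _ ih => exact .symm ih
  | trans _ _ ih ih' => exact .trans ih ih'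
  | comp_congr _ _ ih ih' => exact .comp_congr ih' ih
  | add_congr _ _ ih ih' => exact .add_congr ih ih'
  | smul_congr c _ ih => exact .smul_congr c ih
  | id_comp f => exact .comp_id _
  | comp_id f => exact .id_comp _
  | assoc f g h => exact .symm (.assoc _ _ _)
  | add_comp f f' g => exact .comp_add _ _ _
  | comp_add f g g' => exact .add_comp _ _ _
  | smul_comp r f g => exact .comp_smul _ _ _
  | comp_smul r f g => exact .smul_comp _ _ _
  | add_assoc f g h => exact .add_assoc _ _ _
  | add_comm f g => exact .add_comm _ _
  | zero_add f => exact .zero_add _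
  | smul_add r f g => exact .smul_add _ _ _
  | add_smul r r' f => exact .add_smul _ _ _
  | mul_smul r r' f => exact .mul_smul _ _ _
  | one_smul f => exact .one_smul _
  | zero_smul f => exact .zero_smul _
  | circle i hi h => exact .circle _ _ _
  | zigzag i j hi hj h hij => exact .zagzig _ _ _ _ _ hij
  | zagzig i j hi hj h hij => exact .zigzag _ _ _ _ _ hij
  | cup_cup i j j' hij hj' => exact .cap_cap i j j' hij hj' _ _ _ _ _ _ _ _
  | cap_cap i j j' hij hj' => exact .cup_cup i j j' hij hj' _ _ _ _ _ _ _ _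
  | cap_cup i j j' hij hj' => exact .cup_cap i j j' hij hj' _ _ _ _ _ _ _ _
  | cup_cap i j j' hij hj' => exact .cap_cup i j j' hij hj' _ _ _ _ _ _ _ _

/-- Reflection in a horizontal line. -/
def flip {m n : ℕ} (f : THom δ m n) : THom δ n m :=
  Quotient.map Pre.flip (fun _ _ h => Rel.flip h) f

@[simp] theorem flip_id (n : ℕ) : flip (𝟙 (⟨n⟩ : TL δ)) = 𝟙 _ := rfl

@[simp] theorem flip_cup {m n : ℕ} (i : ℕ) (hi : i ≤ m) (h : n = m + 2) :
    flip (cup i hi h : THom δ m n) = cap i hi h := rfl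

@[simp] theorem flip_cap {m n : ℕ} (i : ℕ) (hi : i ≤ n) (h : m = n + 2) :
    flip (cap i hi h : THom δ m n) = cup i hi h := rfl

@[simp] theorem flip_comp {a b c : ℕ} (f : THom δ a b) (g : THom δ b c) :
    flip (f ≫ g) = flip g ≫ flip f := by
  rcases f with ⟨f⟩; rcases g with ⟨g⟩; rfl

@[simp] theorem flip_add {a b : ℕ} (f g : THom δ a b) : flip (f + g) = flip f + flip g := by
  rcases f with ⟨f⟩; rcases g with ⟨g⟩; rfl

@[simp] theorem flip_smul {a b : ℕ} (c : k) (f : THom δ a b) : flip (c • f) = c • flip f := by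
  rcases f with ⟨f⟩; rfl

@[simp] theorem flip_zero {a b : ℕ} : flip (0 : THom δ a b) = 0 := rfl

/-- Reflection as a linear map. -/
def flipₗ {a b : ℕ} : THom δ a b →ₗ[k] THom δ b a where
  toFun := flip
  map_add' := flip_add
  map_smul' := flip_smul

@[simp] theorem flip_sub {a b : ℕ} (f g : THom δ a b) : flip (f - g) = flip f - flip g :=
  flipₗ.map_sub f g

@[simp] theorem flip_flip {a b : ℕ} (f : THom δ a b) : flip (flip f) = f := by
  induction f using hom_induction with
  | id n => rfl
  | comp f g hf hg => simp [hf, hg]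
  | cup i hi h => rfl
  | cap i hi h => rfl
  | zero => rfl
  | add f g hf hg => simp [hf, hg]
  | smul c f hf => simp [hf]

@[simp] theorem flip_cast {m n : ℕ} (h : m = n) : flip (cast h : THom δ m n) = cast h.symm := by
  subst h; rfl

@[simp] theorem flip_wh (a b : ℕ) {m n M N : ℕ} (hM : M = a + m + b) (hN : N = a + n + b)
    (f : THom δ m n) : flip (wh a b hM hN f) = wh a b hN hM (flip f) := by
  subst hM hN
  induction f using hom_induction with
  | id n => simp
  | @comp m l n f g hf hg => rw [wh_comp a b _ (N := a + l + b) rfl _, flip_comp, hf, hg, ← wh_comp,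
      ← flip_comp]
  | cup i hi h => simp
  | cap i hi h => simp
  | zero => simp
  | add f g hf hg => simp [wh_add, hf, hg]
  | smul c f hf => simp [wh_smul, hf]

theorem flip_rot {m n : ℕ} (f : THom δ m n) : flip (rot f) = rot (flip f) := by
  induction f using hom_induction with
  | id n => rfl
  | comp f g hf hg => simp [rot_comp, hf, hg]
  | cup i hi h => rfl
  | cap i hi h => rfl
  | zero => rfl
  | add f g hf hg => simp [rot_add, hf, hg]
  | smul c f hf =>
    rcases f with ⟨f⟩
    exact congrArg (c • ·) hf

end TemperleyLieb

end

/-! ### Spanning sets of diagrams, and nonvanishing of identities for circle value zero. -/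

noncomputable section

namespace TemperleyLieb

variable {k : Type u} [Field k] {δ : k}

/-! ### Normal forms: caps followed by cups -/

/-- Composites of caps. -/
inductive IsCaps : ∀ {m n : ℕ}, THom δ m n → Prop
  | id (n : ℕ) : IsCaps (𝟙 (⟨n⟩ : TL δ))
  | cons {m n l : ℕ} (i : ℕ) (hi : i ≤ n) (h : m = n + 2) {w : THom δ n l} :
      IsCaps w → IsCaps (cap i hi h ≫ w)

theorem IsCaps.comp {m n l : ℕ} {u : THom δ m n} {v : THom δ n l} (hu : IsCaps u)
    (hv : IsCaps v) : IsCaps (u ≫ v) := by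
  induction hu with
  | id n => simpa using hv
  | cons i hi h _ ih => rw [Category.assoc]; exact .cons i hi h (ih hv)

theorem IsCaps.le {m n : ℕ} {u : THom δ m n} (hu : IsCaps u) : ∃ r, m = n + 2 * r := by
  induction hu with
  | id n => exact ⟨0, rfl⟩
  | cons i hi h _ ih => obtain ⟨r, hr⟩ := ih; exact ⟨r + 1, by omega⟩

theorem IsCaps.eq_cast {m n : ℕ} {u : THom δ m n} (hu : IsCaps u) (h : m = n) : u = cast h := by
  cases hu with
  | id n => rfl
  | cons i hi h' hw => obtain ⟨r, hr⟩ := hw.le; omega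

/-- Each cap removes two strands and has finitely many positions. -/
theorem finite_isCaps (m n : ℕ) : {u : THom δ m n | IsCaps u}.Finite := by
  induction m using Nat.strong_induction_on with
  | _ m ih =>
    by_cases hm : ∃ l, m = l + 2
    · obtain ⟨l, rfl⟩ := hm
      refine Set.Finite.subset (((Set.finite_Iic l).biUnion' (t := fun i hi =>
        (fun w : THom δ l n => (cap i hi rfl : THom δ (l + 2) l) ≫ w) '' {w | IsCaps w})
        fun i hi => (ih l (by omega)).image _).union
        (Set.Subsingleton.finite (s := {u | ∃ h : l + 2 = n, u = cast h}) ?_)) ?_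
      · rintro _ ⟨h, rfl⟩ _ ⟨_, rfl⟩; rfl
      · intro u hu
        cases hu with
        | id n => exact Or.inr ⟨rfl, rfl⟩
        | @cons _ l' _ i hi h w hw =>
          obtain rfl : l' = l := by omega
          exact Or.inl (Set.mem_iUnion₂.2 ⟨i, hi, w, hw, rfl⟩)
    · refine Set.Subsingleton.finite ?_
      have key : ∀ u : THom δ m n, IsCaps u → ∃ h : m = n, u = cast h := by
        intro u hu
        cases hu with
        | id n => exact ⟨rfl, rfl⟩
        | cons i hi h hw => exact absurd ⟨_, h⟩ hm
      intro u hu v hv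
      obtain ⟨h, rfl⟩ := key u hu
      obtain ⟨_, rfl⟩ := key v hv
      rfl

/-- Composites of caps followed by cups. -/
def normalForms (δ : k) (m n : ℕ) : Set (THom δ m n) :=
  {f | ∃ (l : ℕ) (u : THom δ m l) (v : THom δ n l), IsCaps u ∧ IsCaps v ∧ f = u ≫ flip v}

theorem mem_span_normalForms_comp {m n l : ℕ} {f : THom δ m n}
    (hf : f ∈ Submodule.span k (normalForms δ m n)) {v : THom δ l n} (hv : IsCaps v) :
    f ≫ flip v ∈ Submodule.span k (normalForms δ m l) := by
  induction hf using Submodule.span_induction with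
  | mem f hf =>
    obtain ⟨r, u, w, hu, hw, rfl⟩ := hf
    exact Submodule.subset_span ⟨r, u, v ≫ w, hu, hv.comp hw, by simp⟩
  | zero => simp
  | add f g _ _ hf hg => rw [Preadditive.add_comp]; exact add_mem hf hg
  | smul c f _ hf => rw [Linear.smul_comp]; exact Submodule.smul_mem _ c hf

theorem cap_comp_mem_span_normalForms {m n l : ℕ} (i : ℕ) (hi : i ≤ n) (h : m = n + 2)
    {f : THom δ n l} (hf : f ∈ Submodule.span k (normalForms δ n l)) :
    cap i hi h ≫ f ∈ Submodule.span k (normalForms δ m l) := by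
  induction hf using Submodule.span_induction with
  | mem f hf =>
    obtain ⟨r, u, w, hu, hw, rfl⟩ := hf
    exact Submodule.subset_span ⟨r, cap i hi h ≫ u, w, .cons i hi h hu, hw, by simp⟩
  | zero => simp
  | add f g _ _ hf hg => rw [Preadditive.comp_add]; exact add_mem hf hg
  | smul c f _ hf => rw [Linear.comp_smul]; exact Submodule.smul_mem _ c hf

/-- The cup moves up through the caps one at a time: it passes a distant cap, forms a circle with a
cap at its own position, and is straightened by an adjacent cap. -/
theorem cup_comp_caps_mem {m n l : ℕ} (j : ℕ) (hj : j ≤ m) (h : n = m + 2) {w : THom δ n l}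
    (hw : IsCaps w) : cup j hj h ≫ w ∈ Submodule.span k (normalForms δ m l) := by
  induction hw generalizing m j with
  | id n =>
    refine Submodule.subset_span ⟨m, 𝟙 _, cap j hj h, .id m, ?_, by simp⟩
    simpa using IsCaps.cons j hj h (.id m)
  | @cons n n' l i hi h' w hw ih =>
    obtain rfl : n' = m := by omega
    have hmem : w ∈ Submodule.span k (normalForms δ n' l) :=
      Submodule.subset_span ⟨l, w, 𝟙 _, hw, .id l, by simp⟩
    rw [← Category.assoc]
    rcases lt_trichotomy i j with hij | rfl | hij
    · rcases Nat.lt_or_ge (i + 1) j with hij' | hij'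
      · obtain ⟨r, rfl⟩ : ∃ r, n' = r + 2 := ⟨n' - 2, by omega⟩
        rw [← cap_cup_exchange n i (j - 2) j (by omega) (by omega) (by omega) (by omega) rfl rfl h,
          Category.assoc]
        exact cap_comp_mem_span_normalForms _ _ _ (ih _ _ _)
      · rw [cup_cap_zagzig i j _ _ _ (by omega)]
        simpa using hmem
    · rw [cup_cap_circle]
      simpa using Submodule.smul_mem _ δ hmem
    · rcases Nat.lt_or_ge (j + 1) i with hij' | hij'
      · obtain ⟨r, rfl⟩ : ∃ r, n' = r + 2 := ⟨n' - 2, by omega⟩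
        rw [← cap_cup_exchange' n j (i - 2) i (by omega) (by omega) (by omega) (by omega) rfl rfl h,
          Category.assoc]
        exact cap_comp_mem_span_normalForms _ _ _ (ih _ _ _)
      · rw [cup_cap_zigzag j i _ _ _ (by omega)]
        simpa using hmem

/-- The span contains the identities and is stable under composition with each generator from below.
-/
theorem span_normalForms (m n : ℕ) : Submodule.span k (normalForms δ m n) = ⊤ := by
  have key : ∀ {m n : ℕ} (g : THom δ m n) {l : ℕ} (f : THom δ n l),
      f ∈ Submodule.span k (normalForms δ n l) →
        g ≫ f ∈ Submodule.span k (normalForms δ m l) := by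
    intro m n g
    induction g using hom_induction with
    | id n => intro l f hf; simpa using hf
    | comp g g' hg hg' => intro l f hf; rw [Category.assoc]; exact hg _ (hg' _ hf)
    | cup i hi h =>
      intro l f hf
      induction hf using Submodule.span_induction with
      | mem f hf =>
        obtain ⟨r, u, w, hu, hw, rfl⟩ := hf
        rw [← Category.assoc]
        exact mem_span_normalForms_comp (cup_comp_caps_mem i hi h hu) hw
      | zero => simp
      | add f g _ _ hf hg => rw [Preadditive.comp_add]; exact add_mem hf hg
      | smul c f _ hf => rw [Linear.comp_smul]; exact Submodule.smul_mem _ c hf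
    | cap i hi h => intro l f hf; exact cap_comp_mem_span_normalForms i hi h hf
    | zero => intro l f hf; simp
    | add g g' hg hg' => intro l f hf; rw [Preadditive.add_comp]; exact add_mem (hg _ hf) (hg' _ hf)
    | smul c g hg =>
      intro l f hf; rw [Linear.smul_comp]; exact Submodule.smul_mem _ c (hg _ hf)
  refine eq_top_iff.2 fun f _ => ?_
  simpa using key f (𝟙 _) (Submodule.subset_span ⟨n, 𝟙 _, 𝟙 _, .id n, .id n, by simp⟩)

theorem normalForm_induction {m n : ℕ} {motive : THom δ m n → Prop}
    (mem : ∀ (l : ℕ) (u : THom δ m l) (v : THom δ n l), IsCaps u → IsCaps v → motive (u ≫ flip v))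
    (zero : motive 0) (add : ∀ f g, motive f → motive g → motive (f + g))
    (smul : ∀ (c : k) f, motive f → motive (c • f)) (f : THom δ m n) : motive f := by
  have hf : f ∈ Submodule.span k (normalForms δ m n) := by rw [span_normalForms]; trivial
  induction hf using Submodule.span_induction with
  | mem f hf => obtain ⟨l, u, v, hu, hv, rfl⟩ := hf; exact mem l u v hu hv
  | zero => exact zero
  | add f g _ _ hf hg => exact add f g hf hg
  | smul c f _ hf => exact smul c f hf

instance finite_hom (m n : ℕ) : Module.Finite k (THom δ m n) := by
  rw [← Module.finite_def.symm.eq, ← span_normalForms]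
  refine Submodule.fg_span ?_
  refine Set.Finite.subset (((Set.finite_Iic m).biUnion (t := fun l =>
    (fun x : THom δ m l × THom δ n l => x.1 ≫ flip x.2) '' ({u | IsCaps u} ×ˢ {u | IsCaps u}))
    fun l _ => ((finite_isCaps m l).prod (finite_isCaps n l)).image _)) ?_
  rintro f ⟨l, u, v, hu, hv, rfl⟩
  obtain ⟨r, hr⟩ := hu.le
  exact Set.mem_iUnion₂.2 ⟨l, show l ≤ m by omega, (u, v), ⟨hu, hv⟩, rfl⟩

/-- Cups and caps change the number of strands by two. -/
theorem eq_zero_of_parity {m n : ℕ} (h : m % 2 ≠ n % 2) (f : THom δ m n) : f = 0 := by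
  induction f using normalForm_induction with
  | mem l u v hu hv =>
    obtain ⟨r, hr⟩ := hu.le
    obtain ⟨s, hs⟩ := hv.le
    omega
  | zero => rfl
  | add f g hf hg => rw [hf, hg, add_zero]
  | smul c f hf => rw [hf, smul_zero]

/-- `e` vanishes when followed by any cap. -/
def KillsCaps {m n : ℕ} (e : THom δ m n) : Prop :=
  ∀ (l i : ℕ) (hi : i ≤ l) (h : n = l + 2), e ≫ cap i hi h = 0

theorem KillsCaps.comp_isCaps {m n l : ℕ} {e : THom δ m n} (he : KillsCaps e) {u : THom δ n l}
    (hu : IsCaps u) (h : n ≠ l) : e ≫ u = 0 := by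
  cases hu with
  | id n => exact absurd rfl h
  | cons i hi h hw => rw [← Category.assoc, he, Limits.zero_comp]

theorem killsCaps_of_le_one {m n : ℕ} (hn : n ≤ 1) (e : THom δ m n) : KillsCaps e := by
  intro l i hi h; omega

/-- Between a morphism that kills caps and one that kills cups, only identities survive. -/
theorem KillsCaps.comp_eq_zero {a m n b : ℕ} {e : THom δ a m} {e' : THom δ b n}
    (he : KillsCaps e) (he' : KillsCaps e') (h : m ≠ n) (f : THom δ m n) :
    e ≫ f ≫ flip e' = 0 := by
  induction f using normalForm_induction with
  | mem l u v hu hv =>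
    by_cases hm : m = l
    · have h2 := he'.comp_isCaps hv (by omega)
      have h3 : flip v ≫ flip e' = 0 := by rw [← flip_comp, h2, flip_zero]
      rw [Category.assoc, h3, Limits.comp_zero, Limits.comp_zero]
    · rw [Category.assoc, ← Category.assoc e, he.comp_isCaps hu hm, Limits.zero_comp]
  | zero => simp
  | add f g hf hg => rw [Preadditive.add_comp, Preadditive.comp_add, hf, hg, add_zero]
  | smul c f hf => rw [Linear.smul_comp, Linear.comp_smul, hf, smul_zero]

/-- Only the coefficient of the identity diagram survives next to `e`; this is the Schur lemma for
projectors. -/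
theorem KillsCaps.comp_eq_smul {a m b : ℕ} {e : THom δ a m} {e' : THom δ b m}
    (he : KillsCaps e) (f : THom δ m m) :
    ∃ c : k, e ≫ f ≫ flip e' = c • (e ≫ flip e') := by
  induction f using normalForm_induction with
  | mem l u v hu hv =>
    by_cases hm : m = l
    · refine ⟨1, ?_⟩
      subst hm
      rw [hu.eq_cast rfl, hv.eq_cast rfl]
      simp
    · refine ⟨0, ?_⟩
      rw [Category.assoc, ← Category.assoc e, he.comp_isCaps hu hm, Limits.zero_comp, zero_smul]
  | zero => exact ⟨0, by simp⟩
  | add f g hf hg =>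
    obtain ⟨c, hc⟩ := hf
    obtain ⟨d, hd⟩ := hg
    exact ⟨c + d, by rw [Preadditive.add_comp, Preadditive.comp_add, hc, hd, add_smul]⟩
  | smul c f hf =>
    obtain ⟨d, hd⟩ := hf
    exact ⟨c * d, by rw [Linear.smul_comp, Linear.comp_smul, hd, mul_smul]⟩

theorem exists_eq_smul_id {n : ℕ} (hn : n ≤ 1) (f : THom δ n n) : ∃ c : k, f = c • 𝟙 _ := by
  simpa using (killsCaps_of_le_one hn (𝟙 (⟨n⟩ : TL δ))).comp_eq_smul (e' := 𝟙 (⟨n⟩ : TL δ)) f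

/-! ### The unit does not factor through a positive number of strands -/

/-- The functional that picks the coefficient of the empty diagram. -/
def Pre.eps : {m n : ℕ} → Pre k m n → k
  | _, _, id n => if n = 0 then 1 else 0
  | _, _, comp f g => eps f * eps g
  | _, _, cup _ _ _ => 0
  | _, _, cap _ _ _ => 0
  | _, _, zero => 0
  | _, _, add f g => eps f + eps g
  | _, _, smul c f => c * eps f

theorem Pre.eps_eq_zero {m n : ℕ} (f : Pre k m n) (h : m ≠ 0 ∨ n ≠ 0) : f.eps = 0 := by
  induction f with
  | id n => simp [eps]; omega
  | @comp a b c f g hf hg =>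
    by_cases ha : a = 0
    · simp [eps, hg (Or.inr (h.resolve_left (by simpa using ha)))]
    · simp [eps, hf (Or.inl ha)]
  | cup i hi h => rfl
  | cap i hi h => rfl
  | zero => rfl
  | add f g hf hg => simp [eps, hf h, hg h]
  | smul c f hf => simp [eps, hf h]

/-- Anything that meets a positive number of strands gets coefficient zero. This is compatible with
the circle relation only because the circle value is zero. -/
theorem Rel.eps {m n : ℕ} {f g : Pre k m n} (h : Rel (0 : k) f g) : f.eps = g.eps := by
  have hid : ∀ n, n ≠ 0 → (Pre.id n : Pre k n n).eps = 0 := fun n hn => if_neg hn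
  induction h with
  | refl f => rfl
  | symm _ ih => exact ih.symm
  | trans _ _ ih ih' => exact ih.trans ih'
  | comp_congr _ _ ih ih' => simp [Pre.eps, ih, ih']
  | add_congr _ _ ih ih' => simp [Pre.eps, ih, ih']
  | smul_congr c _ ih => simp [Pre.eps, ih]
  | @id_comp a b f =>
    by_cases ha : a = 0
    · simp [Pre.eps, ha]
    · simp [Pre.eps, f.eps_eq_zero (Or.inl ha)]
  | @comp_id a b f =>
    by_cases hb : b = 0
    · simp [Pre.eps, hb]
    · simp [Pre.eps, f.eps_eq_zero (Or.inr hb)]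
  | zigzag i j hi hj h hij => simp [Pre.eps]; omega
  | zagzig i j hi hj h hij => simp [Pre.eps]; omega
  | _ => simp [Pre.eps, mul_add, add_mul] <;> ring

/-- The coefficient of the empty diagram. -/
def eps {m n : ℕ} (f : THom (0 : k) m n) : k :=
  Quotient.lift Pre.eps (fun _ _ h => Rel.eps h) f

theorem eps_comp {a b c : ℕ} (f : THom (0 : k) a b) (g : THom (0 : k) b c) :
    eps (f ≫ g) = eps f * eps g := by
  rcases f with ⟨f⟩; rcases g with ⟨g⟩; rfl

theorem eps_eq_zero {m n : ℕ} (h : m ≠ 0 ∨ n ≠ 0) (f : THom (0 : k) m n) : eps f = 0 := by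
  rcases f with ⟨f⟩; exact f.eps_eq_zero h

theorem eps_smul_id (c : k) : eps (c • 𝟙 (⟨0⟩ : TL (0 : k))) = c := by
  change c * (if 0 = 0 then (1 : k) else 0) = c
  simp

/-- The composite is a scalar, read off by the multiplicative functional `eps`, and `eps` vanishes
on both factors. This is what separates the unit from the projective objects. -/
theorem comp_eq_zero_of_through (hδ : δ = 0) {n : ℕ} (hn : n ≠ 0) (f : THom δ 0 n)
    (g : THom δ n 0) : f ≫ g = 0 := by
  subst hδ
  obtain ⟨c, hc⟩ := exists_eq_smul_id zero_le_one (f ≫ g)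
  have h := eps_comp f g
  rw [hc, eps_smul_id, eps_eq_zero (Or.inr hn), zero_mul] at h
  rw [hc, h, zero_smul]

/-! ### A representation on functions of binary sequences -/

/-- Insert two terms into a sequence. -/
def insertTwo (i : ℕ) (x y : Bool) (σ : ℕ → Bool) : ℕ → Bool := fun n =>
  if n < i then σ n else if n = i then x else if n = i + 1 then y else σ (n - 2)

/-- Delete two terms from a sequence. -/
def deleteTwo (i : ℕ) (σ : ℕ → Bool) : ℕ → Bool := fun n => if n < i then σ n else σ (n + 2)

/-- The operator of a cap. -/
def capOp (s : k) (i : ℕ) : ((ℕ → Bool) → k) →ₗ[k] ((ℕ → Bool) → k) where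
  toFun φ σ := φ (insertTwo i false true σ) + s * φ (insertTwo i true false σ)
  map_add' φ ψ := by ext; simp; ring
  map_smul' c φ := by ext; simp; ring

/-- The coefficients of the cup operators. -/
def cupCoeff (s : k) (x y : Bool) : k := if x = y then 0 else if x then 1 else -s

/-- The operator of a cup. -/
def cupOp (s : k) (i : ℕ) : ((ℕ → Bool) → k) →ₗ[k] ((ℕ → Bool) → k) where
  toFun φ σ := cupCoeff s (σ i) (σ (i + 1)) * φ (deleteTwo i σ)
  map_add' φ ψ := by ext; simp; ring
  map_smul' c φ := by ext; simp; ring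

/-- The representation on formal expressions. -/
def Pre.rep (s : k) : {m n : ℕ} → Pre k m n → (((ℕ → Bool) → k) →ₗ[k] ((ℕ → Bool) → k))
  | _, _, id _ => LinearMap.id
  | _, _, comp f g => (rep s g).comp (rep s f)
  | _, _, cup i _ _ => cupOp s i
  | _, _, cap i _ _ => capOp s i
  | _, _, zero => 0
  | _, _, add f g => rep s f + rep s g
  | _, _, smul c f => c • rep s f

theorem deleteTwo_insertTwo (i : ℕ) (x y : Bool) (σ : ℕ → Bool) :
    deleteTwo i (insertTwo i x y σ) = σ := by
  funext n
  simp only [deleteTwo, insertTwo]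
  split_ifs <;> first | rfl | omega

theorem deleteTwo_insertTwo_succ (i : ℕ) (x y : Bool) (σ : ℕ → Bool) (h : σ i = y) :
    deleteTwo i (insertTwo (i + 1) x y σ) = σ := by
  funext n
  simp only [deleteTwo, insertTwo]
  split_ifs <;> first | rfl | omega | (rw [← h]; congr 1; omega)

theorem deleteTwo_succ_insertTwo (i : ℕ) (x y : Bool) (σ : ℕ → Bool) (h : σ i = x) :
    deleteTwo (i + 1) (insertTwo i x y σ) = σ := by
  funext n
  simp only [deleteTwo, insertTwo]
  split_ifs <;> first | rfl | omega | (rw [← h]; congr 1; omega)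

theorem insertTwo_comm (i j : ℕ) (hij : i ≤ j) (x y z w : Bool) (σ : ℕ → Bool) :
    insertTwo (j + 2) z w (insertTwo i x y σ) = insertTwo i x y (insertTwo j z w σ) := by
  funext n
  simp only [insertTwo]
  split_ifs <;> first | rfl | omega

theorem deleteTwo_comm (i j : ℕ) (hij : i ≤ j) (σ : ℕ → Bool) :
    deleteTwo i (deleteTwo (j + 2) σ) = deleteTwo j (deleteTwo i σ) := by
  funext n
  simp only [deleteTwo]
  split_ifs <;> first | rfl | omega

theorem deleteTwo_insertTwo_lt (i j : ℕ) (hij : i ≤ j) (x y : Bool) (σ : ℕ → Bool) :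
    deleteTwo (j + 2) (insertTwo i x y σ) = insertTwo i x y (deleteTwo j σ) := by
  funext n
  simp only [deleteTwo, insertTwo]
  split_ifs <;> first | rfl | omega | (congr 1; omega)

theorem deleteTwo_insertTwo_gt (i j : ℕ) (hij : i ≤ j) (x y : Bool) (σ : ℕ → Bool) :
    deleteTwo i (insertTwo (j + 2) x y σ) = insertTwo j x y (deleteTwo i σ) := by
  funext n
  simp only [deleteTwo, insertTwo]
  split_ifs <;> first | rfl | omega | (congr 1; omega)

theorem insertTwo_of_lt {i n : ℕ} (h : n < i) (x y : Bool) (σ : ℕ → Bool) :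
    insertTwo i x y σ n = σ n := by simp [insertTwo, h]

theorem insertTwo_self (i : ℕ) (x y : Bool) (σ : ℕ → Bool) : insertTwo i x y σ i = x := by
  simp [insertTwo]

theorem insertTwo_succ (i : ℕ) (x y : Bool) (σ : ℕ → Bool) : insertTwo i x y σ (i + 1) = y := by
  simp [insertTwo]

theorem insertTwo_of_ge {i n : ℕ} (h : i ≤ n) (x y : Bool) (σ : ℕ → Bool) :
    insertTwo i x y σ (n + 2) = σ n := by
  simp only [insertTwo]
  split_ifs <;> first | rfl | omega

theorem deleteTwo_of_lt {i n : ℕ} (h : n < i) (σ : ℕ → Bool) : deleteTwo i σ n = σ n := by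
  simp [deleteTwo, h]

theorem deleteTwo_of_ge {i n : ℕ} (h : i ≤ n) (σ : ℕ → Bool) :
    deleteTwo i σ n = σ (n + 2) := by
  simp [deleteTwo, h]

theorem capOp_cupOp_self (s : k) (i : ℕ) : (capOp s i).comp (cupOp s i) = 0 := by
  ext φ σ
  simp [capOp, cupOp, insertTwo_self, insertTwo_succ, deleteTwo_insertTwo, cupCoeff]

theorem capOp_succ_cupOp (s : k) (hs : s * s = -1) (i : ℕ) :
    (capOp s (i + 1)).comp (cupOp s i) = LinearMap.id := by
  refine LinearMap.ext fun φ => funext fun σ => ?_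
  change cupCoeff s _ _ * φ _ + s * (cupCoeff s _ _ * φ _) = φ σ
  rw [insertTwo_of_lt (Nat.lt_succ_self i), insertTwo_of_lt (Nat.lt_succ_self i), insertTwo_self,
    insertTwo_self]
  cases h : σ i
  · rw [deleteTwo_insertTwo_succ i true false σ h]
    simp only [cupCoeff]
    simp
    linear_combination (-φ σ) * hs
  · rw [deleteTwo_insertTwo_succ i false true σ h]
    simp [cupCoeff]

theorem capOp_cupOp_succ (s : k) (hs : s * s = -1) (i : ℕ) :
    (capOp s i).comp (cupOp s (i + 1)) = LinearMap.id := by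
  refine LinearMap.ext fun φ => funext fun σ => ?_
  change cupCoeff s _ _ * φ _ + s * (cupCoeff s _ _ * φ _) = φ σ
  rw [insertTwo_succ, insertTwo_succ, insertTwo_of_ge le_rfl, insertTwo_of_ge le_rfl]
  cases h : σ i
  · rw [deleteTwo_succ_insertTwo i false true σ h]
    simp [cupCoeff]
  · rw [deleteTwo_succ_insertTwo i true false σ h]
    simp only [cupCoeff]
    simp
    linear_combination (-φ σ) * hs

theorem cupOp_cupOp (s : k) (i j : ℕ) (hij : i ≤ j) :
    (cupOp s i).comp (cupOp s j) = (cupOp s (j + 2)).comp (cupOp s i) := by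
  refine LinearMap.ext fun φ => funext fun σ => ?_
  change cupCoeff s _ _ * (cupCoeff s _ _ * φ _) = cupCoeff s _ _ * (cupCoeff s _ _ * φ _)
  rw [deleteTwo_comm i j hij, deleteTwo_of_ge hij, deleteTwo_of_ge (Nat.le_succ_of_le hij),
    deleteTwo_of_lt (by omega), deleteTwo_of_lt (by omega), mul_left_comm]

theorem capOp_capOp (s : k) (i j : ℕ) (hij : i ≤ j) :
    (capOp s j).comp (capOp s i) = (capOp s i).comp (capOp s (j + 2)) := by
  refine LinearMap.ext fun φ => funext fun σ => ?_
  change _ + s * _ + s * (_ + s * _) = _ + s * _ + s * (_ + s * _)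
  simp only [insertTwo_comm i j hij]
  ring

theorem cupOp_capOp (s : k) (i j : ℕ) (hij : i ≤ j) :
    (cupOp s j).comp (capOp s i) = (capOp s i).comp (cupOp s (j + 2)) := by
  refine LinearMap.ext fun φ => funext fun σ => ?_
  change cupCoeff s _ _ * (_ + s * _) =
    (cupCoeff s _ _ * _) + s * (cupCoeff s _ _ * _)
  simp only [deleteTwo_insertTwo_lt i j hij, insertTwo_of_ge hij,
    show j + 2 + 1 = j + 1 + 2 by omega, insertTwo_of_ge (Nat.le_succ_of_le hij)]
  ring

theorem cupOp_capOp' (s : k) (i j : ℕ) (hij : i ≤ j) :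
    (cupOp s i).comp (capOp s j) = (capOp s (j + 2)).comp (cupOp s i) := by
  refine LinearMap.ext fun φ => funext fun σ => ?_
  change cupCoeff s _ _ * (_ + s * _) =
    (cupCoeff s _ _ * _) + s * (cupCoeff s _ _ * _)
  simp only [deleteTwo_insertTwo_gt i j hij, insertTwo_of_lt (show i < j + 2 by omega),
    insertTwo_of_lt (show i + 1 < j + 2 by omega)]
  ring

/-- A form of the classical action on tensor powers of a plane. Using infinite sequences avoids
tracking the number of strands; the zigzags need `s * s = -1`, while the two contributions `-s` and
`s` of a circle cancel. -/
theorem Rel.rep {s : k} (hs : s * s = -1) {m n : ℕ} {f g : Pre k m n} (h : Rel (0 : k) f g) :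
    f.rep s = g.rep s := by
  induction h with
  | refl f => rfl
  | symm _ ih => exact ih.symm
  | trans _ _ ih ih' => exact ih.trans ih'
  | comp_congr _ _ ih ih' => simp only [Pre.rep, ih, ih']
  | add_congr _ _ ih ih' => simp only [Pre.rep, ih, ih']
  | smul_congr c _ ih => simp only [Pre.rep, ih]
  | add_assoc f g h => simp only [Pre.rep, _root_.add_assoc]
  | add_comm f g => simp only [Pre.rep, _root_.add_comm]
  | add_smul r r' f => simp only [Pre.rep, _root_.add_smul]
  | mul_smul r r' f => simp only [Pre.rep, SemigroupAction.mul_smul]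
  | circle i hi h => simp [Pre.rep, capOp_cupOp_self]
  | zigzag i j hi hj h hij => subst hij; exact capOp_succ_cupOp s hs i
  | zagzig i j hi hj h hij => subst hij; exact capOp_cupOp_succ s hs i
  | cup_cup i j j' hij hj' => subst hj'; exact cupOp_cupOp s i j hij
  | cap_cap i j j' hij hj' => subst hj'; exact capOp_capOp s i j hij
  | cap_cup i j j' hij hj' => subst hj'; exact cupOp_capOp s i j hij
  | cup_cap i j j' hij hj' => subst hj'; exact cupOp_capOp' s i j hij
  | _ =>
    refine LinearMap.ext fun φ => ?_
    simp [Pre.rep]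

/-- The identity diagram acts as the identity operator, which is not zero. -/
theorem id_ne_zero (hδ : δ = 0) {s : k} (hs : s * s = -1) (n : ℕ) : 𝟙 (⟨n⟩ : TL δ) ≠ 0 := by
  subst hδ
  intro h
  have h' : Rel (0 : k) (Pre.id n) Pre.zero := Quotient.exact h
  have := congrArg (fun T => T (fun _ => (1 : k)) (fun _ => true)) (Rel.rep hs h')
  exact one_ne_zero this

end TemperleyLieb

end

/-! ### The scalar trace obtained by closing all strands but one. -/

noncomputable section

namespace TemperleyLieb

variable {k : Type u} [Field k] {δ : k}

/-! ### Closing one strand -/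

/-- Close the rightmost strand. -/
def closeR {m n M N : ℕ} (hM : M = m + 1) (hN : N = n + 1) (f : THom δ M N) : THom δ m n :=
  cup m le_rfl rfl ≫ wh 0 1 (M := m + 2) (N := n + 2) (by omega) (by omega) f ≫ cap n le_rfl rfl

/-- Close the leftmost strand. -/
def closeL {m n M N : ℕ} (hM : M = m + 1) (hN : N = n + 1) (f : THom δ M N) : THom δ m n :=
  cup 0 (Nat.zero_le _) rfl ≫ wh 1 0 (M := m + 2) (N := n + 2) (by omega) (by omega) f ≫
    cap 0 (Nat.zero_le _) rfl

section

variable {m n M N : ℕ} (hM : M = m + 1) (hN : N = n + 1)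

/-- Closing the rightmost strand as a linear map. -/
def closeRₗ : THom δ M N →ₗ[k] THom δ m n where
  toFun := closeR hM hN
  map_add' f g := by simp [closeR, wh_add]
  map_smul' c f := by simp [closeR, wh_smul]

/-- Closing the leftmost strand as a linear map. -/
def closeLₗ : THom δ M N →ₗ[k] THom δ m n where
  toFun := closeL hM hN
  map_add' f g := by simp [closeL, wh_add]
  map_smul' c f := by simp [closeL, wh_smul]

theorem closeR_add (f g : THom δ M N) : closeR hM hN (f + g) = closeR hM hN f + closeR hM hN g :=
  (closeRₗ hM hN).map_add f g

theorem closeR_smul (c : k) (f : THom δ M N) : closeR hM hN (c • f) = c • closeR hM hN f :=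
  (closeRₗ hM hN).map_smul c f

theorem closeR_zero : closeR hM hN (0 : THom δ M N) = 0 := (closeRₗ hM hN).map_zero

theorem closeL_add (f g : THom δ M N) : closeL hM hN (f + g) = closeL hM hN f + closeL hM hN g :=
  (closeLₗ hM hN).map_add f g

theorem closeL_smul (c : k) (f : THom δ M N) : closeL hM hN (c • f) = c • closeL hM hN f :=
  (closeLₗ hM hN).map_smul c f

theorem flip_closeR (f : THom δ M N) : flip (closeR hM hN f) = closeR hN hM (flip f) := by
  simp [closeR]

theorem flip_closeL (f : THom δ M N) : flip (closeL hM hN f) = closeL hN hM (flip f) := by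
  simp [closeL]

/-- A diagram that avoids the closed strand slides below the closing cup. -/
theorem closeR_wh_comp {l L : ℕ} (hL : L = l + 1) (h : L = 0 + l + 1) (h' : M = 0 + m + 1)
    (g : THom δ l m) (f : THom δ M N) :
    closeR hL hN (wh 0 1 h h' g ≫ f) = g ≫ closeR hM hN f := by
  subst hL hM
  rw [closeR, closeR, wh_comp 0 1 _ (N := m + 2) (by omega) _, wh_wh, Category.assoc,
    ← Category.assoc (cup l _ _), ← Category.assoc g]
  congr 1
  have := wh_comp_cup (N := m + 2) (c := 0) (N' := l) g 0 (by omega) rfl (by omega) (by omega)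
    (by omega)
  simp only [wh_zero_zero, cast_rfl, Category.id_comp, Category.comp_id] at this
  exact this.symm

theorem closeR_comp_wh {l L : ℕ} (hL : L = l + 1) (h : N = 0 + n + 1) (h' : L = 0 + l + 1)
    (f : THom δ M N) (g : THom δ n l) :
    closeR hM hL (f ≫ wh 0 1 h h' g) = closeR hM hN f ≫ g := by
  have := congrArg flip (closeR_wh_comp hN hM hL h' h (flip g) (flip f))
  simpa [flip_closeR] using this

theorem closeL_wh_comp {l L : ℕ} (hL : L = l + 1) (h : L = 1 + l + 0) (h' : M = 1 + m + 0)
    (g : THom δ l m) (f : THom δ M N) :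
    closeL hL hN (wh 1 0 h h' g ≫ f) = g ≫ closeL hM hN f := by
  subst hL hM
  rw [closeL, closeL, wh_comp 1 0 _ (N := m + 2) (by omega) _, wh_wh, Category.assoc,
    ← Category.assoc (cup 0 _ _), ← Category.assoc g]
  congr 1
  have := wh_exchange (cup 0 le_rfl rfl : THom δ 0 2) g (M := l) (N := l + 2) (L := m + 2) (N' := m)
    (by omega) (by omega) (by omega) (by omega) (by omega) (by omega) (by omega) (by omega)
  simpa using this

theorem closeL_comp_wh {l L : ℕ} (hL : L = l + 1) (h : N = 1 + n + 0) (h' : L = 1 + l + 0)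
    (f : THom δ M N) (g : THom δ n l) :
    closeL hM hL (f ≫ wh 1 0 h h' g) = closeL hM hN f ≫ g := by
  have := congrArg flip (closeL_wh_comp hN hM hL h' h (flip g) (flip f))
  simpa [flip_closeL] using this

theorem closeR_wh (f : THom δ m n) (h : M = 0 + m + 1) (h' : N = 0 + n + 1) :
    closeR hM hN (wh 0 1 h h' f) = δ • f := by
  have := closeR_wh_comp (M := n + 1) (N := N) rfl hN hM h (by omega) f (cast hN.symm)
  rw [wh_cast] at this
  rw [this]
  subst hN
  simp [closeR, cup_cap_circle]

/-- The closing arcs lie on opposite sides and are exchanged in height. -/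
theorem closeR_closeL {M' N' : ℕ} (hM' : M' = M + 1) (hN' : N' = N + 1) (f : THom δ M' N') :
    closeR hM hN (closeL hM' hN' f) = closeL hM hN (closeR hM' hN' f) := by
  subst hM hN hM' hN'
  simp only [closeR, closeL]
  rw [wh_comp 0 1 _ (N := m + 4) (by omega) _, wh_comp 0 1 _ (N := n + 4) (by omega) _,
    wh_comp 1 0 _ (N := m + 4) (by omega) _, wh_comp 1 0 _ (N := n + 4) (by omega) _]
  simp only [wh_cup, wh_cap, wh_wh, Category.assoc]
  rw [← Category.assoc (cup m _ _), cup_cup_exchange (m + 2) 0 m (m + 2) (by omega) rfl _ _ _ _ rfl,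
    cap_cap_exchange (n + 2) 0 n (n + 2) (by omega) rfl _ _ _ _ (by omega), Category.assoc]
  simp only [Nat.add_comm 1]

end

/-! ### Morphisms between few strands -/

theorem IsCaps.eq_cap {m n : ℕ} {u : THom δ m n} (hu : IsCaps u) (h : m = n + 2) :
    ∃ (i : ℕ) (hi : i ≤ n), u = cap i hi h := by
  cases hu with
  | id n => omega
  | @cons _ n' _ i hi h' w hw =>
    obtain rfl : n' = n := by omega
    refine ⟨i, hi, ?_⟩
    rw [hw.eq_cast rfl]
    simp

theorem exists_hom_two_two (f : THom δ 2 2) : ∃ a b : k,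
    f = a • 𝟙 _ + b • ((cap 0 le_rfl rfl : THom δ 2 0) ≫ cup 0 le_rfl rfl) := by
  induction f using normalForm_induction with
  | mem l u v hu hv =>
    obtain ⟨r, hr⟩ := hu.le
    obtain rfl | rfl : l = 2 ∨ l = 0 := by omega
    · rw [hu.eq_cast rfl, hv.eq_cast rfl]
      exact ⟨1, 0, by simp⟩
    · obtain ⟨i, hi, rfl⟩ := hu.eq_cap rfl
      obtain ⟨j, hj, rfl⟩ := hv.eq_cap rfl
      obtain rfl : i = 0 := by omega
      obtain rfl : j = 0 := by omega
      exact ⟨0, 1, by simp⟩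
  | zero => exact ⟨0, 0, by simp⟩
  | add f g hf hg =>
    obtain ⟨a, b, rfl⟩ := hf
    obtain ⟨c, d, rfl⟩ := hg
    exact ⟨a + c, b + d, by simp only [add_smul]; abel⟩
  | smul c f hf =>
    obtain ⟨a, b, rfl⟩ := hf
    exact ⟨c * a, c * b, by simp only [smul_add, mul_smul]⟩

theorem exists_hom_three_one (f : THom δ 3 1) : ∃ a b : k,
    f = a • cap 0 zero_le_one rfl + b • cap 1 le_rfl rfl := by
  induction f using normalForm_induction with
  | mem l u v hu hv =>
    obtain ⟨r, hr⟩ := hv.le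
    obtain rfl : l = 1 := by obtain ⟨s, hs⟩ := hu.le; omega
    rw [hv.eq_cast rfl]
    obtain ⟨i, hi, rfl⟩ := hu.eq_cap rfl
    obtain rfl | rfl : i = 0 ∨ i = 1 := by omega
    · exact ⟨1, 0, by simp⟩
    · exact ⟨0, 1, by simp⟩
  | zero => exact ⟨0, 0, by simp⟩
  | add f g hf hg =>
    obtain ⟨a, b, rfl⟩ := hf
    obtain ⟨c, d, rfl⟩ := hg
    exact ⟨a + c, b + d, by simp only [add_smul]; abel⟩
  | smul c f hf =>
    obtain ⟨a, b, rfl⟩ := hf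
    exact ⟨c * a, c * b, by simp only [smul_add, mul_smul]⟩

theorem exists_hom_two_zero (f : THom δ 2 0) : ∃ a : k, f = a • cap 0 le_rfl rfl := by
  induction f using normalForm_induction with
  | mem l u v hu hv =>
    obtain ⟨r, hr⟩ := hv.le
    obtain rfl : l = 0 := by omega
    rw [hv.eq_cast rfl]
    obtain ⟨i, hi, rfl⟩ := hu.eq_cap rfl
    obtain rfl : i = 0 := by omega
    exact ⟨1, by simp⟩
  | zero => exact ⟨0, by simp⟩
  | add f g hf hg =>
    obtain ⟨a, rfl⟩ := hf
    obtain ⟨c, rfl⟩ := hg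
    exact ⟨a + c, by simp only [add_smul]⟩
  | smul c f hf =>
    obtain ⟨a, rfl⟩ := hf
    exact ⟨c * a, by simp only [mul_smul]⟩

/-- Caps that end at the empty diagram pass through two strands last, so a diagram through no
strands can be handled on a positive number of strands. -/
theorem IsCaps.exists_cap_zero {n l : ℕ} {u : THom δ n l} (hu : IsCaps u) (hl : l = 0)
    (hn : n ≠ 0) : ∃ u' : THom δ n 2, IsCaps u' ∧ u = u' ≫ cap 0 (Nat.zero_le _) (by omega) := by
  induction hu with
  | id n => omega
  | @cons m n l i hi h w hw ih =>
    by_cases hn' : n = 0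
    · subst hn' hl
      obtain rfl : m = 2 := by omega
      obtain rfl : i = 0 := by omega
      refine ⟨𝟙 _, .id 2, ?_⟩
      rw [hw.eq_cast rfl]
      simp
    · obtain ⟨u', hu', rfl⟩ := ih hl hn'
      exact ⟨cap i hi h ≫ u', .cons i hi h hu', by simp⟩

theorem closeR_two : closeR (m := 1) (n := 1) rfl rfl
    ((cap 0 le_rfl rfl : THom δ 2 0) ≫ cup 0 le_rfl rfl) = 𝟙 _ := by
  rw [closeR, wh_comp 0 1 _ (N := 1) (by omega) _]
  simp only [wh_cap, wh_cup, Category.assoc]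
  rw [← Category.assoc, cup_cap_zagzig 0 1 _ _ _ rfl, cup_cap_zigzag 0 1 _ _ _ rfl]
  simp

theorem closeL_two : closeL (m := 1) (n := 1) rfl rfl
    ((cap 0 le_rfl rfl : THom δ 2 0) ≫ cup 0 le_rfl rfl) = 𝟙 _ := by
  rw [closeL, wh_comp 1 0 _ (N := 1) (by omega) _]
  simp only [wh_cap, wh_cup, Category.assoc]
  rw [← Category.assoc, cup_cap_zigzag 0 1 _ _ _ rfl, cup_cap_zagzig 0 1 _ _ _ rfl]
  simp

/-! ### The trace: close all strands but one -/

/-- The circle value is zero and the strand is nonzero. -/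
class IsDegenerate (δ : k) : Prop where
  circle : δ = 0
  id_ne_zero : 𝟙 (⟨1⟩ : TL δ) ≠ 0

theorem exists_dual_eq_one {V : Type*} [AddCommGroup V] [Module k V] (v : V) :
    ∃ φ : V →ₗ[k] k, v ≠ 0 → φ v = 1 := by
  by_cases hv : v = 0
  · exact ⟨0, fun h => absurd hv h⟩
  · obtain ⟨φ, hφ⟩ : ∃ φ : Module.Dual k V, φ v ≠ 0 := by
      by_contra! h
      exact hv ((Module.forall_dual_apply_eq_zero_iff k v).1 h)
    exact ⟨(φ v)⁻¹ • φ, fun _ => by simp [hφ]⟩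

theorem circle_smul [IsDegenerate δ] {V : Type*} [AddCommGroup V] [Module k V] (v : V) :
    δ • v = 0 := by
  rw [IsDegenerate.circle (δ := δ), zero_smul]

theorem closeR_wh_eq_zero [IsDegenerate δ] {m n M N : ℕ} (hM : M = m + 1) (hN : N = n + 1)
    (f : THom δ m n) (h : M = 0 + m + 1) (h' : N = 0 + n + 1) :
    closeR hM hN (wh 0 1 h h' f) = 0 := by
  rw [closeR_wh, circle_smul]

/-- The scalar by which an endomorphism of a single strand acts. -/
def coeffOne (δ : k) : THom δ 1 1 →ₗ[k] k :=
  Classical.choose (exists_dual_eq_one (𝟙 (⟨1⟩ : TL δ)))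

/-- Close all strands but the leftmost one. -/
def tr : (n : ℕ) → (THom δ n n →ₗ[k] k)
  -- A default value: no strand is left to stay open, and the empty object is not projective.
  | 0 => 0
  | 1 => coeffOne δ
  | n + 2 => (tr (n + 1)).comp (closeRₗ (m := n + 1) (n := n + 1) rfl rfl)

theorem tr_succ {n : ℕ} (hn : 1 ≤ n) (f : THom δ (n + 1) (n + 1)) :
    tr (n + 1) f = tr n (closeR rfl rfl f) := by
  obtain ⟨n, rfl⟩ := Nat.exists_eq_add_of_le' hn
  rfl

/-- Left and right closures commute, which reduces the claim to two strands, where it holds for the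
identity and for cap-cup. -/
theorem tr_eq_tr_closeL {n M : ℕ} (hn : 1 ≤ n) (hM : M = n + 1) (f : THom δ M M) :
    tr M f = tr n (closeL hM hM f) := by
  subst hM
  induction n, hn using Nat.le_induction with
  | base =>
    rw [tr_succ le_rfl]
    obtain ⟨a, b, rfl⟩ := exists_hom_two_two f
    simp only [closeR_add, closeR_smul, closeL_add, closeL_smul, closeR_two, closeL_two]
    congr 3
    simp [closeR, closeL, cup_cap_circle]
  | succ n hn ih =>
    rw [tr_succ (by omega), ih, ← closeR_closeL, ← tr_succ hn]

section Trace

variable [IsDegenerate δ]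

theorem cup_cap_self {m n : ℕ} (i : ℕ) (hi : i ≤ m) (h : n = m + 2) :
    (cup i hi h : THom δ m n) ≫ cap i hi h = 0 := by
  rw [cup_cap_circle, IsDegenerate.circle (δ := δ), zero_smul]

theorem coeffOne_id : coeffOne δ (𝟙 (⟨1⟩ : TL δ)) = 1 :=
  Classical.choose_spec (exists_dual_eq_one (𝟙 (⟨1⟩ : TL δ))) IsDegenerate.id_ne_zero

@[simp] theorem tr_one_id : tr 1 (𝟙 (⟨1⟩ : TL δ)) = 1 := coeffOne_id

theorem tr_flip {n : ℕ} (f : THom δ n n) : tr n (flip f) = tr n f := by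
  induction n with
  | zero => rfl
  | succ n ih =>
    by_cases hn : n = 0
    · subst hn
      obtain ⟨c, rfl⟩ := exists_eq_smul_id le_rfl f
      simp
    · rw [tr_succ (by omega), tr_succ (by omega), ← flip_closeR, ih]

/-- Closing an outer strand commutes with a cup that does not touch it; one of the two sides is
always available, which reduces the claim to one and three strands. -/
theorem tr_comp_cup {n N : ℕ} (hn : 1 ≤ n) (hN : N = n + 2) (i : ℕ) (hi : i ≤ n) (f : THom δ N n) :
    tr N (f ≫ cup i hi hN) = tr n (cup i hi hN ≫ f) := by
  subst hN
  induction n, hn using Nat.le_induction generalizing i with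
  | base =>
    have hδ : δ = 0 := IsDegenerate.circle
    rw [tr_succ (by omega), tr_succ (by omega)]
    have h00 : closeR (m := 2) (n := 2) rfl rfl
        ((cap 0 zero_le_one rfl : THom δ 3 1) ≫ cup 0 zero_le_one rfl) = 0 := by
      have := closeR_wh (M := 3) (N := 3) (m := 2) (n := 2) rfl rfl
        ((cap 0 le_rfl rfl : THom δ 2 0) ≫ cup 0 le_rfl rfl) rfl rfl
      rw [wh_comp 0 1 _ (N := 1) rfl _] at this
      simpa [hδ] using this
    have h11 : closeR (m := 2) (n := 2) rfl rfl
        ((cap 1 le_rfl rfl : THom δ 3 1) ≫ cup 1 le_rfl rfl) = 𝟙 _ := by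
      rw [closeR, wh_comp 0 1 _ (N := 2) (by omega) _]
      simp only [wh_cap, wh_cup, Category.assoc]
      rw [← Category.assoc, cup_cap_zagzig _ _ _ _ _ rfl, cup_cap_zigzag _ _ _ _ _ rfl]
      simp
    have h01 : closeR (m := 2) (n := 2) rfl rfl
        ((cap 0 zero_le_one rfl : THom δ 3 1) ≫ cup 1 le_rfl rfl) =
          (cap 0 le_rfl rfl : THom δ 2 0) ≫ cup 0 le_rfl rfl := by
      rw [closeR, wh_comp 0 1 _ (N := 2) (by omega) _]
      simp only [wh_cap, wh_cup, Category.assoc]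
      rw [cup_cap_zigzag _ _ _ _ _ rfl, Category.comp_id,
        ← cap_cup_exchange 4 0 0 2 le_rfl (by omega) _ _ rfl rfl _]
    have h10 : closeR (m := 2) (n := 2) rfl rfl
        ((cap 1 le_rfl rfl : THom δ 3 1) ≫ cup 0 zero_le_one rfl) =
          (cap 0 le_rfl rfl : THom δ 2 0) ≫ cup 0 le_rfl rfl := by
      have := congrArg flip h01
      simpa [flip_closeR] using this
    obtain ⟨a, b, rfl⟩ := exists_hom_three_one f
    simp only [Preadditive.add_comp, Preadditive.comp_add, Linear.smul_comp, Linear.comp_smul,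
      closeR_add, closeR_smul]
    have hid : closeR (m := 1) (n := 1) rfl rfl (𝟙 (⟨2⟩ : TL δ)) = 0 := by
      simp [closeR, cup_cap_circle, hδ]
    obtain rfl | rfl : i = 0 ∨ i = 1 := by omega
    · rw [h00, h10, cup_cap_self, cup_cap_zigzag _ _ _ _ _ rfl]
      simp [closeR_two, closeR_zero]
    · rw [h11, h01, cup_cap_self, cup_cap_zagzig _ _ _ _ _ rfl]
      have hid' : b * tr 1 (closeR (m := 1) (n := 1) rfl rfl (𝟙 (⟨2⟩ : TL δ))) = 0 := by
        rw [hid, map_zero, mul_zero]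
      simp only [map_add, map_smul, closeR_two, smul_zero, smul_eq_mul, add_zero]
      exact add_eq_left.2 hid'
  | succ n hn ih =>
    -- The cup avoids the rightmost strand here; otherwise it is the last one and avoids the
    -- leftmost strand.
    by_cases h : i ≤ n
    · rw [tr_succ (by omega), tr_succ hn]
      have h1 := closeR_comp_wh (M := n + 3) (N := n + 1) (L := n + 3) (m := n + 2) rfl rfl
        (l := n + 2) rfl (by omega) (by omega) f (cup i h rfl)
      have h2 := closeR_wh_comp (M := n + 3) (N := n + 1) (L := n + 1) (m := n + 2) rfl rfl
        (l := n) rfl (by omega) (by omega) (cup i h rfl) f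
      simp only [wh_cup, zero_add] at h1 h2
      rw [h1, h2, ih]
    · obtain rfl : i = n + 1 := by omega
      rw [tr_eq_tr_closeL (n := n + 2) (by omega) rfl, tr_eq_tr_closeL hn rfl]
      have h1 := closeL_comp_wh (M := n + 3) (N := n + 1) (L := n + 3) (m := n + 2) rfl rfl
        (l := n + 2) rfl (by omega) (by omega) f (cup n le_rfl rfl)
      have h2 := closeL_wh_comp (M := n + 3) (N := n + 1) (L := n + 1) (m := n + 2) rfl rfl
        (l := n) rfl (by omega) (by omega) (cup n le_rfl rfl) f
      simp only [wh_cup, add_comm 1] at h1 h2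
      rw [h1, h2, ih]

theorem tr_cap_comp {n N : ℕ} (hn : 1 ≤ n) (hN : N = n + 2) (i : ℕ) (hi : i ≤ n) (f : THom δ n N) :
    tr N (cap i hi hN ≫ f) = tr n (f ≫ cap i hi hN) := by
  rw [← tr_flip, ← tr_flip (f ≫ _)]
  simpa using tr_comp_cup hn hN i hi (flip f)

theorem tr_comm_isCaps {m n : ℕ} (hn : 1 ≤ n) {u : THom δ m n} (hu : IsCaps u) (f : THom δ n m) :
    tr m (u ≫ f) = tr n (f ≫ u) := by
  induction hu with
  | id n => simp
  | cons i hi h hw ih =>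
    obtain ⟨r, hr⟩ := hw.le
    rw [Category.assoc, tr_cap_comp (by omega), Category.assoc, ih hn, Category.assoc]

/-- Cups and caps of a normal form are carried around the closure one by one, with special care when
the diagram passes through no strands. -/
theorem tr_comm {m n : ℕ} (hm : 1 ≤ m) (hn : 1 ≤ n) (f : THom δ m n) (g : THom δ n m) :
    tr m (f ≫ g) = tr n (g ≫ f) := by
  have key : ∀ {a b : ℕ} (_ : 1 ≤ a) (v : THom δ b a) (_ : IsCaps v) (g : THom δ b a),
      tr a (flip v ≫ g) = tr b (g ≫ flip v) := by
    intro a b ha v hv g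
    rw [← tr_flip, ← tr_flip (g ≫ _)]
    simpa using (tr_comm_isCaps ha hv (flip g)).symm
  induction f using normalForm_induction with
  | mem l u v hu hv =>
    rcases Nat.eq_zero_or_pos l with rfl | hl
    · obtain ⟨u', hu', rfl⟩ := hu.exists_cap_zero rfl (by omega)
      obtain ⟨v', hv', rfl⟩ := hv.exists_cap_zero rfl (by omega)
      -- Cyclicity cannot be applied at the empty object, where the trace is zero by convention. By
      -- height exchange cap-cup on two strands is also a cup followed by a cap through four
      -- strands.
      have h2 : ∀ h : THom δ 2 2,
          tr 2 (((cap 0 le_rfl rfl : THom δ 2 0) ≫ cup 0 le_rfl rfl) ≫ h) =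
            tr 2 (h ≫ (cap 0 le_rfl rfl : THom δ 2 0) ≫ cup 0 le_rfl rfl) := by
        intro h
        rw [cap_cup_exchange 4 0 0 2 le_rfl rfl le_rfl le_rfl rfl rfl rfl, Category.assoc,
          ← tr_comp_cup (by omega), Category.assoc, tr_cap_comp (by omega), Category.assoc]
      have h3 := h2 (flip v' ≫ g ≫ u')
      simp only [flip_comp, flip_cap, Category.assoc] at h3 ⊢
      rw [tr_comm_isCaps (by omega) hu']
      have h4 := key (by omega) v' hv' (g ≫ u' ≫ (cap 0 le_rfl rfl : THom δ 2 0) ≫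
        cup 0 le_rfl rfl)
      simp only [Category.assoc] at h4 ⊢
      exact h3.trans h4
    · rw [Category.assoc, tr_comm_isCaps hl hu, Category.assoc, key hl v hv, Category.assoc]
  | zero => simp
  | add f g hf hg => rw [Preadditive.add_comp, Preadditive.comp_add, map_add, map_add, hf, hg]
  | smul c f hf => rw [Linear.smul_comp, Linear.comp_smul, map_smul, map_smul, hf]

end Trace

/-! ### Partial traces as iterated closures -/

theorem ptrR_zero {m n : ℕ} (f : THom δ m n) : ptrR 0 f = f := by
  simp [ptrR, cups, caps, wr_eq_wh]

/-- The innermost nested arc closes the first strand, so partial traces reduce to single closures.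
-/
theorem ptrR_succ {m m' : ℕ} (n : ℕ) (f : THom δ (m + (n + 1)) (m' + (n + 1))) :
    ptrR (n + 1) f = ptrR n (closeR (m := m + n) (n := m' + n) rfl rfl f) := by
  simp only [ptrR, cups, caps, closeR, wr_eq_wh, Category.assoc]
  rw [wh_comp 0 n _ (N := m + 2 * (n + 1)) (by omega) _,
    wh_comp 0 n _ (N := m' + (n + 1) + (n + 1)) (by omega) _]
  simp only [wh_cup, wh_cap, wh_wh, cast_cup_assoc, Category.assoc, cast_wh_assoc, cast_cap_assoc,
    cap_cast_assoc, zero_add, add_comm 1]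

theorem ptrL_zero {m n : ℕ} (f : THom δ (0 + m) (0 + n)) :
    ptrL 0 f = cast (by omega) ≫ f ≫ cast (by omega) := by
  simp [ptrL, cups, caps, wl_eq_wh]

theorem ptrL_succ {m m' : ℕ} (n : ℕ) (f : THom δ (n + 1 + m) (n + 1 + m')) :
    ptrL (n + 1) f =
      ptrL n (closeL (m := n + m) (n := n + m') (by omega) (by omega) f) := by
  simp only [ptrL, cups, caps, closeL, wl_eq_wh, Category.assoc]
  rw [wh_comp n 0 _ (N := m + 2 * (n + 1)) (by omega) _,
    wh_comp n 0 _ (N := n + 1 + (n + 1 + m')) (by omega) _]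
  simp only [wh_cup, wh_cap, wh_wh, cast_cup_assoc, Category.assoc, cast_wh_assoc, cast_cap_assoc,
    cap_cast_assoc, zero_add, add_zero]

theorem tr_ptrR [IsDegenerate δ] {m : ℕ} (hm : 1 ≤ m) (n : ℕ) (f : THom δ (m + n) (m + n)) :
    tr (m + n) f = tr m (ptrR n f) := by
  induction n with
  | zero => rw [ptrR_zero]; rfl
  | succ n ih => rw [ptrR_succ, ← ih, ← tr_succ (by omega)]; rfl

theorem tr_cast {m n : ℕ} (h : m = n) (f : THom δ n n) :
    tr m (cast h ≫ f ≫ cast h.symm) = tr n f := by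
  subst h; simp

theorem tr_ptrL [IsDegenerate δ] {m : ℕ} (hm : 1 ≤ m) (n : ℕ) (f : THom δ (n + m) (n + m)) :
    tr (n + m) f = tr m (ptrL n f) := by
  induction n with
  | zero => rw [ptrL_zero]; exact (tr_cast (by omega) f).symm
  | succ n ih => rw [ptrL_succ, ← ih, ← tr_eq_tr_closeL (by omega)]

end TemperleyLieb

end

/-! ### Construction of the Jones-Wenzl projectors and their traces. -/

noncomputable section

namespace TemperleyLieb

variable {k : Type u} [Field k] {δ : k}

/-! ### Jones-Wenzl projectors on odd numbers of strands -/

/-- The morphisms that factor through `n` strands. -/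
def through (δ : k) (n a b : ℕ) : Submodule k (THom δ a b) :=
  Submodule.span k {h | ∃ (f : THom δ a n) (g : THom δ n b), h = f ≫ g}

theorem comp_mem_through {n a b : ℕ} (f : THom δ a n) (g : THom δ n b) : f ≫ g ∈ through δ n a b :=
  Submodule.subset_span ⟨f, g, rfl⟩

@[elab_as_elim]
theorem through_induction {n a b : ℕ} {motive : ∀ f : THom δ a b, f ∈ through δ n a b → Prop}
    (mem : ∀ (f : THom δ a n) (g : THom δ n b), motive (f ≫ g) (comp_mem_through f g))
    (zero : motive 0 (zero_mem _))
    (add : ∀ f g hf hg, motive f hf → motive g hg → motive (f + g) (add_mem hf hg))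
    (smul : ∀ (c : k) f hf, motive f hf → motive (c • f) (Submodule.smul_mem _ c hf))
    {f : THom δ a b} (hf : f ∈ through δ n a b) : motive f hf := by
  refine Submodule.span_induction ?_ zero add smul hf
  rintro _ ⟨u, v, rfl⟩
  exact mem u v

theorem eq_zero_of_mem_through {n a b : ℕ} (h : a % 2 ≠ n % 2) {f : THom δ a b}
    (hf : f ∈ through δ n a b) : f = 0 := by
  induction hf using through_induction with
  | mem f g => rw [eq_zero_of_parity h f, Limits.zero_comp]
  | zero => rfl
  | add f g _ _ hf hg => rw [hf, hg, add_zero]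
  | smul c f _ hf => rw [hf, smul_zero]

theorem wh_mem_through {n a b : ℕ} {f : THom δ a b} (hf : f ∈ through δ n a b) (x y : ℕ)
    {N A B : ℕ} (hN : N = x + n + y) (hA : A = x + a + y) (hB : B = x + b + y) :
    wh x y hA hB f ∈ through δ N A B := by
  induction hf using through_induction with
  | mem f g => rw [wh_comp x y _ hN _]; exact comp_mem_through _ _
  | zero => rw [wh_zero]; exact zero_mem _
  | add f g _ _ hf hg => rw [wh_add]; exact add_mem hf hg
  | smul c f _ hf => rw [wh_smul]; exact Submodule.smul_mem _ c hf

theorem flip_mem_through {n a b : ℕ} {f : THom δ a b} (hf : f ∈ through δ n a b) :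
    flip f ∈ through δ n b a := by
  induction hf using through_induction with
  | mem f g => rw [flip_comp]; exact comp_mem_through _ _
  | zero => exact zero_mem _
  | add f g _ _ hf hg => rw [flip_add]; exact add_mem hf hg
  | smul c f _ hf => rw [flip_smul]; exact Submodule.smul_mem _ c hf

/-- `e` is the Jones-Wenzl projector on `n` strands. -/
structure IsJW {n : ℕ} (e : THom δ n n) : Prop where
  kills : KillsCaps e
  mem : 𝟙 _ - e ∈ through δ (n - 2) n n

/-- A normal form to fewer strands must begin with a cap. -/
theorem KillsCaps.comp_eq_zero_of_lt {m n l : ℕ} {e : THom δ m n} (he : KillsCaps e) (h : l < n)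
    (f : THom δ n l) : e ≫ f = 0 := by
  induction f using normalForm_induction with
  | mem r u v hu hv =>
    obtain ⟨a, ha⟩ := hv.le
    rw [← Category.assoc, he.comp_isCaps hu (by omega), Limits.zero_comp]
  | zero => simp
  | add f g hf hg => rw [Preadditive.comp_add, hf, hg, add_zero]
  | smul c f hf => rw [Linear.comp_smul, hf, smul_zero]

theorem KillsCaps.comp_mem_through {m n l b : ℕ} {e : THom δ m n} (he : KillsCaps e) (h : l < n)
    {f : THom δ n b} (hf : f ∈ through δ l n b) : e ≫ f = 0 := by
  induction hf using through_induction with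
  | mem f g => rw [← Category.assoc, he.comp_eq_zero_of_lt h, Limits.zero_comp]
  | zero => simp
  | add f g _ _ hf hg => rw [Preadditive.comp_add, hf, hg, add_zero]
  | smul c f _ hf => rw [Linear.comp_smul, hf, smul_zero]

theorem KillsCaps.through_comp {m n l b : ℕ} {e : THom δ m n} (he : KillsCaps e) (h : l < n)
    {f : THom δ b n} (hf : f ∈ through δ l b n) : f ≫ flip e = 0 := by
  have := congrArg flip (he.comp_mem_through h (flip_mem_through hf))
  simpa using this

theorem isJW_one : IsJW (𝟙 (⟨1⟩ : TL δ)) :=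
  ⟨killsCaps_of_le_one le_rfl _, by simp⟩

namespace IsJW

variable {n : ℕ} {e e' : THom δ n n}

/-- Both sides equal `e ≫ flip e'`, because `𝟙 - e` and `𝟙 - e'` factor through fewer strands.
Symmetry, uniqueness and idempotence follow. -/
theorem eq_flip (hn : 0 < n) (he : IsJW e) (he' : IsJW e') : e = flip e' := by
  have h1 : e ≫ flip e' = e := by
    have := he.kills.comp_mem_through (by omega) (flip_mem_through he'.mem)
    rw [flip_sub, flip_id, Preadditive.comp_sub, Category.comp_id, sub_eq_zero] at this
    exact this.symm
  have h2 : e ≫ flip e' = flip e' := by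
    have := he'.kills.through_comp (by omega) he.mem
    rw [Preadditive.sub_comp, Category.id_comp, sub_eq_zero] at this
    exact this.symm
  exact h1.symm.trans h2

theorem flip_eq (hn : 0 < n) (he : IsJW e) : flip e = e := (he.eq_flip hn he).symm

theorem unique (hn : 0 < n) (he : IsJW e) (he' : IsJW e') : e = e' := by
  rw [he.eq_flip hn he', he'.flip_eq hn]

theorem idem (hn : 0 < n) (he : IsJW e) : e ≫ e = e := by
  have := he.kills.comp_mem_through (by omega) he.mem
  rw [Preadditive.comp_sub, Category.comp_id, sub_eq_zero] at this
  exact this.symm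

end IsJW

/-- If Jones-Wenzl projectors exist on up to `N` strands, a morphism to `N` strands is determined
by its composites with morphisms to them. -/
theorem eq_zero_of_comp_isJW {x N : ℕ} (hN : N % 2 = 1) (g : THom δ x N)
    (hJ : ∀ m ≤ N, m % 2 = 1 → ∃ e : THom δ m m, IsJW e)
    (hg : ∀ m ≤ N, m % 2 = 1 → ∀ e : THom δ m m, IsJW e → ∀ h : THom δ N m, g ≫ h ≫ e = 0) :
    g = 0 := by
  have key : ∀ m ≤ N, ∀ h : THom δ N m, g ≫ h = 0 := by
    intro m
    induction m using Nat.strong_induction_on with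
    | _ m ih =>
      intro hm h
      by_cases hp : m % 2 = 1
      · obtain ⟨e, he⟩ := hJ m hm hp
        have h1 : ∀ f ∈ through δ (m - 2) m m, g ≫ h ≫ f = 0 := by
          intro f hf
          induction hf using through_induction with
          | mem f f' =>
            have := ih (m - 2) (by omega) (by omega) (h ≫ f)
            simp only [← Category.assoc] at this ⊢
            rw [this, Limits.zero_comp]
          | zero => simp
          | add f g _ _ hf hg => rw [Preadditive.comp_add, Preadditive.comp_add, hf, hg, add_zero]
          | smul c f _ hf => rw [Linear.comp_smul, Linear.comp_smul, hf, smul_zero]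
        have h2 := h1 _ he.mem
        rw [Preadditive.comp_sub, Preadditive.comp_sub, Category.comp_id, hg m hm hp e he h,
          sub_zero] at h2
        exact h2
      · rw [eq_zero_of_parity (by omega) h, Limits.comp_zero]
  simpa using key N le_rfl (𝟙 _)

/-- Closing an idle strand makes a circle, whose value is zero. -/
theorem tr_wh_two [IsDegenerate δ] {n N : ℕ} (hn : 1 ≤ n) (f : THom δ n n) (h : N = 0 + n + 2) :
    tr N (wh 0 2 h h f) = 0 := by
  obtain rfl : N = n + 2 := by omega
  rw [tr_succ (by omega), show wh 0 2 h h f = wh 0 1 (by omega) (by omega)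
    (wh 0 1 (M := n + 1) (N := n + 1) (by omega) (by omega) f) by rw [wh_wh], closeR_wh_eq_zero, map_zero]

/-- The inductive construction of Jones-Wenzl projectors, two strands at a time. -/
theorem exists_isJW_step [IsDegenerate δ] {n : ℕ} (hn : n % 2 = 1) {e₀ : THom δ n n}
    {e₁ : THom δ (n + 2) (n + 2)} (h₀ : IsJW e₀) (h₁ : IsJW e₁) (ht₀ : tr n e₀ ≠ 0)
    (ht₁ : tr (n + 2) e₁ ≠ 0) (hJ : ∀ m ≤ n + 2, m % 2 = 1 → ∃ e : THom δ m m, IsJW e) :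
    ∃ e₂ : THom δ (n + 4) (n + 4), IsJW e₂ ∧
      tr (n + 4) e₂ = -(2 * tr (n + 2) e₁ + tr n e₀) := by
  have i₀ := h₀.idem (by omega)
  have i₁ := h₁.idem (by omega)
  have f₀ := h₀.flip_eq (by omega)
  have f₁ := h₁.flip_eq (by omega)
  let E : THom δ (n + 4) (n + 4) := wh 0 2 (by omega) (by omega) e₁
  have hEE : E ≫ E = E := by rw [← wh_comp, i₁]
  have hEf : flip E = E := by rw [flip_wh, f₁]
  have hEcup : e₁ ≫ cup (n + 2) le_rfl rfl = (cup (n + 2) le_rfl rfl : THom δ (n + 2) (n + 4)) ≫ E := by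
    have := wh_comp_cup (N := n + 4) (c := 0) e₁ 0 (by omega) rfl (by omega) (N' := n + 2)
      (by omega) (by omega)
    simpa using this
  have hEcap : E ≫ cap (n + 2) le_rfl rfl = (cap (n + 2) le_rfl rfl : THom δ (n + 4) (n + 2)) ≫ e₁ := by
    have := congrArg flip hEcup
    simpa [f₁, hEf] using this.symm
  have hElow : ∀ (i : ℕ) (hi : i ≤ n), E ≫ (cap i (by omega) rfl : THom δ (n + 4) (n + 2)) = 0 := by
    intro i hi
    have h := congrArg (wh 0 2 (M := n + 4) (N := n + 2) (by omega) (by omega)) (h₁.kills n i hi rfl)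
    rw [wh_comp 0 2 _ (N := n + 4) (by omega) _] at h
    simpa using h
  -- The three directions to be split off from `E`: two copies of the projector on `n + 2` strands
  -- and one of the projector on `n` strands.
  let p₁ : THom δ (n + 4) (n + 2) := E ≫ cap (n + 2) le_rfl rfl
  let p₂ : THom δ (n + 4) (n + 2) := E ≫ cap (n + 1) (by omega) rfl ≫ e₁
  let jo : THom δ (n + 4) n := E ≫ (cap (n + 1) (by omega) rfl : THom δ (n + 4) (n + 2)) ≫
    cap n (by omega) rfl ≫ e₀
  have hp₁ : p₁ ≫ e₁ = p₁ := by
    change (E ≫ _) ≫ e₁ = E ≫ _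
    rw [hEcap, Category.assoc, i₁]
  have hp₂ : p₂ ≫ e₁ = p₂ := by simp only [p₂, Category.assoc, i₁]
  have hjo : jo ≫ e₀ = jo := by simp only [jo, Category.assoc, i₀]
  have hEp₁ : E ≫ p₁ = p₁ := by simp only [p₁, ← Category.assoc, hEE]
  have hEp₂ : E ≫ p₂ = p₂ := by simp only [p₂, ← Category.assoc, hEE]
  have hEjo : E ≫ jo = jo := by simp only [jo, ← Category.assoc, hEE]
  have hflipE : ∀ {m : ℕ} (f : THom δ (n + 4) m), E ≫ f = f → flip f ≫ E = flip f := by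
    intro m f hf
    have := congrArg flip hf
    rwa [flip_comp, hEf] at this
  -- The Gram matrix of `p₁`, `p₂` is `0, 1; 1, s` times `e₁`. It is invertible whatever `s` is,
  -- although `p₁` is isotropic; for this reason the construction adds two strands at once.
  have c11 : flip p₁ ≫ p₁ = 0 := by
    change flip (E ≫ _) ≫ (E ≫ _) = 0
    rw [hEcap, flip_comp, f₁, flip_cap, Category.assoc, ← Category.assoc (cup _ _ _),
      cup_cap_self]
    simp
  have c12 : flip p₁ ≫ p₂ = e₁ := by
    change flip (E ≫ _) ≫ p₂ = e₁
    rw [hEcap, flip_comp, f₁, flip_cap, hEcup, Category.assoc, hEp₂]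
    change cup _ _ _ ≫ (wh 0 2 _ _ e₁ ≫ cap (n + 1) _ _ ≫ e₁) = e₁
    rw [← Category.assoc]
    change (cup (n + 2) le_rfl rfl ≫ E) ≫ _ = _
    rw [← hEcup, Category.assoc, ← Category.assoc (cup _ _ _),
      cup_cap_zagzig (n + 1) (n + 2) _ _ _ rfl, Category.id_comp, i₁]
  have c21 : flip p₂ ≫ p₁ = e₁ := by
    have := congrArg flip c12
    simpa [f₁] using this
  obtain ⟨s, c22⟩ : ∃ s : k, flip p₂ ≫ p₂ = s • e₁ := by
    obtain ⟨s, hs⟩ := h₁.kills.comp_eq_smul (e' := e₁)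
      ((cup (n + 1) (by omega) rfl : THom δ (n + 2) (n + 4)) ≫ E ≫ cap (n + 1) (by omega) rfl)
    refine ⟨s, ?_⟩
    rw [f₁, i₁] at hs
    rw [← hs]
    simp only [p₂, flip_comp, f₁, hEf, flip_cap, Category.assoc]
    rw [← Category.assoc E E, hEE]
  have cj : ∀ f : THom δ (n + 4) (n + 2), f ≫ e₁ = f → flip jo ≫ f = 0 := by
    intro f hf
    rw [← hf, ← hjo, flip_comp, f₀, Category.assoc, ← Category.assoc (flip jo)]
    have := h₀.kills.comp_eq_zero h₁.kills (by omega) (flip jo ≫ f)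
    simpa [f₁] using this
  have cj' : ∀ f : THom δ (n + 4) (n + 2), f ≫ e₁ = f → flip f ≫ jo = 0 := by
    intro f hf
    have := congrArg flip (cj f hf)
    simpa using this
  obtain ⟨r, cjj⟩ : ∃ r : k, flip jo ≫ jo = r • e₀ := by
    obtain ⟨r, hr⟩ := h₀.kills.comp_eq_smul (e' := e₀) (flip jo ≫ jo)
    refine ⟨r, ?_⟩
    rw [f₀, i₀] at hr
    have := congrArg flip hjo
    rw [flip_comp, f₀] at this
    rw [← hr, Category.assoc, hjo, reassoc_of% this]
  have habs : wh 0 2 (M := n + 2) (N := n + 2) (by omega) (by omega) e₀ ≫ e₁ = e₁ := by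
    have := h₁.kills.through_comp (l := n) (by omega)
      (show wh 0 2 (M := n + 2) (N := n + 2) (by omega) (by omega) (𝟙 _ - e₀) ∈ _ from by
        -- For one strand `n - 2` truncates to zero, and then `𝟙 - e₀` vanishes by parity.
        by_cases h1 : n = 1
        · subst h1
          have : (𝟙 _ - e₀ : THom δ 1 1) = 0 := eq_zero_of_mem_through (by omega) h₀.mem
          rw [this, wh_zero]
          exact zero_mem _
        · exact wh_mem_through h₀.mem 0 2 (by omega) _ _)
    rw [wh_sub, wh_id, f₁, Preadditive.sub_comp, cast_self, Category.id_comp, sub_eq_zero] at this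
    exact this.symm
  -- The two nested arcs of `jo` close the last two strands of `e₁`, and `e₀` is absorbed by `e₁`.
  -- Hence `r` is the ratio of the two given traces.
  have htr : tr n (flip jo ≫ jo) = tr (n + 2) e₁ := by
    have hX : closeR (m := n) (n := n) rfl rfl (closeR (m := n + 1) (n := n + 1) rfl rfl e₁) =
        (cup n le_rfl rfl : THom δ n (n + 2)) ≫ (cup (n + 1) (by omega) rfl : THom δ (n + 2) (n + 4)) ≫
          E ≫ (cap (n + 1) (by omega) rfl : THom δ (n + 4) (n + 2)) ≫ cap n le_rfl rfl := by
      rw [closeR, closeR, wh_comp 0 1 _ (N := n + 4) (by omega) _,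
        wh_comp 0 1 _ (N := n + 4) (by omega) _, wh_wh]
      simp [E]
    have hX₀ : e₀ ≫ closeR (m := n) (n := n) rfl rfl (closeR (m := n + 1) (n := n + 1) rfl rfl e₁) =
        closeR (m := n) (n := n) rfl rfl (closeR (m := n + 1) (n := n + 1) rfl rfl e₁) := by
      conv_rhs => rw [← habs, show wh 0 2 (M := n + 2) (N := n + 2) (by omega) (by omega) e₀ =
        wh 0 1 (by omega) (by omega)
          (wh 0 1 (M := n + 1) (N := n + 1) (by omega) (by omega) e₀) by rw [wh_wh],
        closeR_wh_comp rfl, closeR_wh_comp rfl]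
    have hX₁ : closeR (m := n) (n := n) rfl rfl (closeR (m := n + 1) (n := n + 1) rfl rfl e₁) ≫ e₀ =
        closeR (m := n) (n := n) rfl rfl (closeR (m := n + 1) (n := n + 1) rfl rfl e₁) := by
      have := congrArg flip hX₀
      simpa only [flip_comp, flip_closeR, f₀, f₁] using this
    have : flip jo ≫ jo = e₀ ≫ closeR (m := n) (n := n) rfl rfl
        (closeR (m := n + 1) (n := n + 1) rfl rfl e₁) ≫ e₀ := by
      rw [hX]
      simp only [jo, flip_comp, f₀, hEf, flip_cap, Category.assoc]
      rw [← Category.assoc E E, hEE]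
    rw [this, hX₁, hX₀, ← tr_succ (by omega), ← tr_succ (by omega)]
  have hr : r * tr n e₀ = tr (n + 2) e₁ := by
    rw [← htr, cjj, map_smul, smul_eq_mul]
  have hr0 : r ≠ 0 := by
    rintro rfl
    exact ht₁ (by rw [← hr, zero_mul])
  -- From the inverse Gram matrix: `i₂` is dual to `p₁` and orthogonal to `p₂`, while `flip p₁` is
  -- dual to `p₂`.
  let i₂ : THom δ (n + 2) (n + 4) := flip p₂ - s • flip p₁
  let e₂ : THom δ (n + 4) (n + 4) := E - p₂ ≫ flip p₁ - p₁ ≫ i₂ - r⁻¹ • (jo ≫ flip jo)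
  have hi₂E : i₂ ≫ E = i₂ := by
    simp only [i₂, Preadditive.sub_comp, Linear.smul_comp, hflipE _ hEp₁, hflipE _ hEp₂]
  have i21 : i₂ ≫ p₁ = e₁ := by
    simp only [i₂, Preadditive.sub_comp, Linear.smul_comp, c21, c11, smul_zero, sub_zero]
  have i22 : i₂ ≫ p₂ = 0 := by
    simp only [i₂, Preadditive.sub_comp, Linear.smul_comp, c22, c12, sub_self]
  have i2j : i₂ ≫ jo = 0 := by
    simp only [i₂, Preadditive.sub_comp, Linear.smul_comp, cj' _ hp₁, cj' _ hp₂, smul_zero, sub_zero]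
  have he₂E : e₂ ≫ E = e₂ := by
    simp only [e₂, Preadditive.sub_comp, Linear.smul_comp, Category.assoc, hEE, hi₂E,
      hflipE _ hEp₁, hflipE _ hEjo]
  have k₁ : e₂ ≫ p₁ = 0 := by
    simp only [e₂, Preadditive.sub_comp, Linear.smul_comp, Category.assoc, hEp₁, c11, i21,
      cj _ hp₁, hp₁, Limits.comp_zero, smul_zero, sub_zero, sub_self]
  have k₂ : e₂ ≫ p₂ = 0 := by
    simp only [e₂, Preadditive.sub_comp, Linear.smul_comp, Category.assoc, hEp₂, c12, i22,
      cj _ hp₂, hp₂, Limits.comp_zero, smul_zero, sub_self]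
  have k₃ : e₂ ≫ jo = 0 := by
    simp only [e₂, Preadditive.sub_comp, Linear.smul_comp, Category.assoc, hEjo, cj' _ hp₁, i2j,
      cjj, Linear.comp_smul, hjo, Limits.comp_zero, sub_zero, smul_smul, inv_mul_cancel₀ hr0,
      one_smul, sub_self]
  have hlow : ∀ (i : ℕ) (hi : i ≤ n), e₂ ≫ (cap i (by omega) rfl : THom δ (n + 4) (n + 2)) = 0 := by
    intro i hi
    rw [← he₂E, Category.assoc, hElow i hi, Limits.comp_zero]
  have hlast : e₂ ≫ (cap (n + 2) le_rfl rfl : THom δ (n + 4) (n + 2)) = 0 := by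
    rw [← he₂E, Category.assoc]
    exact k₁
  -- The remaining cap is tested against projectors on at most `n + 2` strands. Sequences of caps
  -- after it reduce to `p₂`, to `jo`, or to a cap that is already killed.
  have hmid : e₂ ≫ (cap (n + 1) (by omega) rfl : THom δ (n + 4) (n + 2)) = 0 := by
    refine eq_zero_of_comp_isJW (by omega) _ hJ fun m hm hm' e he f => ?_
    rw [Category.assoc, ← Category.assoc (cap _ _ _)]
    generalize (cap (n + 1) (by omega) rfl : THom δ (n + 4) (n + 2)) ≫ f = f'
    -- A second cap disjoint from the middle one is moved below it, where `e₂` kills it.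
    have hexch : ∀ (j : ℕ) (_ : j + 1 ≤ n) (l : ℕ) (hl : n + 2 = l + 2) (w : THom δ l m),
        e₂ ≫ (cap (n + 1) (by omega) rfl : THom δ (n + 4) (n + 2)) ≫ cap j (by omega) hl ≫ w = 0 := by
      intro j hj l hl w
      rw [← Category.assoc (cap _ _ _), ← cap_cap_exchange (n + 2) j (n - 1) (n + 1) (by omega)
        (by omega) (by omega) (by omega) rfl (by omega) rfl, Category.assoc, ← Category.assoc,
        hlow j (by omega), Limits.zero_comp]
    induction f' using normalForm_induction with
    | mem l u v hu hv =>
      by_cases hml : m = l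
      · subst hml
        rw [hv.eq_cast rfl]
        simp only [cast_rfl, flip_id, Category.comp_id]
        cases hu with
        | id => omega
        | @cons _ n' _ i hi h w hw =>
          obtain rfl : n' = n + 2 := by omega
          obtain hi' | rfl | rfl : i ≤ n ∨ i = n + 1 ∨ i = n + 2 := by omega
          · rw [Category.assoc, ← Category.assoc, hlow i hi', Limits.zero_comp]
          · cases hw with
            | id =>
              rw [he.unique (by omega) h₁, Category.comp_id, ← he₂E, Category.assoc]
              exact k₂
            | @cons _ n' _ j hj h' w hw =>
              obtain rfl : n' = n := by omega
              obtain hj' | rfl : j + 1 ≤ n' ∨ j = n' := by omega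
              · simp only [Category.assoc]
                exact hexch j hj' _ _ _
              · cases hw with
                | id =>
                  rw [he.unique (by omega) h₀, Category.comp_id, ← he₂E, Category.assoc,
                    Category.assoc]
                  exact k₃
                | @cons _ n' _ j' hj' h'' w hw =>
                  simp only [Category.assoc]
                  rw [← Category.assoc (cap j _ _), ← cap_cap_exchange (b := j) j j' (j - 2) j (by omega)
                    (by omega) (by omega) (by omega) (by omega) (by omega) (by omega),
                    Category.assoc]
                  exact hexch j' (by omega) _ _ _
          · rw [Category.assoc, ← Category.assoc, hlast, Limits.zero_comp]
      · have hz := he.kills.comp_isCaps hv hml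
        have := congrArg flip hz
        rw [flip_comp, he.flip_eq (by omega), flip_zero] at this
        rw [Category.assoc, this, Limits.comp_zero, Limits.comp_zero]
    | zero => simp
    | add f g hf hg => rw [Preadditive.add_comp, Preadditive.comp_add, hf, hg, add_zero]
    | smul c f hf => rw [Linear.smul_comp, Linear.comp_smul, hf, smul_zero]
  refine ⟨e₂, ⟨?_, ?_⟩, ?_⟩
  · intro l i hi h
    obtain rfl : l = n + 2 := by omega
    obtain hi' | rfl | rfl : i ≤ n ∨ i = n + 1 ∨ i = n + 2 := by omega
    exacts [hlow i hi', hmid, hlast]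
  · have h1 : (𝟙 _ - E : THom δ (n + 4) (n + 4)) ∈ through δ (n + 2) (n + 4) (n + 4) := by
      have := wh_mem_through h₁.mem 0 2 (N := n + 2) (A := n + 4) (B := n + 4) (by omega) (by omega)
        (by omega)
      rwa [wh_sub, wh_id] at this
    have h2 : jo ≫ flip jo ∈ through δ (n + 2) (n + 4) (n + 4) := by
      have := comp_mem_through (E ≫ (cap (n + 1) (by omega) rfl : THom δ (n + 4) (n + 2)))
        ((cap n (by omega) rfl ≫ e₀) ≫ flip jo)
      simpa only [jo, Category.assoc] using this
    have h3 : 𝟙 _ - e₂ = (𝟙 _ - E) + p₂ ≫ flip p₁ + p₁ ≫ i₂ + r⁻¹ • (jo ≫ flip jo) := by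
      simp only [e₂]; abel
    rw [h3]
    exact add_mem (add_mem (add_mem h1 (comp_mem_through _ _)) (comp_mem_through _ _))
      (Submodule.smul_mem _ _ h2)
  · simp only [e₂, map_sub, map_smul]
    -- The term `E` has trace zero, the two summands of size `n + 2` contribute the trace of `e₁`
    -- each, and the last one that of `e₀`.
    rw [tr_comm (by omega) (by omega) p₂, c12, tr_comm (by omega) (by omega) p₁, i21,
      tr_comm (by omega) (by omega) jo, cjj, map_smul, smul_eq_mul, smul_eq_mul, ← mul_assoc,
      inv_mul_cancel₀ hr0, tr_wh_two (by omega)]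
    ring

/-- The two caps on three strands are isotropic and dual to each other, so the complement is
orthogonal to both; each subtracted term has trace one and the identity has trace zero. -/
theorem exists_isJW_three [IsDegenerate δ] : ∃ e : THom δ 3 3, IsJW e ∧ tr 3 e = -2 := by
  let c₀ : THom δ 3 1 := cap 0 zero_le_one rfl
  let c₁ : THom δ 3 1 := cap 1 le_rfl rfl
  have h00 : flip c₀ ≫ c₀ = 0 := cup_cap_self _ _ _
  have h11 : flip c₁ ≫ c₁ = 0 := cup_cap_self _ _ _
  have h01 : flip c₀ ≫ c₁ = 𝟙 _ := cup_cap_zigzag _ _ _ _ _ rfl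
  have h10 : flip c₁ ≫ c₀ = 𝟙 _ := cup_cap_zagzig _ _ _ _ _ rfl
  refine ⟨𝟙 _ - c₀ ≫ flip c₁ - c₁ ≫ flip c₀, ⟨?_, ?_⟩, ?_⟩
  · intro l i hi h
    obtain rfl : l = 1 := by omega
    obtain rfl | rfl : i = 0 ∨ i = 1 := by omega
    · change (_ - _ - _) ≫ c₀ = 0
      simp [Preadditive.sub_comp, h00, h10]
    · change (_ - _ - _) ≫ c₁ = 0
      simp [Preadditive.sub_comp, h11, h01]
  · have : 𝟙 _ - (𝟙 _ - c₀ ≫ flip c₁ - c₁ ≫ flip c₀) = c₀ ≫ flip c₁ + c₁ ≫ flip c₀ := by abel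
    rw [this]
    exact add_mem (comp_mem_through _ _) (comp_mem_through _ _)
  · have h3 : tr 3 (𝟙 (⟨3⟩ : TL δ)) = 0 := by
      have := tr_wh_two le_rfl (𝟙 (⟨1⟩ : TL δ)) (N := 3) rfl
      simpa using this
    rw [map_sub, map_sub, h3, tr_comm (by omega) le_rfl, h10, tr_comm (by omega) le_rfl, h01,
      tr_one_id]
    ring

/-- The sequence `(-1) ^ s * (s + 1)` solves the recursion of `exists_isJW_step`. The step needs
nonzero traces at the two previous stages only, so the last projector, of trace zero, still exists.
-/
theorem exists_isJW [IsDegenerate δ] {p : ℕ} (hp : ∀ j : ℕ, 0 < j → j < p → (j : k) ≠ 0) (s : ℕ)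
    (hs : s < p) : ∃ e : THom δ (2 * s + 1) (2 * s + 1), IsJW e ∧
      tr (2 * s + 1) e = (-1) ^ s * ((s + 1 : ℕ) : k) := by
  induction s using Nat.strong_induction_on with
  | _ s ih =>
    obtain rfl | rfl | ⟨r, rfl⟩ : s = 0 ∨ s = 1 ∨ ∃ r, s = r + 2 := by
      rcases s with _ | _ | r
      exacts [Or.inl rfl, Or.inr (Or.inl rfl), Or.inr (Or.inr ⟨r, rfl⟩)]
    · exact ⟨𝟙 _, isJW_one, by simp⟩
    · obtain ⟨e, he, ht⟩ := exists_isJW_three (δ := δ)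
      exact ⟨e, he, ht.trans (by norm_num)⟩
    · obtain ⟨e₀, h₀, t₀⟩ := ih r (by omega) (by omega)
      obtain ⟨e₁, h₁, t₁⟩ := ih (r + 1) (by omega) (by omega)
      have hne : ∀ j < p - 1, (-1 : k) ^ j * ((j + 1 : ℕ) : k) ≠ 0 := fun j hj =>
        mul_ne_zero (pow_ne_zero _ (by simp)) (hp _ (by omega) (by omega))
      obtain ⟨e₂, h₂, t₂⟩ := exists_isJW_step (n := 2 * r + 1) (by omega) h₀ h₁
        (by rw [t₀]; exact hne r (by omega))
        (fun h => hne (r + 1) (by omega) (t₁.symm.trans h))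
        (fun m hm hm' => by
          obtain ⟨s, rfl⟩ : ∃ s, m = 2 * s + 1 := ⟨m / 2, by omega⟩
          obtain ⟨e, he, -⟩ := ih s (by omega) (by omega)
          exact ⟨e, he⟩)
      refine ⟨e₂, h₂, t₂.trans ?_⟩
      have t₁' : tr (2 * r + 1 + 2) e₁ = _ := t₁
      rw [t₁', t₀]
      push_cast
      ring

end TemperleyLieb

end

/-! ### The ideal of the top projector is the radical of the trace form. -/

noncomputable section

namespace TemperleyLieb

variable {k : Type u} [Field k] {δ : k}

/-- The Jones-Wenzl projector on `2 s + 1` strands. -/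
def jw (δ : k) (s : ℕ) : THom δ (2 * s + 1) (2 * s + 1) :=
  open Classical in if h : ∃ e : THom δ (2 * s + 1) (2 * s + 1), IsJW e then h.choose else 0

section

theorem cast_ne_zero_of_lt (p : ℕ) [CharP k p] {j : ℕ} (h0 : 0 < j) (h : j < p) : (j : k) ≠ 0 := fun h' =>
  absurd ((CharP.cast_eq_zero_iff k p j).1 h') (Nat.not_dvd_of_pos_of_lt h0 h)

variable (p : ℕ) [CharP k p] [IsDegenerate δ]

theorem isJW_jw {s : ℕ} (hs : s < p) : IsJW (jw δ s) := by
  obtain ⟨e, he, -⟩ := exists_isJW (δ := δ) (p := p) (fun j => cast_ne_zero_of_lt p) s hs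
  have h : ∃ e : THom δ (2 * s + 1) (2 * s + 1), IsJW e := ⟨e, he⟩
  rw [jw, dif_pos h]
  exact h.choose_spec

theorem tr_jw {s : ℕ} (hs : s < p) :
    tr (2 * s + 1) (jw δ s) = (-1) ^ s * ((s + 1 : ℕ) : k) := by
  obtain ⟨e, he, ht⟩ := exists_isJW (δ := δ) (p := p) (fun j => cast_ne_zero_of_lt p) s hs
  rw [(isJW_jw p hs).unique (by omega) he, ht]

theorem tr_jw_ne_zero {s : ℕ} (hs : s < p - 1) : tr (2 * s + 1) (jw δ s) ≠ 0 := by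
  rw [tr_jw p (by omega)]
  exact mul_ne_zero (pow_ne_zero _ (by simp)) (cast_ne_zero_of_lt p (by omega) (by omega))

theorem tr_jw_top [Fact p.Prime] : tr (2 * (p - 1) + 1) (jw δ (p - 1)) = 0 := by
  have hp : 0 < p := (Fact.out : p.Prime).pos
  rw [tr_jw p (by omega), Nat.sub_add_cancel hp, CharP.cast_eq_zero, mul_zero]

theorem jw_idem {s : ℕ} (hs : s < p) : jw δ s ≫ jw δ s = jw δ s :=
  (isJW_jw p hs).idem (by omega)

theorem flip_jw {s : ℕ} (hs : s < p) : flip (jw δ s) = jw δ s :=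
  (isJW_jw p hs).flip_eq (by omega)

theorem jw_comp_jw_eq_zero {s s' : ℕ} (hs : s < p) (hs' : s' < p) (h : s ≠ s')
    (f : THom δ (2 * s + 1) (2 * s' + 1)) : jw δ s ≫ f ≫ jw δ s' = 0 := by
  have := (isJW_jw (δ := δ) p hs).kills.comp_eq_zero (isJW_jw (δ := δ) p hs').kills (by omega) f
  rwa [flip_jw p hs'] at this

theorem exists_jw_comp_jw_eq_smul {s : ℕ} (hs : s < p) (f : THom δ (2 * s + 1) (2 * s + 1)) :
    ∃ c : k, jw δ s ≫ f ≫ jw δ s = c • jw δ s := by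
  obtain ⟨c, hc⟩ := (isJW_jw (δ := δ) p hs).kills.comp_eq_smul (e' := jw δ s) f
  rw [flip_jw p hs, jw_idem p hs] at hc
  exact ⟨c, hc⟩

/-- By cyclicity the trace is a multiple of the trace of the top projector, where `s + 1 = p`
vanishes. -/
theorem tr_jw_top_comp [Fact p.Prime] (f : THom δ (2 * (p - 1) + 1) (2 * (p - 1) + 1)) :
    tr _ (jw δ (p - 1) ≫ f) = 0 := by
  have hp : p - 1 < p := Nat.sub_lt (Fact.out : p.Prime).pos one_pos
  obtain ⟨c, hc⟩ := exists_jw_comp_jw_eq_smul p hp f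
  rw [← jw_idem p hp, Category.assoc, tr_comm (by omega) (by omega), Category.assoc, hc, map_smul,
    tr_jw_top, smul_zero]

end

/-! ### The ideal generated by the top projector -/

/-- The morphisms that factor through `jw s` with strands added on the right. -/
def jwIdeal (δ : k) (s a b : ℕ) : Submodule k (THom δ a b) :=
  Submodule.span k {h | ∃ (r : ℕ) (f : THom δ a (2 * s + 1 + r)) (g : THom δ (2 * s + 1 + r) b),
    h = f ≫ wh 0 r (by omega) (by omega) (jw δ s) ≫ g}

theorem comp_jw_comp_mem {s a b r : ℕ} (f : THom δ a (2 * s + 1 + r))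
    (g : THom δ (2 * s + 1 + r) b) :
    f ≫ wh 0 r (by omega) (by omega) (jw δ s) ≫ g ∈ jwIdeal δ s a b :=
  Submodule.subset_span ⟨r, f, g, rfl⟩

@[elab_as_elim]
theorem jwIdeal_induction {s a b : ℕ} {motive : ∀ f : THom δ a b, f ∈ jwIdeal δ s a b → Prop}
    (mem : ∀ (r : ℕ) (f : THom δ a (2 * s + 1 + r)) (g : THom δ (2 * s + 1 + r) b),
      motive (f ≫ wh 0 r (by omega) (by omega) (jw δ s) ≫ g) (comp_jw_comp_mem f g))
    (zero : motive 0 (zero_mem _))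
    (add : ∀ f g hf hg, motive f hf → motive g hg → motive (f + g) (add_mem hf hg))
    (smul : ∀ (c : k) f hf, motive f hf → motive (c • f) (Submodule.smul_mem _ c hf))
    {f : THom δ a b} (hf : f ∈ jwIdeal δ s a b) : motive f hf := by
  refine Submodule.span_induction ?_ zero add smul hf
  rintro _ ⟨r, u, v, rfl⟩
  exact mem r u v

theorem comp_mem_jwIdeal {s a b c : ℕ} (g : THom δ a b) {f : THom δ b c}
    (hf : f ∈ jwIdeal δ s b c) : g ≫ f ∈ jwIdeal δ s a c := by
  induction hf using jwIdeal_induction with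
  | mem r f f' => rw [← Category.assoc]; exact comp_jw_comp_mem _ _
  | zero => rw [Limits.comp_zero]; exact zero_mem _
  | add f g _ _ hf hg => rw [Preadditive.comp_add]; exact add_mem hf hg
  | smul c f _ hf => rw [Linear.comp_smul]; exact Submodule.smul_mem _ c hf

theorem mem_jwIdeal_comp {s a b c : ℕ} {f : THom δ a b} (hf : f ∈ jwIdeal δ s a b)
    (g : THom δ b c) : f ≫ g ∈ jwIdeal δ s a c := by
  induction hf using jwIdeal_induction with
  | mem r f f' => rw [Category.assoc, Category.assoc]; exact comp_jw_comp_mem _ _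
  | zero => rw [Limits.zero_comp]; exact zero_mem _
  | add f g _ _ hf hg => rw [Preadditive.add_comp]; exact add_mem hf hg
  | smul c f _ hf => rw [Linear.smul_comp]; exact Submodule.smul_mem _ c hf

theorem wh_mem_jwIdeal {s a b : ℕ} {f : THom δ a b} (hf : f ∈ jwIdeal δ s a b) (y : ℕ) {A B : ℕ}
    (hA : A = 0 + a + y) (hB : B = 0 + b + y) : wh 0 y hA hB f ∈ jwIdeal δ s A B := by
  induction hf using jwIdeal_induction with
  | mem r f f' =>
    rw [wh_comp 0 y _ (N := 2 * s + 1 + (r + y)) (by omega) _,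
      wh_comp 0 y _ (N := 2 * s + 1 + (r + y)) (by omega) _, wh_wh]
    exact comp_jw_comp_mem _ _
  | zero => rw [wh_zero]; exact zero_mem _
  | add f g _ _ hf hg => rw [wh_add]; exact add_mem hf hg
  | smul c f _ hf => rw [wh_smul]; exact Submodule.smul_mem _ c hf

theorem ptrR_wh_comp {a b c : ℕ} (n : ℕ) (g : THom δ a b) (f : THom δ (b + n) (c + n))
    (h : a + n = 0 + a + n) (h' : b + n = 0 + b + n) :
    ptrR n (wh 0 n h h' g ≫ f) = g ≫ ptrR n f := by
  induction n with
  | zero => simp [ptrR_zero]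
  | succ n ih =>
    rw [ptrR_succ, ptrR_succ, ← ih _ (by omega) (by omega), show wh 0 (n + 1) h h' g =
      wh 0 1 (by omega) (by omega) (wh 0 n (M := a + n) (N := b + n) (by omega) (by omega) g) by
        rw [wh_wh], closeR_wh_comp rfl]

theorem ptrR_comp_wh {a b c : ℕ} (n : ℕ) (f : THom δ (a + n) (b + n)) (g : THom δ b c)
    (h : b + n = 0 + b + n) (h' : c + n = 0 + c + n) :
    ptrR n (f ≫ wh 0 n h h' g) = ptrR n f ≫ g := by
  induction n with
  | zero => simp [ptrR_zero]
  | succ n ih =>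
    rw [ptrR_succ, ptrR_succ, ← ih _ (by omega) (by omega), show wh 0 (n + 1) h h' g =
      wh 0 1 (by omega) (by omega) (wh 0 n (M := b + n) (N := c + n) (by omega) (by omega) g) by
        rw [wh_wh], closeR_comp_wh rfl rfl]

/-- The morphisms that factor through some `jw b` with `b < B`. -/
def lowIdeal (δ : k) (B a c : ℕ) : Submodule k (THom δ a c) :=
  Submodule.span k {h | ∃ b < B, ∃ (f : THom δ a (2 * b + 1)) (g : THom δ (2 * b + 1) c),
    h = f ≫ jw δ b ≫ g}

theorem comp_mem_lowIdeal {B a c d : ℕ} (g : THom δ a c) {f : THom δ c d}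
    (hf : f ∈ lowIdeal δ B c d) : g ≫ f ∈ lowIdeal δ B a d := by
  induction hf using Submodule.span_induction with
  | mem f hf =>
    obtain ⟨b, hb, u, v, rfl⟩ := hf
    exact Submodule.subset_span ⟨b, hb, g ≫ u, v, by simp⟩
  | zero => rw [Limits.comp_zero]; exact zero_mem _
  | add f g _ _ hf hg => rw [Preadditive.comp_add]; exact add_mem hf hg
  | smul c f _ hf => rw [Linear.comp_smul]; exact Submodule.smul_mem _ c hf

theorem mem_lowIdeal_comp {B a c d : ℕ} {f : THom δ a c} (hf : f ∈ lowIdeal δ B a c)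
    (g : THom δ c d) : f ≫ g ∈ lowIdeal δ B a d := by
  induction hf using Submodule.span_induction with
  | mem f hf =>
    obtain ⟨b, hb, u, v, rfl⟩ := hf
    exact Submodule.subset_span ⟨b, hb, u, v ≫ g, by simp⟩
  | zero => rw [Limits.zero_comp]; exact zero_mem _
  | add f g _ _ hf hg => rw [Preadditive.add_comp]; exact add_mem hf hg
  | smul c f _ hf => rw [Linear.smul_comp]; exact Submodule.smul_mem _ c hf

theorem comp_through_comp_mem {n a b : ℕ} {f : THom δ a b} (hf : f ∈ through δ n a b)
    {S : Submodule k (THom δ a b)}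
    (h : ∀ (u : THom δ a n) (v : THom δ n b), u ≫ v ∈ S) : f ∈ S := by
  induction hf using through_induction with
  | mem f g => exact h f g
  | zero => exact zero_mem _
  | add f g _ _ hf hg => exact add_mem hf hg
  | smul c f _ hf => exact Submodule.smul_mem _ c hf

/-- Bending the last strand is adjoint for the trace form; this transfers statements from odd to
even numbers of strands. -/
theorem tr_cup_comp_wh [IsDegenerate δ] {m n : ℕ} (hm : 1 ≤ m) (f : THom δ (m + 1) n) (g : THom δ (n + 1) m) :
    tr m ((cup m le_rfl rfl ≫ wh 0 1 (M := m + 2) (by omega) (by omega) f) ≫ g) =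
      tr (m + 1) (f ≫ closeR rfl rfl (g ≫ (cup m le_rfl rfl : THom δ m (m + 2)))) := by
  rw [Category.assoc, ← tr_comp_cup hm rfl, tr_succ (by omega), Category.assoc, closeR_wh_comp]

/-- Bending the last strand up and back down is a zigzag. -/
theorem wh_cup_comp_wh_comp_cap {m n : ℕ} (f : THom δ (m + 1) n) :
    wh 0 1 (by omega) (by omega) ((cup m le_rfl rfl : THom δ m (m + 2)) ≫
      wh 0 1 (M := m + 2) (N := n + 1) (by omega) (by omega) f) ≫ cap n le_rfl rfl = f := by
  have h := cap_comp_wh f 0 (M := m + 1) (N := m + 3) (N' := n) (c := 0) (by omega) rfl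
    (by omega) (by omega) (by omega)
  rw [wh_comp 0 1 (N := m + 3) (by omega) (by omega) (by omega), wh_wh, Category.assoc]
  simp only [add_zero, zero_add] at h ⊢
  rw [← h, wh_cup, reassoc_of% cup_cap_zigzag (δ := δ) (0 + m) (m + 1) (by omega) le_rfl rfl (by omega)]
  exact (wh_congr 0 0 _ _ rfl rfl f).trans (by simp)

section

variable (p : ℕ) [Fact p.Prime] [CharP k p] [IsDegenerate δ]

/-- After a cyclic move the idle strands on the right are closed first, which leaves the top
projector composed with an endomorphism. -/
theorem tr_eq_zero_of_mem_jwIdeal {m : ℕ} (hm : 1 ≤ m) {f : THom δ m m}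
    (hf : f ∈ jwIdeal δ (p - 1) m m) : tr m f = 0 := by
  induction hf using jwIdeal_induction with
  | mem r f g =>
    rw [tr_comm hm (by omega), Category.assoc, tr_ptrR (by omega), ptrR_wh_comp, tr_jw_top_comp]
  | zero => exact map_zero _
  | add f g _ _ hf hg => rw [map_add, hf, hg, add_zero]
  | smul c f _ hf => rw [map_smul, hf, smul_zero]

-- On few strands the identity is the projector plus a part through two strands fewer, to which
-- induction applies.
omit [Fact p.Prime] in
theorem id_mem_lowIdeal {B m : ℕ} (hB : B ≤ p) (hm : m % 2 = 1) (hmB : m + 1 ≤ 2 * B) :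
    𝟙 (⟨m⟩ : TL δ) ∈ lowIdeal δ B m m := by
  induction m using Nat.strong_induction_on with
  | _ m ih =>
    obtain ⟨s, rfl⟩ : ∃ s, m = 2 * s + 1 := ⟨m / 2, by omega⟩
    have he := isJW_jw (δ := δ) p (s := s) (by omega)
    have h1 : jw δ s ∈ lowIdeal δ B (2 * s + 1) (2 * s + 1) :=
      Submodule.subset_span ⟨s, by omega, 𝟙 _, 𝟙 _, by simp⟩
    have h2 : 𝟙 _ - jw δ s ∈ lowIdeal δ B (2 * s + 1) (2 * s + 1) := by
      -- Truncated subtraction again: on one strand the part through fewer strands is zero by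
      -- parity.
      by_cases hs : s = 0
      · subst hs
        rw [eq_zero_of_mem_through (by omega) he.mem]
        exact zero_mem _
      · refine comp_through_comp_mem he.mem fun u v => ?_
        have := comp_mem_lowIdeal u (mem_lowIdeal_comp (ih (2 * s + 1 - 2) (by omega) (by omega)
          (by omega)) v)
        simpa using this
    simpa using add_mem h2 h1

/-- From `2 * p - 1` strands on, the top projector with idle strands takes the role of the
projector: the rest still passes through two strands fewer. -/
theorem id_mem_lowIdeal_sup {m : ℕ} (hm : m % 2 = 1) :
    𝟙 (⟨m⟩ : TL δ) ∈ lowIdeal δ (p - 1) m m ⊔ jwIdeal δ (p - 1) m m := by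
  have hp : 2 ≤ p := (Fact.out : p.Prime).two_le
  induction m using Nat.strong_induction_on with
  | _ m ih =>
    by_cases h : m + 1 ≤ 2 * (p - 1)
    · exact Submodule.mem_sup_left (id_mem_lowIdeal p (by omega) hm h)
    · obtain ⟨r, rfl⟩ : ∃ r, m = 2 * (p - 1) + 1 + r := ⟨m - (2 * (p - 1) + 1), by omega⟩
      have he := isJW_jw (δ := δ) p (s := p - 1) (by omega)
      have h1 := comp_jw_comp_mem (δ := δ) (s := p - 1) (r := r) (𝟙 _) (𝟙 _)
      have h2 := wh_mem_through he.mem 0 r (N := 2 * (p - 1) + 1 + r - 2)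
        (A := 2 * (p - 1) + 1 + r) (B := 2 * (p - 1) + 1 + r) (by omega) (by omega) (by omega)
      have h3 := comp_through_comp_mem (S := lowIdeal δ (p - 1) _ _ ⊔ jwIdeal δ (p - 1) _ _) h2
        fun u v => by
          obtain ⟨x, hx, y, hy, hxy⟩ := Submodule.mem_sup.1
            (ih (2 * (p - 1) + 1 + r - 2) (by omega) (by omega))
          have : u ≫ v = u ≫ x ≫ v + u ≫ y ≫ v := by
            rw [← Preadditive.comp_add, ← Preadditive.add_comp, hxy, Category.id_comp]
          rw [this]
          exact add_mem (Submodule.mem_sup_left (comp_mem_lowIdeal u (mem_lowIdeal_comp hx v)))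
            (Submodule.mem_sup_right (comp_mem_jwIdeal u (mem_jwIdeal_comp hy v)))
      have h4 := add_mem h3 (Submodule.mem_sup_right h1)
      rw [wh_sub, wh_id, cast_self, Category.comp_id, Category.id_comp] at h4
      simpa using h4

-- Distinct projectors are orthogonal. For equal ones the block is a multiple of the projector, and
-- the multiple is detected by the trace, which is nonzero below the top.
omit [Fact p.Prime] in
theorem jw_comp_eq_zero {m n : ℕ} (hm : 1 ≤ m) {f : THom δ m n}
    (hf : ∀ g : THom δ n m, tr m (f ≫ g) = 0) {b b' : ℕ} (hb : b < p - 1) (hb' : b' < p)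
    (u : THom δ (2 * b + 1) m) (v : THom δ n (2 * b' + 1)) :
    jw δ b ≫ u ≫ f ≫ v ≫ jw δ b' = 0 := by
  by_cases h : b = b'
  · subst h
    obtain ⟨c, hc⟩ := exists_jw_comp_jw_eq_smul p hb' (u ≫ f ≫ v)
    have h1 := tr_comm (by omega) hm (jw δ b ≫ u) (f ≫ v ≫ jw δ b)
    have h2 := hf (v ≫ jw δ b ≫ jw δ b ≫ u)
    simp only [Category.assoc] at h1 h2 hc
    rw [h2, hc, map_smul, smul_eq_mul, mul_eq_zero, or_iff_left (tr_jw_ne_zero p hb)] at h1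
    rw [hc, h1, zero_smul]
  · have := jw_comp_jw_eq_zero p (by omega) hb' h (u ≫ f ≫ v)
    simpa using this

omit [Fact p.Prime] in
theorem low_comp_low_eq_zero {m n : ℕ} (hm : 1 ≤ m) {f : THom δ m n}
    (hf : ∀ g : THom δ n m, tr m (f ≫ g) = 0) {B a d : ℕ} (hB : B ≤ p)
    {x : THom δ a m} (hx : x ∈ lowIdeal δ (p - 1) a m) {y : THom δ n d}
    (hy : y ∈ lowIdeal δ B n d) : x ≫ f ≫ y = 0 := by
  induction hx using Submodule.span_induction with
  | mem x hx =>
    obtain ⟨b, hb, u, v, rfl⟩ := hx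
    induction hy using Submodule.span_induction with
    | mem y hy =>
      obtain ⟨b', hb', u', v', rfl⟩ := hy
      have := jw_comp_eq_zero p hm hf hb (b' := b') (by omega) v u'
      have h2 := congrArg (fun z => u ≫ z ≫ v') this
      simpa using h2
    | zero => simp
    | add f g _ _ hf hg => simp only [Preadditive.comp_add, hf, hg, add_zero]
    | smul c f _ hf => simp only [Linear.comp_smul, hf, smul_zero]
  | zero => simp
  | add f g _ _ hf hg => simp only [Preadditive.add_comp, hf, hg, add_zero]
  | smul c f _ hf => simp only [Linear.smul_comp, hf, smul_zero]

/-- Splitting both identities into lower projectors and the ideal, the block between lower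
projectors vanishes. -/
theorem mem_jwIdeal_of_tr_odd {m n : ℕ} (hm : m % 2 = 1) {f : THom δ m n}
    (hf : ∀ g : THom δ n m, tr m (f ≫ g) = 0) : f ∈ jwIdeal δ (p - 1) m n := by
  by_cases hn : n % 2 = 1
  · obtain ⟨x, hx, y, hy, hxy⟩ := Submodule.mem_sup.1 (id_mem_lowIdeal_sup (δ := δ) p hm)
    obtain ⟨x', hx', y', hy', hxy'⟩ := Submodule.mem_sup.1 (id_mem_lowIdeal_sup (δ := δ) p hn)
    have h : f = x ≫ f ≫ x' + (y ≫ f ≫ x' + f ≫ y') := by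
      rw [← add_assoc, ← Preadditive.add_comp, hxy, Category.id_comp, ← Preadditive.comp_add, hxy',
        Category.comp_id]
    rw [h, low_comp_low_eq_zero p (by omega) hf (Nat.sub_le _ _) hx hx', zero_add]
    exact add_mem (mem_jwIdeal_comp hy _) (comp_mem_jwIdeal _ hy')
  · rw [eq_zero_of_parity (by omega) f]
    exact zero_mem _

-- On the source only projectors of nonzero trace occur; the target may also contain the top
-- projector, which is orthogonal to them. Hence no ideal part is left over.
omit [Fact p.Prime] in
theorem eq_zero_of_tr_odd {m n : ℕ} (hm : m % 2 = 1) (hmp : m + 1 ≤ 2 * (p - 1))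
    (hnp : n + 1 ≤ 2 * p) {f : THom δ m n} (hf : ∀ g : THom δ n m, tr m (f ≫ g) = 0) : f = 0 := by
  by_cases hn : n % 2 = 1
  · have := low_comp_low_eq_zero p (by omega) hf le_rfl
      (id_mem_lowIdeal p (Nat.sub_le _ _) hm hmp) (id_mem_lowIdeal p le_rfl hn hnp)
    simpa using this
  · exact eq_zero_of_parity (by omega) f

/-- The form `tr (f ≫ g)` is non-degenerate modulo the ideal of the top projector. -/
theorem mem_jwIdeal_of_tr {m n : ℕ} (hm : 1 ≤ m) {f : THom δ m n}
    (hf : ∀ g : THom δ n m, tr m (f ≫ g) = 0) : f ∈ jwIdeal δ (p - 1) m n := by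
  by_cases h : m % 2 = 1
  · exact mem_jwIdeal_of_tr_odd p h hf
  · obtain ⟨m, rfl⟩ : ∃ m', m = m' + 1 := ⟨m - 1, by omega⟩
    have h1 := mem_jwIdeal_of_tr_odd p (m := m) (by omega)
      (f := cup m le_rfl rfl ≫ wh 0 1 (M := m + 2) (N := n + 1) (by omega) (by omega) f)
      fun g => by rw [tr_cup_comp_wh (by omega), hf]
    rw [← wh_cup_comp_wh_comp_cap f]
    exact mem_jwIdeal_comp (wh_mem_jwIdeal h1 1 _ _) _

theorem eq_zero_of_tr {m n : ℕ} (hm : 1 ≤ m) (hmp : m ≤ 2 * p - 2) (hnp : n ≤ 2 * p - 2)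
    {f : THom δ m n} (hf : ∀ g : THom δ n m, tr m (f ≫ g) = 0) : f = 0 := by
  by_cases h : m % 2 = 1
  · exact eq_zero_of_tr_odd p h (by omega) (by omega) hf
  · obtain ⟨m, rfl⟩ : ∃ m', m = m' + 1 := ⟨m - 1, by omega⟩
    have h1 := eq_zero_of_tr_odd p (m := m) (by omega) (by omega) (by omega)
      (f := cup m le_rfl rfl ≫ wh 0 1 (M := m + 2) (N := n + 1) (by omega) (by omega) f)
      fun g => by rw [tr_cup_comp_wh (by omega), hf]
    rw [← wh_cup_comp_wh_comp_cap f, h1, wh_zero, Limits.zero_comp]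

/-- Elements of the ideal are in the radical of the trace form, and this form is nondegenerate in
the given range. -/
theorem eq_zero_of_mem_jwIdeal {m n : ℕ} (hm : 1 ≤ m) (hmp : m ≤ 2 * p - 2) (hnp : n ≤ 2 * p - 2)
    {f : THom δ m n} (hf : f ∈ jwIdeal δ (p - 1) m n) : f = 0 :=
  eq_zero_of_tr p hm hmp hnp fun g => tr_eq_zero_of_mem_jwIdeal p hm (mem_jwIdeal_comp hf g)

end

theorem jwIdeal_zero_zero [IsDegenerate δ] {s : ℕ} {f : THom δ 0 0} (hf : f ∈ jwIdeal δ s 0 0) :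
    f = 0 := by
  induction hf using jwIdeal_induction with
  | mem r f g => exact comp_eq_zero_of_through IsDegenerate.circle (by omega) _ _
  | zero => rfl
  | add f g _ _ hf hg => rw [hf, hg, add_zero]
  | smul c f _ hf => rw [hf, smul_zero]

theorem flip_mem_jwIdeal (p : ℕ) [Fact p.Prime] [CharP k p] [IsDegenerate δ] {a b : ℕ}
    {f : THom δ a b} (hf : f ∈ jwIdeal δ (p - 1) a b) : flip f ∈ jwIdeal δ (p - 1) b a := by
  have hp : p - 1 < p := Nat.sub_lt (Fact.out : p.Prime).pos one_pos
  induction hf using jwIdeal_induction with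
  | mem r f g =>
    rw [flip_comp, flip_comp, flip_wh, flip_jw p hp, Category.assoc]
    exact comp_jw_comp_mem _ _
  | zero => rw [flip_zero]; exact zero_mem _
  | add f g _ _ hf hg => rw [flip_add]; exact add_mem hf hg
  | smul c f _ hf => rw [flip_smul]; exact Submodule.smul_mem _ c hf

end TemperleyLieb

end

/-! ### Kauffman bracket at `q ^ 4 = -1`: naturality of the twist and its trace on projectors. -/

noncomputable section

namespace TemperleyLieb

variable {k : Type u} [Field k] {δ : k}

/-! ### Crossings and twists for `q ^ 4 = -1` -/

theorem crossing_eq (q : k) {M N : ℕ} (i : ℕ) (hi : i + 2 ≤ N) (h : N = M + 2) :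
    (crossing q i hi : THom δ N N) =
      q • 𝟙 _ + q⁻¹ • ((cap i (by omega) h : THom δ N M) ≫ cup i (by omega) h) := by
  obtain rfl : M = N - 2 := by omega
  rfl

theorem doubleBraiding_succ (q : k) (n : ℕ) : (doubleBraiding q (n + 1) : THom δ (n + 2) (n + 2)) =
    crossing q n le_rfl ≫ wh 0 1 (by omega) (by omega) (doubleBraiding q n) ≫
      crossing q n le_rfl := by
  rw [doubleBraiding, wr_eq_wh]

theorem twist_succ (q : k) (n : ℕ) : (twist q (n + 1) : THom δ (n + 1) (n + 1)) =
    (-q ^ 3) • (doubleBraiding q n ≫ wh 0 1 (by omega) (by omega) (twist q n)) := by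
  rw [twist, wr_eq_wh]

@[simp] theorem wh_crossing (q : k) {N M : ℕ} (a b i : ℕ) (hi : i + 2 ≤ N) (h : M = a + N + b) :
    wh a b h h (crossing q i hi : THom δ N N) = crossing q (a + i) (by omega) := by
  rw [crossing_eq q i hi (M := N - 2) (by omega),
    crossing_eq q (a + i) (by omega) (M := a + (N - 2) + b) (by omega), wh_add, wh_smul, wh_smul,
    wh_id, wh_comp a b h rfl h, wh_cap, wh_cup, cast_self]

theorem doubleBraiding_succ_succ (q : k) (n : ℕ) :
    (doubleBraiding q (n + 2) : THom δ (n + 3) (n + 3)) =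
      crossing q (n + 1) le_rfl ≫ crossing q n (by omega) ≫
        wh 0 2 (by omega) (by omega) (doubleBraiding q n) ≫ crossing q n (by omega) ≫
        crossing q (n + 1) le_rfl := by
  rw [doubleBraiding_succ, doubleBraiding_succ, wh_comp 0 1 (N := n + 3) _ (by omega),
    wh_comp 0 1 (N := n + 3) _ (by omega), wh_wh, wh_crossing]
  simp only [zero_add, Category.assoc]

@[simp] theorem flip_crossing (q : k) {N : ℕ} (i : ℕ) (hi : i + 2 ≤ N) :
    flip (crossing q i hi : THom δ N N) = crossing q i hi := by
  rw [crossing_eq q i hi (M := N - 2) (by omega)]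
  simp

@[simp] theorem flip_doubleBraiding (q : k) (n : ℕ) :
    flip (doubleBraiding q n : THom δ (n + 1) (n + 1)) = doubleBraiding q n := by
  induction n with
  | zero => rfl
  | succ n ih => rw [doubleBraiding_succ]; simp [ih]

/-- Disjoint crossings and cups. -/
theorem cup_crossing_of_lt (q : k) {M N : ℕ} (i j j' : ℕ) (hij : i ≤ j) (hj' : j' = j + 2)
    (hi : i ≤ M) (hj : j + 2 ≤ M) (h : N = M + 2) :
    (cup i hi h : THom δ M N) ≫ crossing q j' (by omega) = crossing q j hj ≫ cup i hi h := by
  rw [crossing_eq q j' (by omega) h, crossing_eq q j hj (M := M - 2) (by omega)]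
  simp only [Preadditive.comp_add, Preadditive.add_comp, Linear.smul_comp, Linear.comp_smul,
    Category.id_comp, Category.comp_id, Category.assoc]
  rw [cup_cup_exchange M i j j' hij hj' _ _ _ _ (by omega),
    reassoc_of% cap_cup_exchange' N i j j' hij hj' (by omega) (by omega)
      (show M = M - 2 + 2 by omega) (show M = M - 2 + 2 by omega) h]

theorem twist_succ_succ (q : k) (n : ℕ) : (twist q (n + 2) : THom δ (n + 2) (n + 2)) =
    (q ^ 6) • (crossing q n le_rfl ≫ wh 0 1 (N := n + 2) (by omega) (by omega) (doubleBraiding q n) ≫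
      crossing q n le_rfl ≫ wh 0 1 (N := n + 2) (by omega) (by omega) (doubleBraiding q n) ≫
      wh 0 2 (by omega) (by omega) (twist q n)) := by
  rw [twist_succ, twist_succ, wh_smul,
    wh_comp 0 1 (n := n + 1) (N := n + 2) _ (by omega), wh_wh,
    Linear.comp_smul, smul_smul, doubleBraiding_succ]
  simp only [Category.assoc]
  rw [show -q ^ 3 * -q ^ 3 = q ^ 6 by ring]

theorem closeR_cap_cup (n : ℕ) : closeR (m := n + 1) (n := n + 1) rfl rfl
    ((cap n le_rfl rfl : THom δ (n + 2) n) ≫ cup n le_rfl rfl) = 𝟙 _ := by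
  have h := cup_cap_zigzag (δ := δ) n (n + 1) (m := n + 1) (by omega) (by omega) rfl rfl
  have h' := cup_cap_zagzig (δ := δ) n (n + 1) (m := n + 1) (by omega) (by omega) rfl rfl
  rw [closeR, wh_comp 0 1 (N := n + 1) _ (by omega), wh_cap, wh_cup]
  simp only [zero_add, Category.assoc]
  rw [h, reassoc_of% h']

/-- The cap-cup term of the bracket dies, so braids act on projectors by powers of `q`. -/
theorem KillsCaps.comp_crossing {a N : ℕ} {e : THom δ a N} (he : KillsCaps e) (q : k) (i : ℕ)
    (hi : i + 2 ≤ N) : e ≫ crossing q i hi = q • e := by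
  rw [crossing_eq q i hi (M := N - 2) (by omega)]
  have := he (N - 2) i (by omega) (by omega)
  simp [reassoc_of% this]

theorem KillsCaps.comp_doubleBraiding {a N : ℕ} {e : THom δ a N} (he : KillsCaps e) (q : k)
    (n r : ℕ) (h : N = 0 + (n + 1) + r) :
    e ≫ wh 0 r h h (doubleBraiding q n) = q ^ (2 * n) • e := by
  induction n generalizing r with
  | zero => simp [doubleBraiding]
  | succ n ih =>
    rw [doubleBraiding_succ, wh_comp 0 r h h, wh_comp 0 r h h, wh_crossing, wh_wh,
      ← Category.assoc e, he.comp_crossing, Linear.smul_comp, ← Category.assoc e,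
      ih, Linear.smul_comp, he.comp_crossing, smul_smul, smul_smul]
    congr 1
    ring

/-- Each new strand contributes `-q ^ 3` and `2 * n` crossings, and `n * (n + 2) + 2 * n + 3 = (n +
1) * (n + 3)`. -/
theorem KillsCaps.comp_twist {a N : ℕ} {e : THom δ a N} (he : KillsCaps e) (q : k)
    (n r : ℕ) (h : N = 0 + n + r) :
    e ≫ wh 0 r h h (twist q n) = ((-1) ^ n * q ^ (n * (n + 2))) • e := by
  induction n generalizing r with
  | zero => simp [twist]
  | succ n ih =>
    rw [twist_succ, wh_smul, wh_comp 0 r h h, wh_wh, Linear.comp_smul, ← Category.assoc e,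
      he.comp_doubleBraiding, Linear.smul_comp, ih, smul_smul, smul_smul]
    congr 1
    ring

/-- The second term of the bracket contains a circle, which is zero. -/
theorem cup_crossing_self [IsDegenerate δ] (q : k) {M N : ℕ} (i : ℕ) (hi : i ≤ M) (h : N = M + 2) :
    (cup i hi h : THom δ M N) ≫ crossing q i (by omega) = q • cup i hi h := by
  rw [crossing_eq q i (by omega) h]
  simp [reassoc_of% cup_cap_self (δ := δ) i hi h]

theorem cup_crossing_succ (q : k) {M N : ℕ} (i j : ℕ) (hj : j ≤ M) (h : N = M + 2)
    (hij : j = i + 1) : (cup i (by omega) h : THom δ M N) ≫ crossing q j (by omega) =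
      q • cup i (by omega) h + q⁻¹ • cup j hj h := by
  rw [crossing_eq q j (by omega) h]
  simp [reassoc_of% cup_cap_zigzag (δ := δ) i j (by omega) hj h hij]

theorem cup_succ_crossing (q : k) {M N : ℕ} (i j : ℕ) (hj : j ≤ M) (h : N = M + 2)
    (hij : j = i + 1) : (cup j hj h : THom δ M N) ≫ crossing q i (by omega) =
      q • cup j hj h + q⁻¹ • cup i (by omega) h := by
  rw [crossing_eq q i (by omega) h]
  simp [reassoc_of% cup_cap_zagzig (δ := δ) i j (by omega) hj h hij]

theorem ne_zero_of_pow {q : k} (hq : q ^ 4 = -1) : q ≠ 0 := by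
  rintro rfl
  simp at hq

theorem inv_sq_of_pow {q : k} (hq : q ^ 4 = -1) : q⁻¹ * q⁻¹ = -(q * q) := by
  have h0 := ne_zero_of_pow hq
  field_simp
  linear_combination hq

section

variable [IsDegenerate δ] {q : k} (hq : q ^ 4 = -1)

include hq

/-- A cup slides past a strand: the coefficient of the original cup is `q ^ 2 + q⁻¹ ^ 2 = 0`. -/
theorem cup_crossing_crossing {M N : ℕ} (i j : ℕ) (hj : j ≤ M) (h : N = M + 2) (hij : j = i + 1) :
    (cup i (by omega) h : THom δ M N) ≫ crossing q j (by omega) ≫ crossing q i (by omega) =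
      cup j hj h := by
  have h0 := ne_zero_of_pow hq
  rw [← Category.assoc, cup_crossing_succ q i j hj h hij, Preadditive.add_comp, Linear.smul_comp,
    Linear.smul_comp, cup_crossing_self, cup_succ_crossing q i j hj h hij, smul_add, smul_smul,
    smul_smul, smul_smul, inv_sq_of_pow hq, inv_mul_cancel₀ h0]
  module

theorem cup_succ_crossing_crossing {M N : ℕ} (i j : ℕ) (hj : j ≤ M) (h : N = M + 2)
    (hij : j = i + 1) :
    (cup j hj h : THom δ M N) ≫ crossing q i (by omega) ≫ crossing q j (by omega) =
      cup i (by omega) h := by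
  have h0 := ne_zero_of_pow hq
  rw [← Category.assoc, cup_succ_crossing q i j hj h hij, Preadditive.add_comp, Linear.smul_comp,
    Linear.smul_comp, cup_crossing_self, cup_crossing_succ q i j hj h hij, smul_add, smul_smul,
    smul_smul, smul_smul, inv_sq_of_pow hq, inv_mul_cancel₀ h0]
  module

/-- Resolving the first crossing on the left side and the last on the right side, the terms agree
once cups and caps slide past strands. -/
theorem crossing_braid {N : ℕ} (i j : ℕ) (hij : j = i + 1) (hj : j + 2 ≤ N) :
    (crossing q i (by omega) : THom δ N N) ≫ crossing q j hj ≫ crossing q i (by omega) =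
      crossing q j hj ≫ crossing q i (by omega) ≫ crossing q j hj := by
  have h0 := ne_zero_of_pow hq
  obtain ⟨M, rfl⟩ : ∃ M, N = M + 2 := ⟨N - 2, by omega⟩
  have h1 := cup_crossing_crossing (δ := δ) hq i j (M := M) (by omega) rfl hij
  have h2 := cup_succ_crossing_crossing (δ := δ) hq i j (M := M) (by omega) rfl hij
  have h4 := congrArg flip h2
  simp only [flip_comp, flip_crossing, flip_cup, Category.assoc] at h4
  conv_lhs =>
    arg 1
    rw [crossing_eq q i (by omega) (M := M) rfl]
  conv_rhs =>
    arg 2; arg 2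
    rw [crossing_eq q j hj (M := M) rfl]
  simp only [Preadditive.comp_add, Preadditive.add_comp, Linear.smul_comp, Linear.comp_smul,
    Category.id_comp, Category.comp_id, Category.assoc]
  rw [h1, reassoc_of% h4]

theorem cup_doubleBraiding_last (n : ℕ) :
    (cup n (by omega) rfl : THom δ (n + 1) (n + 3)) ≫ doubleBraiding q (n + 2) =
      doubleBraiding q n ≫ cup n (by omega) rfl := by
  have h := wh_comp_cup (doubleBraiding q n : THom δ (n + 1) (n + 1)) 0 (c := 0) (M := n + 1)
    (N := n + 3) (N' := n + 1) (by omega) (by omega) (by omega) (by omega) (by omega)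
  simp only [wh_zero_zero, cast_self, Category.id_comp, Category.comp_id, add_zero, zero_add] at h
  rw [doubleBraiding_succ_succ,
    reassoc_of% cup_crossing_crossing (δ := δ) hq n (n + 1) (M := n + 1) (by omega) rfl rfl,
    ← reassoc_of% h, cup_succ_crossing_crossing hq n (n + 1) (M := n + 1) (by omega) rfl rfl]

theorem doubleBraiding_cup {n N : ℕ} (i : ℕ) (hi : i ≤ n) (hN : N = n + 2) :
    (doubleBraiding q n : THom δ (n + 1) (n + 1)) ≫
        (cup i (by omega) (by omega) : THom δ (n + 1) (N + 1)) =
      cup i (by omega) (by omega) ≫ doubleBraiding q N := by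
  subst hN
  induction n generalizing i with
  | zero =>
    obtain rfl : i = 0 := by omega
    exact (cup_doubleBraiding_last hq 0).symm
  | succ n ih =>
    rcases Nat.lt_or_ge n i with h | h
    · obtain rfl : i = n + 1 := by omega
      exact (cup_doubleBraiding_last hq (n + 1)).symm
    · have h1 := congrArg (wh 0 1 (M := n + 2) (N := n + 4) (by omega) (by omega)) (ih i h)
      rw [wh_comp 0 1 (N := n + 2) _ (by omega), wh_comp 0 1 (N := n + 4) _ (by omega), wh_cup] at h1
      simp only [zero_add] at h1
      rw [doubleBraiding_succ, doubleBraiding_succ q (n + 2), ← Category.assoc (cup i _ _),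
        cup_crossing_of_lt q i n (n + 2) h rfl (by omega) (by omega) rfl]
      simp only [Category.assoc]
      rw [← reassoc_of% h1, cup_crossing_of_lt q i n (n + 2) h rfl (by omega) (by omega) rfl]

/-- It suffices to slide cups and caps past the extra strand, whose two passages on either side of
them cancel nothing but the position. -/
theorem doubleBraiding_natural {m n : ℕ} (f : THom δ m n) :
    doubleBraiding q m ≫ wh 0 1 (by omega) (by omega) f =
      wh 0 1 (by omega) (by omega) f ≫ doubleBraiding q n := by
  induction f using hom_induction with
  | id n => rw [wh_id, cast_self, Category.id_comp, Category.comp_id]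
  | @comp a b c f g hf hg =>
    rw [wh_comp 0 1 (N := b + 1) _ (by omega), reassoc_of% hf, hg, Category.assoc]
  | cup i hi h =>
    rw [wh_cup]
    simp only [zero_add]
    exact doubleBraiding_cup hq i hi h
  | cap i hi h =>
    rw [wh_cap]
    simp only [zero_add]
    simpa using (congrArg flip (doubleBraiding_cup (δ := δ) hq i hi h)).symm
  | zero => simp
  | add f g hf hg => rw [wh_add, Preadditive.comp_add, Preadditive.add_comp, hf, hg]
  | smul c f hf => rw [wh_smul, Linear.comp_smul, Linear.smul_comp, hf]

@[simp] theorem flip_twist (n : ℕ) : flip (twist q n : THom δ n n) = twist q n := by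
  induction n with
  | zero => rfl
  | succ n ih => rw [twist_succ, flip_smul, flip_comp, flip_wh, ih, flip_doubleBraiding,
      doubleBraiding_natural hq]

/-- Two double braidings with the two legs of a cup. -/
theorem cup_doubleBraiding_crossing_doubleBraiding (n : ℕ) :
    (cup n le_rfl rfl : THom δ n (n + 2)) ≫
        wh 0 1 (by omega) (by omega) (doubleBraiding q n) ≫ crossing q n le_rfl ≫
        wh 0 1 (by omega) (by omega) (doubleBraiding q n) = q • cup n le_rfl rfl := by
  induction n with
  | zero =>
    simp only [doubleBraiding, wh_id, cast_self, Category.comp_id, Category.id_comp]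
    exact cup_crossing_self q 0 le_rfl rfl
  | succ n ih =>
    have h1 := congrArg (wh 0 1 (M := n + 1) (N := n + 3) (by omega) (by omega)) ih
    rw [wh_comp 0 1 (N := n + 3) _ (by omega), wh_comp 0 1 (N := n + 3) _ (by omega),
      wh_comp 0 1 (N := n + 3) _ (by omega), wh_smul, wh_cup, wh_wh, wh_crossing] at h1
    simp only [zero_add] at h1
    have h2 : (wh 0 2 (M := n + 3) (N := n + 3) (by omega) (by omega) (doubleBraiding q n)) ≫
        crossing q (n + 1) le_rfl = (crossing q (n + 1) le_rfl : THom δ _ _) ≫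
          wh 0 2 (by omega) (by omega) (doubleBraiding q n) := by
      have := wh_exchange (doubleBraiding q n : THom δ (n + 1) (n + 1))
        (crossing q 0 le_rfl : THom δ 2 2) (M := n + 3) (N := n + 3) (N' := n + 3) (L := n + 3)
        (by omega) (by omega) (by omega) (by omega) (by omega) (by omega) (by omega) (by omega)
      simpa using this
    rw [doubleBraiding_succ, wh_comp 0 1 (N := n + 3) _ (by omega),
      wh_comp 0 1 (N := n + 3) _ (by omega), wh_wh, wh_crossing]
    simp only [zero_add, Category.assoc]
    rw [reassoc_of% crossing_braid (δ := δ) hq n (n + 1) rfl (by omega), reassoc_of% h2,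
      reassoc_of% cup_succ_crossing_crossing (δ := δ) hq n (n + 1) (M := n + 1) le_rfl rfl rfl,
      ← reassoc_of% h2, reassoc_of% h1, Linear.smul_comp,
      cup_crossing_crossing hq n (n + 1) (M := n + 1) le_rfl rfl rfl]

/-- A cup not at the end is handled by naturality of the double braiding and induction; for the last
cup the two legs cancel. -/
theorem twist_cup {n N : ℕ} (i : ℕ) (hi : i ≤ n) (hN : N = n + 2) :
    (twist q n : THom δ n n) ≫ cup i hi hN = cup i hi hN ≫ twist q N := by
  subst hN
  have last : ∀ n, (cup n le_rfl rfl : THom δ n (n + 2)) ≫ twist q (n + 2) =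
      twist q n ≫ cup n le_rfl rfl := by
    intro n
    have h := wh_comp_cup (twist q n : THom δ n n) 0 (c := 0) (M := n)
      (N := n + 2) (N' := n) (by omega) (by omega) (by omega) (by omega) (by omega)
    simp only [wh_zero_zero, cast_self, Category.id_comp, Category.comp_id, add_zero, zero_add] at h
    -- The scalars are `q ^ 6` from the twists of the two legs, `q` from their first crossing and
    -- `q` from the double braidings; together `q ^ 8 = 1`.
    rw [twist_succ_succ, Linear.comp_smul, ← Category.assoc (cup n _ _), cup_crossing_self,
      Linear.smul_comp, smul_smul]
    have h1 := cup_doubleBraiding_crossing_doubleBraiding (δ := δ) hq n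
    rw [← Category.assoc, ← Category.assoc] at h1
    simp only [← Category.assoc]
    rw [h1, Linear.smul_comp, smul_smul, h, show q ^ 6 * q * q = (q ^ 4) ^ 2 by ring, hq]
    simp
  induction n generalizing i with
  | zero =>
    obtain rfl : i = 0 := by omega
    exact (last 0).symm
  | succ n ih =>
    rcases Nat.lt_or_ge n i with h | h
    · obtain rfl : i = n + 1 := by omega
      exact (last (n + 1)).symm
    · have h1 := congrArg (wh 0 1 (M := n + 1) (N := n + 3) (by omega) (by omega)) (ih i h)
      rw [wh_comp 0 1 (N := n + 1) _ (by omega), wh_comp 0 1 (N := n + 3) _ (by omega), wh_cup] at h1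
      simp only [zero_add] at h1
      rw [twist_succ, twist_succ, Linear.smul_comp, Linear.comp_smul, Category.assoc, h1,
        ← Category.assoc, ← Category.assoc, doubleBraiding_cup hq i h rfl]

theorem twist_natural {m n : ℕ} (f : THom δ m n) : twist q m ≫ f = f ≫ twist q n := by
  induction f using hom_induction with
  | id n => rw [Category.id_comp, Category.comp_id]
  | comp f g hf hg => rw [reassoc_of% hf, hg, Category.assoc]
  | cup i hi h => exact twist_cup hq i hi h
  | cap i hi h => simpa [hq] using (congrArg flip (twist_cup (δ := δ) hq i hi h)).symm
  | zero => simp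
  | add f g hf hg => rw [Preadditive.comp_add, Preadditive.add_comp, hf, hg]
  | smul c f hf => rw [Linear.comp_smul, Linear.smul_comp, hf]

/-- Both outer crossings are resolved. The term without cap-cups closes to a circle and vanishes,
each mixed term gives the shorter double braiding, and the last one its closure. -/
theorem closeR_doubleBraiding_succ (n : ℕ) :
    closeR rfl rfl (doubleBraiding q (n + 1) : THom δ (n + 2) (n + 2)) =
      (2 : k) • doubleBraiding q n + (q⁻¹ * q⁻¹) • wh 0 1 (by omega) (by omega)
        (closeR rfl rfl (doubleBraiding q n : THom δ (n + 1) (n + 1))) := by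
  have h0 := ne_zero_of_pow hq
  set D : THom δ (n + 1) (n + 1) := doubleBraiding q n
  set U : THom δ (n + 2) (n + 2) := (cap n le_rfl rfl : THom δ (n + 2) n) ≫ cup n le_rfl rfl with hU
  have h1 : U ≫ wh 0 1 (by omega) (by omega) D ≫ U =
      wh 0 2 (by omega) (by omega) (closeR rfl rfl D) ≫ U := by
    have := cap_comp_wh (closeR rfl rfl D : THom δ n n) 0 (c := 0) (M := n)
      (N := n + 2) (N' := n) (by omega) (by omega) (by omega) (by omega) (by omega)
    simp only [wh_zero_zero, cast_self, Category.id_comp, Category.comp_id, add_zero, zero_add] at this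
    rw [hU, ← reassoc_of% this, closeR]
    simp only [Category.assoc]
  have h2 : wh 0 2 (M := n + 2) (N := n + 2) (by omega) (by omega) (closeR rfl rfl D : THom δ n n) =
      wh 0 1 (by omega) (by omega) (wh 0 1 (M := n + 1) (N := n + 1) (by omega) (by omega)
        (closeR rfl rfl D)) := by rw [wh_wh]
  rw [doubleBraiding_succ, crossing_eq q n le_rfl rfl, ← hU]
  simp only [Preadditive.comp_add, Preadditive.add_comp, Linear.smul_comp, Linear.comp_smul,
    Category.id_comp, Category.comp_id]
  rw [h1, h2]
  simp only [closeR_add, closeR_smul, smul_add]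
  rw [closeR_wh_eq_zero, closeR_wh_comp rfl rfl, closeR_comp_wh rfl rfl, closeR_wh_comp rfl rfl,
    hU, closeR_cap_cup, Category.comp_id, Category.id_comp, Category.comp_id, smul_smul, smul_smul,
    smul_smul, mul_inv_cancel₀ h0, inv_mul_cancel₀ h0]
  module

/-- The closed double braiding of `n` strands acts by scalars with `c (n + 1) = 2 * q ^ (2 * n) - q
^ 2 * c n` and `c 0 = 0`; two steps multiply `c` by `q ^ 4 = -1`. -/
theorem KillsCaps.comp_closeR_doubleBraiding {a N : ℕ} {e : THom δ a N} (he : KillsCaps e)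
    (s r : ℕ) (h : N = 0 + (2 * s + 1) + r) :
    e ≫ wh 0 r h h (closeR rfl rfl (doubleBraiding q (2 * s + 1) : THom δ (2 * s + 2) (2 * s + 2)))
      = (2 * (-1) ^ s : k) • e := by
  have h1 : ∀ n c r (h : N = 0 + n + r) (h' : N = 0 + (n + 1) + (r - 1)),
      e ≫ wh 0 r h h (closeR rfl rfl (doubleBraiding q n : THom δ (n + 1) (n + 1))) = c • e →
      e ≫ wh 0 (r - 1) h' h' (closeR rfl rfl (doubleBraiding q (n + 1) : THom δ (n + 2) (n + 2)))
        = (2 * q ^ (2 * n) - q * q * c) • e := by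
    intro n c r h h' hc
    rw [closeR_doubleBraiding_succ hq, inv_sq_of_pow hq, wh_add, wh_smul, wh_smul, wh_wh,
      Preadditive.comp_add, Linear.comp_smul, Linear.comp_smul, he.comp_doubleBraiding,
      wh_congr (0 + 0) (1 + (r - 1)) _ _ (a' := 0) (b' := r) rfl (by omega), hc]
    module
  induction s generalizing r with
  | zero =>
    have h0 : closeR rfl rfl (doubleBraiding q 0 : THom δ 1 1) = 0 := by
      have := closeR_wh_eq_zero (δ := δ) (m := 0) (n := 0) rfl rfl (𝟙 _) (by omega) (by omega)
      rwa [wh_id, cast_self] at this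
    have := h1 0 0 (r + 1) (by omega) (by omega) (by rw [h0]; simp)
    simpa using this
  | succ s ih =>
    have := h1 _ _ _ (by omega) (by omega) (h1 _ _ _ (by omega) (by omega) (ih (r + 2) (by omega)))
    refine this.trans ?_
    congr 1
    linear_combination 2 * (-1) ^ s * hq

/-- The trace of the twist on a projector with one further strand. -/
theorem tr_jw_twist (p : ℕ) [CharP k p] {s : ℕ} (hs : s < p) :
    tr (2 * s + 2) (wh 0 1 (by omega) (by omega) (jw δ s) ≫ twist q (2 * s + 2)) =
      -2 * q ^ 2 * tr (2 * s + 1) (jw δ s) := by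
  have he := (isJW_jw (δ := δ) p hs).kills
  have h1 := he.comp_closeR_doubleBraiding hq s 0 (by omega)
  have h2 := he.comp_twist q (2 * s + 1) 0 (by omega)
  rw [wh_zero_zero] at h1 h2
  simp only [cast_self, Category.id_comp, Category.comp_id] at h1 h2
  rw [twist_succ, Linear.comp_smul, map_smul, tr_succ (by omega), closeR_wh_comp rfl rfl,
    closeR_comp_wh rfl rfl, reassoc_of% h1, Linear.smul_comp, h2, map_smul, map_smul]
  simp only [smul_eq_mul]
  -- The exponent is `4 * (s * (s + 1) + s) + 3`, and `s * (s + 1)` is even. The signs then cancel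
  -- and leave `2 * q ^ 6 = -2 * q ^ 2`.
  have h3 : q ^ ((2 * s + 1) * (2 * s + 1 + 2)) = (-1) ^ s * q ^ 3 := by
    rw [show (2 * s + 1) * (2 * s + 1 + 2) = 4 * (s * (s + 1) + s) + 3 by ring, pow_add, pow_mul,
      hq, pow_add, (Nat.even_mul_succ_self s).neg_one_pow, one_mul]
  have h4 : (-1 : k) ^ s * (-1) ^ s = 1 := by rw [← mul_pow]; simp
  rw [h3, pow_succ (-1 : k), pow_mul]
  linear_combination (2 * q ^ 6 * tr (2 * s + 1) (jw δ s)) * h4 +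
    2 * q ^ 2 * tr (2 * s + 1) (jw δ s) * hq

end

end TemperleyLieb

end

/-! ### Nested arcs: bending strands turns closures and gluings into composites. -/

noncomputable section

namespace TemperleyLieb

variable {k : Type u} [Field k] {δ : k}

/-! ### Nested arcs and bending -/

/-- `n` nested cups. -/
def nest (n : ℕ) {N : ℕ} (h : N = n + n) : THom δ 0 N := cups 0 0 le_rfl n ≫ cast (by omega)

theorem nest_zero {N : ℕ} (h : N = 0 + 0) : (nest 0 h : THom δ 0 N) = cast (by omega) := by
  simp [nest, cups]

theorem nest_succ (n : ℕ) {M N : ℕ} (h : N = n + 1 + (n + 1)) (hM : M = n + n) :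
    (nest (n + 1) h : THom δ 0 N) = nest n hM ≫ cup n (by omega) (by omega) := by
  subst hM
  simp only [nest, cups, Category.assoc, cast_cup, cup_cast]
  simp

/-- Nested arcs also grow from the outside. The zigzag of `n` arcs needs both views, as the
innermost arc on one side meets the outermost on the other. -/
theorem nest_succ_outer (n : ℕ) {M N : ℕ} (h : N = n + 1 + (n + 1)) (hM : M = n + n) :
    (nest (n + 1) h : THom δ 0 N) =
      (cup 0 le_rfl rfl : THom δ 0 2) ≫ wh 1 1 (by omega) (by omega) (nest n hM) := by
  induction n generalizing N M with
  | zero =>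
    subst hM
    obtain rfl : N = 2 := by omega
    rw [nest_succ 0 _ rfl, nest_zero]
    simp
  | succ n ih =>
    rw [nest_succ (n + 1) _ (M := n + 1 + (n + 1)) rfl, ih _ (M := n + n) rfl,
      nest_succ n hM (M := n + n) rfl, wh_comp 1 1 _ (N := n + 1 + (n + 1)) (by omega) _, wh_cup,
      Category.assoc]
    congr 3
    omega

/-- One strand is straightened at a time. -/
theorem wh_nest_comp_wh_flip_nest (n : ℕ) {N : ℕ} (h : N = n + n) {M : ℕ} (hM : M = n + n + n) :
    wh 0 n (M := n) (N := M) (by omega) (by omega) (nest n h : THom δ 0 N) ≫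
      wh n 0 (by omega) (by omega) (flip (nest n h : THom δ 0 N)) = 𝟙 _ := by
  subst h hM
  induction n with
  | zero => simp [nest_zero]
  | succ n ih =>
    have h1 := congrArg (wh 0 1 (M := n + 1) (N := n + 1) (by omega) (by omega)) ih
    rw [wh_comp 0 1 (N := n + n + n + 1) _ (by omega) _, wh_wh, wh_wh, wh_id] at h1
    have h2 := wh_exchange (cup n le_rfl rfl : THom δ n (n + 1 + 1))
      (wh 0 1 (M := n + n + 1) (N := 1) (by omega) (by omega) (flip (nest n rfl)))
      (M := n + n + n + 1) (N := n + 1 + (n + 1) + (n + 1)) (N' := n + 1) (L := n + 3)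
      (by omega) (by omega) (by omega) (by omega) (by omega) (by omega) (by omega) (by omega)
    rw [wh_wh, wh_wh, wh_cup, wh_cup] at h2
    have h3 : (nest (n + 1) rfl : THom δ 0 _) = nest n rfl ≫ cup n (by omega) (by omega) :=
      nest_succ n _ rfl
    have h4 : (nest (n + 1) rfl : THom δ 0 _) =
      (cup 0 le_rfl rfl : THom δ 0 2) ≫ wh 1 1 (by omega) (by omega) (nest n rfl) :=
      nest_succ_outer n _ rfl
    conv_lhs =>
      arg 2
      rw [h4]
    rw [h3, flip_comp, flip_wh, flip_cup,
      wh_comp 0 (n + 1) _ (N := n + n + n + 1) (by omega) _,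
      wh_comp (n + 1) 0 _ (N := n + 3) (by omega) _, wh_wh, wh_cup, wh_cap]
    simp only [zero_add, add_zero, Category.assoc] at h1 h2 ⊢
    rw [reassoc_of% h2, cup_cap_zigzag n (n + 1) (by omega) le_rfl rfl rfl, Category.comp_id]
    exact h1

theorem rot_id (n : ℕ) : rot (𝟙 (⟨n⟩ : TL δ)) = 𝟙 _ := rfl

theorem rot_zero (m n : ℕ) : rot (0 : THom δ m n) = 0 := rfl

theorem rot_smul {m n : ℕ} (c : k) (f : THom δ m n) : rot (c • f) = c • rot f := by
  rcases f with ⟨f⟩; rfl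

/-- A cap joining two neighbouring left legs leaves their right legs joined by a cup at the mirrored
position. -/
theorem nest_cap (m i : ℕ) (hi : i ≤ m) {N N' N'' : ℕ} (h : N = m + 2 + (m + 2)) (h' : N' = m + m)
    (h'' : N'' = N' + 2) :
    (nest (m + 2) h : THom δ 0 N) ≫ (cap i (by omega) (by omega) : THom δ N N'') =
      nest m h' ≫ cup (m + (m - i)) (by omega) (by omega) := by
  subst h''
  induction m generalizing i N N' with
  | zero =>
    obtain rfl : i = 0 := by omega
    rw [nest_succ 1 h (M := N' + 2) (by omega), nest_succ 0 _ h', Category.assoc,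
      cup_cap_zagzig 0 (0 + 1) (by omega) (by omega) _ rfl, Category.comp_id]
  | succ m ih =>
    rw [nest_succ (m + 2) h (M := N' + 2) (by omega), Category.assoc]
    rcases Nat.lt_or_ge m i with h1 | h1
    · obtain rfl : i = m + 1 := by omega
      rw [cup_cap_zagzig (m + 1) (m + 2) (by omega) (by omega) _ rfl, Category.comp_id,
        nest_succ (m + 1) _ h']
      congr 2
      omega
    · rw [← cap_cup_exchange N (b := N') i m (m + 2) h1 rfl (by omega) (by omega) (by omega)
          (by omega) (by omega)]
      obtain ⟨N₀, rfl⟩ : ∃ N₀, N' = N₀ + 2 := ⟨N' - 2, by omega⟩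
      rw [reassoc_of% ih i h1 (N := N₀ + 2 + 2) (N' := N₀) (by omega) (by omega),
        cup_cup_exchange (N₀ + 2) m (m + (m - i)) (m + (m - i) + 2) (by omega) rfl (by omega)
          (by omega) rfl (by omega) (by omega), nest_succ m h' (M := N₀) (by omega),
        Category.assoc]
      congr 3
      omega

theorem nest_cap_right (m i : ℕ) (hi : i ≤ m) {N N' N'' : ℕ} (h : N = m + 2 + (m + 2))
    (h' : N' = m + m)
    (h'' : N'' = N' + 2) :
    (nest (m + 2) h : THom δ 0 N) ≫ (cap (m + 2 + i) (by omega) (by omega) : THom δ N N'') =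
      nest m h' ≫ cup (m - i) (by omega) (by omega) := by
  subst h''
  induction m generalizing i N N' with
  | zero =>
    obtain rfl : i = 0 := by omega
    rw [nest_succ 1 h (M := N' + 2) (by omega), nest_succ 0 _ h', Category.assoc,
      cup_cap_zigzag (0 + 1) (0 + 2 + 0) (by omega) (by omega) _ rfl, Category.comp_id]
  | succ m ih =>
    rw [nest_succ (m + 2) h (M := N' + 2) (by omega), Category.assoc]
    rcases Nat.eq_zero_or_pos i with rfl | h1
    · rw [cup_cap_zigzag (m + 2) (m + 1 + 2 + 0) (by omega) (by omega) _ (by omega),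
        Category.comp_id, nest_succ (m + 1) _ h']
      congr 2
    · rw [← cap_cup_exchange' N (b := N') (m + 2) (m + 2 + (i - 1)) (m + 1 + 2 + i) (by omega)
          (by omega) (by omega) (by omega) (by omega) (by omega) (by omega)]
      obtain ⟨N₀, rfl⟩ : ∃ N₀, N' = N₀ + 2 := ⟨N' - 2, by omega⟩
      rw [reassoc_of% ih (i - 1) (by omega) (N := N₀ + 2 + 2) (N' := N₀) (by omega) (by omega),
        ← cup_cup_exchange (a := N₀) (b := N₀ + 2) (c := N₀ + 4) (N₀ + 2) (m - (i - 1)) m (m + 2) (by omega) rfl (by omega)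
          (by omega) (by omega) (by omega) (by omega), nest_succ m h' (M := N₀) (by omega),
        Category.assoc]
      congr 3
      omega

/-- A diagram on the left legs of nested cups slides to the right legs. -/
theorem nest_rot {m n N N' M : ℕ} (g : THom δ m n) (h : N = n + n) (h' : N' = m + m)
    (hM : M = m + n) :
    (nest n h : THom δ 0 N) ≫ wh 0 n (N := M) (by omega) (by omega) (rot g) =
      nest m h' ≫ wh m 0 (by omega) (by omega) g := by
  subst h h' hM
  induction g using hom_induction with
  | id n => simp [rot_id]
  | @comp a b c f g hf hg =>
    have := wh_exchange (rot f) g (M := b + b) (N := a + b) (N' := b + c) (L := a + c)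
      (by omega) (by omega) (by omega) (by omega) (by omega) (by omega) (by omega) (by omega)
    rw [rot_comp, wh_comp 0 c _ (N := b + c) (by omega) _, reassoc_of% hg, ← this, reassoc_of% hf,
      ← wh_comp]
  | @cup m n i hi h =>
    subst h
    change _ ≫ wh 0 _ _ _ (cap (m - i) _ _) = _
    rw [wh_cap, wh_cup]
    simp only [zero_add]
    rw [nest_cap m (m - i) (by omega) rfl rfl (by omega)]
    congr 2
    omega
  | @cap m n i hi h =>
    subst h
    change _ ≫ wh 0 _ _ _ (cup (n - i) _ _) = _
    rw [wh_cap, wh_cup, nest_cap_right n i (by omega) rfl rfl (by omega)]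
    simp only [zero_add]
  | zero => simp [rot_zero]
  | add f g hf hg => simp only [rot_add, wh_add, Preadditive.comp_add, hf, hg]
  | smul c f hf => simp only [rot_smul, wh_smul, Linear.comp_smul, hf]

theorem cups_comp_cast (N i : ℕ) (hi : i ≤ N) (n : ℕ) {M L : ℕ} (h : N + 2 * n = M)
    (hL : L = n + n) :
    cups N i hi n ≫ cast h = (wh i (N - i) (by omega) (by omega) (nest n hL : THom δ 0 L)) := by
  subst h
  induction n generalizing L with
  | zero =>
    subst hL
    rw [nest_zero]
    simp [cups]
  | succ n ih =>
    rw [nest_succ n hL (M := n + n) rfl, wh_comp i (N - i) _ (N := N + 2 * n) (by omega) _, ← ih rfl,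
      wh_cup, cups]
    simp

theorem flip_cups (N i : ℕ) (hi : i ≤ N) (n : ℕ) :
    flip (cups N i hi n : THom δ _ _) = caps N i hi n := by
  induction n with
  | zero => simp [cups, caps]
  | succ n ih => simp [cups, caps, ih]

theorem cast_comp_caps (N i : ℕ) (hi : i ≤ N) (n : ℕ) {M L : ℕ} (h : M = N + 2 * n)
    (hL : L = n + n) :
    cast h ≫ caps N i hi n = (wh i (N - i) (by omega) (by omega) (flip (nest n hL : THom δ 0 L))) := by
  rw [← flip_wh, ← cups_comp_cast N i hi n h.symm hL, flip_comp, flip_cups, flip_cast]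

/-- Bend the last `n` lower ends up to the right. -/
def bend {v n : ℕ} (y : THom δ (v + n) 0) : THom δ v n :=
  wh v 0 (M := v) (N := v + n + n) (by omega) (by omega) (nest n rfl) ≫
    wh 0 n (by omega) (by omega) y

/-- Bend the `n` upper ends down to the right. -/
def unbend {v n : ℕ} (u : THom δ v n) : THom δ (v + n) 0 :=
  wh 0 n (N := n + n) (by omega) (by omega) u ≫ flip (nest n rfl)

theorem bend_wh_comp {v v' n : ℕ} (f : THom δ v' v) (y : THom δ (v + n) 0)
    (h : v' + n = 0 + v' + n) (h' : v + n = 0 + v + n) :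
    bend (wh 0 n h h' f ≫ y) = f ≫ bend y := by
  have := wh_exchange f (nest n rfl : THom δ 0 (n + n)) (M := v') (N := v) (N' := v' + n + n)
    (L := v + n + n)
    (by omega) (by omega) (by omega) (by omega) (by omega) (by omega) (by omega) (by omega)
  rw [bend, wh_comp 0 n _ (N := v + n + n) (by omega) _, wh_wh, bend]
  simp only [zero_add, wh_zero_zero, cast_self, Category.id_comp, Category.comp_id] at this ⊢
  rw [← Category.assoc, ← Category.assoc, this]

/-- A rotated diagram on the bent legs travels along the nested arcs and comes out upright at the
top. -/
theorem bend_rot {v n n' : ℕ} (g : THom δ n' n) (y : THom δ (v + n') 0)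
    (h : v + n = v + n + 0) (h' : v + n' = v + n' + 0) :
    bend (wh v 0 h h' (rot g) ≫ y) = bend y ≫ g := by
  have h1 := wh_exchange y g (M := v + n' + n') (N := n') (N' := v + n' + n) (L := n)
    (by omega) (by omega) (by omega) (by omega) (by omega) (by omega) (by omega) (by omega)
  have h2 := congrArg (wh v 0 (M := v) (N := v + n' + n) (by omega) (by omega))
    (nest_rot g (N := n + n) (N' := n' + n') (M := n' + n) rfl rfl rfl)
  rw [wh_comp v 0 _ (N := v + n + n) (by omega) _, wh_wh,
    wh_comp v 0 _ (N := v + n' + n') (by omega) _, wh_wh] at h2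
  rw [bend, wh_comp 0 n _ (N := v + n' + n) (by omega) _, wh_wh, bend]
  simp only [zero_add, add_zero, wh_zero_zero, cast_self, Category.id_comp, Category.comp_id,
    Category.assoc] at h1 h2 ⊢
  rw [h1, reassoc_of% h2]

theorem bend_unbend {v n : ℕ} (u : THom δ v n) : bend (unbend u) = u := by
  have h := congrArg flip (wh_nest_comp_wh_flip_nest (δ := δ) n rfl rfl)
  simp only [flip_comp, flip_wh, flip_flip, flip_id] at h
  rw [unbend, bend_wh_comp, bend, h, Category.comp_id]

theorem bend_add {v n : ℕ} (y y' : THom δ (v + n) 0) : bend (y + y') = bend y + bend y' := by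
  simp [bend, wh_add]

theorem bend_smul {v n : ℕ} (c : k) (y : THom δ (v + n) 0) : bend (c • y) = c • bend y := by
  simp [bend, wh_smul]

/-- Bending as a linear map. -/
def bendₗ {v n : ℕ} : THom δ (v + n) 0 →ₗ[k] THom δ v n where
  toFun := bend
  map_add' := bend_add
  map_smul' := bend_smul

/-- When nothing connects the lower part to the upper one, the closing arcs are exactly the bends;
this matches duality for the cutting morphism with duality of bent families. -/
theorem ptrR_comp {v v' n : ℕ} (y : THom δ (v + n) 0) (x : THom δ 0 (v' + n)) :
    ptrR n (y ≫ x) = bend y ≫ flip (bend (flip x)) := by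
  rw [ptrR, ← Category.assoc, cups_comp_cast v v le_rfl n _ rfl, cast_comp_caps v' v' le_rfl n _ rfl,
    wr_eq_wh, wh_comp 0 n _ (N := n) (by omega) _, bend, bend, flip_comp, flip_wh, flip_wh, flip_flip,
    wh_congr v (v - v) _ _ (a' := v) (b' := 0) rfl (by omega),
    wh_congr v' (v' - v') _ _ (a' := v') (b' := 0) rfl (by omega)]
  simp only [Category.assoc]

/-- The same mechanism with `c` on the joined strands: bend into `c` from below and out of it above.
-/
theorem glue_comp {v v' n n' w w' : ℕ} (y : THom δ (v + n) 0) (x : THom δ 0 (v' + n'))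
    (c : THom δ (n + w) (n' + w')) :
    glue (y ≫ x) c = wr w (bend y) ≫ c ≫ wr w' (flip (bend (flip x))) := by
  have h1 := wh_exchange x c (M := n + w) (N := v' + n' + (n + w)) (N' := n' + w')
    (L := v' + n' + (n' + w'))
    (by omega) (by omega) (by omega) (by omega) (by omega) (by omega) (by omega) (by omega)
  rw [glue, ← Category.assoc, cups_comp_cast (v + w) v _ n (M := v + n + (n + w)) _ rfl,
    cast_comp_caps (v' + w') v' _ n' _ rfl, tensor_eq_wh,
    wh_comp 0 (n + w) _ (N := n + w) (by omega) _, bend, bend, flip_comp, flip_wh, flip_wh, flip_flip,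
    wr_eq_wh, wr_eq_wh, wh_comp 0 w _ (N := v + n + (n + w)) (by omega) _,
    wh_comp 0 w' _ (N := v' + n' + (n' + w')) (by omega) _, wh_wh, wh_wh, wh_wh, wh_wh,
    wh_congr v (v + w - v) _ _ (a' := 0 + v) (b' := 0 + w) (by omega) (by omega),
    wh_congr v' (v' + w' - v') _ _ (a' := 0 + v') (b' := 0 + w') (by omega) (by omega)]
  simp only [zero_add, add_zero, wh_zero_zero, cast_self, Category.id_comp, Category.comp_id,
    Category.assoc] at h1 ⊢
  rw [reassoc_of% h1]

end TemperleyLieb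

end

/-! ### Reduction of tilting objects to matrices of diagrams. -/

noncomputable section

namespace MixedVerlinde

open TemperleyLieb

variable {k : Type u} [Field k] {δ : k}

/-! ### Matrix entries of morphisms of tilting objects -/

/-- The numbers of strands of the terms of the ambient direct sum. -/
abbrev num (X : Tilt δ) (i : X.X.ι) : ℕ := (X.X.X i).n

/-- The matrix entries of a morphism. -/
def entry {X Y : Tilt δ} (f : X ⟶ Y) (i : X.X.ι) (j : Y.X.ι) : THom δ (num X i) (num Y j) := f.f i j

theorem hom_ext {X Y : Tilt δ} {f g : X ⟶ Y} (h : ∀ i j, entry f i j = entry g i j) : f = g := by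
  refine Karoubi.hom_ext _ _ ?_
  ext i j
  exact h i j

@[simp] theorem entry_comp {X Y Z : Tilt δ} (f : X ⟶ Y) (g : Y ⟶ Z) (i : X.X.ι) (l : Z.X.ι) :
    entry (f ≫ g) i l = ∑ j, entry f i j ≫ entry g j l := rfl

@[simp] theorem entry_add {X Y : Tilt δ} (f g : X ⟶ Y) (i : X.X.ι) (j : Y.X.ι) :
    entry (f + g) i j = entry f i j + entry g i j := rfl

@[simp] theorem entry_smul {X Y : Tilt δ} (c : k) (f : X ⟶ Y) (i : X.X.ι) (j : Y.X.ι) :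
    entry (c • f) i j = c • entry f i j := rfl

/-- Matrix entries as linear maps. -/
def entryₗ {X Y : Tilt δ} (i : X.X.ι) (j : Y.X.ι) : (X ⟶ Y) →ₗ[k] THom δ (num X i) (num Y j) where
  toFun f := entry f i j
  map_add' _ _ := rfl
  map_smul' _ _ := rfl

@[simp] theorem entry_zero {X Y : Tilt δ} (i : X.X.ι) (j : Y.X.ι) :
    entry (0 : X ⟶ Y) i j = 0 := rfl

@[simp] theorem entry_sub {X Y : Tilt δ} (f g : X ⟶ Y) (i : X.X.ι) (j : Y.X.ι) :
    entry (f - g) i j = entry f i j - entry g i j := (entryₗ i j).map_sub f g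

@[simp] theorem entry_sum {X Y : Tilt δ} {ι : Type*} (s : Finset ι) (f : ι → (X ⟶ Y))
    (i : X.X.ι) (j : Y.X.ι) : entry (∑ l ∈ s, f l) i j = ∑ l ∈ s, entry (f l) i j :=
  map_sum (entryₗ i j) f s

/-- The matrix of a morphism, as a linear map. -/
def entriesₗ {X Y : Tilt δ} : (X ⟶ Y) →ₗ[k] (∀ (i : X.X.ι) (j : Y.X.ι), THom δ (num X i) (num Y j)) :=
  LinearMap.pi fun i => LinearMap.pi fun j => entryₗ i j

instance finite_tilt_hom (X Y : Tilt δ) : Module.Finite k (X ⟶ Y) :=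
  Module.Finite.of_injective entriesₗ fun _ _ h =>
    hom_ext fun i j => congrFun (congrFun h i) j

instance (a : ℕ) : Unique (strands a : Tilt δ).X.ι := inferInstanceAs (Unique PUnit)

instance (a b : ℕ) : Unique (tensorObj (strands a) (strands b) : Tilt δ).X.ι :=
  ⟨⟨(default, default)⟩, fun _ => rfl⟩

/-- The morphism of strand objects given by a diagram. -/
def emb {a b : ℕ} (f : THom δ a b) : (strands a : Tilt δ) ⟶ strands b :=
  (toKaroubi _).map ((Mat_.embedding (TL δ)).map f)

/-- The diagram of a morphism of strand objects. -/
def unemb {a b : ℕ} (f : (strands a : Tilt δ) ⟶ strands b) : THom δ a b := entry f default default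

@[simp] theorem unemb_emb {a b : ℕ} (f : THom δ a b) : unemb (emb f) = f := rfl

@[simp] theorem emb_unemb {a b : ℕ} (f : (strands a : Tilt δ) ⟶ strands b) : emb (unemb f) = f :=
  hom_ext fun _ _ => rfl

@[simp] theorem emb_id (a : ℕ) : emb (𝟙 (⟨a⟩ : TL δ)) = 𝟙 _ := by
  refine ((toKaroubi _).congr_map ((Mat_.embedding (TL δ)).map_id _)).trans ?_
  exact (toKaroubi _).map_id _

theorem emb_comp {a b c : ℕ} (f : THom δ a b) (g : THom δ b c) : emb (f ≫ g) = emb f ≫ emb g :=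
  ((toKaroubi _).congr_map ((Mat_.embedding (TL δ)).map_comp f g)).trans ((toKaroubi _).map_comp _ _)

theorem emb_add {a b : ℕ} (f g : THom δ a b) : emb (f + g) = emb f + emb g := rfl

theorem emb_smul {a b : ℕ} (c : k) (f : THom δ a b) : emb (c • f) = c • emb f := rfl

theorem emb_zero (a b : ℕ) : emb (0 : THom δ a b) = 0 := rfl

/-- `emb` as a linear map. -/
def embₗ {a b : ℕ} : THom δ a b →ₗ[k] ((strands a : Tilt δ) ⟶ strands b) where
  toFun := emb
  map_add' := emb_add
  map_smul' := emb_smul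

theorem emb_sum {a b : ℕ} {ι : Type*} (s : Finset ι) (f : ι → THom δ a b) :
    emb (∑ i ∈ s, f i) = ∑ i ∈ s, emb (f i) := map_sum embₗ f s

@[simp] theorem unemb_comp {a b c : ℕ} (f : (strands a : Tilt δ) ⟶ strands b)
    (g : strands b ⟶ strands c) : unemb (f ≫ g) = unemb f ≫ unemb g := by
  conv_lhs => rw [← emb_unemb f, ← emb_unemb g, ← emb_comp, unemb_emb]

@[simp] theorem unemb_id (a : ℕ) : unemb (𝟙 (strands a : Tilt δ)) = 𝟙 _ := by
  rw [← emb_id, unemb_emb]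

@[simp] theorem unemb_add {a b : ℕ} (f g : (strands a : Tilt δ) ⟶ strands b) :
    unemb (f + g) = unemb f + unemb g := rfl

@[simp] theorem unemb_smul {a b : ℕ} (c : k) (f : (strands a : Tilt δ) ⟶ strands b) :
    unemb (c • f) = c • unemb f := rfl

@[simp] theorem unemb_sub {a b : ℕ} (f g : (strands a : Tilt δ) ⟶ strands b) :
    unemb (f - g) = unemb f - unemb g := entry_sub f g _ _

@[simp] theorem unemb_zero (a b : ℕ) : unemb (0 : (strands a : Tilt δ) ⟶ strands b) = 0 := rfl

@[simp] theorem unemb_sum {a b : ℕ} {ι : Type*} (s : Finset ι)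
    (f : ι → ((strands a : Tilt δ) ⟶ strands b)) :
    unemb (∑ i ∈ s, f i) = ∑ i ∈ s, unemb (f i) := entry_sum s f _ _

/-- The idempotent of an object, as a matrix. -/
theorem entry_id_comp {X Y : Tilt δ} (f : X ⟶ Y) (i : X.X.ι) (j : Y.X.ι) :
    ∑ l, entry (𝟙 X) i l ≫ entry f l j = entry f i j := by
  rw [← entry_comp, Category.id_comp]

theorem entry_comp_id {X Y : Tilt δ} (f : X ⟶ Y) (i : X.X.ι) (j : Y.X.ι) :
    ∑ l, entry f i l ≫ entry (𝟙 Y) l j = entry f i j := by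
  rw [← entry_comp, Category.comp_id]

/-- Morphisms from matrices that absorb the idempotents. -/
def mkHom {X Y : Tilt δ} (f : ∀ (i : X.X.ι) (j : Y.X.ι), THom δ (num X i) (num Y j))
    (hl : ∀ i j, ∑ l, entry (𝟙 X) i l ≫ f l j = f i j)
    (hr : ∀ i j, ∑ l, f i l ≫ entry (𝟙 Y) l j = f i j) : X ⟶ Y :=
  ⟨f, by
    have h1 : X.p ≫ (show X.X ⟶ Y.X from f) = f := by ext i j; exact hl i j
    have h2 : (show X.X ⟶ Y.X from f) ≫ Y.p = f := by ext i j; exact hr i j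
    exact (congrArg (X.p ≫ ·) h2).trans h1⟩

@[simp] theorem entry_mkHom {X Y : Tilt δ} (f : ∀ (i : X.X.ι) (j : Y.X.ι), THom δ (num X i) (num Y j))
    (hl) (hr) (i : X.X.ι) (j : Y.X.ι) : entry (mkHom (X := X) (Y := Y) f hl hr) i j = f i j := rfl

@[simp] theorem entry_id_strands (a : ℕ) (i j) : entry (𝟙 (strands a : Tilt δ)) i j = 𝟙 _ := by
  rw [← emb_id]; rfl

/-- The projection to a term of the ambient direct sum. -/
def proj (X : Tilt δ) (i : X.X.ι) : X ⟶ strands (num X i) :=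
  mkHom (fun i' _ => entry (𝟙 X) i' i) (fun i' _ => entry_id_comp (𝟙 X) i' i) (fun i' j => by
    refine (Fintype.sum_unique _).trans ?_
    rw [entry_id_strands]
    exact Category.comp_id _)

/-- The inclusion of a term of the ambient direct sum. -/
def incl (X : Tilt δ) (i : X.X.ι) : strands (num X i) ⟶ X :=
  mkHom (fun _ i' => entry (𝟙 X) i i') (fun j i' => by
    refine (Fintype.sum_unique _).trans ?_
    rw [entry_id_strands]
    exact Category.id_comp _) (fun _ i' => entry_comp_id (𝟙 X) i i')

/-- Projections and inclusions are columns and rows of the idempotent of `X`; their products sum to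
its square. -/
theorem sum_proj_incl (X : Tilt δ) : ∑ i, proj X i ≫ incl X i = 𝟙 X := by
  refine hom_ext fun i j => ?_
  rw [entry_sum, ← entry_id_comp (𝟙 X) i j]
  refine Finset.sum_congr rfl fun l _ => ?_
  rw [entry_comp]
  exact Fintype.sum_unique _

theorem entry_incl_comp {X Y : Tilt δ} (f : X ⟶ Y) (i : X.X.ι) (j : Y.X.ι) (l) :
    entry (incl X i ≫ f) l j = entry f i j := entry_id_comp f i j

theorem entry_comp_proj {X Y : Tilt δ} (f : X ⟶ Y) (i : X.X.ι) (j : Y.X.ι) (l) :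
    entry (f ≫ proj Y j) i l = entry f i j := entry_comp_id f i j

theorem incl_comp_proj {X Y : Tilt δ} (f : X ⟶ Y) (i : X.X.ι) (j : Y.X.ι) :
    incl X i ≫ f ≫ proj Y j = emb (entry f i j) := by
  refine hom_ext fun a b => ?_
  rw [entry_incl_comp, entry_comp_proj]
  rfl

theorem eq_sum_entry {X Y : Tilt δ} (f : X ⟶ Y) :
    f = ∑ i, ∑ j, proj X i ≫ emb (entry f i j) ≫ incl Y j := by
  conv_lhs => rw [← Category.id_comp f, ← Category.comp_id f, ← sum_proj_incl X, ← sum_proj_incl Y]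
  simp only [Preadditive.sum_comp, Preadditive.comp_sum, ← incl_comp_proj, Category.assoc]
  rw [Finset.sum_comm]

/-! ### Tensor products -/

@[simp] theorem entry_tensorHom {X X' Y Y' : Tilt δ} (f : X ⟶ X') (g : Y ⟶ Y') (x) (y) :
    entry (tensorHom f g) x y = tensor (entry f x.1 y.1) (entry g x.2 y.2) := rfl

theorem tensorHom_id (X Y : Tilt δ) : tensorHom (𝟙 X) (𝟙 Y) = 𝟙 (tensorObj X Y) := rfl

theorem tensorHom_comp {X X' X'' Y Y' Y'' : Tilt δ} (f : X ⟶ X') (f' : X' ⟶ X'') (g : Y ⟶ Y')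
    (g' : Y' ⟶ Y'') : tensorHom f g ≫ tensorHom f' g' = tensorHom (f ≫ f') (g ≫ g') :=
  Karoubi.hom_ext _ _ (matTensorHom_comp f.f f'.f g.f g'.f)

/-- The tensor product of morphisms as a bilinear map. -/
def tensorHomₗ {X X' Y Y' : Tilt δ} :
    (X ⟶ X') →ₗ[k] (Y ⟶ Y') →ₗ[k] (tensorObj X Y ⟶ tensorObj X' Y') :=
  LinearMap.mk₂ k tensorHom
    (fun _ _ _ => hom_ext fun _ _ => LinearMap.map_add₂ tensorₗ _ _ _)
    (fun _ _ _ => hom_ext fun _ _ => LinearMap.map_smul₂ tensorₗ _ _ _)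
    (fun _ _ _ => hom_ext fun _ _ => map_add (tensorₗ _) _ _)
    (fun _ _ _ => hom_ext fun _ _ => map_smul (tensorₗ _) _ _)

/-- Tensoring with an identity on the right. -/
def whiskR {X X' : Tilt δ} (Y : Tilt δ) (f : X ⟶ X') : tensorObj X Y ⟶ tensorObj X' Y :=
  tensorHom f (𝟙 Y)

/-- Tensoring with an identity on the left. -/
def whiskL (X : Tilt δ) {Y Y' : Tilt δ} (g : Y ⟶ Y') : tensorObj X Y ⟶ tensorObj X Y' :=
  tensorHom (𝟙 X) g

section

variable {X X' X'' Y Y' Y'' : Tilt δ}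

@[simp] theorem whiskR_id (X Y : Tilt δ) : whiskR Y (𝟙 X) = 𝟙 _ := rfl

@[simp] theorem whiskL_id (X Y : Tilt δ) : whiskL X (𝟙 Y) = 𝟙 _ := rfl

theorem whiskR_comp (f : X ⟶ X') (f' : X' ⟶ X'') : whiskR Y (f ≫ f') = whiskR Y f ≫ whiskR Y f' := by
  rw [whiskR, whiskR, whiskR, tensorHom_comp, Category.comp_id]

theorem whiskL_comp (f : Y ⟶ Y') (f' : Y' ⟶ Y'') : whiskL X (f ≫ f') = whiskL X f ≫ whiskL X f' := by
  rw [whiskL, whiskL, whiskL, tensorHom_comp, Category.comp_id]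

theorem tensorHom_eq (f : X ⟶ X') (g : Y ⟶ Y') : tensorHom f g = whiskR Y f ≫ whiskL X' g := by
  rw [whiskR, whiskL, tensorHom_comp, Category.comp_id, Category.id_comp]

theorem tensorHom_eq' (f : X ⟶ X') (g : Y ⟶ Y') : tensorHom f g = whiskL X g ≫ whiskR Y' f := by
  rw [whiskR, whiskL, tensorHom_comp, Category.comp_id, Category.id_comp]

theorem whisk_exchange (f : X ⟶ X') (g : Y ⟶ Y') :
    whiskR Y f ≫ whiskL X' g = whiskL X g ≫ whiskR Y' f := by
  rw [← tensorHom_eq, tensorHom_eq']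

/-- Tensoring with an identity on the right, as a linear map. -/
def whiskRₗ (Y : Tilt δ) : (X ⟶ X') →ₗ[k] (tensorObj X Y ⟶ tensorObj X' Y) :=
  tensorHomₗ.flip (𝟙 Y)

theorem whiskR_sum {ι : Type*} (s : Finset ι) (f : ι → (X ⟶ X')) :
    whiskR Y (∑ i ∈ s, f i) = ∑ i ∈ s, whiskR Y (f i) := map_sum (whiskRₗ Y) f s

end

theorem tensor_id (a b : ℕ) : tensor (𝟙 (⟨a⟩ : TL δ)) (𝟙 (⟨b⟩ : TL δ)) = 𝟙 _ := by
  rw [tensor, wr_id, wl_id, Category.id_comp]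

@[simp] theorem entry_id_tensor_strands (a b : ℕ) (i j) :
    entry (𝟙 (tensorObj (strands a) (strands b) : Tilt δ)) i j = 𝟙 _ := by
  rw [← tensorHom_id, entry_tensorHom, entry_id_strands, entry_id_strands]
  exact tensor_id a b

/-- Juxtaposition of strand objects. -/
def joinHom (a b : ℕ) : tensorObj (strands a) (strands b) ⟶ (strands (a + b) : Tilt δ) :=
  mkHom (fun _ _ => 𝟙 (⟨a + b⟩ : TL δ))
    (fun i j => by
      refine (Fintype.sum_unique _).trans ?_
      rw [entry_id_tensor_strands]
      exact Category.comp_id _)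
    (fun i j => by
      refine (Fintype.sum_unique _).trans ?_
      rw [entry_id_strands]
      exact Category.comp_id _)

/-- The inverse of juxtaposition. -/
def joinInv (a b : ℕ) : (strands (a + b) : Tilt δ) ⟶ tensorObj (strands a) (strands b) :=
  mkHom (fun _ _ => 𝟙 (⟨a + b⟩ : TL δ))
    (fun i j => by
      refine (Fintype.sum_unique _).trans ?_
      rw [entry_id_strands]
      exact Category.comp_id _)
    (fun i j => by
      refine (Fintype.sum_unique _).trans ?_
      rw [entry_id_tensor_strands]
      exact Category.comp_id _)

theorem joinHom_joinInv (a b : ℕ) :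
    joinHom a b ≫ joinInv a b = 𝟙 (tensorObj (strands a) (strands b) : Tilt δ) := by
  refine hom_ext fun i j => ?_
  rw [entry_comp, entry_id_tensor_strands]
  refine (Fintype.sum_unique _).trans ?_
  exact Category.comp_id _

theorem joinInv_joinHom (a b : ℕ) : joinInv a b ≫ joinHom a b = 𝟙 (strands (a + b) : Tilt δ) := by
  refine hom_ext fun i j => ?_
  rw [entry_comp, entry_id_strands]
  refine (Fintype.sum_unique _).trans ?_
  exact Category.comp_id _

/-- The entry of a morphism from a tensor product of strand objects. -/
theorem unemb_joinInv_comp {a b c : ℕ} (f : tensorObj (strands a) (strands b) ⟶ (strands c : Tilt δ)) :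
    unemb (joinInv a b ≫ f) = entry f default default := by
  rw [unemb, entry_comp]
  refine (Fintype.sum_unique _).trans ?_
  exact Category.id_comp _

theorem joinHom_natural {a b c d : ℕ} (f : THom δ a b) (g : THom δ c d) :
    tensorHom (emb f) (emb g) ≫ joinHom b d = joinHom a c ≫ emb (tensor f g) := by
  refine hom_ext fun i j => ?_
  rw [entry_comp, entry_comp]
  refine (Fintype.sum_unique _).trans (Eq.trans ?_ (Fintype.sum_unique _).symm)
  exact (Category.comp_id _).trans (Category.id_comp _).symm

/-! ### Naturality of the twist -/

/-- Naturality of the diagrammatic twist lets one of the two sandwiching idempotents pass through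
and merge with the other. -/
theorem entry_twistHom (q : k) (hq : q ^ 4 = -1) [IsDegenerate δ] (X : Tilt δ) (i j) :
    entry (twistHom q X) i j = twist q (num X i) ≫ entry (𝟙 X) i j := by
  change ∑ l, entry (𝟙 X) i l ≫ (∑ l', (twist q (num X l) ≫ (𝟙 X.X : X.X ⟶ X.X) l l') ≫
    entry (𝟙 X) l' j) = _
  have h (l) : ∑ l', (twist q (num X l) ≫ (𝟙 X.X : X.X ⟶ X.X) l l') ≫
      entry (𝟙 X) l' j = twist q (num X l) ≫ entry (𝟙 X) l j := by
    simp only [Category.assoc]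
    rw [← Preadditive.comp_sum]
    congr 1
    exact congrFun (congrFun (Category.id_comp X.p) l) j
  simp only [h, ← Category.assoc, ← twist_natural hq]
  simp only [Category.assoc]
  rw [← Preadditive.comp_sum, entry_id_comp]

theorem twistHom_natural {q : k} (hq : q ^ 4 = -1) [IsDegenerate δ] {X Y : Tilt δ} (f : X ⟶ Y) :
    twistHom q X ≫ f = f ≫ twistHom q Y := by
  refine hom_ext fun i j => ?_
  simp only [entry_comp, entry_twistHom q hq, Category.assoc]
  rw [← Preadditive.comp_sum, entry_id_comp]
  simp only [← Category.assoc, ← twist_natural hq]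
  simp only [Category.assoc]
  rw [← Preadditive.comp_sum, entry_comp_id]

theorem twistHom_strands {q : k} (hq : q ^ 4 = -1) [IsDegenerate δ] (n : ℕ) :
    twistHom q (strands n : Tilt δ) = emb (twist q n) := by
  refine hom_ext fun i j => ?_
  rw [entry_twistHom q hq, entry_id_strands]
  exact Category.comp_id _

end MixedVerlinde

end

/-! ### Indecomposable summands, and the tensor ideals in terms of diagrams. -/

noncomputable section

namespace MixedVerlinde

open TemperleyLieb

/-! ### Decomposition into indecomposable objects -/

/-- A finite-dimensional algebra without nontrivial idempotents is local. -/
theorem isLocalRing_of_idempotents (k : Type*) [Field k] {R : Type*} [Ring R] [Algebra k R]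
    [Module.Finite k R] [Nontrivial R] (h : ∀ e : R, e * e = e → e = 0 ∨ e = 1) :
    IsLocalRing R := by
  have key : ∀ a : R, IsUnit a ∨ IsNilpotent a := by
    intro a
    -- Fitting decomposition for left multiplication by `a`: the kernel component of `1` is an
    -- idempotent, which decides between nilpotent and invertible.
    obtain ⟨n, hn, hn0⟩ := ((LinearMap.mulLeft k a).eventually_isCompl_ker_pow_range_pow.and
      (Filter.eventually_gt_atTop 0)).exists
    rw [LinearMap.pow_mulLeft] at hn
    obtain ⟨x, hx, y, hy, hxy⟩ := Submodule.mem_sup.1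
      (hn.sup_eq_top ▸ Submodule.mem_top : (1 : R) ∈ _)
    rw [LinearMap.mem_ker, LinearMap.mulLeft_apply] at hx
    obtain ⟨z, rfl⟩ := hy
    rw [LinearMap.mulLeft_apply] at hxy
    have hxx : x * x = x := by
      have h1 : x - x * x ∈ LinearMap.ker (LinearMap.mulLeft k (a ^ n)) := by
        rw [LinearMap.mem_ker, LinearMap.mulLeft_apply, mul_sub, ← mul_assoc, hx, zero_mul, sub_zero]
      have h2 : x - x * x ∈ LinearMap.range (LinearMap.mulLeft k (a ^ n)) :=
        ⟨z * x, by rw [LinearMap.mulLeft_apply, ← mul_assoc, ← sub_eq_of_eq_add' hxy.symm]; noncomm_ring⟩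
      have := (Submodule.disjoint_def.1 hn.disjoint) _ h1 h2
      exact (sub_eq_zero.1 this).symm
    rcases h x hxx with rfl | rfl
    · left
      obtain ⟨n, rfl⟩ : ∃ m, n = m + 1 := ⟨n - 1, by omega⟩
      rw [zero_add, pow_succ', mul_assoc] at hxy
      have hs : Function.Surjective (LinearMap.mulLeft k a) := fun w =>
        ⟨a ^ n * z * w, by rw [LinearMap.mulLeft_apply, ← mul_assoc, hxy, one_mul]⟩
      have hi := LinearMap.injective_iff_surjective.2 hs
      refine ⟨⟨a, a ^ n * z, hxy, hi ?_⟩, rfl⟩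
      simp only [LinearMap.mulLeft_apply]
      rw [← mul_assoc, hxy, one_mul, mul_one]
    · right
      exact ⟨n, by rwa [mul_one] at hx⟩
  refine ⟨fun {a b} hab => ?_⟩
  rcases key a with h | h
  · exact Or.inl h
  · exact Or.inr (eq_sub_of_add_eq' hab ▸ h.isUnit_one_sub)

/-- The nonunits of a local ring are closed under sums and, here, under scalars. -/
theorem exists_isUnit_of_mem_span {k : Type*} [Field k] {R : Type*} [Ring R] [Algebra k R]
    [IsLocalRing R] {S : Set R} {x : R} (hx : x ∈ Submodule.span k S) (hu : IsUnit x) :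
    ∃ s ∈ S, IsUnit s := by
  by_contra! hS
  have : x ∈ nonunits R := by
    clear hu
    induction hx using Submodule.span_induction with
    | mem x hx => exact hS x hx
    | zero => exact not_isUnit_zero
    | add x y _ _ hx hy => exact IsLocalRing.nonunits_add hx hy
    | smul c x _ hx =>
      intro h
      rcases eq_or_ne c 0 with rfl | hc
      · rw [zero_smul] at h
        exact not_isUnit_zero h
      · have := (IsUnit.mk0 c⁻¹ (inv_ne_zero hc)).map (algebraMap k R)
        refine hx ?_
        have h2 := this.mul h
        rwa [← Algebra.smul_def, smul_smul, inv_mul_cancel₀ hc, one_smul] at h2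
  exact this hu

variable {k : Type u} [Field k] {δ : k}

theorem IsIndecomposable.isLocalRing {T : Tilt δ} (hT : IsIndecomposable T) :
    IsLocalRing (End T) := by
  have : Module.Finite k (End T) := finite_tilt_hom T T
  have : Nontrivial (End T) := ⟨⟨1, 0, hT.1⟩⟩
  exact isLocalRing_of_idempotents k fun e he => hT.2 e he

theorem exists_inv_of_isUnit {T : Tilt δ} {a : End T} (ha : IsUnit a) :
    ∃ b : T ⟶ T, (show T ⟶ T from a) ≫ b = 𝟙 T ∧ b ≫ (show T ⟶ T from a) = 𝟙 T := by
  obtain ⟨u, rfl⟩ := ha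
  exact ⟨(↑u⁻¹ : End T), u.inv_mul, u.mul_inv⟩

/-- If the identity of an indecomposable object is a combination of endomorphisms, then one of
them is invertible. -/
theorem IsIndecomposable.exists_inv {T : Tilt δ} (hT : IsIndecomposable T) {S : Set (T ⟶ T)}
    (hS : 𝟙 T ∈ Submodule.span k S) : ∃ a ∈ S, ∃ b : T ⟶ T, a ≫ b = 𝟙 T ∧ b ≫ a = 𝟙 T := by
  have := hT.isLocalRing
  obtain ⟨s, hs, hu⟩ := exists_isUnit_of_mem_span (k := k) (R := End T) (S := S) hS isUnit_one
  exact ⟨s, hs, exists_inv_of_isUnit hu⟩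

/-- The image of an idempotent. -/
def image {X : Tilt δ} (e : X ⟶ X) (he : e ≫ e = e) : Tilt δ :=
  ⟨X.X, e.f, congrArg Karoubi.Hom.f he⟩

/-- The inclusion of the image of an idempotent. -/
def imageIncl {X : Tilt δ} (e : X ⟶ X) (he : e ≫ e = e) : image e he ⟶ X :=
  ⟨e.f, by
    have h1 : e.f ≫ e.f = e.f := congrArg Karoubi.Hom.f he
    change e.f ≫ e.f ≫ X.p = e.f
    rw [Karoubi.comp_p, h1]⟩

/-- The projection to the image of an idempotent. -/
def imageProj {X : Tilt δ} (e : X ⟶ X) (he : e ≫ e = e) : X ⟶ image e he :=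
  ⟨e.f, by
    have h1 : e.f ≫ e.f = e.f := congrArg Karoubi.Hom.f he
    change X.p ≫ e.f ≫ e.f = e.f
    rw [h1, Karoubi.p_comp]⟩

theorem imageProj_imageIncl {X : Tilt δ} (e : X ⟶ X) (he : e ≫ e = e) :
    imageProj e he ≫ imageIncl e he = e := he

theorem imageIncl_imageProj {X : Tilt δ} (e : X ⟶ X) (he : e ≫ e = e) :
    imageIncl e he ≫ imageProj e he = 𝟙 (image e he) :=
  Karoubi.hom_ext _ _ (show e.f ≫ e.f = e.f from congrArg Karoubi.Hom.f he)

/-- The image of an idempotent is a direct summand. -/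
def imageRetract {X : Tilt δ} (e : X ⟶ X) (he : e ≫ e = e) : Retract (image e he) X :=
  ⟨imageIncl e he, imageProj e he, imageIncl_imageProj e he⟩

/-- The endomorphisms of the image embed into those of `X`, and the identity of `X` is not reached
unless `e` is the identity. This makes the splitting into indecomposables terminate. -/
theorem finrank_end_image_lt {X : Tilt δ} (e : X ⟶ X) (he : e ≫ e = e) (h1 : e ≠ 𝟙 X) :
    Module.finrank k (image e he ⟶ image e he) < Module.finrank k (X ⟶ X) := by
  let φ : (image e he ⟶ image e he) →ₗ[k] (X ⟶ X) :=
    { toFun := fun f => imageProj e he ≫ f ≫ imageIncl e he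
      map_add' := fun f g => by simp
      map_smul' := fun c f => by simp }
  have hφ : Function.Injective φ := by
    intro f g hfg
    have := congrArg (fun f => imageIncl e he ≫ f ≫ imageProj e he) hfg
    simpa [φ, imageIncl_imageProj, reassoc_of% imageIncl_imageProj e he] using this
  have hr : LinearMap.range φ ≠ ⊤ := by
    refine fun h => h1 ?_
    obtain ⟨f, hf⟩ : 𝟙 X ∈ LinearMap.range φ := h ▸ Submodule.mem_top
    have h2 : e ≫ φ f = φ f := by
      have h3 : e ≫ imageProj e he = imageProj e he :=
        Karoubi.hom_ext _ _ (show e.f ≫ e.f = e.f from congrArg Karoubi.Hom.f he)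
      simp [φ, reassoc_of% h3]
    rw [hf, Category.comp_id] at h2
    exact h2
  have := Submodule.finrank_lt hr
  rwa [LinearMap.finrank_range_of_inj hφ] at this

/-- Every object is a direct sum of indecomposable objects. -/
theorem id_mem_span_indecomposable (X : Tilt δ) :
    𝟙 X ∈ Submodule.span k {h : X ⟶ X | ∃ (T : Tilt δ) (f : X ⟶ T) (g : T ⟶ X),
      IsIndecomposable T ∧ g ≫ f = 𝟙 T ∧ h = f ≫ g} := by
  induction hn : Module.finrank k (X ⟶ X) using Nat.strong_induction_on generalizing X with
  | _ n ih =>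
    by_cases h0 : 𝟙 X = 0
    · rw [h0]; exact zero_mem _
    by_cases hX : IsIndecomposable X
    · exact Submodule.subset_span ⟨X, 𝟙 X, 𝟙 X, hX, by simp, by simp⟩
    obtain ⟨e, he, he0, he1⟩ : ∃ e : X ⟶ X, e ≫ e = e ∧ e ≠ 0 ∧ e ≠ 𝟙 X := by
      by_contra! h
      exact hX ⟨h0, fun f hf => or_iff_not_imp_left.2 fun hf0 => h f hf hf0⟩
    have key : ∀ (e : X ⟶ X) (_ : e ≫ e = e) (_ : e ≠ 𝟙 X), e ∈ Submodule.span k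
        {h : X ⟶ X | ∃ (T : Tilt δ) (f : X ⟶ T) (g : T ⟶ X),
          IsIndecomposable T ∧ g ≫ f = 𝟙 T ∧ h = f ≫ g} := by
      intro e he he1
      have h1 := ih _ (hn ▸ finrank_end_image_lt e he he1) (image e he) rfl
      let φ : (image e he ⟶ image e he) →ₗ[k] (X ⟶ X) :=
        { toFun := fun f => imageProj e he ≫ f ≫ imageIncl e he
          map_add' := fun f g => by simp
          map_smul' := fun c f => by simp }
      have h2 := Submodule.mem_map_of_mem (f := φ) h1
      rw [Submodule.map_span] at h2
      have h3 : φ (𝟙 _) = e := by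
        simp only [φ, LinearMap.coe_mk, AddHom.coe_mk, Category.id_comp, imageProj_imageIncl]
      rw [h3] at h2
      refine Submodule.span_mono ?_ h2
      rintro _ ⟨_, ⟨T, f, g, hT, hgf, rfl⟩, rfl⟩
      refine ⟨T, imageProj e he ≫ f, g ≫ imageIncl e he, hT, ?_, by simp [φ]⟩
      rw [Category.assoc, reassoc_of% imageIncl_imageProj e he, hgf]
    have h1 := key e he he1
    have h2 := key (𝟙 X - e) (by simp [he]) (by simpa using he0)
    simpa using add_mem h2 h1

/-- Every indecomposable summand of a strand object has a highest weight. -/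
theorem IsIndecomposable.exists_isTilting {T : Tilt δ} (hT : IsIndecomposable T) {n : ℕ}
    (h : Nonempty (Retract T (strands n))) : ∃ m ≤ n, IsTilting m T := by
  classical
  have h' : ∃ n, Nonempty (Retract T (strands n)) := ⟨n, h⟩
  exact ⟨Nat.find h', Nat.find_min' h' h, hT, Nat.find_spec h', fun r hr =>
    not_nonempty_iff.1 (Nat.find_min h' hr)⟩

theorem entry_comp_strands {X Y : Tilt δ} {n : ℕ} (f : X ⟶ strands n) (g : strands n ⟶ Y)
    (i : X.X.ι) (j : Y.X.ι) : entry (f ≫ g) i j = entry f i default ≫ entry g default j := by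
  rw [entry_comp, Fintype.sum_unique]

theorem comp_mem_tiltIdeal {N : ℕ} {X Y Z : Tilt δ} (g : X ⟶ Y) {f : Y ⟶ Z}
    (hf : f ∈ tiltIdeal N Y Z) : g ≫ f ∈ tiltIdeal N X Z := by
  induction hf using Submodule.span_induction with
  | mem f hf =>
    obtain ⟨m, T, f, f', hm, hT, rfl⟩ := hf
    exact Submodule.subset_span ⟨m, T, g ≫ f, f', hm, hT, by simp⟩
  | zero => rw [Limits.comp_zero]; exact zero_mem _
  | add f g _ _ hf hg => rw [Preadditive.comp_add]; exact add_mem hf hg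
  | smul c f _ hf => rw [Linear.comp_smul]; exact Submodule.smul_mem _ c hf

theorem mem_tiltIdeal_comp {N : ℕ} {X Y Z : Tilt δ} {f : X ⟶ Y} (hf : f ∈ tiltIdeal N X Y)
    (g : Y ⟶ Z) : f ≫ g ∈ tiltIdeal N X Z := by
  induction hf using Submodule.span_induction with
  | mem f hf =>
    obtain ⟨m, T, f, f', hm, hT, rfl⟩ := hf
    exact Submodule.subset_span ⟨m, T, f, f' ≫ g, hm, hT, by simp⟩
  | zero => rw [Limits.zero_comp]; exact zero_mem _
  | add f g _ _ hf hg => rw [Preadditive.add_comp]; exact add_mem hf hg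
  | smul c f _ hf => rw [Linear.smul_comp]; exact Submodule.smul_mem _ c hf

/-- A criterion for an identity to lie in an ideal of tilting objects. -/
theorem id_mem_tiltIdeal {N n : ℕ} {X : Tilt δ} (hX : Nonempty (Retract X (strands n)))
    (h : ∀ (m : ℕ) (T : Tilt δ), IsTilting m T → Nonempty (Retract T X) → N ≤ m + 1) :
    𝟙 X ∈ tiltIdeal N X X := by
  refine Submodule.span_le.2 ?_ (id_mem_span_indecomposable X)
  rintro _ ⟨T, f, g, hT, hgf, rfl⟩
  obtain ⟨ρ⟩ := hX
  have hTX : Retract T X := ⟨g, f, hgf⟩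
  obtain ⟨m, -, hm⟩ := hT.exists_isTilting ⟨hTX.trans ρ⟩
  exact Submodule.subset_span ⟨m, T, f, g, h m T hm ⟨hTX⟩, hm, rfl⟩

/-- A summand of weight zero would be a summand of the empty object, and the empty object does not
factor through a positive number of strands. -/
theorem id_strands_mem_tiltIdeal [IsDegenerate δ] {n : ℕ} (hn : 1 ≤ n) :
    𝟙 (strands n : Tilt δ) ∈ tiltIdeal 2 (strands n) (strands n) := by
  refine id_mem_tiltIdeal ⟨Retract.refl _⟩ fun m T hT hT' => ?_
  by_contra hm
  obtain rfl : m = 0 := by omega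
  obtain ⟨ρ⟩ := hT.2.1
  obtain ⟨σ⟩ := hT'
  have h1 := comp_eq_zero_of_through IsDegenerate.circle (by omega : n ≠ 0)
    (unemb (ρ.r ≫ σ.i)) (unemb (σ.r ≫ ρ.i))
  rw [← unemb_comp, Category.assoc, reassoc_of% σ.retract] at h1
  have h2 : ρ.r ≫ ρ.i = 0 := by rw [← emb_unemb (ρ.r ≫ ρ.i), h1, emb_zero]
  have h3 : 𝟙 T = ρ.i ≫ (ρ.r ≫ ρ.i) ≫ ρ.r := by simp
  rw [h2] at h3
  exact hT.1.1 (by simpa using h3)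

/-- The morphisms that factor through sums of nonempty strand objects. -/
def posIdeal (X Y : Tilt δ) : Submodule k (X ⟶ Y) :=
  Submodule.span k {h | ∃ (n : ℕ) (f : X ⟶ strands n) (g : strands n ⟶ Y), 1 ≤ n ∧ h = f ≫ g}

/-- The bound `2 ≤ m + 1` means positive weight. From here on projectivity is handled through
nonempty strand objects alone. -/
theorem tiltIdeal_two [IsDegenerate δ] (X Y : Tilt δ) : tiltIdeal 2 X Y = posIdeal X Y := by
  refine le_antisymm (Submodule.span_le.2 ?_) (Submodule.span_le.2 ?_)
  · rintro _ ⟨m, T, f, g, hm, hT, rfl⟩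
    obtain ⟨ρ⟩ := hT.2.1
    exact Submodule.subset_span ⟨m, f ≫ ρ.i, ρ.r ≫ g, by omega, by simp⟩
  · rintro _ ⟨n, f, g, hn, rfl⟩
    have := comp_mem_tiltIdeal f (mem_tiltIdeal_comp (id_strands_mem_tiltIdeal (δ := δ) hn) g)
    rwa [Category.id_comp] at this

theorem isProj_iff [IsDegenerate δ] {X : Tilt δ} : IsProj X ↔ 𝟙 X ∈ posIdeal X X := by
  rw [IsProj, MemTiltIdeal, tiltIdeal_two]

theorem isProj_strands [IsDegenerate δ] {n : ℕ} (hn : 1 ≤ n) : IsProj (strands n : Tilt δ) :=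
  id_strands_mem_tiltIdeal hn

section

variable (p : ℕ) [Fact p.Prime] [CharP k p] [IsDegenerate δ]

/-- The identity of `T` is the sum of a part through the top projector and a part through `m - 2`
strands. As `End T` is local, one part yields an isomorphism, and the second would contradict
minimality of `m`. -/
theorem entry_mem_of_isTilting {m : ℕ} {T : Tilt δ} (hT : IsTilting m T) (hm : 2 * p ≤ m + 1)
    {X Y : Tilt δ} (f : X ⟶ T) (g : T ⟶ Y) (i : X.X.ι) (j : Y.X.ι) :
    entry (f ≫ g) i j ∈ jwIdeal δ (p - 1) (num X i) (num Y j) := by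
  have hp : 2 ≤ p := (Fact.out : p.Prime).two_le
  obtain ⟨ρ⟩ := hT.2.1
  obtain ⟨r, rfl⟩ : ∃ r, m = 2 * (p - 1) + 1 + r := ⟨m - (2 * (p - 1) + 1), by omega⟩
  let J : THom δ (2 * (p - 1) + 1 + r) (2 * (p - 1) + 1 + r) :=
    wh 0 r (by omega) (by omega) (jw δ (p - 1))
  have he := isJW_jw (δ := δ) p (s := p - 1) (by omega)
  have h2 := wh_mem_through he.mem 0 r (N := 2 * (p - 1) + 1 + r - 2)
    (A := 2 * (p - 1) + 1 + r) (B := 2 * (p - 1) + 1 + r) (by omega) (by omega) (by omega)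
  rw [wh_sub, wh_id, cast_self] at h2
  let φ : THom δ (2 * (p - 1) + 1 + r) (2 * (p - 1) + 1 + r) →ₗ[k] (T ⟶ T) :=
    { toFun := fun f => ρ.i ≫ emb f ≫ ρ.r
      map_add' := fun f g => by simp [emb_add]
      map_smul' := fun c f => by simp [emb_smul] }
  have hφ : ∀ f, φ f = ρ.i ≫ emb f ≫ ρ.r := fun _ => rfl
  have h3 := Submodule.mem_map_of_mem (f := φ) h2
  rw [through, Submodule.map_span] at h3
  have h4 : 𝟙 T ∈ Submodule.span k ({φ J} ∪ φ '' {h | ∃ (f : THom δ _ (2 * (p - 1) + 1 + r - 2))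
      (g : THom δ (2 * (p - 1) + 1 + r - 2) _), h = f ≫ g}) := by
    rw [Submodule.span_union]
    have h5 : 𝟙 T = φ J + φ (𝟙 _ - J) := by
      rw [← map_add, add_sub_cancel, hφ, emb_id, Category.id_comp, ρ.retract]
    rw [h5]
    exact add_mem (Submodule.mem_sup_left (Submodule.mem_span_singleton_self _))
      (Submodule.mem_sup_right h3)
  obtain ⟨a, ha, b, hab, hba⟩ := hT.1.exists_inv h4
  rcases ha with rfl | ⟨_, ⟨u, v, rfl⟩, rfl⟩
  · have h6 : f ≫ g = (f ≫ ρ.i) ≫ emb J ≫ (ρ.r ≫ b ≫ g) := by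
      have : φ J ≫ b ≫ g = g := by rw [reassoc_of% hab]
      conv_lhs => rw [← this]
      simp only [hφ, Category.assoc]
    have h7 : entry (f ≫ g) i j = entry (f ≫ ρ.i) i default ≫ J ≫
        entry (ρ.r ≫ b ≫ g) default j := by
      rw [h6, entry_comp_strands, entry_comp_strands (emb J)]
      rfl
    rw [h7]
    exact comp_jw_comp_mem _ _
  · refine ((hT.2.2 (2 * (p - 1) + 1 + r - 2) (by omega)).false
      ⟨ρ.i ≫ emb u, emb v ≫ ρ.r ≫ b, ?_⟩).elim
    simpa only [hφ, emb_comp, Category.assoc] using hab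

/-- A summand of low weight in the image of the idempotent would be an idempotent of at most `2 * p
- 2` strands lying in the diagram ideal, hence zero. -/
theorem emb_jw_mem_tiltIdeal (r : ℕ) : emb (wh 0 r (M := 2 * (p - 1) + 1 + r)
    (N := 2 * (p - 1) + 1 + r) (by omega) (by omega) (jw δ (p - 1))) ∈ tiltIdeal (2 * p) _ _ := by
  have hp : 2 ≤ p := (Fact.out : p.Prime).two_le
  set J : THom δ (2 * (p - 1) + 1 + r) (2 * (p - 1) + 1 + r) :=
    wh 0 r (by omega) (by omega) (jw δ (p - 1)) with hJ
  have hJJ : emb J ≫ emb J = emb J := by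
    rw [← emb_comp, hJ, ← wh_comp, jw_idem p (by omega)]
  have key : 𝟙 (image (emb J) hJJ) ∈ tiltIdeal (2 * p) _ _ := by
    refine id_mem_tiltIdeal ⟨imageRetract _ _⟩ fun m T hT hT' => ?_
    by_contra hm
    obtain ⟨ρ⟩ := hT.2.1
    obtain ⟨σ⟩ := hT'
    have h1 : ρ.r ≫ ρ.i = (ρ.r ≫ σ.i ≫ imageIncl _ _) ≫ emb J ≫ imageProj _ _ ≫ σ.r ≫ ρ.i := by
      have h0 := imageProj_imageIncl (emb J) hJJ
      have h2 : imageIncl (emb J) hJJ ≫ emb J ≫ imageProj _ _ = 𝟙 _ := by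
        have : emb J ≫ imageProj (emb J) hJJ = imageProj (emb J) hJJ :=
          Karoubi.hom_ext _ _
            (show (emb J).f ≫ (emb J).f = (emb J).f from congrArg Karoubi.Hom.f hJJ)
        rw [this, imageIncl_imageProj]
      simp only [Category.assoc]
      rw [reassoc_of% h2, reassoc_of% σ.retract]
    have h2 : unemb (ρ.r ≫ ρ.i) ∈ jwIdeal δ (p - 1) m m := by
      rw [h1, unemb_comp, unemb_comp, unemb_emb]
      exact comp_jw_comp_mem _ _
    have h3 : unemb (ρ.r ≫ ρ.i) = 0 := by
      -- The trace argument needs at least one strand; the empty object is covered by the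
      -- coefficient of the empty diagram.
      rcases Nat.eq_zero_or_pos m with rfl | hm0
      · exact jwIdeal_zero_zero h2
      · exact eq_zero_of_mem_jwIdeal p hm0 (by omega) (by omega) h2
    have h4 : ρ.r ≫ ρ.i = 0 := by rw [← emb_unemb (ρ.r ≫ ρ.i), h3, emb_zero]
    have h5 : 𝟙 T = ρ.i ≫ (ρ.r ≫ ρ.i) ≫ ρ.r := by simp
    rw [h4] at h5
    exact hT.1.1 (by simpa using h5)
  have := comp_mem_tiltIdeal (imageProj (emb J) hJJ) (mem_tiltIdeal_comp key (imageIncl (emb J) hJJ))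
  rwa [Category.id_comp, imageProj_imageIncl] at this

/-- The ideal of `2 p` is given by the ideal of the top projector. -/
theorem mem_tiltIdeal_iff {X Y : Tilt δ} {f : X ⟶ Y} : f ∈ tiltIdeal (2 * p) X Y ↔
    ∀ i j, entry f i j ∈ jwIdeal δ (p - 1) (num X i) (num Y j) := by
  constructor
  · intro hf i j
    induction hf using Submodule.span_induction with
    | mem f hf =>
      obtain ⟨m, T, f, g, hm, hT, rfl⟩ := hf
      exact entry_mem_of_isTilting p hT hm f g i j
    | zero => exact zero_mem _
    | add f g _ _ hf hg => exact add_mem hf hg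
    | smul c f _ hf => exact Submodule.smul_mem _ c hf
  · intro hf
    rw [eq_sum_entry f]
    refine sum_mem fun i _ => sum_mem fun j _ => comp_mem_tiltIdeal _ (mem_tiltIdeal_comp ?_ _)
    have h := hf i j
    generalize entry f i j = g at h
    induction h using jwIdeal_induction with
    | mem r f g =>
      rw [emb_comp, emb_comp]
      exact comp_mem_tiltIdeal _ (mem_tiltIdeal_comp (emb_jw_mem_tiltIdeal p r) _)
    | zero => exact zero_mem _
    | add f g _ _ hf hg => exact add_mem hf hg
    | smul c f _ hf => exact Submodule.smul_mem _ c hf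

end

end MixedVerlinde

end

/-! ### Presentations of projective objects by strands, and the induced trace. -/

noncomputable section

namespace MixedVerlinde

open TemperleyLieb

variable {k : Type u} [Field k] {δ : k}

/-! ### Matrix entries of morphisms of tensor products -/

/-- The matrix entries of a morphism of tensor products. -/
def entry₂ {X Y X' Y' : Tilt δ} (f : tensorObj X Y ⟶ tensorObj X' Y') (i : X.X.ι) (j : Y.X.ι)
    (i' : X'.X.ι) (j' : Y'.X.ι) : THom δ (num X i + num Y j) (num X' i' + num Y' j') :=
  f.f (i, j) (i', j')

/-- A sum over a row of an identity matrix with coefficients. -/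
theorem sum_tensor_id_comp {a b : ℕ} (N : Mat_ (TL δ)) (f : THom δ a b) {c : ℕ} (j : N.ι)
    (g : ∀ j, THom δ (b + (N.X j).n) c) :
    ∑ j', tensor f ((𝟙 N : N ⟶ N) j j') ≫ g j' = wr (N.X j).n f ≫ g j := by
  rw [Fintype.sum_eq_single j]
  · rw [Mat_.id_apply_self]
    change (wr _ f ≫ wl b (𝟙 (⟨(N.X j).n⟩ : TL δ))) ≫ _ = _
    rw [wl_id, Category.comp_id]
  · intro j' hj
    rw [Mat_.id_apply_of_ne _ _ _ hj.symm]
    change tensorₗ f 0 ≫ _ = 0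
    rw [map_zero, Limits.zero_comp]

theorem sum_id_tensor_comp {a b : ℕ} (N : Mat_ (TL δ)) (f : THom δ a b) {c : ℕ} (j : N.ι)
    (g : ∀ j, THom δ ((N.X j).n + b) c) :
    ∑ j', tensor ((𝟙 N : N ⟶ N) j j') f ≫ g j' = wl (N.X j).n f ≫ g j := by
  rw [Fintype.sum_eq_single j]
  · rw [Mat_.id_apply_self]
    change (wr a (𝟙 (⟨(N.X j).n⟩ : TL δ)) ≫ wl _ f) ≫ _ = _
    rw [wr_id, Category.id_comp]
  · intro j' hj
    rw [Mat_.id_apply_of_ne _ _ _ hj.symm]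
    change tensorₗ 0 f ≫ _ = 0
    rw [LinearMap.map_zero₂, Limits.zero_comp]

theorem sum_comp_tensor_id {a b : ℕ} (N : Mat_ (TL δ)) (f : THom δ a b) {c : ℕ} (j : N.ι)
    (g : ∀ j, THom δ c (a + (N.X j).n)) :
    ∑ j', g j' ≫ tensor f ((𝟙 N : N ⟶ N) j' j) = g j ≫ wr (N.X j).n f := by
  rw [Fintype.sum_eq_single j]
  · rw [Mat_.id_apply_self]
    change _ ≫ (wr _ f ≫ wl b (𝟙 (⟨(N.X j).n⟩ : TL δ))) = _
    rw [wl_id, Category.comp_id]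
  · intro j' hj
    rw [Mat_.id_apply_of_ne _ _ _ hj]
    change _ ≫ tensorₗ f 0 = 0
    rw [map_zero, Limits.comp_zero]

theorem sum_comp_id_tensor {a b : ℕ} (N : Mat_ (TL δ)) (f : THom δ a b) {c : ℕ} (j : N.ι)
    (g : ∀ j, THom δ c ((N.X j).n + a)) :
    ∑ j', g j' ≫ tensor ((𝟙 N : N ⟶ N) j' j) f = g j ≫ wl (N.X j).n f := by
  rw [Fintype.sum_eq_single j]
  · rw [Mat_.id_apply_self]
    change _ ≫ (wr a (𝟙 (⟨(N.X j).n⟩ : TL δ)) ≫ wl _ f) = _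
    rw [wr_id, Category.id_comp]
  · intro j' hj
    rw [Mat_.id_apply_of_ne _ _ _ hj]
    change _ ≫ tensorₗ 0 f = 0
    rw [LinearMap.map_zero₂, Limits.comp_zero]

/-- When the neighbour already absorbs the idempotent of the idle factor, that idempotent may be
replaced by the identity; the sum over the idle index then collapses. -/
theorem matTensorHom_id_right_comp {A A' B : Mat_ (TL δ)} {C : Mat_ (TL δ)} {e : A' ⟶ A'}
    {p : B ⟶ B} (hp : p ≫ p = p) {F : matTensor A' B ⟶ C} (hF : matTensorHom e p ≫ F = F)
    (g : A ⟶ A') : matTensorHom g p ≫ F = matTensorHom g (𝟙 B) ≫ F := by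
  rw [← hF, ← Category.assoc, matTensorHom_comp, ← Category.assoc, matTensorHom_comp, hp,
    Category.id_comp]

theorem matTensorHom_id_left_comp {A B B' : Mat_ (TL δ)} {C : Mat_ (TL δ)} {e : B' ⟶ B'}
    {p : A ⟶ A} (hp : p ≫ p = p) {F : matTensor A B' ⟶ C} (hF : matTensorHom p e ≫ F = F)
    (g : B ⟶ B') : matTensorHom p g ≫ F = matTensorHom (𝟙 A) g ≫ F := by
  rw [← hF, ← Category.assoc, matTensorHom_comp, ← Category.assoc, matTensorHom_comp, hp,
    Category.id_comp]

theorem comp_matTensorHom_id_right {A A' B : Mat_ (TL δ)} {C : Mat_ (TL δ)} {e : A ⟶ A}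
    {p : B ⟶ B} (hp : p ≫ p = p) {F : C ⟶ matTensor A B} (hF : F ≫ matTensorHom e p = F)
    (g : A ⟶ A') : F ≫ matTensorHom g p = F ≫ matTensorHom g (𝟙 B) := by
  rw [← hF, Category.assoc, matTensorHom_comp, Category.assoc, matTensorHom_comp, hp,
    Category.comp_id]

theorem comp_matTensorHom_id_left {A B B' : Mat_ (TL δ)} {C : Mat_ (TL δ)} {e : B ⟶ B}
    {p : A ⟶ A} (hp : p ≫ p = p) {F : C ⟶ matTensor A B} (hF : F ≫ matTensorHom p e = F)
    (g : B ⟶ B') : F ≫ matTensorHom p g = F ≫ matTensorHom (𝟙 A) g := by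
  rw [← hF, Category.assoc, matTensorHom_comp, Category.assoc, matTensorHom_comp, hp,
    Category.comp_id]

section

variable {X X' X'' Y Y' Y'' : Tilt δ}

theorem entry₂_whiskR_comp (g : X ⟶ X') (f : tensorObj X' Y ⟶ tensorObj X'' Y'')
    (i : X.X.ι) (j : Y.X.ι) (i'' : X''.X.ι) (j'' : Y''.X.ι) :
    entry₂ (whiskR Y g ≫ f) i j i'' j'' =
      ∑ i', wr (num Y j) (entry g i i') ≫ entry₂ f i' j i'' j'' := by
  have h : (whiskR Y g ≫ f).f = matTensorHom g.f (𝟙 Y.X) ≫ f.f :=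
    matTensorHom_id_right_comp Y.idem (Karoubi.p_comp f) g.f
  change (whiskR Y g ≫ f).f (i, j) (i'', j'') = _
  rw [h]
  refine (Fintype.sum_prod_type _).trans (Finset.sum_congr rfl fun i' _ => ?_)
  exact sum_tensor_id_comp Y.X (entry g i i') j fun j' => entry₂ f i' j' i'' j''

theorem entry₂_comp_whiskR (f : tensorObj X Y ⟶ tensorObj X' Y') (g : X' ⟶ X'')
    (i : X.X.ι) (j : Y.X.ι) (i'' : X''.X.ι) (j'' : Y'.X.ι) :
    entry₂ (f ≫ whiskR Y' g) i j i'' j'' =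
      ∑ i', entry₂ f i j i' j'' ≫ wr (num Y' j'') (entry g i' i'') := by
  have h : (f ≫ whiskR Y' g).f = f.f ≫ matTensorHom g.f (𝟙 Y'.X) :=
    comp_matTensorHom_id_right Y'.idem (Karoubi.comp_p f) g.f
  change (f ≫ whiskR Y' g).f (i, j) (i'', j'') = _
  rw [h]
  refine (Fintype.sum_prod_type _).trans (Finset.sum_congr rfl fun i' _ => ?_)
  exact sum_comp_tensor_id Y'.X (entry g i' i'') j'' fun j' => entry₂ f i j i' j'

theorem entry₂_whiskL_comp (g : Y ⟶ Y') (f : tensorObj X Y' ⟶ tensorObj X'' Y'')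
    (i : X.X.ι) (j : Y.X.ι) (i'' : X''.X.ι) (j'' : Y''.X.ι) :
    entry₂ (whiskL X g ≫ f) i j i'' j'' =
      ∑ j', wl (num X i) (entry g j j') ≫ entry₂ f i j' i'' j'' := by
  have h : (whiskL X g ≫ f).f = matTensorHom (𝟙 X.X) g.f ≫ f.f :=
    matTensorHom_id_left_comp X.idem (Karoubi.p_comp f) g.f
  change (whiskL X g ≫ f).f (i, j) (i'', j'') = _
  rw [h]
  refine (Fintype.sum_prod_type_right _).trans (Finset.sum_congr rfl fun j' _ => ?_)
  exact sum_id_tensor_comp X.X (entry g j j') i fun i' => entry₂ f i' j' i'' j''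

theorem entry₂_comp_whiskL (f : tensorObj X Y ⟶ tensorObj X' Y') (g : Y' ⟶ Y'')
    (i : X.X.ι) (j : Y.X.ι) (i'' : X'.X.ι) (j'' : Y''.X.ι) :
    entry₂ (f ≫ whiskL X' g) i j i'' j'' =
      ∑ j', entry₂ f i j i'' j' ≫ wl (num X' i'') (entry g j' j'') := by
  have h : (f ≫ whiskL X' g).f = f.f ≫ matTensorHom (𝟙 X'.X) g.f :=
    comp_matTensorHom_id_left X'.idem (Karoubi.comp_p f) g.f
  change (f ≫ whiskL X' g).f (i, j) (i'', j'') = _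
  rw [h]
  refine (Fintype.sum_prod_type_right _).trans (Finset.sum_congr rfl fun j' _ => ?_)
  exact sum_comp_id_tensor X'.X (entry g j' j'') i'' fun i' => entry₂ f i j i' j'

theorem entry₂_whiskL_incl (f : tensorObj X Y ⟶ tensorObj X' Y') (i : X.X.ι) (j : Y.X.ι)
    (i' : X'.X.ι) (j' : Y'.X.ι) :
    entry₂ (whiskL X (incl Y j) ≫ f) i default i' j' = entry₂ f i j i' j' := by
  have h := entry₂_whiskL_comp (𝟙 Y) f i j i' j'
  rw [whiskL_id, Category.id_comp] at h
  rw [h]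
  exact entry₂_whiskL_comp (incl Y j) f i default i' j'

theorem entry₂_whiskL_proj (f : tensorObj X Y ⟶ tensorObj X' Y') (i : X.X.ι) (j : Y.X.ι)
    (i' : X'.X.ι) (j' : Y'.X.ι) :
    entry₂ (f ≫ whiskL X' (proj Y' j')) i j i' default = entry₂ f i j i' j' := by
  have h := entry₂_comp_whiskL f (𝟙 Y') i j i' j'
  rw [whiskL_id, Category.comp_id] at h
  rw [h]
  exact entry₂_comp_whiskL f (proj Y' j') i j i' default

theorem entry₂_whiskR_incl (f : tensorObj X Y ⟶ tensorObj X' Y') (i : X.X.ι) (j : Y.X.ι)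
    (i' : X'.X.ι) (j' : Y'.X.ι) :
    entry₂ (whiskR Y (incl X i) ≫ f) default j i' j' = entry₂ f i j i' j' := by
  have h := entry₂_whiskR_comp (𝟙 X) f i j i' j'
  rw [whiskR_id, Category.id_comp] at h
  rw [h]
  exact entry₂_whiskR_comp (incl X i) f default j i' j'

theorem entry₂_whiskR_proj (f : tensorObj X Y ⟶ tensorObj X' Y') (i : X.X.ι) (j : Y.X.ι)
    (i' : X'.X.ι) (j' : Y'.X.ι) :
    entry₂ (f ≫ whiskR Y' (proj X' i')) i j default j' = entry₂ f i j i' j' := by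
  have h := entry₂_comp_whiskR f (𝟙 X') i j i' j'
  rw [whiskR_id, Category.comp_id] at h
  rw [h]
  exact entry₂_comp_whiskR f (proj X' i') i j default j'

theorem unemb_join {a b c d : ℕ} (f : tensorObj (strands a) (strands b) ⟶
    (tensorObj (strands c) (strands d) : Tilt δ)) :
    unemb (joinInv a b ≫ f ≫ joinHom c d) = entry₂ f default default default default := by
  rw [unemb_joinInv_comp, entry_comp, Fintype.sum_unique]
  exact Category.comp_id _

/-- The matrix entries of a morphism, cut down by the idempotents. -/
theorem comp_sandwich_comp {W Z : Tilt δ} (b : W ⟶ X) (M : X.X ⟶ X'.X) (a : X' ⟶ Z) :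
    b ≫ (sandwich M : X ⟶ X') ≫ a = ⟨b.f ≫ M ≫ a.f, by simp⟩ := by
  refine Karoubi.hom_ext _ _ ?_
  change b.f ≫ (X.p ≫ M ≫ X'.p) ≫ a.f = b.f ≫ M ≫ a.f
  simp

end

/-! ### The modified trace -/

/-- A presentation of an object as a direct summand of a sum of nonempty strand objects. -/
structure Presentation (P : Tilt δ) where
  ι : Type
  [fin : Fintype ι]
  n : ι → ℕ
  pos : ∀ l, 1 ≤ n l
  a : ∀ l, P ⟶ strands (n l)
  b : ∀ l, strands (n l) ⟶ P
  sum_eq : ∑ l, a l ≫ b l = 𝟙 P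

attribute [instance] Presentation.fin

theorem exists_sum_of_mem_posIdeal {X Y : Tilt δ} {f : X ⟶ Y} (hf : f ∈ posIdeal X Y) :
    ∃ (ι : Type) (_ : Fintype ι) (n : ι → ℕ) (a : ∀ l, X ⟶ strands (n l))
      (b : ∀ l, strands (n l) ⟶ Y), (∀ l, 1 ≤ n l) ∧ ∑ l, a l ≫ b l = f := by
  induction hf using Submodule.span_induction with
  | mem f hf =>
    obtain ⟨n, a, b, hn, rfl⟩ := hf
    exact ⟨Unit, inferInstance, fun _ => n, fun _ => a, fun _ => b, fun _ => hn, by simp⟩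
  | zero => exact ⟨Empty, inferInstance, fun _ => 0, fun l => l.elim, fun l => l.elim,
      fun l => l.elim, by simp⟩
  | add f g _ _ hf hg =>
    obtain ⟨ι, _, n, a, b, hn, rfl⟩ := hf
    obtain ⟨ι', _, n', a', b', hn', rfl⟩ := hg
    refine ⟨ι ⊕ ι', inferInstance, Sum.elim n n', Sum.rec a a', Sum.rec b b', ?_, ?_⟩
    · rintro (l | l)
      · exact hn l
      · exact hn' l
    · exact Fintype.sum_sum_type _
  | smul c f _ hf =>
    obtain ⟨ι, _, n, a, b, hn, rfl⟩ := hf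
    exact ⟨ι, inferInstance, n, fun l => c • a l, b, hn, by
      rw [Finset.smul_sum]; simp only [Linear.smul_comp]⟩

theorem IsProj.nonempty_presentation [IsDegenerate δ] {P : Tilt δ} (hP : IsProj P) :
    Nonempty (Presentation P) := by
  obtain ⟨ι, _, n, a, b, hn, h⟩ := exists_sum_of_mem_posIdeal (isProj_iff.1 hP)
  exact ⟨⟨ι, n, hn, a, b, h⟩⟩

namespace Presentation

theorem isProj [IsDegenerate δ] {P : Tilt δ} (d : Presentation P) : IsProj P := by
  rw [isProj_iff, ← d.sum_eq]
  exact sum_mem fun l _ => Submodule.subset_span ⟨d.n l, d.a l, d.b l, d.pos l, rfl⟩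

/-- The presentation of a nonempty strand object. -/
def ofStrands (n : ℕ) (hn : 1 ≤ n) : Presentation (strands n : Tilt δ) :=
  ⟨Unit, fun _ => n, fun _ => hn, fun _ => 𝟙 _, fun _ => 𝟙 _, by simp⟩

/-- The trace computed from a presentation. -/
def trace {P : Tilt δ} (d : Presentation P) (f : P ⟶ P) : k :=
  ∑ l, tr (d.n l) (unemb (d.b l ≫ f ≫ d.a l))

/-- Insert the presentation of the other object between the factors and move each term around the
diagram trace. With equal objects and one identity it gives independence of the presentation. -/
theorem trace_comm [IsDegenerate δ] {P Q : Tilt δ} (d : Presentation P) (d' : Presentation Q)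
    (f : P ⟶ Q) (g : Q ⟶ P) : d.trace (f ≫ g) = d'.trace (g ≫ f) := by
  have h : ∀ {P Q : Tilt δ} (d : Presentation P) (d' : Presentation Q) (f : P ⟶ Q) (g : Q ⟶ P),
      d.trace (f ≫ g) = ∑ l, ∑ l', tr (d.n l)
        (unemb (d.b l ≫ f ≫ d'.a l') ≫ unemb (d'.b l' ≫ g ≫ d.a l)) := by
    intro P Q d d' f g
    refine Finset.sum_congr rfl fun l _ => ?_
    rw [← map_sum]
    congr 1
    simp only [← unemb_comp]
    rw [← unemb_sum]
    congr 1
    have h1 : f ≫ g = ∑ l', f ≫ (d'.a l' ≫ d'.b l') ≫ g := by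
      rw [← Preadditive.comp_sum, ← Preadditive.sum_comp, d'.sum_eq, Category.id_comp]
    rw [h1]
    simp only [Preadditive.comp_sum, Preadditive.sum_comp, Category.assoc]
  rw [h d d', h d' d, Finset.sum_comm]
  exact Finset.sum_congr rfl fun l _ => Finset.sum_congr rfl fun l' _ =>
    tr_comm (d.pos l') (d'.pos l) _ _

/-- The presentation of a tensor product, from one of the left factor. -/
def tensorR {P : Tilt δ} (d : Presentation P) (X : Tilt δ) : Presentation (tensorObj P X) where
  ι := d.ι × X.X.ι
  n := fun x => d.n x.1 + num X x.2
  pos := fun x => (d.pos x.1).trans (Nat.le_add_right _ _)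
  a := fun x => tensorHom (d.a x.1) (proj X x.2) ≫ joinHom _ _
  b := fun x => joinInv _ _ ≫ tensorHom (d.b x.1) (incl X x.2)
  sum_eq := by
    have h : tensorHomₗ (∑ l, d.a l ≫ d.b l) (∑ j, proj X j ≫ incl X j) = 𝟙 (tensorObj P X) := by
      rw [d.sum_eq, sum_proj_incl]; rfl
    rw [← h, LinearMap.map_sum₂, Fintype.sum_prod_type]
    refine Finset.sum_congr rfl fun l _ => ?_
    rw [map_sum]
    refine Finset.sum_congr rfl fun j _ => ?_
    rw [Category.assoc, reassoc_of% joinHom_joinInv, tensorHom_comp]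
    rfl

/-- The presentation of a tensor product, from one of the right factor. -/
def tensorL {P : Tilt δ} (d : Presentation P) (X : Tilt δ) : Presentation (tensorObj X P) where
  ι := X.X.ι × d.ι
  n := fun x => num X x.1 + d.n x.2
  pos := fun x => (d.pos x.2).trans (Nat.le_add_left _ _)
  a := fun x => tensorHom (proj X x.1) (d.a x.2) ≫ joinHom _ _
  b := fun x => joinInv _ _ ≫ tensorHom (incl X x.1) (d.b x.2)
  sum_eq := by
    have h : tensorHomₗ (∑ j, proj X j ≫ incl X j) (∑ l, d.a l ≫ d.b l) = 𝟙 (tensorObj X P) := by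
      rw [d.sum_eq, sum_proj_incl]; rfl
    rw [← h, LinearMap.map_sum₂, Fintype.sum_prod_type]
    refine Finset.sum_congr rfl fun l _ => ?_
    rw [map_sum]
    refine Finset.sum_congr rfl fun j _ => ?_
    rw [Category.assoc, reassoc_of% joinHom_joinInv, tensorHom_comp]
    rfl

/-- Puts the diagonal blocks into the form in which the partial trace over the idle factor can be
pulled inside. -/
theorem unemb_tensorR {P X : Tilt δ} (d : Presentation P) (l : d.ι) (j : X.X.ι)
    (f : tensorObj P X ⟶ tensorObj P X) :
    unemb ((d.tensorR X).b (l, j) ≫ f ≫ (d.tensorR X).a (l, j)) =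
      ∑ i, wr (num X j) (entry (d.b l) default i) ≫ ∑ i', entry₂ f i j i' j ≫
        wr (num X j) (entry (d.a l) i' default) := by
  have h : (d.tensorR X).b (l, j) ≫ f ≫ (d.tensorR X).a (l, j) = joinInv _ _ ≫
      (whiskL _ (incl X j) ≫ (whiskR _ (d.b l) ≫ f ≫ whiskR _ (d.a l)) ≫ whiskL _ (proj X j)) ≫
        joinHom _ _ := by
    change (joinInv _ _ ≫ tensorHom (d.b l) (incl X j)) ≫ f ≫
        tensorHom (d.a l) (proj X j) ≫ joinHom _ _ = _
    rw [tensorHom_eq', tensorHom_eq]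
    simp only [Category.assoc]
  rw [h]
  refine (unemb_join _).trans ?_
  refine (entry₂_whiskL_incl _ _ _ _ _).trans ((entry₂_whiskL_proj _ _ _ _ _).trans ?_)
  rw [entry₂_whiskR_comp]
  simp only [entry₂_comp_whiskR]
  rfl

theorem unemb_tensorL {P X : Tilt δ} (d : Presentation P) (l : d.ι) (j : X.X.ι)
    (f : tensorObj X P ⟶ tensorObj X P) :
    unemb ((d.tensorL X).b (j, l) ≫ f ≫ (d.tensorL X).a (j, l)) =
      ∑ i, wl (num X j) (entry (d.b l) default i) ≫ ∑ i', entry₂ f j i j i' ≫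
        wl (num X j) (entry (d.a l) i' default) := by
  have h : (d.tensorL X).b (j, l) ≫ f ≫ (d.tensorL X).a (j, l) = joinInv _ _ ≫
      (whiskR _ (incl X j) ≫ (whiskL _ (d.b l) ≫ f ≫ whiskL _ (d.a l)) ≫ whiskR _ (proj X j)) ≫
        joinHom _ _ := by
    change (joinInv _ _ ≫ tensorHom (incl X j) (d.b l)) ≫ f ≫
        tensorHom (proj X j) (d.a l) ≫ joinHom _ _ = _
    rw [tensorHom_eq, tensorHom_eq']
    simp only [Category.assoc]
  rw [h]
  refine (unemb_join _).trans ?_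
  refine (entry₂_whiskR_incl _ _ _ _ _).trans ((entry₂_whiskR_proj _ _ _ _ _).trans ?_)
  rw [entry₂_whiskL_comp]
  simp only [entry₂_comp_whiskL]
  rfl

end Presentation

end MixedVerlinde

end

/-! ### Existence and uniqueness of the modified trace. -/

noncomputable section

namespace TemperleyLieb

variable {k : Type u} [Field k] {δ : k}

/-- The right partial trace as a linear map. -/
def ptrRₗ {m m' : ℕ} (n : ℕ) : THom δ (m + n) (m' + n) →ₗ[k] THom δ m m' where
  toFun := ptrR n
  map_add' f g := by simp only [ptrR, wr_add, Preadditive.add_comp, Preadditive.comp_add]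
  map_smul' c f := by
    simp only [ptrR, wr_smul, Linear.smul_comp, Linear.comp_smul, RingHom.id_apply]

/-- The left partial trace as a linear map. -/
def ptrLₗ {m m' : ℕ} (n : ℕ) : THom δ (n + m) (n + m') →ₗ[k] THom δ m m' where
  toFun := ptrL n
  map_add' f g := by simp only [ptrL, wl_add, Preadditive.add_comp, Preadditive.comp_add]
  map_smul' c f := by
    simp only [ptrL, wl_smul, Linear.smul_comp, Linear.comp_smul, RingHom.id_apply]

theorem ptrL_wh_comp {a b c : ℕ} (n : ℕ) (g : THom δ a b) (f : THom δ (n + b) (n + c))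
    (h : n + a = n + a + 0) (h' : n + b = n + b + 0) :
    ptrL n (wh n 0 h h' g ≫ f) = g ≫ ptrL n f := by
  induction n with
  | zero => simp [ptrL_zero]
  | succ n ih =>
    rw [ptrL_succ, ptrL_succ, ← ih _ (by omega) (by omega), show wh (n + 1) 0 h h' g =
      wh 1 0 (by omega) (by omega) (wh n 0 (M := n + a) (N := n + b) (by omega) (by omega) g) by
        rw [wh_wh]; exact wh_congr (n + 1) 0 (by omega) h' (by omega) rfl g, closeL_wh_comp (by omega)]

theorem ptrL_comp_wh {a b c : ℕ} (n : ℕ) (f : THom δ (n + a) (n + b)) (g : THom δ b c)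
    (h : n + b = n + b + 0) (h' : n + c = n + c + 0) :
    ptrL n (f ≫ wh n 0 h h' g) = ptrL n f ≫ g := by
  induction n with
  | zero => simp [ptrL_zero]
  | succ n ih =>
    rw [ptrL_succ, ptrL_succ, ← ih _ (by omega) (by omega), show wh (n + 1) 0 h h' g =
      wh 1 0 (by omega) (by omega) (wh n 0 (M := n + b) (N := n + c) (by omega) (by omega) g) by
        rw [wh_wh]; exact wh_congr (n + 1) 0 (by omega) h' (by omega) rfl g, closeL_comp_wh (by omega) (by omega)]

end TemperleyLieb

namespace MixedVerlinde

open TemperleyLieb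

variable {k : Type u} [Field k] {δ : k}

theorem unemb_comp_sandwich_comp {X Y : Tilt δ} {a b : ℕ} (f : strands a ⟶ X) (M : X.X ⟶ Y.X)
    (g : Y ⟶ strands b) : unemb (f ≫ (sandwich M : X ⟶ Y) ≫ g) =
      ∑ i, entry f default i ≫ ∑ i', (show THom δ (num X i) (num Y i') from M i i') ≫
        entry g i' default := by
  rw [comp_sandwich_comp]; rfl

theorem unemb_comp_partialTraceR {P X : Tilt δ} {n n' : ℕ} (b : strands n ⟶ P)
    (f : tensorObj P X ⟶ tensorObj P X) (a : P ⟶ strands n') :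
    unemb (b ≫ partialTraceR f ≫ a) = ∑ j, ∑ i, entry b default i ≫
      ∑ i', ptrR (num X j) (entry₂ f i j i' j) ≫ entry a i' default := by
  refine (unemb_comp_sandwich_comp b _ a).trans ?_
  rw [Finset.sum_comm]
  refine Finset.sum_congr rfl fun i _ => ?_
  rw [← Preadditive.comp_sum, Finset.sum_comm]
  congr 1
  exact Finset.sum_congr rfl fun i' _ => Preadditive.sum_comp _ _ _

theorem unemb_comp_partialTraceL {P X : Tilt δ} {n n' : ℕ} (b : strands n ⟶ P)
    (f : tensorObj X P ⟶ tensorObj X P) (a : P ⟶ strands n') :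
    unemb (b ≫ partialTraceL f ≫ a) = ∑ j, ∑ i, entry b default i ≫
      ∑ i', ptrL (num X j) (entry₂ f j i j i') ≫ entry a i' default := by
  refine (unemb_comp_sandwich_comp b _ a).trans ?_
  rw [Finset.sum_comm]
  refine Finset.sum_congr rfl fun i _ => ?_
  rw [← Preadditive.comp_sum, Finset.sum_comm]
  congr 1
  exact Finset.sum_congr rfl fun i' _ => Preadditive.sum_comp _ _ _

namespace Presentation

variable [IsDegenerate δ]

/-- Closing all strands but the first may be done in two stages, first the strands of `X`; the maps
of the presentation of `P` do not touch those. -/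
theorem trace_tensorR {P X : Tilt δ} (d : Presentation P) (f : tensorObj P X ⟶ tensorObj P X) :
    (d.tensorR X).trace f = d.trace (partialTraceR f) := by
  refine (Fintype.sum_prod_type _).trans (Finset.sum_congr rfl fun l _ => ?_)
  refine Eq.trans ?_ (((congrArg (tr (d.n l)) (unemb_comp_partialTraceR (d.b l) f (d.a l))).trans
    (map_sum (tr (d.n l)) _ _)).symm)
  refine Finset.sum_congr rfl fun j _ => ?_
  refine (congrArg (tr (d.n l + num X j)) (d.unemb_tensorR l j f)).trans ?_
  refine (tr_ptrR (d.pos l) _ _).trans (congrArg _ ?_)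
  refine (map_sum (ptrRₗ (num X j)) _ _).trans (Finset.sum_congr rfl fun i _ => ?_)
  refine (congrArg (ptrR _) (congrArg (· ≫ _) (wr_eq_wh _ _))).trans ((ptrR_wh_comp _ _ _ _ _).trans ?_)
  congr 1
  refine (map_sum (ptrRₗ (num X j)) _ _).trans (Finset.sum_congr rfl fun i' _ => ?_)
  refine (congrArg (ptrR _) (congrArg (_ ≫ ·) (wr_eq_wh _ _))).trans (ptrR_comp_wh _ _ _ _ _)

/-- Here the strands of `X` are closed around the left, which is allowed by the equality of left and
right closures. -/
theorem trace_tensorL {P X : Tilt δ} (d : Presentation P) (f : tensorObj X P ⟶ tensorObj X P) :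
    (d.tensorL X).trace f = d.trace (partialTraceL f) := by
  refine (Fintype.sum_prod_type_right _).trans (Finset.sum_congr rfl fun l _ => ?_)
  refine Eq.trans ?_ (((congrArg (tr (d.n l)) (unemb_comp_partialTraceL (d.b l) f (d.a l))).trans
    (map_sum (tr (d.n l)) _ _)).symm)
  refine Finset.sum_congr rfl fun j _ => ?_
  refine (congrArg (tr (num X j + d.n l)) (d.unemb_tensorL l j f)).trans ?_
  refine (tr_ptrL (d.pos l) _ _).trans (congrArg _ ?_)
  refine (map_sum (ptrLₗ (num X j)) _ _).trans (Finset.sum_congr rfl fun i _ => ?_)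
  refine (congrArg (ptrL _) (congrArg (· ≫ _) (wl_eq_wh _ _))).trans ((ptrL_wh_comp _ _ _ _ _).trans ?_)
  congr 1
  refine (map_sum (ptrLₗ (num X j)) _ _).trans (Finset.sum_congr rfl fun i' _ => ?_)
  refine (congrArg (ptrL _) (congrArg (_ ≫ ·) (wl_eq_wh _ _))).trans (ptrL_comp_wh _ _ _ _ _)

theorem trace_eq_zero (p : ℕ) [Fact p.Prime] [CharP k p] {P : Tilt δ} (d : Presentation P)
    {f : P ⟶ P} (hf : f ∈ tiltIdeal (2 * p) P P) : d.trace f = 0 :=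
  Finset.sum_eq_zero fun l _ => tr_eq_zero_of_mem_jwIdeal p (d.pos l)
    ((mem_tiltIdeal_iff p).1 (comp_mem_tiltIdeal (d.b l) (mem_tiltIdeal_comp hf (d.a l)))
      default default)

/-- The trace computed from a presentation, as a linear map. -/
def traceₗ {P : Tilt δ} (d : Presentation P) : (P ⟶ P) →ₗ[k] k where
  toFun := d.trace
  map_add' f g := by
    simp only [trace, Preadditive.add_comp, Preadditive.comp_add, unemb_add, map_add,
      Finset.sum_add_distrib]
  map_smul' c f := by
    simp only [trace, Linear.smul_comp, Linear.comp_smul, unemb_smul, map_smul, smul_eq_mul,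
      Finset.mul_sum, RingHom.id_apply]

end Presentation

section

variable [IsDegenerate δ]

open Classical in
/-- The modified trace of the ideal of projective objects. -/
def modTr (P : Tilt δ) (f : P ⟶ P) : k :=
  if h : IsProj P then (h.nonempty_presentation.some).trace f else 0

theorem modTr_eq {P : Tilt δ} (d : Presentation P) (f : P ⟶ P) : modTr P f = d.trace f := by
  rw [modTr, dif_pos d.isProj]
  simpa only [Category.comp_id, Category.id_comp] using
    (d.isProj.nonempty_presentation.some).trace_comm d f (𝟙 P)

theorem modTr_strands {n : ℕ} (hn : 1 ≤ n) (f : (strands n : Tilt δ) ⟶ strands n) :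
    modTr _ f = tr n (unemb f) := by
  rw [modTr_eq (.ofStrands n hn)]
  change ∑ _ : Unit, tr n (unemb (𝟙 _ ≫ f ≫ 𝟙 _)) = _
  rw [Category.comp_id, Category.id_comp, Fintype.sum_unique]

theorem isModifiedTrace_modTr (p : ℕ) [Fact p.Prime] [CharP k p] :
    IsModifiedTrace p (modTr (δ := δ)) where
  map_add P hP f g := by
    obtain ⟨d⟩ := hP.nonempty_presentation
    simp only [modTr_eq d]
    exact d.traceₗ.map_add f g
  map_smul P hP c f := by
    obtain ⟨d⟩ := hP.nonempty_presentation
    simp only [modTr_eq d]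
    exact d.traceₗ.map_smul c f
  congr P hP f g h := by
    obtain ⟨d⟩ := hP.nonempty_presentation
    simp only [modTr_eq d]
    rw [← sub_eq_zero]
    exact (d.traceₗ.map_sub f g).symm.trans (d.trace_eq_zero p h)
  cyclic P Q hP hQ f g := by
    obtain ⟨d⟩ := hP.nonempty_presentation
    obtain ⟨d'⟩ := hQ.nonempty_presentation
    rw [modTr_eq d, modTr_eq d', d.trace_comm d']
  right P X hP f := by
    obtain ⟨d⟩ := hP.nonempty_presentation
    rw [modTr_eq d, modTr_eq (d.tensorR X), d.trace_tensorR]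
  left X P hP f := by
    obtain ⟨d⟩ := hP.nonempty_presentation
    rw [modTr_eq d, modTr_eq (d.tensorL X), d.trace_tensorL]

/-! ### Uniqueness of the modified trace -/

theorem IsProj.tensorR {P : Tilt δ} (hP : IsProj P) (X : Tilt δ) : IsProj (tensorObj P X) :=
  (hP.nonempty_presentation.some.tensorR X).isProj

theorem IsProj.tensorL {P : Tilt δ} (hP : IsProj P) (X : Tilt δ) : IsProj (tensorObj X P) :=
  (hP.nonempty_presentation.some.tensorL X).isProj

end

namespace IsModifiedTrace

variable {p : ℕ} {t : ∀ P : Tilt δ, (P ⟶ P) → k} (ht : IsModifiedTrace p t)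
include ht

/-- The modified trace of a projective object as a linear map. -/
def toLinear {P : Tilt δ} (hP : IsProj P) : (P ⟶ P) →ₗ[k] k where
  toFun := t P
  map_add' := ht.map_add P hP
  map_smul' := ht.map_smul P hP

theorem map_sum {P : Tilt δ} (hP : IsProj P) {ι : Type*} (s : Finset ι) (f : ι → (P ⟶ P)) :
    t P (∑ i ∈ s, f i) = ∑ i ∈ s, t P (f i) := _root_.map_sum (ht.toLinear hP) f s

variable [IsDegenerate δ]

theorem eq_strands_one (f : (strands 1 : Tilt δ) ⟶ strands 1) :
    t _ f = t _ (𝟙 (strands 1)) * tr 1 (unemb f) := by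
  obtain ⟨c, hc⟩ := exists_eq_smul_id le_rfl (unemb f)
  have h : f = c • 𝟙 (strands 1) := by
    rw [← emb_unemb f, hc, emb_smul, emb_id]
  rw [h, ht.map_smul _ (isProj_strands le_rfl), unemb_smul, _root_.map_smul, unemb_id, tr_one_id,
    smul_eq_mul, mul_one, mul_comm]

variable [Fact p.Prime] [CharP k p]

/-- Writing `n` strands as one strand tensored with the others, compatibility with right partial
traces reduces every modified trace to one strand, whose endomorphisms are scalars. -/
theorem eq_strands {n : ℕ} (hn : 1 ≤ n) (f : (strands n : Tilt δ) ⟶ strands n) :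
    t _ f = t _ (𝟙 (strands 1)) * tr n (unemb f) := by
  obtain ⟨n, rfl⟩ := Nat.exists_eq_add_of_le hn
  have hP : IsProj (tensorObj (strands 1) (strands n) : Tilt δ) := (isProj_strands le_rfl).tensorR _
  have key : ∀ t : ∀ P : Tilt δ, (P ⟶ P) → k, IsModifiedTrace p t → t _ f = t _ (partialTraceR (joinHom 1 n ≫ f ≫ joinInv 1 n)) := by
    intro t ht
    rw [← ht.right _ _ (isProj_strands le_rfl), ht.cyclic _ _ hP (isProj_strands hn),
      Category.assoc, joinInv_joinHom, Category.comp_id]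
  rw [key t ht, ht.eq_strands_one, ← modTr_strands le_rfl, ← key _ (isModifiedTrace_modTr p),
    modTr_strands hn]

theorem eq_modTr {P : Tilt δ} (hP : IsProj P) (f : P ⟶ P) :
    t P f = t _ (𝟙 (strands 1)) * modTr P f := by
  obtain ⟨d⟩ := hP.nonempty_presentation
  have key : ∀ t : ∀ P : Tilt δ, (P ⟶ P) → k, IsModifiedTrace p t →
      t P f = ∑ l, t _ (d.b l ≫ f ≫ d.a l) := by
    intro t ht
    conv_lhs => rw [← Category.comp_id f, ← d.sum_eq, Preadditive.comp_sum, ht.map_sum hP]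
    refine Finset.sum_congr rfl fun l _ => ?_
    rw [← Category.assoc, ht.cyclic _ _ hP (isProj_strands (d.pos l))]
  rw [key t ht, key _ (isModifiedTrace_modTr p), Finset.mul_sum]
  exact Finset.sum_congr rfl fun l _ => by
    rw [ht.eq_strands (d.pos l), modTr_strands (d.pos l)]

end IsModifiedTrace

end MixedVerlinde

end

/-! ### Reproducing identities over projectors. -/

noncomputable section

namespace TemperleyLieb

variable {k : Type u} [Field k] {δ : k}

/-! ### Reproducing sums over projectors -/

theorem closeR_comp_cup {n m : ℕ} (g : THom δ (n + 1) m) :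
    closeR rfl rfl (g ≫ (cup m le_rfl rfl : THom δ m (m + 2))) =
      (cup n le_rfl rfl : THom δ n (n + 2)) ≫ wh 0 1 (by omega) (by omega) g := by
  rw [closeR, wh_comp 0 1 _ (N := m + 1) (by omega) _, wh_cup, Category.assoc,
    cup_cap_zigzag (0 + m) (m + 1) (by omega) le_rfl rfl (by omega), Category.comp_id]

section

variable (p : ℕ) [CharP k p] [IsDegenerate δ]

/-- Both sides come from the scalar by which `jw s ≫ f ≫ jw s` is a multiple of `jw s`. This is the
origin of the coefficients `tr (jw s)` in the chromatic morphism. -/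
theorem jw_comp_comp_jw {s : ℕ} (hs : s < p - 1)
    (f : THom δ (2 * s + 1) (2 * s + 1)) :
    tr _ (jw δ s) • (jw δ s ≫ f ≫ jw δ s) = tr _ (f ≫ jw δ s) • jw δ s := by
  obtain ⟨c, hc⟩ := exists_jw_comp_jw_eq_smul p (by omega : s < p) f
  have h := tr_comm (by omega) (by omega) (jw δ s) (f ≫ jw δ s)
  rw [Category.assoc, jw_idem p (by omega), hc, map_smul, smul_eq_mul] at h
  rw [hc, ← h, smul_smul]
  congr 1
  exact mul_comm _ _

variable [Fact p.Prime]

/-- Families that reproduce `h` on projectors give a decomposition of `h` over projectors. -/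
theorem sum_jw_sub_mem {v v' : ℕ} (hv : v' % 2 = 1) {ι : Type*} [Fintype ι]
    (y : ι → ∀ s, THom δ v (2 * s + 1)) (x : ι → ∀ s, THom δ (2 * s + 1) v') (h : THom δ v v')
    (H : ∀ s < p - 1, ∀ β : THom δ v' (2 * s + 1),
      ∑ i, tr _ (x i s ≫ β ≫ jw δ s) • (y i s ≫ jw δ s) - h ≫ β ≫ jw δ s ∈
        jwIdeal δ (p - 1) v (2 * s + 1)) :
    ∑ i, ∑ s ∈ Finset.range (p - 1), tr _ (jw δ s) • (y i s ≫ jw δ s ≫ x i s) - h ∈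
      jwIdeal δ (p - 1) v v' := by
  set S := ∑ i, ∑ s ∈ Finset.range (p - 1), tr _ (jw δ s) • (y i s ≫ jw δ s ≫ x i s) with hS
  -- Modulo the ideal it suffices to test on lower projectors; against `jw b` only the summand `s =
  -- b` survives, and it reproduces `h` by hypothesis.
  obtain ⟨e, he, e', he', hee⟩ := Submodule.mem_sup.1 (id_mem_lowIdeal_sup (δ := δ) p hv)
  have h1 : S - h = (S - h) ≫ e + (S - h) ≫ e' := by
    rw [← Preadditive.comp_add, hee, Category.comp_id]
  rw [h1]
  refine add_mem ?_ (comp_mem_jwIdeal _ he')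
  clear h1 hee
  induction he using Submodule.span_induction with
  | mem f hf =>
    obtain ⟨b, hb, f, g, rfl⟩ := hf
    have key : (S - h) ≫ f ≫ jw δ b ∈ jwIdeal δ (p - 1) v (2 * b + 1) := by
      rw [Preadditive.sub_comp]
      convert H b hb f using 2
      rw [hS, Preadditive.sum_comp]
      refine Finset.sum_congr rfl fun i _ => ?_
      rw [Preadditive.sum_comp, Finset.sum_eq_single b]
      · have := congrArg (y i b ≫ ·) (jw_comp_comp_jw p hb (x i b ≫ f))
        simpa only [Category.assoc, Linear.comp_smul, Linear.smul_comp] using this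
      · intro s hs hsb
        have := jw_comp_jw_eq_zero p (by have := Finset.mem_range.1 hs; omega) (by omega) hsb
          (x i s ≫ f)
        simp only [Category.assoc] at this
        simp only [Linear.smul_comp, Category.assoc, this, Limits.comp_zero, smul_zero]
      · intro h; exact absurd (Finset.mem_range.2 hb) h
    have := mem_jwIdeal_comp key g
    simpa only [Category.assoc] using this
  | zero => rw [Limits.comp_zero]; exact zero_mem _
  | add f g _ _ hf hg => rw [Preadditive.comp_add]; exact add_mem hf hg
  | smul c f _ hf => rw [Linear.comp_smul]; exact Submodule.smul_mem _ c hf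

/-- Families that reproduce `h` on few strands give a decomposition of `h` with one strand
added. -/
theorem sum_chromatic_sub_mem {v v' : ℕ} {ι : Type*} [Fintype ι]
    (y : ι → ∀ r, THom δ v r) (x : ι → ∀ r, THom δ r v') (h : THom δ v v')
    (H : ∀ r, 1 ≤ r → r ≤ 2 * p - 2 → ∀ β : THom δ v' r,
      ∑ i, tr _ (x i r ≫ β) • y i r - h ≫ β ∈ jwIdeal δ (p - 1) v r) :
    ∑ i, ∑ s ∈ Finset.range (p - 1), tr _ (jw δ s) •
      (wh 0 1 (M := v + 1) (N := v' + 1) (by omega) (by omega)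
          (y i (2 * s + 1) ≫ jw δ s ≫ x i (2 * s + 1)) +
        wh 0 1 (by omega) (by omega) (y i (2 * s + 2)) ≫ cap (2 * s + 1) le_rfl rfl ≫ jw δ s ≫
          cup (2 * s + 1) le_rfl rfl ≫ wh 0 1 (by omega) (by omega) (x i (2 * s + 2))) -
      wh 0 1 (by omega) (by omega) h ∈ jwIdeal δ (p - 1) (v + 1) (v' + 1) := by
  -- In the odd case the terms with `2 * s + 2` strands vanish by parity. In the even case those
  -- with `2 * s + 1` do, and the extra strand makes the number odd, so that projectors are
  -- available.
  by_cases hv : v' % 2 = 1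
  · have h1 := sum_jw_sub_mem p hv (fun i s => y i (2 * s + 1)) (fun i s => x i (2 * s + 1)) h
      fun s hs β => by
        have h2 := mem_jwIdeal_comp (H (2 * s + 1) (by omega) (by omega) (β ≫ jw δ s)) (jw δ s)
        simpa only [Preadditive.sub_comp, Preadditive.sum_comp, Linear.smul_comp, Category.assoc,
          jw_idem p (by omega : s < p)] using h2
    have h2 := wh_mem_jwIdeal h1 1 (A := v + 1) (B := v' + 1) (by omega) (by omega)
    rw [wh_sub] at h2
    convert h2 using 2
    rw [wh_sum]
    refine Finset.sum_congr rfl fun i _ => ?_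
    rw [wh_sum]
    refine Finset.sum_congr rfl fun s _ => ?_
    rw [wh_smul, eq_zero_of_parity (by omega) (x i (2 * s + 2)), wh_zero]
    simp only [Limits.comp_zero, add_zero]
  · have h1 := sum_jw_sub_mem p (v := v + 1) (v' := v' + 1) (by omega)
      (fun i s => wh 0 1 (by omega) (by omega) (y i (2 * s + 2)) ≫ cap (2 * s + 1) le_rfl rfl)
      (fun i s => cup (2 * s + 1) le_rfl rfl ≫ wh 0 1 (by omega) (by omega) (x i (2 * s + 2)))
      (wh 0 1 (by omega) (by omega) h)
      fun s hs β => by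
        -- The test morphism with its extra strand bent up, so that the hypothesis for `2 * s + 2`
        -- strands applies; unbending it recovers `β ≫ jw s`.
        set β' : THom δ v' (2 * s + 2) := (cup v' le_rfl rfl : THom δ v' (v' + 2)) ≫
          wh 0 1 (by omega) (by omega) (β ≫ jw δ s) with hβ
        have h2 := wh_mem_jwIdeal (s := p - 1) (H (2 * s + 2) (by omega) (by omega) β') 1
          (A := v + 1) (B := 2 * s + 3) (by omega) (by omega)
        have h3 := mem_jwIdeal_comp (mem_jwIdeal_comp h2
          (cap (2 * s + 1) le_rfl rfl : THom δ (2 * s + 3) (2 * s + 1))) (jw δ s)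
        rw [wh_sub, wh_comp 0 1 (by omega) (N := v' + 1) (by omega) (by omega), Preadditive.sub_comp, Category.assoc,
          hβ, wh_cup_comp_wh_comp_cap, Preadditive.sub_comp, wh_sum] at h3
        simp only [Preadditive.sum_comp, Category.assoc, jw_idem p (by omega : s < p), wh_smul,
          Linear.smul_comp] at h3
        convert h3 using 2
        refine Finset.sum_congr rfl fun i _ => ?_
        have h4 := tr_cup_comp_wh (m := 2 * s + 1) (by omega) (x i (2 * s + 2)) (β ≫ jw δ s)
        rw [closeR_comp_cup] at h4
        rw [h4, Category.assoc]
    convert h1 using 2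
    refine Finset.sum_congr rfl fun i _ => Finset.sum_congr rfl fun s _ => ?_
    rw [eq_zero_of_parity (by omega) (x i (2 * s + 1))]
    simp only [Limits.comp_zero, wh_zero, zero_add, Category.assoc]

end

end TemperleyLieb

end

/-! ### Bending and gluing along the dual of an object. -/

noncomputable section

namespace MixedVerlinde

open TemperleyLieb

variable {k : Type u} [Field k] {δ : k}

/-! ### Bending the dual tensor factor -/

/-- The matrix entries of a morphism from a tensor product to a strand object. -/
def entryL {X Y : Tilt δ} {n : ℕ} (y : tensorObj X Y ⟶ strands n) (i : X.X.ι) (j : Y.X.ι) :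
    THom δ (num X i + num Y j) n := y.f (i, j) default

/-- The matrix entries of a morphism from a strand object to a tensor product. -/
def entryR {X Y : Tilt δ} {n : ℕ} (x : strands n ⟶ tensorObj X Y) (i : X.X.ι) (j : Y.X.ι) :
    THom δ n (num X i + num Y j) := x.f default (i, j)

section

variable {X Y : Tilt δ} {n : ℕ}

theorem sum_wr_entry_comp_entryL (y : tensorObj X Y ⟶ strands n) (i : X.X.ι) (j : Y.X.ι) :
    ∑ l, wr (num Y j) (entry (𝟙 X) i l) ≫ entryL y l j = entryL y i j := by
  have h : y.f = matTensorHom X.p (𝟙 Y.X) ≫ y.f :=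
    (Karoubi.p_comp y).symm.trans (matTensorHom_id_right_comp Y.idem (Karoubi.p_comp y) X.p)
  refine Eq.symm ((congrFun (congrFun h (i, j)) default).trans ?_)
  refine (Fintype.sum_prod_type _).trans (Finset.sum_congr rfl fun l _ => ?_)
  exact sum_tensor_id_comp Y.X (entry (𝟙 X) i l) j fun j' => entryL y l j'

theorem sum_wl_entry_comp_entryL (y : tensorObj X Y ⟶ strands n) (i : X.X.ι) (j : Y.X.ι) :
    ∑ l, wl (num X i) (entry (𝟙 Y) j l) ≫ entryL y i l = entryL y i j := by
  have h : y.f = matTensorHom (𝟙 X.X) Y.p ≫ y.f :=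
    (Karoubi.p_comp y).symm.trans (matTensorHom_id_left_comp X.idem (Karoubi.p_comp y) Y.p)
  refine Eq.symm ((congrFun (congrFun h (i, j)) default).trans ?_)
  refine (Fintype.sum_prod_type_right _).trans (Finset.sum_congr rfl fun l _ => ?_)
  exact sum_id_tensor_comp X.X (entry (𝟙 Y) j l) i fun i' => entryL y i' l

theorem sum_entryR_comp_wr_entry (x : strands n ⟶ tensorObj X Y) (i : X.X.ι) (j : Y.X.ι) :
    ∑ l, entryR x l j ≫ wr (num Y j) (entry (𝟙 X) l i) = entryR x i j := by
  have h : x.f = x.f ≫ matTensorHom X.p (𝟙 Y.X) :=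
    (Karoubi.comp_p x).symm.trans (comp_matTensorHom_id_right Y.idem (Karoubi.comp_p x) X.p)
  refine Eq.symm ((congrFun (congrFun h default) (i, j)).trans ?_)
  refine (Fintype.sum_prod_type _).trans (Finset.sum_congr rfl fun l _ => ?_)
  exact sum_comp_tensor_id Y.X (entry (𝟙 X) l i) j fun j' => entryR x l j'

theorem sum_entryR_comp_wl_entry (x : strands n ⟶ tensorObj X Y) (i : X.X.ι) (j : Y.X.ι) :
    ∑ l, entryR x i l ≫ wl (num X i) (entry (𝟙 Y) l j) = entryR x i j := by
  have h : x.f = x.f ≫ matTensorHom (𝟙 X.X) Y.p :=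
    (Karoubi.comp_p x).symm.trans (comp_matTensorHom_id_left X.idem (Karoubi.comp_p x) Y.p)
  refine Eq.symm ((congrFun (congrFun h default) (i, j)).trans ?_)
  refine (Fintype.sum_prod_type_right _).trans (Finset.sum_congr rfl fun l _ => ?_)
  exact sum_comp_id_tensor X.X (entry (𝟙 Y) l j) i fun i' => entryR x i' l

end

/-- Bend the upper ends down to the right. -/
def bendDown {v n : ℕ} (x : THom δ 0 (v + n)) : THom δ n v := flip (bend (flip x))

/-- Bending as a linear map. -/
def bendDownₗ {v n : ℕ} : THom δ 0 (v + n) →ₗ[k] THom δ n v where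
  toFun := bendDown
  map_add' x x' := by rw [bendDown, flip_add, bend_add, flip_add]; rfl
  map_smul' c x := by rw [bendDown, flip_smul, bend_smul, flip_smul]; rfl

theorem bend_wr_comp {v v' n : ℕ} (f : THom δ v' v) (y : THom δ (v + n) 0) :
    bend (wr n f ≫ y) = f ≫ bend y := by
  rw [wr_eq_wh, bend_wh_comp]

theorem bend_wl_rot_comp {v n n' : ℕ} (g : THom δ n' n) (y : THom δ (v + n') 0) :
    bend (wl v (rot g) ≫ y) = bend y ≫ g := by
  rw [wl_eq_wh, bend_rot]

theorem bendDown_comp_wr {v v' n : ℕ} (f : THom δ v v') (x : THom δ 0 (v + n)) :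
    bendDown (x ≫ wr n f) = bendDown x ≫ f := by
  rw [bendDown, flip_comp, wr_eq_wh, flip_wh, bend_wh_comp, flip_comp, TemperleyLieb.flip_flip]; rfl

theorem bendDown_comp_wl_rot {v n n' : ℕ} (g : THom δ n n') (x : THom δ 0 (v + n')) :
    bendDown (x ≫ wl v (rot g)) = g ≫ bendDown x := by
  rw [bendDown, flip_comp, wl_eq_wh, flip_wh, flip_rot, bend_rot, flip_comp, TemperleyLieb.flip_flip]; rfl

variable {V G P : Tilt δ}

/-- Bend the lower ends of the dual factor up. -/
def bendY (y : tensorObj V (dual G) ⟶ unit) : V ⟶ G :=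
  mkHom (fun i j => bend (entryL y i j))
    (fun i j => by
      rw [← sum_wr_entry_comp_entryL y i j]
      refine Eq.trans ?_ (map_sum bendₗ _ _).symm
      exact Finset.sum_congr rfl fun l _ => (bend_wr_comp _ _).symm)
    (fun i j => by
      rw [← sum_wl_entry_comp_entryL y i j]
      refine Eq.trans ?_ (map_sum bendₗ _ _).symm
      exact Finset.sum_congr rfl fun l _ => (bend_wl_rot_comp (entry (𝟙 G) l j) _).symm)

/-- Bend the upper ends of the dual factor down. -/
def bendX (x : unit ⟶ tensorObj V (dual G)) : G ⟶ V :=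
  mkHom (fun j i => bendDown (entryR x i j))
    (fun j i => by
      rw [← sum_entryR_comp_wl_entry x i j]
      refine Eq.trans ?_ (map_sum bendDownₗ _ _).symm
      exact Finset.sum_congr rfl fun l _ => (bendDown_comp_wl_rot (entry (𝟙 G) j l) _).symm)
    (fun j i => by
      rw [← sum_entryR_comp_wr_entry x i j]
      refine Eq.trans ?_ (map_sum bendDownₗ _ _).symm
      exact Finset.sum_congr rfl fun l _ => (bendDown_comp_wr _ _).symm)

/-- Bending as a linear map. -/
def bendYₗ : (tensorObj V (dual G) ⟶ unit) →ₗ[k] (V ⟶ G) where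
  toFun := bendY
  map_add' y y' := hom_ext fun i j => bend_add (entryL y i j) (entryL y' i j)
  map_smul' c y := hom_ext fun i j => bend_smul c (entryL y i j)

/-- Bending as a linear map. -/
def bendXₗ : (unit ⟶ tensorObj V (dual G)) →ₗ[k] (G ⟶ V) where
  toFun := bendX
  map_add' x x' := hom_ext fun j i => bendDownₗ.map_add (entryR x i j) (entryR x' i j)
  map_smul' c x := hom_ext fun j i => bendDownₗ.map_smul c (entryR x i j)

/-- Unbend each entry and cut down by the idempotents; after bending, the rotated idempotent of the
dual stands upright and is absorbed. -/
theorem bendY_surjective : Function.Surjective (bendY : _ → (V ⟶ G)) := by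
  intro u
  let M : (tensorObj V (dual G)).X ⟶ (unit : Tilt δ).X := fun x _ => unbend (entry u x.1 x.2)
  let y : tensorObj V (dual G) ⟶ unit := ⟨(tensorObj V (dual G)).p ≫ M ≫ (unit : Tilt δ).p, by simp⟩
  have hM : (tensorObj V (dual G)).p ≫ M ≫ (unit : Tilt δ).p = (tensorObj V (dual G)).p ≫ M :=
    congrArg (_ ≫ ·) (Category.comp_id M)
  refine ⟨y, hom_ext fun i j => ?_⟩
  have hy : entryL y i j = ∑ l, ∑ m, wr (num G j) (entry (𝟙 V) i l) ≫
      wl (num V l) (rot (entry (𝟙 G) m j)) ≫ unbend (entry u l m) := by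
    refine (congrFun (congrFun hM (i, j)) default).trans ((Fintype.sum_prod_type _).trans ?_)
    exact Finset.sum_congr rfl fun l _ => Finset.sum_congr rfl fun m _ => Category.assoc _ _ _
  change bend (entryL y i j) = _
  rw [hy]
  refine (map_sum bendₗ _ _).trans ?_
  rw [← entry_id_comp u i j]
  refine Finset.sum_congr rfl fun l _ => ?_
  rw [← entry_comp_id u l j, Preadditive.comp_sum]
  refine (map_sum bendₗ _ _).trans (Finset.sum_congr rfl fun m _ => ?_)
  refine (bend_wr_comp _ _).trans (congrArg (_ ≫ ·) ((bend_wl_rot_comp (entry (𝟙 G) m j) _).trans ?_))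
  rw [bend_unbend]

theorem bendX_surjective : Function.Surjective (bendX : _ → (G ⟶ V)) := by
  intro u
  let M : (unit : Tilt δ).X ⟶ (tensorObj V (dual G)).X :=
    fun _ x => flip (unbend (flip (entry u x.2 x.1)))
  let y : unit ⟶ tensorObj V (dual G) := ⟨(unit : Tilt δ).p ≫ M ≫ (tensorObj V (dual G)).p, by simp⟩
  have hM : (unit : Tilt δ).p ≫ M ≫ (tensorObj V (dual G)).p = M ≫ (tensorObj V (dual G)).p :=
    Category.id_comp _
  refine ⟨y, hom_ext fun j i => ?_⟩
  have hy : entryR y i j = ∑ l, ∑ m, (flip (unbend (flip (entry u m l))) ≫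
      wl (num V l) (rot (entry (𝟙 G) j m))) ≫ wr (num G j) (entry (𝟙 V) l i) := by
    refine (congrFun (congrFun hM default) (i, j)).trans ((Fintype.sum_prod_type _).trans ?_)
    refine Finset.sum_congr rfl fun l _ => Finset.sum_congr rfl fun m _ => ?_
    exact (congrArg (_ ≫ ·) (exchange _ _)).trans (Category.assoc _ _ _).symm
  change bendDown (entryR y i j) = _
  rw [hy]
  refine (map_sum bendDownₗ _ _).trans ?_
  rw [← entry_comp_id u j i]
  refine Finset.sum_congr rfl fun l _ => ?_
  rw [← entry_id_comp u j l, Preadditive.sum_comp]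
  refine (map_sum bendDownₗ _ _).trans (Finset.sum_congr rfl fun m _ => ?_)
  refine (bendDown_comp_wr _ _).trans
    (congrArg (· ≫ _) ((bendDown_comp_wl_rot (entry (𝟙 G) j m) _).trans ?_))
  rw [bendDown, TemperleyLieb.flip_flip, bend_unbend, TemperleyLieb.flip_flip]

theorem sandwich_f {X Y : Tilt δ} (f : X ⟶ Y) : (sandwich f.f : X ⟶ Y) = f :=
  Karoubi.hom_ext _ _ f.comm

theorem entry₂_comp_strands {X Y X' Y' : Tilt δ} {n : ℕ} (y : tensorObj X Y ⟶ strands n)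
    (x : strands n ⟶ tensorObj X' Y') (i : X.X.ι) (j : Y.X.ι) (i' : X'.X.ι) (j' : Y'.X.ι) :
    entry₂ (y ≫ x) i j i' j' = entryL y i j ≫ entryR x i' j' :=
  (entry_comp y x (i, j) (i', j')).trans (Fintype.sum_unique _)

theorem partialTraceR_comp (y : tensorObj V (dual G) ⟶ unit) (x : unit ⟶ tensorObj V (dual G)) :
    partialTraceR (y ≫ x) = bendY y ≫ bendX x := by
  rw [← sandwich_f (bendY y ≫ bendX x), partialTraceR]
  congr 1
  ext i i'
  refine Finset.sum_congr rfl fun j _ => ?_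
  refine (congrArg (ptrR _) (entry₂_comp_strands y x i j i' j)).trans ?_
  exact ptrR_comp (entryL y i j) (entryR x i' j)

/-- Gluing as a linear map. -/
def glueₗ {v v' n n' w w' : ℕ} (g : THom δ (n + w) (n' + w')) :
    THom δ (v + n) (v' + n') →ₗ[k] THom δ (v + w) (v' + w') where
  toFun f := glue f g
  map_add' f f' := by simp only [glue, tensor, wr_add, Preadditive.add_comp, Preadditive.comp_add]
  map_smul' c f := by
    simp only [glue, tensor, wr_smul, Linear.smul_comp, Linear.comp_smul, RingHom.id_apply]

/-- The matrix entries of an endomorphism of a tensor product with a dual object. -/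
def entryD (f : tensorObj V (dual G) ⟶ tensorObj V (dual G)) (i : V.X.ι) (j : G.X.ι)
    (i' : V.X.ι) (j' : G.X.ι) : THom δ (num V i + num G j) (num V i' + num G j') :=
  f.f (i, j) (i', j')

theorem entryD_comp (y : tensorObj V (dual G) ⟶ unit) (x : unit ⟶ tensorObj V (dual G))
    (i : V.X.ι) (j : G.X.ι) (i' : V.X.ι) (j' : G.X.ι) :
    entryD (y ≫ x) i j i' j' = (show THom δ (num V i + num G j) 0 from entryL y i j) ≫
      (show THom δ 0 (num V i' + num G j') from entryR x i' j') :=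
  entry₂_comp_strands y x i j i' j'

/-- The matrix entries obtained by gluing along a dual factor. -/
def glueSum (f : tensorObj V (dual G) ⟶ tensorObj V (dual G)) (c : tensorObj G P ⟶ tensorObj G P)
    (i : V.X.ι) (a : P.X.ι) (i' : V.X.ι) (a' : P.X.ι) :
    THom δ (num V i + num P a) (num V i' + num P a') :=
  ∑ j : G.X.ι, ∑ j' : G.X.ι, glue (entryD f i j i' j') (entry₂ c j a j' a')

/-- The matrix of diagrams obtained by gluing. -/
def glueMat (f : tensorObj V (dual G) ⟶ tensorObj V (dual G))
    (c : tensorObj G P ⟶ tensorObj G P) : matTensor V.X P.X ⟶ matTensor V.X P.X :=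
  fun x y => glueSum f c x.1 x.2 y.1 y.2

theorem glueAlong_eq (f : tensorObj V (dual G) ⟶ tensorObj V (dual G))
    (c : tensorObj G P ⟶ tensorObj G P) : glueAlong f c = sandwich (glueMat f c) := rfl

theorem glueSum_comp (y : tensorObj V (dual G) ⟶ unit) (x : unit ⟶ tensorObj V (dual G))
    (c : tensorObj G P ⟶ tensorObj G P) (i : V.X.ι) (a : P.X.ι) (i' : V.X.ι) (a' : P.X.ι) :
    glueSum (y ≫ x) c i a i' a' =
      entry₂ (whiskR P (bendY y) ≫ c ≫ whiskR P (bendX x)) i a i' a' := by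
  rw [entry₂_whiskR_comp]
  refine Finset.sum_congr rfl fun j _ => ?_
  rw [entry₂_comp_whiskR, Preadditive.comp_sum]
  refine Finset.sum_congr rfl fun j' _ => ?_
  rw [entryD_comp]
  exact glue_comp (entryL y i j) (entryR x i' j') (entry₂ c j a j' a')

theorem glueSum_add (f f' : tensorObj V (dual G) ⟶ tensorObj V (dual G))
    (c : tensorObj G P ⟶ tensorObj G P) (i : V.X.ι) (a : P.X.ι) (i' : V.X.ι) (a' : P.X.ι) :
    glueSum (f + f') c i a i' a' = glueSum f c i a i' a' + glueSum f' c i a i' a' := by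
  simp only [glueSum, ← Finset.sum_add_distrib]
  exact Finset.sum_congr rfl fun j _ => Finset.sum_congr rfl fun j' _ =>
    (glueₗ (entry₂ c j a j' a')).map_add (entryD f i j i' j') (entryD f' i j i' j')

theorem glueSum_smul (r : k) (f : tensorObj V (dual G) ⟶ tensorObj V (dual G))
    (c : tensorObj G P ⟶ tensorObj G P) (i : V.X.ι) (a : P.X.ι) (i' : V.X.ι) (a' : P.X.ι) :
    glueSum (r • f) c i a i' a' = r • glueSum f c i a i' a' := by
  simp only [glueSum, Finset.smul_sum]
  exact Finset.sum_congr rfl fun j _ => Finset.sum_congr rfl fun j' _ =>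
    (glueₗ (entry₂ c j a j' a')).map_smul r (entryD f i j i' j')

/-- Replaces the gluing in the definition of chromatic morphisms by a composite, term by term in the
cutting morphism. -/
theorem glueAlong_comp (y : tensorObj V (dual G) ⟶ unit) (x : unit ⟶ tensorObj V (dual G))
    (c : tensorObj G P ⟶ tensorObj G P) :
    glueAlong (y ≫ x) c = whiskR P (bendY y) ≫ c ≫ whiskR P (bendX x) := by
  rw [← sandwich_f (whiskR P (bendY y) ≫ c ≫ whiskR P (bendX x)), glueAlong_eq]
  congr 1
  ext a b
  exact glueSum_comp y x c a.1 a.2 b.1 b.2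

theorem sandwich_add {X Y : Tilt δ} (M N : X.X ⟶ Y.X) :
    (sandwich (M + N) : X ⟶ Y) = sandwich M + sandwich N := by
  refine Karoubi.hom_ext _ _ ?_
  change X.p ≫ (M + N) ≫ Y.p = X.p ≫ M ≫ Y.p + X.p ≫ N ≫ Y.p
  rw [Preadditive.add_comp, Preadditive.comp_add]

theorem sandwich_smul {X Y : Tilt δ} (c : k) (M : X.X ⟶ Y.X) :
    (sandwich (c • M) : X ⟶ Y) = c • sandwich M := by
  refine Karoubi.hom_ext _ _ ?_
  change X.p ≫ (c • M) ≫ Y.p = c • (X.p ≫ M ≫ Y.p)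
  rw [Linear.smul_comp, Linear.comp_smul]

theorem wr_mem_jwIdeal {s m n : ℕ} {f : THom δ m n} (hf : f ∈ jwIdeal δ s m n) (r : ℕ) :
    wr r f ∈ jwIdeal δ s (m + r) (n + r) := by
  rw [wr_eq_wh]
  exact wh_mem_jwIdeal hf _ _ _

theorem glue_mem_jwIdeal {s v v' n n' w w' : ℕ} {f : THom δ (v + n) (v' + n')}
    (hf : f ∈ jwIdeal δ s _ _) (g : THom δ (n + w) (n' + w')) :
    glue f g ∈ jwIdeal δ s (v + w) (v' + w') :=
  comp_mem_jwIdeal _ (comp_mem_jwIdeal _ (mem_jwIdeal_comp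
    (mem_jwIdeal_comp (wr_mem_jwIdeal hf _) _) _))

theorem bend_mem_jwIdeal {s v n : ℕ} {y : THom δ (v + n) 0} (hy : y ∈ jwIdeal δ s _ _) :
    bend y ∈ jwIdeal δ s v n :=
  comp_mem_jwIdeal _ (wh_mem_jwIdeal hy _ _ _)

theorem glueAlong_add (f f' : tensorObj V (dual G) ⟶ tensorObj V (dual G))
    (c : tensorObj G P ⟶ tensorObj G P) :
    glueAlong (f + f') c = glueAlong f c + glueAlong f' c := by
  have h : glueMat (f + f') c = glueMat f c + glueMat f' c := by
    ext a b
    exact glueSum_add f f' c a.1 a.2 b.1 b.2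
  rw [glueAlong_eq, h, glueAlong_eq, glueAlong_eq]
  exact sandwich_add (X := tensorObj V P) (Y := tensorObj V P) (glueMat f c) (glueMat f' c)

theorem glueAlong_smul (r : k) (f : tensorObj V (dual G) ⟶ tensorObj V (dual G))
    (c : tensorObj G P ⟶ tensorObj G P) : glueAlong (r • f) c = r • glueAlong f c := by
  have h : glueMat (r • f) c = r • glueMat f c := by
    ext a b
    exact glueSum_smul r f c a.1 a.2 b.1 b.2
  rw [glueAlong_eq, h, glueAlong_eq]
  exact sandwich_smul (X := tensorObj V P) (Y := tensorObj V P) r (glueMat f c)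

/-- Gluing along a dual factor as a linear map. -/
def glueAlongₗ (c : tensorObj G P ⟶ tensorObj G P) :
    (tensorObj V (dual G) ⟶ tensorObj V (dual G)) →ₗ[k] (tensorObj V P ⟶ tensorObj V P) where
  toFun f := glueAlong f c
  map_add' f f' := glueAlong_add f f' c
  map_smul' r f := glueAlong_smul r f c

section

variable (p : ℕ) [Fact p.Prime] [CharP k p] [IsDegenerate δ]

theorem sandwich_mem_tiltIdeal {X Y : Tilt δ} {M : X.X ⟶ Y.X}
    (hM : ∀ i j, (show THom δ (num X i) (num Y j) from M i j) ∈ jwIdeal δ (p - 1) _ _) :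
    (sandwich M : X ⟶ Y) ∈ tiltIdeal (2 * p) X Y := by
  refine (mem_tiltIdeal_iff p).2 fun i j => ?_
  change ∑ l, entry (𝟙 X) i l ≫ (∑ l', (show THom δ (num X l) (num Y l') from M l l') ≫
    entry (𝟙 Y) l' j) ∈ _
  exact sum_mem fun l _ => comp_mem_jwIdeal _ (sum_mem fun l' _ => mem_jwIdeal_comp (hM l l') _)

theorem glueAlong_mem_tiltIdeal {f : tensorObj V (dual G) ⟶ tensorObj V (dual G)}
    (hf : f ∈ tiltIdeal (2 * p) _ _) (c : tensorObj G P ⟶ tensorObj G P) :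
    glueAlong f c ∈ tiltIdeal (2 * p) _ _ := by
  rw [glueAlong_eq]
  exact sandwich_mem_tiltIdeal p fun a b => sum_mem fun i _ => sum_mem fun j _ =>
    glue_mem_jwIdeal ((mem_tiltIdeal_iff p).1 hf (a.1, i) (b.1, j)) _

theorem bendY_mem_tiltIdeal {y : tensorObj V (dual G) ⟶ unit} (hy : y ∈ tiltIdeal (2 * p) _ _) :
    bendY y ∈ tiltIdeal (2 * p) V G :=
  (mem_tiltIdeal_iff p).2 fun i j =>
    bend_mem_jwIdeal ((mem_tiltIdeal_iff p).1 hy (i, j) default)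

theorem bendX_mem_tiltIdeal {x : unit ⟶ tensorObj V (dual G)} (hx : x ∈ tiltIdeal (2 * p) _ _) :
    bendX x ∈ tiltIdeal (2 * p) G V :=
  (mem_tiltIdeal_iff p).2 fun j i => flip_mem_jwIdeal p (bend_mem_jwIdeal
    (flip_mem_jwIdeal p ((mem_tiltIdeal_iff p).1 hx default (i, j))))

end

end MixedVerlinde

end

/-! ### Dual families, and the chromatic condition after bending. -/

noncomputable section

/-- Every bilinear form has families that are dual to each other and span modulo the kernels. -/
theorem LinearMap.exists_dual_families {k V W : Type*} [Field k] [AddCommGroup V] [Module k V]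
    [AddCommGroup W] [Module k W] [FiniteDimensional k V] (B : V →ₗ[k] W →ₗ[k] k) :
    ∃ (r : ℕ) (y : Fin r → V) (x : Fin r → W), (∀ i j, B (y i) (x j) = if i = j then 1 else 0) ∧
      (∀ v, ∃ a : Fin r → k, ∀ w, B (v - ∑ i, a i • y i) w = 0) ∧
      (∀ w, ∃ a : Fin r → k, ∀ v, B v (w - ∑ i, a i • x i) = 0) := by
  let b := Module.finBasis k (V ⧸ LinearMap.ker B)
  let B' : (V ⧸ LinearMap.ker B) →ₗ[k] W →ₗ[k] k := (LinearMap.ker B).liftQ B le_rfl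
  have hB : ∀ v, B' ((LinearMap.ker B).mkQ v) = B v := fun v => Submodule.liftQ_apply _ _ _
  -- After division by the left kernel the form is injective on a finite-dimensional space, so every
  -- coordinate functional comes from the other side.
  have hsurj : Function.Surjective B'.flip := LinearMap.flip_surjective_iff₁.2
    (LinearMap.ker_eq_bot.1 (Submodule.ker_liftQ_eq_bot _ _ _ le_rfl))
  choose y hy using fun i => (LinearMap.ker B).mkQ_surjective (b i)
  choose x hx using fun i => hsurj (b.coord i)
  have hxb : ∀ v j, B v (x j) = b.repr ((LinearMap.ker B).mkQ v) j := fun v j => by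
    rw [← hB, ← LinearMap.flip_apply, hx, Module.Basis.coord_apply]
  have hv : ∀ v, B v = ∑ i, b.repr ((LinearMap.ker B).mkQ v) i • B (y i) := by
    intro v
    simp only [← hB, hy, ← map_smul, ← map_sum]
    rw [b.sum_repr]
  refine ⟨_, y, x, fun i j => ?_, fun v => ⟨b.repr ((LinearMap.ker B).mkQ v), fun w => ?_⟩,
    fun w => ⟨fun i => B (y i) w, fun v => ?_⟩⟩
  · rw [hxb, hy, Module.Basis.repr_self, Finsupp.single_apply]
  · rw [map_sub, LinearMap.sub_apply, hv v, map_sum]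
    simp
  · rw [map_sub, map_sum, hv v]
    simp only [LinearMap.sum_apply, LinearMap.smul_apply, hxb, hy, Module.Basis.repr_self, map_smul,
      Finsupp.single_apply, smul_eq_mul]
    simp [mul_comm]

namespace MixedVerlinde

open TemperleyLieb

variable {k : Type u} [Field k] {δ : k}

/-! ### Equality modulo the ideal -/

section EqMod

variable {p : ℕ} {X Y Z : Tilt δ}

theorem EqMod.refl (f : X ⟶ Y) : EqMod p f f := by
  rw [EqMod, sub_self]; exact zero_mem _

theorem EqMod.symm {f g : X ⟶ Y} (h : EqMod p f g) : EqMod p g f := by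
  have := neg_mem h
  rwa [neg_sub] at this

theorem EqMod.trans {f g h : X ⟶ Y} (hfg : EqMod p f g) (hgh : EqMod p g h) : EqMod p f h := by
  have := add_mem hfg hgh
  rwa [sub_add_sub_cancel] at this

theorem EqMod.comp_left (f : X ⟶ Y) {g g' : Y ⟶ Z} (h : EqMod p g g') : EqMod p (f ≫ g) (f ≫ g') := by
  rw [EqMod, ← Preadditive.comp_sub]
  exact comp_mem_tiltIdeal f h

theorem EqMod.comp_right {f f' : X ⟶ Y} (h : EqMod p f f') (g : Y ⟶ Z) : EqMod p (f ≫ g) (f' ≫ g) := by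
  rw [EqMod, ← Preadditive.sub_comp]
  exact mem_tiltIdeal_comp h g

theorem EqMod.smul (c : k) {f g : X ⟶ Y} (h : EqMod p f g) : EqMod p (c • f) (c • g) := by
  rw [EqMod, ← smul_sub]
  exact Submodule.smul_mem _ c h

end EqMod

/-! ### Dual bases with respect to the modified trace -/

variable (p : ℕ) [IsDegenerate δ]

/-- Families of morphisms that are dual with respect to the modified trace and span modulo the
ideal. -/
structure IsDualPair {V G : Tilt δ} {r : ℕ} (y : Fin r → (V ⟶ G)) (x : Fin r → (G ⟶ V)) : Prop where
  dual : ∀ i j, modTr V (y i ≫ x j) = if i = j then 1 else 0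
  span_left : ∀ f : V ⟶ G, ∃ a : Fin r → k, EqMod p f (∑ i, a i • y i)
  span_right : ∀ g : G ⟶ V, ∃ a : Fin r → k, EqMod p g (∑ i, a i • x i)

section

variable [Fact p.Prime] [CharP k p] {p}

theorem modTr_congr {P : Tilt δ} (hP : IsProj P) {f g : P ⟶ P} (h : EqMod p f g) :
    modTr P f = modTr P g := (isModifiedTrace_modTr p).congr P hP f g h

theorem modTr_comm (p : ℕ) [Fact p.Prime] [CharP k p] {P Q : Tilt δ} (hP : IsProj P)
    (hQ : IsProj Q) (f : P ⟶ Q) (g : Q ⟶ P) :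
    modTr P (f ≫ g) = modTr Q (g ≫ f) := (isModifiedTrace_modTr p).cyclic P Q hP hQ f g

/-- The modified trace as a linear map. -/
def modTrₗ (p : ℕ) [Fact p.Prime] [CharP k p] {P : Tilt δ} (hP : IsProj P) : (P ⟶ P) →ₗ[k] k :=
  (isModifiedTrace_modTr p).toLinear hP

theorem modTrₗ_apply {P : Tilt δ} (hP : IsProj P) (f : P ⟶ P) : modTrₗ p hP f = modTr P f := rfl

namespace IsDualPair

variable {V G : Tilt δ} {r : ℕ} {y : Fin r → (V ⟶ G)} {x : Fin r → (G ⟶ V)}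

theorem swap (h : IsDualPair p y x) (hV : IsProj V) (hG : IsProj G) : IsDualPair p x y where
  dual i j := by
    rw [modTr_comm p hG hV, h.dual]
    exact if_congr eq_comm rfl rfl
  span_left := h.span_right
  span_right := h.span_left

theorem eqMod_sum (h : IsDualPair p y x) (hV : IsProj V) (f : V ⟶ G) :
    EqMod p f (∑ i, modTr V (f ≫ x i) • y i) := by
  obtain ⟨a, ha⟩ := h.span_left f
  have : ∀ j, modTr V (f ≫ x j) = a j := by
    intro j
    rw [modTr_congr hV (ha.comp_right (x j)), Preadditive.sum_comp, ← modTrₗ_apply (p := p) hV,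
      map_sum]
    simp only [Linear.smul_comp, map_smul, modTrₗ_apply, h.dual]
    simp
  simpa only [this] using ha

end IsDualPair

/-- The modified trace is nondegenerate. -/
theorem mem_tiltIdeal_of_modTr_comp {Q : Tilt δ} (hQ : IsProj Q) {f : Q ⟶ unit}
    (hf : ∀ g : unit ⟶ Q, modTr Q (f ≫ g) = 0) : f ∈ tiltIdeal (2 * p) Q unit := by
  obtain ⟨d⟩ := hQ.nonempty_presentation
  rw [← Category.id_comp f, ← d.sum_eq, Preadditive.sum_comp]
  refine sum_mem fun l _ => ?_
  rw [Category.assoc]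
  refine comp_mem_tiltIdeal _ ((mem_tiltIdeal_iff p).2 fun _ _ => ?_)
  refine mem_jwIdeal_of_tr p (f := unemb (d.b l ≫ f)) (d.pos l) fun g => ?_
  have := hf (emb g ≫ d.b l)
  rw [← Category.assoc, modTr_comm p hQ (isProj_strands (d.pos l)), modTr_strands (d.pos l),
    ← Category.assoc, unemb_comp, unemb_emb] at this
  exact this

/-- The trace form is only controlled from a nonempty source, so the diagram is reflected first. -/
theorem mem_tiltIdeal_of_modTr_comp' {Q : Tilt δ} (hQ : IsProj Q) {g : unit ⟶ Q}
    (hg : ∀ f : Q ⟶ unit, modTr Q (f ≫ g) = 0) : g ∈ tiltIdeal (2 * p) unit Q := by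
  obtain ⟨d⟩ := hQ.nonempty_presentation
  rw [← Category.comp_id g, ← d.sum_eq, Preadditive.comp_sum]
  refine sum_mem fun l _ => ?_
  rw [← Category.assoc]
  refine mem_tiltIdeal_comp ((mem_tiltIdeal_iff p).2 fun _ _ => ?_) _
  change unemb (g ≫ d.a l) ∈ _
  rw [← TemperleyLieb.flip_flip (unemb (g ≫ d.a l))]
  refine flip_mem_jwIdeal p (mem_jwIdeal_of_tr p (d.pos l) fun f => ?_)
  have := hg (d.a l ≫ emb (flip f))
  rw [Category.assoc, modTr_comm p hQ (isProj_strands (d.pos l)), modTr_strands (d.pos l),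
    Category.assoc, unemb_comp, unemb_emb] at this
  refine Eq.trans ?_ this
  refine (tr_flip _).symm.trans (congrArg _ ?_)
  exact (flip_comp _ _).trans (congrArg (_ ≫ ·) (TemperleyLieb.flip_flip _))

theorem exists_dual_families {Q : Tilt δ} (hQ : IsProj Q) :
    ∃ (r : ℕ) (y : Fin r → (Q ⟶ unit)) (x : Fin r → (unit ⟶ Q)),
      (∀ i j, modTr Q (y i ≫ x j) = if i = j then 1 else 0) ∧
      (∀ f : Q ⟶ unit, ∃ a : Fin r → k, EqMod p f (∑ i, a i • y i)) ∧
      (∀ g : unit ⟶ Q, ∃ a : Fin r → k, EqMod p g (∑ i, a i • x i)) := by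
  let B : (Q ⟶ unit) →ₗ[k] (unit ⟶ Q) →ₗ[k] k :=
    LinearMap.mk₂ k (fun f g => modTrₗ p hQ (f ≫ g))
      (fun f f' g => by rw [Preadditive.add_comp, map_add])
      (fun c f g => by rw [Linear.smul_comp, map_smul])
      (fun f g g' => by rw [Preadditive.comp_add, map_add])
      (fun c f g => by rw [Linear.comp_smul, map_smul])
  have hB : ∀ f g, B f g = modTr Q (f ≫ g) := fun _ _ => rfl
  obtain ⟨r, y, x, hd, hy, hx⟩ := B.exists_dual_families
  refine ⟨r, y, x, hd, fun f => ?_, fun g => ?_⟩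
  · obtain ⟨a, ha⟩ := hy f
    exact ⟨a, mem_tiltIdeal_of_modTr_comp hQ ha⟩
  · obtain ⟨a, ha⟩ := hx g
    exact ⟨a, mem_tiltIdeal_of_modTr_comp' hQ ha⟩

/-- Compatibility with the right partial trace turns duality on `V ⊗ G^*` into duality of bent
families; spanning is inherited because bending is surjective and preserves the ideal. -/
theorem isDualPair_bend {V G : Tilt δ} (hV : IsProj V) {r : ℕ}
    {y : Fin r → (tensorObj V (dual G) ⟶ unit)} {x : Fin r → (unit ⟶ tensorObj V (dual G))}
    (hd : ∀ i j, modTr _ (y i ≫ x j) = if i = j then 1 else 0)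
    (hy : ∀ f : tensorObj V (dual G) ⟶ unit, ∃ a : Fin r → k, EqMod p f (∑ i, a i • y i))
    (hx : ∀ g : unit ⟶ tensorObj V (dual G), ∃ a : Fin r → k, EqMod p g (∑ i, a i • x i)) :
    IsDualPair p (fun i => bendY (y i)) (fun i => bendX (x i)) where
  dual i j := by
    rw [← partialTraceR_comp, ← (isModifiedTrace_modTr p).right _ _ hV, hd]
  span_left f := by
    obtain ⟨f, rfl⟩ := bendY_surjective f
    obtain ⟨a, ha⟩ := hy f
    refine ⟨a, ?_⟩
    have := bendY_mem_tiltIdeal p ha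
    have h2 : bendY (f - ∑ i, a i • y i) = bendY f - ∑ i, a i • bendY (y i) := by
      change bendYₗ _ = bendYₗ f - ∑ i, a i • bendYₗ (y i)
      simp only [map_sub, map_sum, map_smul]
    rwa [h2] at this
  span_right f := by
    obtain ⟨f, rfl⟩ := bendX_surjective f
    obtain ⟨a, ha⟩ := hx f
    refine ⟨a, ?_⟩
    have := bendX_mem_tiltIdeal p ha
    have h2 : bendX (f - ∑ i, a i • x i) = bendX f - ∑ i, a i • bendX (x i) := by
      change bendXₗ _ = bendXₗ f - ∑ i, a i • bendXₗ (x i)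
      simp only [map_sub, map_sum, map_smul]
    rwa [h2] at this

theorem exists_isDualPair_of_isChromatic {G P : Tilt δ} {c : tensorObj G P ⟶ tensorObj G P}
    (hc : IsChromatic p modTr G P c) {V : Tilt δ} (hV : IsProj V) :
    ∃ (r : ℕ) (y : Fin r → (V ⟶ G)) (x : Fin r → (G ⟶ V)), IsDualPair p y x ∧
      EqMod p (∑ i, whiskR P (y i) ≫ c ≫ whiskR P (x i)) (𝟙 _) := by
  obtain ⟨Λ, ⟨r, y, x, hd, hy, hx, hΛ⟩, h⟩ := hc V hV
  refine ⟨r, _, _, isDualPair_bend hV hd hy hx, ?_⟩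
  refine EqMod.trans ?_ h
  have h1 := glueAlong_mem_tiltIdeal p hΛ c
  have h2 : glueAlong (Λ - ∑ i, y i ≫ x i) c = glueAlong Λ c -
      ∑ i, whiskR P (bendY (y i)) ≫ c ≫ whiskR P (bendX (x i)) := by
    simp only [← glueAlong_comp]
    exact (map_sub (glueAlongₗ c) _ _).trans (congrArg (_ - ·) (map_sum (glueAlongₗ c) _ _))
  rw [h2] at h1
  exact EqMod.symm h1

/-- A cutting morphism exists by nondegeneracy of the trace, so the bent condition for all dual
pairs yields the condition as defined. -/
theorem isChromatic_of_forall_isDualPair {G P : Tilt δ} {c : tensorObj G P ⟶ tensorObj G P}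
    (hc : ∀ (V : Tilt δ), IsProj V → ∀ (r : ℕ) (y : Fin r → (V ⟶ G)) (x : Fin r → (G ⟶ V)),
      IsDualPair p y x → EqMod p (∑ i, whiskR P (y i) ≫ c ≫ whiskR P (x i)) (𝟙 _)) :
    IsChromatic p modTr G P c := by
  intro V hV
  obtain ⟨r, y, x, hd, hy, hx⟩ := exists_dual_families (p := p) (hV.tensorR (dual G))
  refine ⟨∑ i, y i ≫ x i, ⟨r, y, x, hd, hy, hx, EqMod.refl _⟩, ?_⟩
  have := hc V hV r _ _ (isDualPair_bend hV hd hy hx)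
  simp only [← glueAlong_comp] at this
  refine EqMod.trans ?_ this
  exact (map_sum (glueAlongₗ c) _ _) ▸ EqMod.refl _

end

end MixedVerlinde

end

/-! ### An explicit projective generator and chromatic morphism. -/

noncomputable section

namespace MixedVerlinde

open TemperleyLieb

variable {k : Type u} [Field k] {δ : k}

/-! ### A projective generator -/

/-- The direct sum of the strand objects with `1, …, 2 p - 2` strands. -/
def gen (δ : k) (p : ℕ) : Tilt δ := (toKaroubi _).obj ⟨Fin (2 * p - 2), fun i => ⟨i + 1⟩⟩

/-- The projection of the generator to its term with `r` strands. -/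
def genProj (p : ℕ) : (r : ℕ) → (gen δ p ⟶ strands r)
  -- Default values, here and for `r` above `2 * p - 2`; only strand numbers between 1 and `2 * p -
  -- 2` are terms of the generator.
  | 0 => 0
  | r + 1 => if h : r < 2 * p - 2 then proj (gen δ p) ⟨r, h⟩ else 0

/-- The inclusion into the generator of its term with `r` strands. -/
def genIncl (p : ℕ) : (r : ℕ) → (strands r ⟶ gen δ p)
  | 0 => 0
  | r + 1 => if h : r < 2 * p - 2 then incl (gen δ p) ⟨r, h⟩ else 0

theorem genIncl_genProj {p r : ℕ} (h1 : 1 ≤ r) (h2 : r ≤ 2 * p - 2) :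
    genIncl (δ := δ) p r ≫ genProj p r = 𝟙 _ := by
  obtain ⟨r, rfl⟩ := Nat.exists_eq_add_of_le' h1
  have h : r < 2 * p - 2 := h2
  have e : genIncl (δ := δ) p (r + 1) = incl (gen δ p) ⟨r, h⟩ := dif_pos h
  have e' : genProj (δ := δ) p (r + 1) = proj (gen δ p) ⟨r, h⟩ := dif_pos h
  rw [e, e']
  have := incl_comp_proj (𝟙 (gen δ p)) ⟨r, h⟩ ⟨r, h⟩
  rw [Category.id_comp] at this
  refine this.trans ?_
  have h2 : entry (𝟙 (gen δ p)) ⟨r, h⟩ ⟨r, h⟩ = 𝟙 (⟨r + 1⟩ : TL δ) :=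
    Mat_.id_apply_self (⟨Fin (2 * p - 2), fun i => ⟨i + 1⟩⟩ : Mat_ (TL δ)) ⟨r, h⟩
  exact (congrArg emb h2).trans (emb_id _)

section

variable [IsDegenerate δ]

/-- The presentation of the generator. -/
def genPresentation (p : ℕ) : Presentation (gen δ p) where
  ι := Fin (2 * p - 2)
  n i := i + 1
  pos _ := Nat.le_add_left _ _
  a := proj (gen δ p)
  b := incl (gen δ p)
  sum_eq := sum_proj_incl (gen δ p)

theorem isProj_gen (p : ℕ) : IsProj (gen δ p) := (genPresentation p).isProj

end

variable (p : ℕ)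

/-- The morphisms that factor through sums of copies of the generator, modulo the ideal. -/
def genIdeal (X Y : Tilt δ) : Submodule k (X ⟶ Y) :=
  Submodule.span k {h : X ⟶ Y | ∃ (f : X ⟶ gen δ p) (g : gen δ p ⟶ Y), h = f ≫ g} ⊔
    tiltIdeal (2 * p) X Y

theorem comp_mem_genIdeal {X Y Z W : Tilt δ} (f : X ⟶ Y) {h : Y ⟶ Z} (hh : h ∈ genIdeal p Y Z)
    (g : Z ⟶ W) : f ≫ h ≫ g ∈ genIdeal p X W := by
  obtain ⟨x, hx, y, hy, rfl⟩ := Submodule.mem_sup.1 hh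
  rw [Preadditive.add_comp, Preadditive.comp_add]
  refine add_mem (Submodule.mem_sup_left ?_)
    (Submodule.mem_sup_right (comp_mem_tiltIdeal _ (mem_tiltIdeal_comp hy _)))
  clear hh
  induction hx using Submodule.span_induction with
  | mem h hh =>
    obtain ⟨u, v, rfl⟩ := hh
    exact Submodule.subset_span ⟨f ≫ u, v ≫ g, by simp only [Category.assoc]⟩
  | zero => rw [Limits.zero_comp, Limits.comp_zero]; exact zero_mem _
  | add f g _ _ hf hg => rw [Preadditive.add_comp, Preadditive.comp_add]; exact add_mem hf hg
  | smul c f _ hf => rw [Linear.smul_comp, Linear.comp_smul]; exact Submodule.smul_mem _ c hf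

section

variable [Fact p.Prime] [CharP k p] [IsDegenerate δ]

/-- Beyond the range of the generator, the top projector is zero modulo the ideal, so the identity
passes through two strands fewer. -/
theorem id_strands_mem_genIdeal {n : ℕ} (hn : 1 ≤ n) :
    𝟙 (strands n : Tilt δ) ∈ genIdeal p (strands n) (strands n) := by
  have hp : 2 ≤ p := (Fact.out : p.Prime).two_le
  induction n using Nat.strong_induction_on with
  | _ n ih =>
    by_cases h : n ≤ 2 * p - 2
    · exact Submodule.mem_sup_left (Submodule.subset_span ⟨genIncl p n, genProj p n,
        (genIncl_genProj hn h).symm⟩)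
    · obtain ⟨r, rfl⟩ : ∃ r, n = 2 * (p - 1) + 1 + r := ⟨n - (2 * (p - 1) + 1), by omega⟩
      have he := isJW_jw (δ := δ) p (s := p - 1) (by omega)
      have h2 := wh_mem_through he.mem 0 r (N := 2 * (p - 1) + 1 + r - 2)
        (A := 2 * (p - 1) + 1 + r) (B := 2 * (p - 1) + 1 + r) (by omega) (by omega) (by omega)
      rw [wh_sub, wh_id, cast_self] at h2
      rw [← emb_id, ← sub_add_cancel (𝟙 _) (wh 0 r (by omega) (by omega) (jw δ (p - 1))), emb_add]
      refine add_mem ?_ (Submodule.mem_sup_right (emb_jw_mem_tiltIdeal p r))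
      refine comp_through_comp_mem (S := Submodule.comap embₗ (genIdeal p _ _)) h2 fun u v => ?_
      change emb (u ≫ v) ∈ genIdeal p _ _
      have := comp_mem_genIdeal p (emb u) (ih (2 * (p - 1) + 1 + r - 2) (by omega) (by omega)) (emb v)
      rwa [Category.id_comp, ← emb_comp] at this

theorem isProjGenerator_gen : IsProjGenerator p (gen δ p) := by
  refine ⟨isProj_gen p, fun P hP => ?_⟩
  obtain ⟨d⟩ := hP.nonempty_presentation
  have h : 𝟙 P ∈ genIdeal p P P := by
    rw [← d.sum_eq]
    refine sum_mem fun l _ => ?_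
    have := comp_mem_genIdeal p (d.a l) (id_strands_mem_genIdeal p (d.pos l)) (d.b l)
    rwa [Category.id_comp] at this
  obtain ⟨x, hx, y, hy, hxy⟩ := Submodule.mem_sup.1 h
  obtain ⟨n, c, f, rfl⟩ := (Submodule.mem_span_set' ).1 hx
  choose u v huv using fun i => (f i).2
  refine ⟨n, fun i => c i • u i, v, ?_⟩
  refine EqMod.symm ?_
  rw [EqMod, ← hxy]
  simp only [huv, Linear.smul_comp]
  rwa [add_sub_cancel_left]

end

/-! ### The chromatic morphism -/

variable (δ)

/-- The chromatic morphism based at `w + 1` strands. -/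
def chrom (w : ℕ) : tensorObj (gen δ p) (strands (w + 1)) ⟶ tensorObj (gen δ p) (strands (w + 1)) :=
  -- The first summand serves objects with an odd number of strands and ignores `P`; the second, for
  -- even numbers, uses the first strand of `P` and leaves the other `w` strands idle.
  ∑ s ∈ Finset.range (p - 1), tr _ (jw δ s) •
    (whiskR _ (genProj p (2 * s + 1) ≫ emb (jw δ s) ≫ genIncl p (2 * s + 1)) +
      whiskR _ (genProj p (2 * s + 2)) ≫ joinHom _ _ ≫
        emb (wh 0 w (by omega) (by omega) ((cap (2 * s + 1) le_rfl rfl : THom δ (2 * s + 3) _) ≫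
          jw δ s ≫ cup (2 * s + 1) le_rfl rfl)) ≫ joinInv _ _ ≫ whiskR _ (genIncl p (2 * s + 2)))

variable {δ}

theorem whiskR_emb {a b : ℕ} (n : ℕ) (f : THom δ a b) :
    whiskR (strands n) (emb f) = joinHom a n ≫ emb (wr n f) ≫ joinInv b n := by
  have h := joinHom_natural f (𝟙 (⟨n⟩ : TL δ))
  have h2 : tensor f (𝟙 (⟨n⟩ : TL δ)) = wr n f := by
    rw [tensor, wl_id, Category.comp_id]
  rw [emb_id, h2] at h
  rw [← reassoc_of% h, joinHom_joinInv, Category.comp_id]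
  rfl

/-- Brings a block of the chromatic morphism between strand objects into the shape of
`sum_chromatic_sub_mem`, with `w` idle strands. -/
theorem whiskR_chrom_whiskR {v v' w : ℕ} (u : strands v ⟶ gen δ p) (u' : gen δ p ⟶ strands v') :
    whiskR _ u ≫ chrom δ p w ≫ whiskR _ u' = joinHom v (w + 1) ≫ emb (wh 0 w (by omega) (by omega)
      (∑ s ∈ Finset.range (p - 1), tr _ (jw δ s) •
        (wh 0 1 (M := v + 1) (N := v' + 1) (by omega) (by omega)
            (unemb (u ≫ genProj p (2 * s + 1)) ≫ jw δ s ≫ unemb (genIncl p (2 * s + 1) ≫ u')) +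
          wh 0 1 (by omega) (by omega) (unemb (u ≫ genProj p (2 * s + 2))) ≫
            cap (2 * s + 1) le_rfl rfl ≫ jw δ s ≫ cup (2 * s + 1) le_rfl rfl ≫
            wh 0 1 (by omega) (by omega) (unemb (genIncl p (2 * s + 2) ≫ u'))))) ≫
      joinInv v' (w + 1) := by
  rw [chrom, wh_sum, emb_sum]
  simp only [Preadditive.sum_comp, Preadditive.comp_sum]
  refine Finset.sum_congr rfl fun s _ => ?_
  rw [wh_smul, emb_smul, wh_add, emb_add]
  simp only [Linear.smul_comp, Linear.comp_smul, Preadditive.add_comp, Preadditive.comp_add]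
  congr 2
  · rw [← whiskR_comp, ← whiskR_comp, wh_wh]
    have h : u ≫ (genProj p (2 * s + 1) ≫ emb (jw δ s) ≫ genIncl p (2 * s + 1)) ≫ u' =
        emb (unemb (u ≫ genProj p (2 * s + 1)) ≫ jw δ s ≫ unemb (genIncl p (2 * s + 1) ≫ u')) := by
      simp only [emb_comp, emb_unemb, Category.assoc]
    rw [h, whiskR_emb, wr_eq_wh]
    exact congrArg (fun f => joinHom v (w + 1) ≫ emb f ≫ joinInv v' (w + 1))
      (wh_congr 0 (w + 1) _ _ rfl (by omega) _)
  · have h1 : whiskR (strands (w + 1)) u ≫ whiskR _ (genProj p (2 * s + 2)) = joinHom _ _ ≫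
        emb (wh 0 w (N := 2 * s + 2 + (w + 1)) (by omega) (by omega) (wh 0 1 (M := v + 1)
          (N := 2 * s + 3) (by omega)
          (by omega) (unemb (u ≫ genProj p (2 * s + 2))))) ≫ joinInv _ (w + 1) := by
      rw [← whiskR_comp, wh_wh, ← emb_unemb (u ≫ genProj p (2 * s + 2)), whiskR_emb, wr_eq_wh]
      exact congrArg (fun f => joinHom v (w + 1) ≫ emb f ≫ joinInv _ (w + 1))
        (wh_congr 0 (w + 1) _ _ rfl (by omega) _)
    have h2 : whiskR (strands (w + 1)) (genIncl p (2 * s + 2)) ≫ whiskR _ u' = joinHom _ _ ≫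
        emb (wh 0 w (M := 2 * s + 2 + (w + 1)) (by omega) (by omega) (wh 0 1 (N := v' + 1)
          (M := 2 * s + 3) (by omega)
          (by omega) (unemb (genIncl p (2 * s + 2) ≫ u')))) ≫ joinInv _ (w + 1) := by
      rw [← whiskR_comp, wh_wh, ← emb_unemb (genIncl p (2 * s + 2) ≫ u'), whiskR_emb, wr_eq_wh]
      exact congrArg (fun f => joinHom _ (w + 1) ≫ emb f ≫ joinInv _ (w + 1))
        (wh_congr 0 (w + 1) _ _ rfl (by omega) _)
    simp only [Category.assoc]
    rw [reassoc_of% h1, h2, reassoc_of% joinInv_joinHom, reassoc_of% joinInv_joinHom]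
    have e : ∀ {a b c : ℕ} (f₁ : THom δ a (2 * s + 3)) (f₂ : THom δ (2 * s + 3) b) (f₃ : THom δ b c)
        (f₄ : THom δ c (2 * s + 3)) (f₅ : THom δ (2 * s + 3) (v' + 1)) (h : v + (w + 1) = 0 + a + w),
        wh 0 w h (by omega) (f₁ ≫ f₂ ≫ f₃ ≫ f₄ ≫ f₅) =
          wh 0 w h (N := 2 * s + 2 + (w + 1)) (by omega) f₁ ≫ wh 0 w (N := 2 * s + 2 + (w + 1))
            (by omega) (by omega) (f₂ ≫ f₃ ≫ f₄) ≫ wh 0 w (N := v' + (w + 1)) (by omega) (by omega) f₅ := by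
      intro a b c f₁ f₂ f₃ f₄ f₅ h
      rw [← wh_comp, ← wh_comp]
      simp only [Category.assoc]
    rw [e, emb_comp, emb_comp]
    simp only [Category.assoc]

end MixedVerlinde

end

/-! ### The chromatic property, and independence of the chromatic morphism. -/

noncomputable section

namespace MixedVerlinde

open TemperleyLieb

variable {k : Type u} [Field k] {δ : k} {p : ℕ} [Fact p.Prime] [CharP k p] [IsDegenerate δ]

theorem emb_mem_tiltIdeal {a b : ℕ} {f : THom δ a b} (hf : f ∈ jwIdeal δ (p - 1) a b) :
    emb f ∈ tiltIdeal (2 * p) _ _ := (mem_tiltIdeal_iff p).2 fun _ _ => hf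

theorem unemb_mem_jwIdeal {a b : ℕ} {f : (strands a : Tilt δ) ⟶ strands b}
    (hf : f ∈ tiltIdeal (2 * p) _ _) : unemb f ∈ jwIdeal δ (p - 1) a b :=
  (mem_tiltIdeal_iff p).1 hf default default

omit [IsDegenerate δ] in
theorem emb_sub {a b : ℕ} (f g : THom δ a b) : emb (f - g) = emb f - emb g := map_sub embₗ f g

/-- Dual families to the generator reproduce morphisms on few strands. -/
theorem IsDualPair.sum_tr_smul_sub_mem {V : Tilt δ} (hV : IsProj V) {r : ℕ}
    {y : Fin r → (V ⟶ gen δ p)} {x : Fin r → (gen δ p ⟶ V)} (h : IsDualPair p y x) {v v' n : ℕ}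
    (b : strands v ⟶ V) (a : V ⟶ strands v') (h1 : 1 ≤ n) (h2 : n ≤ 2 * p - 2) (β : THom δ v' n) :
    ∑ i, tr n (unemb (genIncl p n ≫ x i ≫ a) ≫ β) • unemb ((b ≫ y i) ≫ genProj p n) -
      unemb (b ≫ a) ≫ β ∈ jwIdeal δ (p - 1) v n := by
  have h3 := ((h.eqMod_sum hV (a ≫ emb β ≫ genIncl p n)).comp_left b).comp_right (genProj p n)
  have h4 := unemb_mem_jwIdeal h3.symm
  simp only [Category.assoc, genIncl_genProj h1 h2, Category.comp_id] at h4
  rw [unemb_sub, ← Category.assoc b a, unemb_comp (b ≫ a), unemb_emb] at h4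
  convert h4 using 2
  simp only [Preadditive.sum_comp, Preadditive.comp_sum, unemb_sum, Linear.smul_comp,
    Linear.comp_smul, unemb_smul, Category.assoc]
  refine Finset.sum_congr rfl fun i _ => ?_
  congr 1
  have h5 := modTr_comm p hV (isProj_strands h1) (a ≫ emb β) (genIncl p n ≫ x i)
  simp only [Category.assoc] at h5
  rw [h5, modTr_strands h1]
  congr 1
  rw [← unemb_emb β, ← unemb_comp]
  simp only [Category.assoc, unemb_emb]

/-- By a presentation of `V` the difference is tested between strand objects, where dual families
have the reproducing property required by `sum_chromatic_sub_mem`. -/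
theorem IsDualPair.sum_whiskR_chrom {V : Tilt δ} (hV : IsProj V) {r : ℕ}
    {y : Fin r → (V ⟶ gen δ p)} {x : Fin r → (gen δ p ⟶ V)} (h : IsDualPair p y x) (w : ℕ) :
    EqMod p (∑ i, whiskR _ (y i) ≫ chrom δ p w ≫ whiskR _ (x i))
      (𝟙 (tensorObj V (strands (w + 1)))) := by
  obtain ⟨d⟩ := hV.nonempty_presentation
  have hid : ∑ l, whiskR (strands (w + 1)) (d.a l) ≫ whiskR _ (d.b l) = 𝟙 _ := by
    simp only [← whiskR_comp]
    rw [← whiskR_sum, d.sum_eq, whiskR_id]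
  set D := ∑ i, whiskR _ (y i) ≫ chrom δ p w ≫ whiskR _ (x i) -
    𝟙 (tensorObj V (strands (w + 1))) with hD
  change D ∈ _
  have key : ∀ l l', whiskR _ (d.b l) ≫ D ≫ whiskR _ (d.a l') ∈ tiltIdeal (2 * p) _ _ := by
    intro l l'
    have h1 := sum_chromatic_sub_mem p (fun i n => unemb ((d.b l ≫ y i) ≫ genProj p n))
      (fun i n => unemb (genIncl p n ≫ x i ≫ d.a l')) (unemb (d.b l ≫ d.a l'))
      fun n h1 h2 β => h.sum_tr_smul_sub_mem hV (d.b l) (d.a l') h1 h2 β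
    have h2 := comp_mem_tiltIdeal (joinHom (d.n l) (w + 1)) (mem_tiltIdeal_comp
      (emb_mem_tiltIdeal (wh_mem_jwIdeal h1 w (A := d.n l + (w + 1)) (B := d.n l' + (w + 1))
        (by omega) (by omega))) (joinInv _ (w + 1)))
    convert h2 using 1
    have h3 : whiskR _ (d.b l) ≫ D ≫ whiskR _ (d.a l') = ∑ i, whiskR _ (d.b l ≫ y i) ≫ chrom δ p w ≫
        whiskR _ (x i ≫ d.a l') - whiskR (strands (w + 1)) (d.b l ≫ d.a l') := by
      simp only [hD, Preadditive.sub_comp, Preadditive.comp_sub, Preadditive.sum_comp,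
        Preadditive.comp_sum, whiskR_comp, Category.assoc, Category.id_comp]
    rw [h3, wh_sub, emb_sub, Preadditive.sub_comp, Preadditive.comp_sub]
    congr 1
    · simp only [whiskR_chrom_whiskR]
      rw [← Preadditive.comp_sum, ← Preadditive.sum_comp, ← emb_sum, ← wh_sum]
    · rw [wh_wh, ← emb_unemb (d.b l ≫ d.a l'), whiskR_emb, wr_eq_wh]
      exact congrArg (fun f => joinHom _ (w + 1) ≫ emb f ≫ joinInv _ (w + 1))
        (wh_congr 0 (w + 1) _ _ rfl (by omega) _)
  have h1 : D = ∑ l, ∑ l', whiskR _ (d.a l) ≫ (whiskR _ (d.b l) ≫ D ≫ whiskR _ (d.a l')) ≫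
      whiskR _ (d.b l') := by
    conv_lhs => rw [← Category.comp_id D, ← Category.id_comp (D ≫ _), ← hid]
    simp only [Preadditive.sum_comp, Preadditive.comp_sum, Category.assoc]
    rw [Finset.sum_comm]
  rw [h1]
  exact sum_mem fun l _ => sum_mem fun l' _ =>
    comp_mem_tiltIdeal _ (mem_tiltIdeal_comp (key l l') _)

theorem isChromatic_chrom (w : ℕ) :
    IsChromatic p modTr (gen δ p) (strands (w + 1)) (chrom δ p w) :=
  isChromatic_of_forall_isDualPair fun _ hV _ _ _ h => h.sum_whiskR_chrom hV w

/-- Values of the red kink for a chromatic morphism are those for the explicit chromatic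
morphism. -/
theorem redKink_eq_of_isChromatic {q : k} (hq : q ^ 4 = -1) {G P : Tilt δ}
    (hG : IsProj G) (hP : IsProj P)
    {c : tensorObj G P ⟶ tensorObj G P} (hc : IsChromatic p modTr G P c) {w : ℕ}
    (φ : P ⟶ strands (w + 1)) (f : strands (w + 1) ⟶ P) :
    redKink modTr q c (φ ≫ f) = redKink modTr q (chrom δ p w) (f ≫ φ) := by
  -- One dual pair serves twice: `c` reproduces the identity of the generator with it, and `chrom`
  -- that of `G` with the swapped pair. The second identity is inserted, the trace is rotated, and
  -- the first removes `c`.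
  obtain ⟨r, y, x, h, h1⟩ := exists_isDualPair_of_isChromatic hc (isProj_gen (δ := δ) p)
  have h2 := (h.swap (isProj_gen p) hG).sum_whiskR_chrom hG w
  have hT : ∀ X : Tilt δ, IsProj (tensorObj X (strands (w + 1))) := fun X =>
    (isProj_strands (Nat.le_add_left _ _)).tensorL X
  have e1 : ∀ (X : Tilt δ) (R : Tilt δ) (g : strands (w + 1) ⟶ R) (g' : R ⟶ strands (w + 1)),
      tensorHom (twistHom q X) (g ≫ g') = tensorHom (twistHom q X) g ≫ whiskL X g' := by
    intro X R g g'
    rw [tensorHom_eq, whiskL_comp, tensorHom_eq, Category.assoc]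
  have e2 : tensorHom (twistHom q G) (φ ≫ f) = whiskL G φ ≫ tensorHom (twistHom q G) f := by
    rw [tensorHom_eq', whiskL_comp, tensorHom_eq', Category.assoc]
  -- Naturality moves the twist from `G` to the generator.
  have e3 : ∀ i, whiskR (strands (w + 1)) (y i) ≫ tensorHom (twistHom q G) f =
      tensorHom (twistHom q _) f ≫ whiskR P (y i) := by
    intro i
    rw [whiskR, whiskR, tensorHom_comp, tensorHom_comp, ← twistHom_natural hq, Category.comp_id,
      Category.id_comp]
  have h3 := ((h2.symm.comp_right (tensorHom (twistHom q G) f)).comp_left (c ≫ whiskL G φ))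
  have h4 := (h1.comp_left (chrom δ p w ≫ tensorHom (twistHom q _) f)).comp_right (whiskL _ φ)
  rw [redKink, redKink, e1, e2]
  have h5 := modTr_congr (hP.tensorL G) h3
  have h6 := modTr_congr (hT _) h4
  simp only [Category.id_comp, Category.comp_id, Preadditive.sum_comp, Preadditive.comp_sum,
    Category.assoc] at h5 h6
  rw [h5, ← h6, ← modTrₗ_apply (p := p) (hP.tensorL G), ← modTrₗ_apply (p := p) (hT _), map_sum,
    map_sum]
  refine Finset.sum_congr rfl fun i _ => ?_
  rw [modTrₗ_apply, modTrₗ_apply]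
  have h7 := modTr_comm p (hP.tensorL G) (hT (gen δ p)) (c ≫ whiskL G φ ≫ whiskR _ (x i))
    (chrom δ p w ≫ whiskR _ (y i) ≫ tensorHom (twistHom q G) f)
  simp only [Category.assoc] at h7
  rw [h7, ← whisk_exchange, reassoc_of% (e3 i)]

end MixedVerlinde

end

/-! ### Evaluation of the kinks. -/

noncomputable section

namespace TemperleyLieb

variable {k : Type u} [Field k] {δ : k}

/-- Closing the right end of an arc joins its two ends. -/
theorem closeR_cap_comp_cup {n : ℕ} (f : THom δ n n) :
    closeR (m := n + 1) (n := n + 1) rfl rfl ((cap n le_rfl rfl : THom δ (n + 2) n) ≫ f ≫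
      cup n le_rfl rfl) = wh 0 1 (by omega) (by omega) f := by
  have h : f ≫ (cup n le_rfl rfl : THom δ n (n + 2)) = cup n le_rfl rfl ≫
      wh 0 1 (M := n + 2) (N := n + 2) (by omega) (by omega)
        (wh 0 1 (M := n + 1) (N := n + 1) (by omega) (by omega) f) := by
    have := wh_comp_cup f 0 (M := n) (N := n + 2) (N' := n) (c := 0) (by omega) rfl (by omega)
      (by omega) (by omega)
    rw [wh_wh]
    simpa using this
  rw [h, ← Category.assoc, closeR_comp_wh _ rfl rfl, closeR_cap_cup, Category.id_comp]

theorem tr_wh_comp_cap_cup {n : ℕ} (f : THom δ (n + 1) (n + 1)) :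
    tr (n + 2) (wh 0 1 (by omega) (by omega) f ≫ (cap n le_rfl rfl : THom δ (n + 2) n) ≫
      cup n le_rfl rfl) = tr (n + 1) f := by
  rw [tr_succ (by omega), closeR_wh_comp rfl rfl rfl, closeR_cap_cup, Category.comp_id]

theorem tr_wh_comp_tensor_cap_cup {r : ℕ} (g : THom δ (r + 1) (r + 1)) (t : THom δ r r) :
    tr (r + 2) (wh 0 1 (by omega) (by omega) g ≫
      tensor t ((cap 0 le_rfl rfl : THom δ 2 0) ≫ cup 0 le_rfl rfl)) =
    tr (r + 1) (g ≫ wh 0 1 (by omega) (by omega) t) := by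
  have h : tensor t ((cap 0 le_rfl rfl : THom δ 2 0) ≫ cup 0 le_rfl rfl) =
      wh 0 1 (M := r + 2) (N := r + 2) (by omega) (by omega) (wh 0 1 (M := r + 1) (N := r + 1) (by omega) (by omega) t) ≫
        (cap r le_rfl rfl : THom δ (r + 2) r) ≫ cup r le_rfl rfl := by
    rw [tensor, wh_wh, wr_eq_wh, wl_comp]
    rfl
  rw [h, ← tr_wh_comp_cap_cup (g ≫ _), wh_comp 0 1 (by omega) (N := r + 2) (by omega) (by omega),
    Category.assoc]

end TemperleyLieb

namespace MixedVerlinde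

open TemperleyLieb

variable {k : Type u} [Field k] {δ : k} {p : ℕ} [Fact p.Prime] [CharP k p] [IsDegenerate δ]

/-- Rotating the trace and using naturality of the twist reduces a block through one term of the
generator to a diagram trace. -/
theorem modTr_kink_block {q : k} (hq : q ^ 4 = -1) {r w : ℕ} (h1 : 1 ≤ r) (h2 : r ≤ 2 * p - 2)
    (g : THom δ (r + (w + 1)) (r + (w + 1))) (f : THom δ (w + 1) (w + 1)) :
    modTr _ ((whiskR _ (genProj p r) ≫ joinHom r (w + 1) ≫ emb g ≫ joinInv r (w + 1) ≫
      whiskR _ (genIncl p r)) ≫ tensorHom (twistHom q (gen δ p)) (emb f)) =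
    tr _ (g ≫ tensor (twist q r) f) := by
  have hT : ∀ X : Tilt δ, IsProj (tensorObj X (strands (w + 1))) := fun X =>
    (isProj_strands (Nat.le_add_left _ _)).tensorL X
  have h3 := modTr_comm p (hT (gen δ p)) (isProj_strands (by omega : 1 ≤ r + (w + 1)))
    (whiskR _ (genProj p r) ≫ joinHom r (w + 1)) (emb g ≫ joinInv r (w + 1) ≫
      whiskR _ (genIncl p r) ≫ tensorHom (twistHom q (gen δ p)) (emb f))
  have h4 : whiskR _ (genIncl p r) ≫ tensorHom (twistHom q (gen δ p)) (emb f) ≫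
      whiskR _ (genProj p r) = tensorHom (emb (twist q r)) (emb f) := by
    rw [whiskR, whiskR, tensorHom_comp, tensorHom_comp, twistHom_natural hq,
      ← Category.assoc, genIncl_genProj h1 h2, Category.id_comp, Category.id_comp,
      Category.comp_id, twistHom_strands hq]
  simp only [Category.assoc] at h3 ⊢
  rw [h3, reassoc_of% h4, joinHom_natural, reassoc_of% joinInv_joinHom, ← emb_comp,
    modTr_strands (by omega), unemb_emb]

theorem redKink_chrom {q : k} (hq : q ^ 4 = -1) {w : ℕ} (f : THom δ (w + 1) (w + 1)) :
    redKink modTr q (chrom δ p w) (emb f) = ∑ s ∈ Finset.range (p - 1), tr _ (jw δ s) *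
      (tr _ (wr (w + 1) (jw δ s) ≫ tensor (twist q (2 * s + 1)) f) +
        tr _ (wh 0 w (M := 2 * s + 2 + (w + 1)) (N := 2 * s + 2 + (w + 1)) (by omega) (by omega)
          ((cap (2 * s + 1) le_rfl rfl : THom δ (2 * s + 3) _) ≫ jw δ s ≫
            cup (2 * s + 1) le_rfl rfl) ≫ tensor (twist q (2 * s + 2)) f)) := by
  have hT : IsProj (tensorObj (gen δ p) (strands (w + 1))) :=
    (isProj_strands (Nat.le_add_left _ _)).tensorL _
  rw [redKink, chrom, Preadditive.sum_comp, ← modTrₗ_apply (p := p) hT, map_sum]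
  refine Finset.sum_congr rfl fun s hs => ?_
  have hs' := Finset.mem_range.1 hs
  rw [Linear.smul_comp, map_smul, smul_eq_mul, Preadditive.add_comp, map_add, modTrₗ_apply,
    modTrₗ_apply, modTr_kink_block hq (by omega) (by omega), whiskR_comp, whiskR_comp, whiskR_emb]
  have := modTr_kink_block (p := p) hq (r := 2 * s + 1) (by omega) (by omega) (wr (w + 1) (jw δ s)) f
  simp only [Category.assoc] at this ⊢
  rw [this]

/-- The value of the red kink next to a single strand. -/
theorem redKink_chrom_zero {q : k} (hq : q ^ 4 = -1) :
    redKink modTr q (chrom δ p 0) (emb (𝟙 _)) =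
      -2 * q ^ 2 * ∑ s ∈ Finset.range (p - 1), ((s + 1 : ℕ) : k) ^ 2 := by
  rw [redKink_chrom hq, Finset.mul_sum]
  refine Finset.sum_congr rfl fun s hs => ?_
  have hs' := Finset.mem_range.1 hs
  have e : ∀ r, tensor (twist q r) (𝟙 (⟨0 + 1⟩ : TL δ)) = wh 0 1 (by omega) (by omega) (twist q r) := by
    intro r
    rw [tensor, wl_id, Category.comp_id, wr_eq_wh]
  -- In the odd terms the strand of `P` is unlinked and closes to a circle.
  have h1 : tr _ (wr (0 + 1) (jw δ s) ≫ tensor (twist q (2 * s + 1)) (𝟙 (⟨0 + 1⟩ : TL δ))) = 0 := by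
    rw [e, wr_eq_wh, ← wh_comp]
    rw [tr_succ (by omega), closeR_wh_eq_zero, map_zero]
  -- Closing the strand of `P` joins the cap to the cup and leaves `jw s` with one further strand,
  -- twisted as a whole.
  have h2 : tr _ (wh 0 0 (M := 2 * s + 2 + (0 + 1)) (N := 2 * s + 2 + (0 + 1)) (by omega) (by omega)
      ((cap (2 * s + 1) le_rfl rfl : THom δ (2 * s + 3) _) ≫ jw δ s ≫
        cup (2 * s + 1) le_rfl rfl) ≫ tensor (twist q (2 * s + 2)) (𝟙 (⟨0 + 1⟩ : TL δ))) =
      -2 * q ^ 2 * tr (2 * s + 1) (jw δ s) := by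
    have e2 : ∀ g : THom δ (2 * s + 3) (2 * s + 3), wh 0 0 (M := 2 * s + 2 + (0 + 1))
        (N := 2 * s + 2 + (0 + 1)) (by omega) (by omega) g = g := fun g => by
      rw [wh_zero_zero]
      exact (Category.id_comp _).trans (Category.comp_id _)
    rw [e, e2, tr_succ (by omega), closeR_comp_wh _ rfl rfl, closeR_cap_comp_cup]
    exact tr_jw_twist hq p (by omega)
  rw [h1, h2, tr_jw p (by omega)]
  have h3 : ((-1 : k) ^ s) * (-1) ^ s = 1 := by rw [← mul_pow]; simp
  linear_combination (-2 * q ^ 2 * ((s + 1 : ℕ) : k) ^ 2) * h3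

/-- The value of the red kink next to a nilpotent endomorphism of two strands. -/
theorem redKink_chrom_one {q : k} (hq : q ^ 4 = -1) :
    redKink modTr q (chrom δ p 1)
      (emb ((cap 0 le_rfl rfl : THom δ (1 + 1) 0) ≫ cup 0 le_rfl rfl)) =
      redKink modTr q (chrom δ p 0) (emb (𝟙 (⟨0 + 1⟩ : TL δ))) := by
  rw [redKink_chrom hq, redKink_chrom hq]
  refine Finset.sum_congr rfl fun s hs => ?_
  have e : ∀ r, tensor (twist q r) (𝟙 (⟨0 + 1⟩ : TL δ)) = wh 0 1 (by omega) (by omega) (twist q r) := by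
    intro r
    rw [tensor, wl_id, Category.comp_id, wr_eq_wh]
  rw [e, e]
  refine congrArg (tr _ (jw δ s) * ·) (congrArg₂ (· + ·) ?_ ?_)
  -- The chromatic morphism uses only the first strand of `P`. Closing the second turns cap-cup into
  -- one plain strand, for the odd and the even terms alike.
  · have h := tr_wh_comp_tensor_cap_cup (wh 0 1 (by omega) (by omega) (jw δ s)) (twist q (2 * s + 1))
    rw [wh_wh] at h
    rw [wr_eq_wh, wr_eq_wh]
    exact h
  · have e2 : ∀ g : THom δ (2 * s + 3) (2 * s + 3), wh 0 0 (M := 2 * s + 2 + (0 + 1))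
        (N := 2 * s + 2 + (0 + 1)) (by omega) (by omega) g = g := fun g => by
      rw [wh_zero_zero]
      exact (Category.id_comp _).trans (Category.comp_id _)
    rw [e2]
    exact tr_wh_comp_tensor_cap_cup (r := 2 * s + 2) _ (twist q (2 * s + 2))

end MixedVerlinde

end

/-! ### Two strands as the projective cover of the unit, and its cutting morphism. -/

noncomputable section

namespace TemperleyLieb

variable {k : Type u} [Field k] {δ : k}

theorem exists_hom_zero_two (f : THom δ 0 2) : ∃ a : k, f = a • cup 0 le_rfl rfl := by
  obtain ⟨a, ha⟩ := exists_hom_two_zero (flip f)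
  refine ⟨a, ?_⟩
  rw [← flip_flip f, ha]
  simp

/-- The nilpotent endomorphism of two strands. -/
def capCup : THom δ 2 2 := (cap 0 le_rfl rfl : THom δ 2 0) ≫ cup 0 le_rfl rfl

theorem tr_capCup : tr 2 (capCup : THom δ 2 2) = tr 1 (𝟙 (⟨1⟩ : TL δ)) := by
  rw [capCup, tr_succ le_rfl, closeR_two]

variable [IsDegenerate δ]

theorem capCup_comp_capCup : (capCup : THom δ 2 2) ≫ capCup = 0 := by
  rw [capCup, Category.assoc, reassoc_of% cup_cap_self (δ := δ) (m := 0) (n := 2) 0 le_rfl rfl]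
  simp

theorem tr_two_id : tr 2 (𝟙 (⟨2⟩ : TL δ)) = 0 := by
  rw [tr_succ le_rfl]
  have := closeR_wh_eq_zero (m := 1) (n := 1) rfl rfl (𝟙 (⟨1⟩ : TL δ)) rfl rfl
  rw [wh_id] at this
  rw [cast_self] at this
  rw [this, map_zero]

end TemperleyLieb

namespace MixedVerlinde

open TemperleyLieb

variable {k : Type u} [Field k]

theorem isDegenerate_circleValue {q : k} (hq : q ^ 4 = -1) : IsDegenerate (circleValue q) := by
  have h : circleValue q = 0 := by
    rw [circleValue, ← inv_pow, pow_two q⁻¹, inv_sq_of_pow hq]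
    ring
  -- The representation needs a square root of `-1`, and `q ^ 2` is one.
  exact ⟨h, id_ne_zero h (s := q ^ 2) (by linear_combination hq) 1⟩

variable {δ : k} [IsDegenerate δ]

/-- The endomorphism algebra is spanned by the identity and cap-cup, whose square contains a circle
and is zero. The trace separates the two, so the algebra is that of dual numbers. -/
theorem isIndecomposable_strands_two : IsIndecomposable (strands 2 : Tilt δ) := by
  have hU := tr_capCup (δ := δ)
  rw [tr_one_id] at hU
  have key : ∀ a b : k, a • 𝟙 (⟨2⟩ : TL δ) + b • capCup = 0 → a = 0 ∧ b = 0 := by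
    intro a b h
    have h1 := congrArg (tr 2) h
    have h2 := congrArg (fun f => tr 2 (f ≫ capCup)) h
    simp only [map_add, map_smul, tr_two_id, hU, Preadditive.add_comp, Linear.smul_comp,
      capCup_comp_capCup, Category.id_comp, Limits.zero_comp, map_zero, smul_eq_mul] at h1 h2
    exact ⟨by simpa using h2, by simpa using h1⟩
  refine ⟨fun h => ?_, fun f hf => ?_⟩
  · have h1 := congrArg unemb h
    have := key 1 0 (by rw [one_smul, zero_smul, add_zero]; rwa [unemb_id, unemb_zero] at h1)
    exact one_ne_zero this.1
  · obtain ⟨a, b, hab⟩ := exists_hom_two_two (unemb f)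
    have hab' : unemb f = a • 𝟙 (⟨2⟩ : TL δ) + b • capCup := hab
    have h1 := congrArg unemb hf
    rw [unemb_comp, hab'] at h1
    simp only [Preadditive.add_comp, Preadditive.comp_add, Linear.smul_comp, Linear.comp_smul,
      capCup_comp_capCup, Category.id_comp, Category.comp_id] at h1
    have h2 := key (a * a - a) (a * b + b * a - b) (by
      rw [← sub_eq_zero] at h1
      rw [← h1]
      module)
    have hf' : f = emb (a • 𝟙 (⟨2⟩ : TL δ) + b • capCup) := by rw [← hab', emb_unemb]
    have h3 : a * (a - 1) = 0 := by linear_combination h2.1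
    rcases mul_eq_zero.1 h3 with h | h
    · left
      have hb : b = 0 := by linear_combination -h2.2 + 2 * b * h
      rw [hf', h, hb, zero_smul, zero_smul, add_zero, emb_zero]
    · right
      have ha : a = 1 := by linear_combination h
      have hb : b = 0 := by linear_combination h2.2 - 2 * b * h
      rw [hf', ha, hb, one_smul, zero_smul, add_zero, emb_id]

/-- Morphisms from projective objects to the unit factor through two strands. -/
theorem IsProj.exists_comp_cap {P : Tilt δ} (hP : IsProj P) (f : P ⟶ unit) :
    ∃ β : P ⟶ strands 2, f = β ≫ emb (cap 0 le_rfl rfl) := by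
  obtain ⟨d⟩ := hP.nonempty_presentation
  have h : ∀ l, ∃ g : THom δ (d.n l) 2, unemb (d.b l ≫ f) = g ≫ cap 0 le_rfl rfl := by
    intro l
    -- With at least one strand present, the last one can be bent up and capped off at the end, so
    -- that the final step is a cap on two strands.
    obtain ⟨m, hm⟩ := Nat.exists_eq_add_of_le' (d.pos l)
    generalize unemb (d.b l ≫ f) = u
    revert u
    rw [hm]
    exact fun u => ⟨_, (wh_cup_comp_wh_comp_cap u).symm⟩
  choose g hg using h
  refine ⟨∑ l, d.a l ≫ emb (g l), ?_⟩
  rw [← Category.id_comp f, ← d.sum_eq]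
  simp only [Preadditive.sum_comp, Category.assoc]
  refine Finset.sum_congr rfl fun l _ => ?_
  rw [← emb_comp, ← hg, emb_unemb]

/-- Morphisms from the unit to projective objects factor through two strands. -/
theorem IsProj.exists_cup_comp {P : Tilt δ} (hP : IsProj P) (f : unit ⟶ P) :
    ∃ α : strands 2 ⟶ P, f = emb (cup 0 le_rfl rfl) ≫ α := by
  obtain ⟨d⟩ := hP.nonempty_presentation
  have h : ∀ l, ∃ g : THom δ 2 (d.n l), unemb (f ≫ d.a l) = cup 0 le_rfl rfl ≫ g := by
    intro l
    obtain ⟨m, hm⟩ := Nat.exists_eq_add_of_le' (d.pos l)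
    generalize unemb (f ≫ d.a l) = u
    revert u
    rw [hm]
    intro u
    have := congrArg TemperleyLieb.flip (wh_cup_comp_wh_comp_cap (flip u))
    rw [flip_comp, flip_cap, TemperleyLieb.flip_flip] at this
    exact ⟨_, this.symm⟩
  choose g hg using h
  refine ⟨∑ l, emb (g l) ≫ d.b l, ?_⟩
  rw [← Category.comp_id f, ← d.sum_eq]
  simp only [Preadditive.comp_sum]
  refine Finset.sum_congr rfl fun l _ => ?_
  rw [← Category.assoc, ← Category.assoc, ← emb_comp, ← hg, emb_unemb]

variable {p : ℕ} [Fact p.Prime] [CharP k p]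

theorem isProjCoverUnit_strands_two : IsProjCoverUnit p (strands 2 : Tilt δ) := by
  have hp : 2 ≤ p := (Fact.out : p.Prime).two_le
  refine ⟨isProj_strands (by omega), isIndecomposable_strands_two,
    emb (cap 0 le_rfl rfl), fun h => ?_⟩
  rw [EqMod, sub_zero] at h
  have h1 := eq_zero_of_mem_jwIdeal p (by omega) (by omega) (by omega) (unemb_mem_jwIdeal h)
  rw [unemb_emb] at h1
  have hU := tr_capCup (δ := δ)
  rw [tr_one_id, capCup, h1, Limits.zero_comp, map_zero] at hU
  exact zero_ne_one hU

-- Both Hom spaces are lines, spanned by the cap and the cup, and their composite on two strands has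
-- trace one.
omit [Fact p.Prime] [CharP k p] in
theorem isCutting_strands_two : IsCutting p modTr (strands 2 : Tilt δ) (emb capCup) := by
  refine ⟨1, fun _ => emb (cap 0 le_rfl rfl), fun _ => emb (cup 0 le_rfl rfl), fun i j => ?_,
    fun f => ?_, fun f => ?_, ?_⟩
  · rw [if_pos (Subsingleton.elim i j), ← emb_comp, modTr_strands (by omega), unemb_emb]
    exact tr_capCup.trans tr_one_id
  · obtain ⟨a, ha⟩ := exists_hom_two_zero (unemb f)
    refine ⟨fun _ => a, ?_⟩
    rw [← emb_unemb f, ha, emb_smul, Fin.sum_univ_one]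
    exact EqMod.refl _
  · obtain ⟨a, ha⟩ := exists_hom_zero_two (unemb f)
    refine ⟨fun _ => a, ?_⟩
    rw [← emb_unemb f, ha, emb_smul, Fin.sum_univ_one]
    exact EqMod.refl _
  · rw [Fin.sum_univ_one, ← emb_comp]
    exact EqMod.refl _

/-- The projective cover of the unit is given by two strands. -/
theorem IsProjCoverUnit.exists_iso {P : Tilt δ} (hP : IsProjCoverUnit p P) :
    ∃ (φ : P ⟶ strands 2) (ψ : strands 2 ⟶ P), φ ≫ ψ = 𝟙 P ∧ ψ ≫ φ = 𝟙 _ := by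
  obtain ⟨hproj, hind, f, hf⟩ := hP
  -- Nondegeneracy pairs `f` with some `x`. Both factor through two strands, and the pairing is the
  -- coefficient `a` of the identity in the resulting endomorphism, which is therefore invertible.
  obtain ⟨x, hx⟩ : ∃ x : unit ⟶ P, modTr P (f ≫ x) ≠ 0 := by
    by_contra! h
    refine hf ?_
    rw [EqMod, sub_zero]
    exact mem_tiltIdeal_of_modTr_comp hproj h
  obtain ⟨β, rfl⟩ := hproj.exists_comp_cap f
  obtain ⟨α, rfl⟩ := hproj.exists_cup_comp x
  obtain ⟨a, b, hab⟩ := exists_hom_two_two (unemb (α ≫ β))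
  have hab' : unemb (α ≫ β) = a • 𝟙 (⟨2⟩ : TL δ) + b • capCup := hab
  have h1 : modTr P ((β ≫ emb (cap 0 le_rfl rfl)) ≫ emb (cup 0 le_rfl rfl) ≫ α) = a := by
    have h2 := modTr_comm p hproj (isProj_strands (by omega : 1 ≤ 2)) β (emb capCup ≫ α)
    rw [Category.assoc, modTr_strands (by omega), unemb_comp, hab', unemb_emb, Preadditive.comp_add,
      Linear.comp_smul, Linear.comp_smul, capCup_comp_capCup, smul_zero, add_zero, map_smul,
      Category.comp_id, tr_capCup, tr_one_id, smul_eq_mul, mul_one] at h2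
    rw [← h2, capCup, emb_comp]
    simp only [Category.assoc]
  rw [h1] at hx
  -- The inverse of `a + b * U` when `U ^ 2 = 0`.
  have h3 : α ≫ (β ≫ emb (a⁻¹ • 𝟙 (⟨2⟩ : TL δ) - (a⁻¹ * a⁻¹ * b) • capCup)) = 𝟙 _ := by
    rw [← Category.assoc, ← emb_unemb (α ≫ β), hab', ← emb_comp, ← emb_id]
    congr 1
    simp only [Preadditive.comp_sub, Preadditive.add_comp, Linear.smul_comp, Linear.comp_smul,
      capCup_comp_capCup, Category.id_comp, Category.comp_id]
    match_scalars
    · field_simp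
    · field_simp
      ring
  refine ⟨_, α, ?_, h3⟩
  set φ := β ≫ emb (a⁻¹ • 𝟙 (⟨2⟩ : TL δ) - (a⁻¹ * a⁻¹ * b) • capCup)
  refine (hind.2 (φ ≫ α) (by rw [Category.assoc, reassoc_of% h3])).resolve_left fun h => ?_
  refine (isIndecomposable_strands_two (δ := δ)).1 ?_
  rw [← h3, ← Category.comp_id (α ≫ φ), ← h3, Category.assoc, ← Category.assoc φ, h]
  simp only [Limits.zero_comp, Limits.comp_zero]

/-- Transported to two strands, the cutting morphism is unique modulo the ideal, and the ideal has
no nonzero endomorphism of two strands; hence the equality is strict. -/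
theorem IsCutting.eq_of_iso {P : Tilt δ} (hP : IsProj P) {Λ : P ⟶ P} (hΛ : IsCutting p modTr P Λ)
    {φ : P ⟶ strands 2} {ψ : strands 2 ⟶ P} (h : φ ≫ ψ = 𝟙 P) (h' : ψ ≫ φ = 𝟙 _) :
    Λ = φ ≫ emb capCup ≫ ψ := by
  have hp : 2 ≤ p := (Fact.out : p.Prime).two_le
  obtain ⟨r, y, x, hd, hy, -, hxy⟩ := hΛ
  have hx : ∀ i, ∃ b : k, x i = b • (emb (cup 0 le_rfl rfl) ≫ ψ) := by
    intro i
    obtain ⟨b, hb⟩ := exists_hom_zero_two (unemb (x i ≫ φ))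
    refine ⟨b, ?_⟩
    rw [← Linear.smul_comp, ← emb_smul, ← hb, emb_unemb, Category.assoc, h, Category.comp_id]
  choose b hb using hx
  obtain ⟨a, ha⟩ := hy (φ ≫ emb (cap 0 le_rfl rfl))
  -- Pairing the cap with `x i` computes the coefficient in two ways, by duality and by the trace of
  -- cap-cup.
  have hab : ∀ i, a i = b i := by
    intro i
    have h1 := modTr_congr hP (ha.comp_right (x i))
    rw [Preadditive.sum_comp, ← modTrₗ_apply (p := p) hP (∑ j, _), map_sum] at h1
    simp only [Linear.smul_comp, map_smul, modTrₗ_apply, hd, smul_eq_mul, mul_ite, mul_one,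
      mul_zero, Finset.sum_ite_eq', Finset.mem_univ, if_true] at h1
    rw [← h1, hb i, Linear.comp_smul, ← modTrₗ_apply (p := p) hP, map_smul, modTrₗ_apply,
      Category.assoc, modTr_comm p hP (isProj_strands (by omega : 1 ≤ 2))]
    simp only [Category.assoc]
    rw [h', Category.comp_id, ← emb_comp, modTr_strands (by omega), unemb_emb, smul_eq_mul]
    rw [show tr 2 ((cap 0 le_rfl rfl : THom δ 2 0) ≫ cup 0 le_rfl rfl) = 1 from
      tr_capCup.trans tr_one_id, mul_one]
  have h1 : EqMod p Λ (φ ≫ emb capCup ≫ ψ) := by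
    refine hxy.trans ?_
    have h2 := (ha.comp_right (emb (cup 0 le_rfl rfl) ≫ ψ)).symm
    have e1 : (∑ i, a i • y i) ≫ emb (cup 0 le_rfl rfl) ≫ ψ = ∑ i, y i ≫ x i := by
      rw [Preadditive.sum_comp]
      refine Finset.sum_congr rfl fun i _ => ?_
      rw [hab i, Linear.smul_comp, hb i, Linear.comp_smul]
    have e2 : (φ ≫ emb (cap 0 le_rfl rfl)) ≫ emb (cup 0 le_rfl rfl) ≫ ψ = φ ≫ emb capCup ≫ ψ := by
      rw [capCup, emb_comp]
      simp only [Category.assoc]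
    rwa [e1, e2] at h2
  have h2 := unemb_mem_jwIdeal ((h1.comp_left ψ).comp_right φ)
  have h3 := eq_zero_of_mem_jwIdeal p (by omega) (by omega) (by omega) h2
  have h4 : (ψ ≫ Λ) ≫ φ = emb capCup := by
    rw [← sub_eq_zero]
    have := congrArg emb h3
    rw [emb_unemb, emb_zero] at this
    simp only [Category.assoc, h', Category.comp_id] at this ⊢
    rwa [reassoc_of% h'] at this
  rw [← h4]
  simp only [Category.assoc]
  rw [h, Category.comp_id, reassoc_of% h]

end MixedVerlinde

end

/-! ### Rescaling the trace, and the final value. -/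

noncomputable section

namespace MixedVerlinde

open TemperleyLieb

variable {k : Type u} [Field k] {δ : k}

theorem glue_smul_smul {v v' n n' w w' : ℕ} {a : k} (ha : a ≠ 0) (f : THom δ (v + n) (v' + n'))
    (g : THom δ (n + w) (n' + w')) : glue (a • f) (a⁻¹ • g) = glue f g := by
  have h : tensor (a • f) (a⁻¹ • g) = tensor f g := by
    change tensorₗ (a • f) (a⁻¹ • g) = tensorₗ f g
    rw [LinearMap.map_smul₂, map_smul, smul_smul, mul_inv_cancel₀ ha, one_smul]
  rw [glue, h, glue]

theorem glueAlong_smul_smul {V G P : Tilt δ} {a : k} (ha : a ≠ 0)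
    (f : tensorObj V (dual G) ⟶ tensorObj V (dual G)) (c : tensorObj G P ⟶ tensorObj G P) :
    glueAlong (a • f) (a⁻¹ • c) = glueAlong f c := by
  rw [glueAlong, glueAlong]
  congr 1
  ext x y
  refine Finset.sum_congr rfl fun i _ => Finset.sum_congr rfl fun j _ => ?_
  exact glue_smul_smul ha _ _

/-! ### Rescaling the modified trace -/

section

variable {p : ℕ} {t t' : ∀ P : Tilt δ, (P ⟶ P) → k} (ht' : IsModifiedTrace p t')
  {a : k} (ha : a ≠ 0) (h : ∀ P, IsProj P → ∀ f, t P f = a * t' P f)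

include ht' ha h

/-- Only one of the two dual bases is rescaled. Cutting morphisms scale inversely to the trace, and
chromatic morphisms compensate them. -/
theorem IsCutting.smul {Q : Tilt δ} (hQ : IsProj Q) {Λ : Q ⟶ Q} (hΛ : IsCutting p t Q Λ) :
    IsCutting p t' Q (a • Λ) := by
  obtain ⟨r, y, x, hd, hy, hx, hxy⟩ := hΛ
  refine ⟨r, y, fun i => a • x i, fun i j => ?_, hy, fun g => ?_, ?_⟩
  · rw [Linear.comp_smul, ht'.map_smul Q hQ, ← h Q hQ, hd]
  · obtain ⟨b, hb⟩ := hx g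
    refine ⟨fun i => b i * a⁻¹, ?_⟩
    simp only [smul_smul, mul_assoc, inv_mul_cancel₀ ha, mul_one]
    exact hb
  · simp only [Linear.comp_smul, ← Finset.smul_sum]
    exact hxy.smul a

variable [IsDegenerate δ]

theorem IsChromatic.smul {G P : Tilt δ} {c : tensorObj G P ⟶ tensorObj G P}
    (hc : IsChromatic p t G P c) : IsChromatic p t' G P (a⁻¹ • c) := by
  intro V hV
  obtain ⟨Λ, hΛ, hΛc⟩ := hc V hV
  refine ⟨a • Λ, hΛ.smul ht' ha h (hV.tensorR _), ?_⟩
  rwa [glueAlong_smul_smul ha]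

omit ht' in
theorem redKink_smul {G P : Tilt δ} (hP : IsProj P) (q : k) (c : tensorObj G P ⟶ tensorObj G P)
    (f : P ⟶ P) : redKink t' q (a⁻¹ • c) (a • f) = a⁻¹ * redKink t q c f := by
  have e : tensorHom (twistHom q G) (a • f) = a • tensorHom (twistHom q G) f :=
    map_smul (tensorHomₗ _) a f
  rw [redKink, redKink, e, Linear.smul_comp, Linear.comp_smul, smul_smul, inv_mul_cancel₀ ha,
    one_smul, h _ (hP.tensorL G), inv_mul_cancel_left₀ ha]

/-- The scalars of the cutting and of the chromatic morphism cancel, so the value scales like the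
trace. -/
theorem IsInvariantOfKink.smul {q d : k} (hd : IsInvariantOfKink p t q d) :
    IsInvariantOfKink p t' q (a⁻¹ * d) := by
  obtain ⟨G, P, Λ, c, hG, hP, hΛ, hc, rfl⟩ := hd
  exact ⟨G, P, a • Λ, a⁻¹ • c, hG, hP, hΛ.smul ht' ha h hP.1, hc.smul ht' ha h,
    (redKink_smul ha h hP.1 q c Λ).symm⟩

end

/-! ### The value of the invariant -/

section

variable [IsDegenerate δ] {p : ℕ} [Fact p.Prime] [CharP k p]

/-- The common value of the red kinks. -/
def kinkValue (p : ℕ) (q : k) : k := (((p - 1) * p * (2 * p - 1) / 3 : ℕ) : k) * (q ^ 2)⁻¹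

-- Stated without division, so that the natural-number quotient by 3 is seen to be exact.
omit [Fact p.Prime] [CharP k p] in
theorem six_mul_sum_sq (hp : 1 ≤ p) :
    6 * ∑ s ∈ Finset.range (p - 1), (s + 1) ^ 2 = (p - 1) * p * (2 * p - 1) := by
  obtain ⟨n, rfl⟩ := Nat.exists_eq_add_of_le' hp
  rw [Nat.add_sub_cancel, show 2 * (n + 1) - 1 = 2 * n + 1 by omega]
  clear hp
  induction n with
  | zero => rfl
  | succ n ih => rw [Finset.sum_range_succ, mul_add, ih]; ring

theorem redKink_chrom_zero_eq {q : k} (hq : q ^ 4 = -1) :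
    redKink modTr q (chrom δ p 0) (emb (𝟙 (⟨0 + 1⟩ : TL δ))) = kinkValue p q := by
  have hp : 2 ≤ p := (Fact.out : p.Prime).two_le
  rw [redKink_chrom_zero hq, kinkValue, ← inv_pow, pow_two q⁻¹, inv_sq_of_pow hq]
  have h := six_mul_sum_sq (p := p) (by omega)
  rw [show (p - 1) * p * (2 * p - 1) / 3 = 2 * ∑ s ∈ Finset.range (p - 1), (s + 1) ^ 2 by omega]
  push_cast
  ring

theorem redKink_strands_one {q : k} (hq : q ^ 4 = -1) {G : Tilt δ} (hG : IsProj G)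
    {c : tensorObj G (strands 1) ⟶ tensorObj G (strands 1)}
    (hc : IsChromatic p modTr G (strands 1) c) : redKink modTr q c (𝟙 _) = kinkValue p q := by
  have h := redKink_eq_of_isChromatic hq hG (isProj_strands le_rfl) hc (w := 0) (𝟙 _) (𝟙 _)
  rw [Category.comp_id] at h
  refine h.trans ?_
  rw [← redKink_chrom_zero_eq (δ := δ) hq, emb_id]

/-- All choices lead to one value: the cover is isomorphic to two strands, its cutting morphism
becomes cap-cup, and the chromatic morphism may be exchanged. The explicit data show that the value
is attained. -/
theorem isInvariantOfKink_modTr_iff {q : k} (hq : q ^ 4 = -1) (d : k) :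
    IsInvariantOfKink (δ := δ) p modTr q d ↔ d = kinkValue p q := by
  have h1 : redKink modTr q (chrom δ p 1) (emb capCup) = kinkValue p q :=
    (redKink_chrom_one hq).trans (redKink_chrom_zero_eq hq)
  constructor
  · rintro ⟨G, P, Λ, c, hG, hP, hΛ, hc, rfl⟩
    obtain ⟨φ, ψ, h, h'⟩ := hP.exists_iso
    rw [hΛ.eq_of_iso hP.1 h h']
    refine (redKink_eq_of_isChromatic hq hG.1 hP.1 hc (w := 1) φ (emb capCup ≫ ψ)).trans ?_
    rw [Category.assoc, h', Category.comp_id]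
    exact h1
  · rintro rfl
    exact ⟨gen δ p, strands 2, emb capCup, chrom δ p 1, isProjGenerator_gen p,
      isProjCoverUnit_strands_two, isCutting_strands_two, isChromatic_chrom 1, h1.symm⟩

variable {t : ∀ P : Tilt δ, (P ⟶ P) → k} (ht : IsModifiedTrace p t)

include ht

theorem IsModifiedTrace.isInvariantOfKink {q : k} (hq : q ^ 4 = -1)
    (h1 : t (strands 1) (𝟙 (strands 1)) ≠ 0) {d : k} (hd : IsInvariantOfKink p t q d) :
    (t (strands 1) (𝟙 (strands 1)))⁻¹ * d = kinkValue p q :=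
  (isInvariantOfKink_modTr_iff hq _).1 (hd.smul (isModifiedTrace_modTr p) h1
    fun _ hP f => ht.eq_modTr hP f)

theorem IsModifiedTrace.isInvariantOfKink_iff {q : k} (hq : q ^ 4 = -1)
    (h1 : t (strands 1) (𝟙 (strands 1)) = 1) (d : k) :
    IsInvariantOfKink p t q d ↔ d = kinkValue p q := by
  constructor
  · intro hd
    have := ht.isInvariantOfKink hq (by rw [h1]; exact one_ne_zero) hd
    rwa [h1, inv_one, one_mul] at this
  · rintro rfl
    have := ((isInvariantOfKink_modTr_iff (δ := δ) (p := p) hq _).2 rfl).smul ht one_ne_zero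
      fun P hP f => by rw [ht.eq_modTr hP f, h1, one_mul, one_mul]
    rwa [inv_one, one_mul] at this

theorem IsModifiedTrace.redKink_strands_one {q : k} (hq : q ^ 4 = -1)
    (h1 : t (strands 1) (𝟙 (strands 1)) = 1) {G : Tilt δ} (hG : IsProj G)
    {c : tensorObj G (strands 1) ⟶ tensorObj G (strands 1)}
    (hc : IsChromatic p t G (strands 1) c) : redKink t q c (𝟙 _) = kinkValue p q := by
  have h : ∀ P, IsProj P → ∀ f, t P f = 1 * modTr P f := fun P hP f => by
    rw [ht.eq_modTr hP f, h1]
  have hc' := hc.smul (isModifiedTrace_modTr p) one_ne_zero h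
  rw [inv_one, one_smul] at hc'
  rw [← MixedVerlinde.redKink_strands_one hq hG hc', redKink, redKink,
    h _ ((isProj_strands le_rfl).tensorL G), one_mul]

end

section

variable {p : ℕ} [Fact p.Prime] [CharP k p]

/-- The factor `p` is coprime to 3, so it survives the division. -/
theorem kinkValue_eq_zero (hp : 3 < p) (q : k) : kinkValue p q = 0 := by
  have hprime : p.Prime := Fact.out
  have h : ((p - 1) * p * (2 * p - 1) / 3) * 3 = (p - 1) * p * (2 * p - 1) := by
    have := six_mul_sum_sq hprime.one_le
    omega
  have h2 : p ∣ (p - 1) * p * (2 * p - 1) / 3 := by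
    refine (Nat.Coprime.dvd_of_dvd_mul_right ((Nat.coprime_primes hprime Nat.prime_three).2
      (by omega)) ?_)
    rw [h]
    exact ⟨(p - 1) * (2 * p - 1), by ring⟩
  rw [kinkValue, (CharP.cast_eq_zero_iff k p _).2 h2, zero_mul]

/-- For `p = 3` the division removes the factor 3: the integer is 10, which is 1 modulo 3. -/
theorem kinkValue_three [CharP k 3] {q : k} (hq : q ≠ 0) : kinkValue 3 q ≠ 0 := by
  have h : (((3 - 1) * 3 * (2 * 3 - 1) / 3 : ℕ) : k) = 1 := by
    have h3 : ((3 : ℕ) : k) = 0 := CharP.cast_eq_zero k 3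
    norm_num at h3 ⊢
    linear_combination 3 * h3
  rw [kinkValue, h, one_mul]
  exact inv_ne_zero (pow_ne_zero 2 hq)

end

end MixedVerlinde

end

theorem mainTheorem4 {k : Type*} [Field k] [IsAlgClosed k] (p : ℕ) [Fact p.Prime] [CharP k p]
    (q : k) (hq : IsPrimitiveRoot (q ^ 2) 4) :
    (∃ t : ∀ P : MixedVerlinde.Tilt (MixedVerlinde.circleValue q), (P ⟶ P) → k,
      MixedVerlinde.IsModifiedTrace p t ∧
      t (MixedVerlinde.strands 1) (𝟙 (MixedVerlinde.strands 1)) = 1) ∧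
    (∀ t : ∀ P : MixedVerlinde.Tilt (MixedVerlinde.circleValue q), (P ⟶ P) → k,
      MixedVerlinde.IsModifiedTrace p t →
      t (MixedVerlinde.strands 1) (𝟙 (MixedVerlinde.strands 1)) = 1 →
      (∀ d : k, MixedVerlinde.IsDeltaPlus p q t d ↔
        d = (((p - 1) * p * (2 * p - 1) / 3 : ℕ) : k) * (q ^ 2)⁻¹) ∧
      (∀ d : k, MixedVerlinde.IsDeltaMinus p q t d ↔
        d = (((p - 1) * p * (2 * p - 1) / 3 : ℕ) : k) * q ^ 2) ∧
      (∀ (G : MixedVerlinde.Tilt (MixedVerlinde.circleValue q))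
        (c : MixedVerlinde.tensorObj G (MixedVerlinde.strands 1) ⟶
          MixedVerlinde.tensorObj G (MixedVerlinde.strands 1)),
        MixedVerlinde.IsProjGenerator p G →
        MixedVerlinde.IsChromatic p t G (MixedVerlinde.strands 1) c →
        MixedVerlinde.redKink t q c (𝟙 (MixedVerlinde.strands 1)) =
          (((p - 1) * p * (2 * p - 1) / 3 : ℕ) : k) * (q ^ 2)⁻¹ ∧
        MixedVerlinde.redKink t q⁻¹ c (𝟙 (MixedVerlinde.strands 1)) =
          (((p - 1) * p * (2 * p - 1) / 3 : ℕ) : k) * q ^ 2) ∧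
      (3 < p → MixedVerlinde.IsDeltaPlus p q t 0 ∧ MixedVerlinde.IsDeltaMinus p q t 0)) ∧
    (MixedVerlinde.IsTwistNondegenerate p q ↔ p = 3) := by
  have hq4 : q ^ 4 = -1 := by
    have h := hq.pow_eq_one
    have h2 : (q ^ 2) ^ 2 ≠ 1 := hq.pow_ne_one_of_pos_of_lt (by norm_num) (by norm_num)
    have h3 : (q ^ 4 - 1) * (q ^ 4 + 1) = 0 := by linear_combination h
    rcases mul_eq_zero.1 h3 with h4 | h4
    · exact absurd (by linear_combination h4) h2
    · linear_combination h4
  have hq0 := TemperleyLieb.ne_zero_of_pow hq4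
  have hq4' : q⁻¹ ^ 4 = -1 := by rw [inv_pow, hq4, inv_neg, inv_one]
  have := MixedVerlinde.isDegenerate_circleValue hq4
  have hinv : MixedVerlinde.kinkValue p q⁻¹ =
      (((p - 1) * p * (2 * p - 1) / 3 : ℕ) : k) * q ^ 2 := by
    rw [MixedVerlinde.kinkValue, inv_pow, inv_inv]
  have hprime : p.Prime := Fact.out
  -- In characteristic two `-1 = 1`, so `q ^ 2` would have order at most two.
  have hp2 : p ≠ 2 := by
    rintro rfl
    refine hq.pow_ne_one_of_pos_of_lt (l := 2) (by norm_num) (by norm_num) ?_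
    rw [← pow_mul, hq4, CharTwo.neg_eq]
  have htr := MixedVerlinde.isModifiedTrace_modTr (δ := MixedVerlinde.circleValue q) p
  have htr1 : MixedVerlinde.modTr (MixedVerlinde.strands 1)
      (𝟙 (MixedVerlinde.strands 1 : MixedVerlinde.Tilt (MixedVerlinde.circleValue q))) = 1 := by
    rw [MixedVerlinde.modTr_strands le_rfl, MixedVerlinde.unemb_id, TemperleyLieb.tr_one_id]
  refine ⟨⟨_, htr, htr1⟩, fun t ht h1 => ⟨fun d => ht.isInvariantOfKink_iff hq4 h1 d, fun d => ?_,
    fun G c hG hc => ⟨ht.redKink_strands_one hq4 h1 hG.1 hc, ?_⟩, fun hp => ⟨?_, ?_⟩⟩, ?_, ?_⟩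
  · rw [← hinv]
    exact ht.isInvariantOfKink_iff hq4' h1 d
  · rw [← hinv]
    exact ht.redKink_strands_one hq4' h1 hG.1 hc
  · exact (ht.isInvariantOfKink_iff hq4 h1 0).2 (MixedVerlinde.kinkValue_eq_zero hp q).symm
  · exact (ht.isInvariantOfKink_iff hq4' h1 0).2 (MixedVerlinde.kinkValue_eq_zero hp q⁻¹).symm
  · rintro ⟨t, ht, ⟨P, f, hP, hf⟩, a, b, ha, -, ha0, -⟩
    -- A modified trace is determined by this value, so a nonzero trace can be normalized; the value
    -- of the kink is then a nonzero multiple of the normalized one.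
    have h1 : t (MixedVerlinde.strands 1) (𝟙 (MixedVerlinde.strands 1)) ≠ 0 := fun h => hf (by
      rw [ht.eq_modTr hP f, h, zero_mul])
    have h2 := ht.isInvariantOfKink hq4 h1 ha
    by_contra hp3
    have hp : 3 < p := by
      have := hprime.two_le
      omega
    rw [MixedVerlinde.kinkValue_eq_zero hp] at h2
    exact mul_ne_zero (inv_ne_zero h1) ha0 h2
  · rintro rfl
    exact ⟨_, htr, ⟨_, _, MixedVerlinde.isProj_strands le_rfl, htr1.trans_ne one_ne_zero⟩, _, _,
      (MixedVerlinde.isInvariantOfKink_modTr_iff hq4 _).2 rfl,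
      (MixedVerlinde.isInvariantOfKink_modTr_iff hq4' _).2 rfl,
      MixedVerlinde.kinkValue_three hq0, MixedVerlinde.kinkValue_three (inv_ne_zero hq0)⟩
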